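/- **Theorem 4.11.** Let $k$ be a field of characteristic $0$; all graded vector spaces $V$ below are finite-dimensional and $\mathbb Z$-graded, with the convention $(V[i])^j=V^{i+j}$. *The structures.* (a) A *$G$-algebra* is a graded commutative associative (non-unital) algebra with a bracket $[\ \bullet\ ]$ of degree $-1$ which is a graded Lie bracket with respect to the degree shifted by one and a derivation of the product in each argument. Let $\widehat{\odot}\,\mathsf{Lie}(V^*[-2])$ be the free $G$-algebra on $V^*[-2]$, completed with respect to the number of generators, and let $I$ be its multiplicative ideal generated by the commutant $\mathsf{Lie}^{\ge 2}(V^*[-2])$ of the free Lie algebra. A *$G_\infty^{(2)}$-structure on $V$* is a differential of the $G$-algebra $\widehat{\odot}\,\mathsf{Lie}(V^*[-2])/I^2$: a $k$-linear map $D$ of degree $1$ with $D^2=0$ which is a derivation of the product and of the bracket and does not decrease the filtration by the number of generators. (b) Let $\mathcal O=\widehat{\odot}\,(V^*[-2])$ (with constants) be the ring of formal functions on the pointed formal manifold $(V[2],0)$, with coordinates $t^\alpha$ of degree $2-|e_\alpha|$ dual to a homogeneous basis $(e_\alpha)$ of $V$, and identify the tangent module, shifted by two, with $\mathcal O\otimes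 V$, $e_\alpha\leftrightarrow\partial/\partial t^\alpha$. A *geometric $C_\infty$-structure on $(V[2],0)$* consists of a vector field $\nu$ of degree $1$ on $V[2]$ with $\nu(\nu(f))=0$ for every $f\in\mathcal O$, which vanishes at $0$, and of maps $\mu_n:(\mathcal O\otimes V)^{\otimes n}\to\mathcal O\otimes V$ of degree $2-n$, $n\ge 1$, such that $\mu_1$ is the Lie derivative $\mathrm{Lie}_\nu$, the maps $\mu_n$ with $n\ge2$ are $\mathcal O$-multilinear (with the usual Koszul signs), the $\mu_n$ satisfy the equations of an $A_\infty$-algebra, and each $\mu_n$, $n\ge 2$, vanishes on (signed) shuffle products, i.e. the $A_\infty$-algebra is a $C_\infty$-algebra. *The operads.* Each of the two kinds of structure consists of a differential $d$ on $V$ together with further multilinear operations on $V$. For (b) these are the Taylor coefficients at $0$, $V^{\odot p}\to V$ ($p\ge 1$) and $V^{\otimes n}\otimes V^{\odot p}\to V$ ($n\ge2$, $p\ge0$), of $\nu$ and of $\mu_n$, where $d$ is the linear part of $\nu$. For (a) they are the duals of the components of $D|_{V^*[-2]}$: modulo $I^2$ the map $D|_{V^*[-2]}$ takes values in $$\widehat\odot^{\ge1}(V^*[-2])\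 \oplus\ \Big(\widehat\odot (V^*[-2])\otimes \mathsf{Lie}^{\ge2}(V^*[-2])\Big)^{\wedge},$$ and the dual of $\mathsf{Lie}^{n}(V^*[-2])$ is, up to a shift, the quotient of $V^{\otimes n}$ by shuffle products. The dg operad of a kind of structure is the dg suboperad (with unit, symmetric group actions, compositions and differential) generated by all these operations other than $d$ in the product, over all $V$ and all structures of that kind on $V$, of the endomorphism operads $\{\mathrm{Hom}(V^{\otimes n},V)\}_{n}$, whose differentials are induced by $d$. Denote by $\mathcal G_\infty^{(2)}$ the dg operad obtained from (a) and by $\mathcal Gerst^c_\infty$ the one obtained from (b). *The claim.* 1. For every $V$, evaluation identifies the $G_\infty^{(2)}$-structures on $V$ with the algebras over the dg operad $\mathcal G_\infty^{(2)}$ on $V$ (a differential $d$ on $V$ together with a morphism of dg operads to the endomorphism operad of $(V,d)$). In the same way it identifies the geometric $C_\infty$-structures on $(V[2],0)$ with the algebras over $\mathcal Gerst^c_\infty$ on $V$. 2. For every $V$ there is a bijection $D\mapsto(\nu,\mu_\bullet)$ from the $G_\infty^{(2)}$-structures on $V$ to the geometric $C_\infty$-structures on $(V[2],0)$ for which $\nu$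 is the vector field induced by $D$ modulo $I$ and the tensors $\mu_n$, $n\ge2$, are (with the standard signs) dual to the component of $D|_{V^*[-2]}$ in $I/I^2$. These bijections are induced by an isomorphism of dg operads $$\mathcal G_\infty^{(2)}\ \cong\ \mathcal Gerst^c_\infty ,$$ that is, an element of $\mathcal G_\infty^{(2)}$ acts on $V$ through $D$ as the corresponding element of $\mathcal Gerst^c_\infty$ acts through $(\nu,\mu_\bullet)$. -/

import Mathlib

universe u

noncomputable section

namespace GInf

/-! ### Graded vector spaces and signs

A finite-dimensional `ℤ`-graded vector space over `k` is given by a homogeneous basis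
`e_0, …, e_{dim-1}` together with the degrees of the basis vectors. -/

/-- A finite-dimensional graded vector space, given by the degrees of a homogeneous basis. -/
structure GrSp where
  dim : ℕ
  deg : Fin dim → ℤ

/-- The set of indices of the basis `e_α` of `V`. -/
abbrev GrSp.Idx (V : GrSp) : Type := Fin V.dim

/-- The degree `2 - |e_α|` of the dual basis element `t^α` of `V^*[-2]`. -/
def GrSp.tdeg (V : GrSp) (α : V.Idx) : ℤ := 2 - V.deg α

/-- The degree `|e_α| - 1` of `e_α` in the shifted space `V[1]`. -/
def GrSp.sdeg (V : GrSp) (α : V.Idx) : ℤ := V.deg α - 1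

/-- The sign `(-1)^n`. -/
abbrev sgn (n : ℤ) : ℤˣ := n.negOnePow

/-- The total degree of a list. -/
def lsum {X : Type*} (d : X → ℤ) (l : List X) : ℤ := (l.map d).sum

/-- `∑_{i<j} d(x_i) d(x_j)`. -/
def pairSum {X : Type*} (d : X → ℤ) : List X → ℤ
  | [] => 0
  | x :: l => d x * lsum d l + pairSum d l

/-- `∑_{i=1}^n (n-i) d(x_i)`. -/
def staircaseSum {X : Type*} (d : X → ℤ) : List X → ℤ
  | [] => 0
  | x :: l => (l.length : ℤ) * d x + staircaseSum d l

/-- All the shuffles of two words, with their Koszul signs. -/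
def signedShuffles {X : Type*} (d : X → ℤ) : List X → List X → List (ℤˣ × List X)
  | [], B => [(1, B)]
  | a :: A, [] => [(1, a :: A)]
  | a :: A, b :: B =>
      (signedShuffles d A (b :: B)).map (fun s => (s.1, a :: s.2)) ++
      (signedShuffles d (a :: A) B).map
        (fun s => (sgn (d b * lsum d (a :: A)) * s.1, b :: s.2))
  termination_by A B => A.length + B.length

/-! ### Free graded commutative Gerstenhaber algebras and their quotients -/

/-- Monomials in the two binary operations (product and bracket) of a Gerstenhaber algebra,
with generators `t^i`. -/
inductive GMon (ι : Type) : Type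
  | gen : ι → GMon ι
  | mul : GMon ι → GMon ι → GMon ι
  | br : GMon ι → GMon ι → GMon ι

namespace GMon

variable {ι : Type}

/-- The number of generators in a monomial. -/
def weight : GMon ι → ℕ
  | gen _ => 1
  | mul a b => weight a + weight b
  | br a b => weight a + weight b

/-- The degree of a monomial: the product has degree `0` and the bracket has degree `-1`. -/
def degree (d : ι → ℤ) : GMon ι → ℤ
  | gen i => d i
  | mul a b => degree d a + degree d b
  | br a b => degree d a + degree d b - 1

/-- Monomials which involve only the bracket. -/
def IsLie : GMon ι → Prop
  | gen _ => True
  | mul _ _ => False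
  | br a b => IsLie a ∧ IsLie b

open Classical in
/-- The number of factors (with respect to the product) of a monomial which are Lie monomials of
weight at least two, i.e. which lie in the commutant of the free Lie algebra. -/
def commutatorFactors : GMon ι → ℕ
  | gen _ => 0
  | mul a b => commutatorFactors a + commutatorFactors b
  | br a b => if IsLie a ∧ IsLie b then 1 else 0

end GMon

section FreeG

variable (k : Type u) [Field k] (V : GrSp)

/-- Formal (possibly infinite) linear combinations of monomials in the `t^α`. -/
abbrev GSer : Type u := GMon V.Idx → k

/-- The series consisting of one monomial. -/
def mono (m : GMon V.Idx) : GSer k V := open Classical in Pi.single m 1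

/-- The bilinear extension of the product of monomials. -/
def serMul : GSer k V →ₗ[k] GSer k V →ₗ[k] GSer k V :=
  LinearMap.mk₂ k
    (fun x y m => match m with
      | .mul a b => x a * y b
      | _ => 0)
    (by intro x x' y; funext m; cases m <;> simp [add_mul])
    (by intro c x y; funext m; cases m <;> simp [mul_assoc])
    (by intro x y y'; funext m; cases m <;> simp [mul_add])
    (by intro c x y; funext m; cases m <;> simp [mul_left_comm])

/-- The bilinear extension of the bracket of monomials. -/
def serBr : GSer k V →ₗ[k] GSer k V →ₗ[k] GSer k V :=
  LinearMap.mk₂ k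
    (fun x y m => match m with
      | .br a b => x a * y b
      | _ => 0)
    (by intro x x' y; funext m; cases m <;> simp [add_mul])
    (by intro c x y; funext m; cases m <;> simp [mul_assoc])
    (by intro x y y'; funext m; cases m <;> simp [mul_add])
    (by intro c x y; funext m; cases m <;> simp [mul_left_comm])

/-- The degree of a monomial in the generators `t^α` of degree `2 - |e_α|`. -/
abbrev mdeg (m : GMon V.Idx) : ℤ := m.degree V.tdeg

/-- The relations of the quotient, by the `n`-th multiplicative power of the ideal generated by the
commutant of the Lie algebra, of the free graded commutative Gerstenhaber algebra:
graded commutativity and associativity of the product, antisymmetry and Jacobi identity of the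
(odd) bracket, the Poisson identity, and vanishing of the products which contain at least `n`
commutators. The last four constructors close this set of relations under the two operations. -/
inductive GRel (n : ℕ) : GSer k V → Prop
  | comm (a b : GMon V.Idx) :
      GRel n (mono k V (.mul a b) - sgn (mdeg V a * mdeg V b) • mono k V (.mul b a))
  | assoc (a b c : GMon V.Idx) :
      GRel n (mono k V (.mul (.mul a b) c) - mono k V (.mul a (.mul b c)))
  | anti (a b : GMon V.Idx) :
      GRel n (mono k V (.br a b) + sgn ((mdeg V a + 1) * (mdeg V b + 1)) • mono k V (.br b a))
  | jacobi (a b c : GMon V.Idx) :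
      GRel n (mono k V (.br a (.br b c)) - mono k V (.br (.br a b) c)
        - sgn ((mdeg V a + 1) * (mdeg V b + 1)) • mono k V (.br b (.br a c)))
  | poisson (a b c : GMon V.Idx) :
      GRel n (mono k V (.br a (.mul b c)) - mono k V (.mul (.br a b) c)
        - sgn ((mdeg V a + 1) * mdeg V b) • mono k V (.mul b (.br a c)))
  | power (m : GMon V.Idx) : n ≤ m.commutatorFactors → GRel n (mono k V m)
  | mul_left (y x : GSer k V) : GRel n x → GRel n (serMul k V y x)
  | mul_right (x y : GSer k V) : GRel n x → GRel n (serMul k V x y)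
  | br_left (y x : GSer k V) : GRel n x → GRel n (serBr k V y x)
  | br_right (x y : GSer k V) : GRel n x → GRel n (serBr k V x y)

/-- The component of weight `w` of a series. -/
def truncAt (w : ℕ) : GSer k V →ₗ[k] GSer k V where
  toFun x m := if m.weight = w then x m else 0
  map_add' x y := by funext m; by_cases h : m.weight = w <;> simp [h]
  map_smul' c x := by funext m; by_cases h : m.weight = w <;> simp [h]

/-- The closed (with respect to the weight filtration) ideal of relations. -/
def relIdeal (n : ℕ) : Submodule k (GSer k V) where
  carrier := {x | ∀ w, truncAt k V w x ∈ Submodule.span k {y | GRel k V n y}}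
  add_mem' hx hy w := by rw [map_add]; exact add_mem (hx w) (hy w)
  zero_mem' w := by rw [map_zero]; exact zero_mem _
  smul_mem' c x hx w := by rw [map_smul]; exact Submodule.smul_mem _ c (hx w)

/-- The quotient `G`-algebra of the weight-completed free `G`-algebra on `V^*[-2]` by the `n`-th
power of the ideal generated by the commutant of `Lie(V^*[-2])`. Algebras over the operad of graded
commutative Gerstenhaber algebras have no unit, so the constants are omitted: this is the
augmentation ideal of the (unital) completed symmetric algebra of `Lie(V^*[-2])` modulo `I^n`. -/
abbrev QuotG (n : ℕ) : Type u := GSer k V ⧸ relIdeal k V n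

variable {k V}

lemma truncAt_serMul (w : ℕ) (x y : GSer k V) :
    truncAt k V w (serMul k V x y) =
      ∑ u ∈ Finset.HasAntidiagonal.antidiagonal w, serMul k V (truncAt k V u.1 x) (truncAt k V u.2 y) := by
  funext m
  cases m with
  | gen i => simp [truncAt, serMul, Finset.sum_apply]
  | br a b => simp [truncAt, serMul, Finset.sum_apply]
  | mul a b =>
    simp only [truncAt, serMul, LinearMap.coe_mk, AddHom.coe_mk, LinearMap.mk₂_apply,
      Finset.sum_apply, GMon.weight]
    by_cases h : a.weight + b.weight = w
    · refine Eq.trans (if_pos h) ?_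
      rw [Finset.sum_eq_single (a.weight, b.weight)]
      · simp
      · rintro ⟨u, v⟩ - hne
        by_cases h1 : a.weight = u
        · by_cases h2 : b.weight = v
          · exact absurd (by rw [h1, h2]) hne
          · simp [h2]
        · simp [h1]
      · intro hn
        exact absurd (Finset.HasAntidiagonal.mem_antidiagonal.2 h) hn
    · refine (if_neg h).trans (Finset.sum_eq_zero ?_).symm
      rintro ⟨u, v⟩ huv
      rw [Finset.HasAntidiagonal.mem_antidiagonal] at huv
      by_cases h1 : a.weight = u
      · by_cases h2 : b.weight = v
        · exact absurd (by rw [h1, h2]; exact huv) h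
        · simp [h2]
      · simp [h1]

lemma truncAt_serBr (w : ℕ) (x y : GSer k V) :
    truncAt k V w (serBr k V x y) =
      ∑ u ∈ Finset.HasAntidiagonal.antidiagonal w, serBr k V (truncAt k V u.1 x) (truncAt k V u.2 y) := by
  funext m
  cases m with
  | gen i => simp [truncAt, serBr, Finset.sum_apply]
  | mul a b => simp [truncAt, serBr, Finset.sum_apply]
  | br a b =>
    simp only [truncAt, serBr, LinearMap.coe_mk, AddHom.coe_mk, LinearMap.mk₂_apply,
      Finset.sum_apply, GMon.weight]
    by_cases h : a.weight + b.weight = w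
    · refine Eq.trans (if_pos h) ?_
      rw [Finset.sum_eq_single (a.weight, b.weight)]
      · simp
      · rintro ⟨u, v⟩ - hne
        by_cases h1 : a.weight = u
        · by_cases h2 : b.weight = v
          · exact absurd (by rw [h1, h2]) hne
          · simp [h2]
        · simp [h1]
      · intro hn
        exact absurd (Finset.HasAntidiagonal.mem_antidiagonal.2 h) hn
    · refine (if_neg h).trans (Finset.sum_eq_zero ?_).symm
      rintro ⟨u, v⟩ huv
      rw [Finset.HasAntidiagonal.mem_antidiagonal] at huv
      by_cases h1 : a.weight = u
      · by_cases h2 : b.weight = v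
        · exact absurd (by rw [h1, h2]; exact huv) h
        · simp [h2]
      · simp [h1]

/-- A bilinear operation on a module for which a submodule is a two-sided ideal descends to the
quotient. -/
def liftOp {M : Type u} [AddCommGroup M] [Module k M] (J : Submodule k M)
    (B : M →ₗ[k] M →ₗ[k] M)
    (hr : ∀ x, ∀ y ∈ J, B x y ∈ J) (hl : ∀ x ∈ J, ∀ y, B x y ∈ J) :
    (M ⧸ J) →ₗ[k] (M ⧸ J) →ₗ[k] (M ⧸ J) :=
  J.liftQ
    { toFun := fun x => J.mapQ J (B x) (fun y hy => hr x y hy)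
      map_add' := fun x x' => by
        apply LinearMap.ext
        intro q
        obtain ⟨y, rfl⟩ := J.mkQ_surjective q
        simp
      map_smul' := fun c x => by
        apply LinearMap.ext
        intro q
        obtain ⟨y, rfl⟩ := J.mkQ_surjective q
        simp }
    (by
      intro x hx
      rw [LinearMap.mem_ker]
      apply LinearMap.ext
      intro q
      obtain ⟨y, rfl⟩ := J.mkQ_surjective q
      simpa using hl x hx y)

lemma span_op_right {n : ℕ} (B : GSer k V →ₗ[k] GSer k V →ₗ[k] GSer k V)
    (hB : ∀ y x, GRel k V n x → GRel k V n (B y x)) (y x : GSer k V)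
    (hx : x ∈ Submodule.span k {z | GRel k V n z}) :
    B y x ∈ Submodule.span k {z | GRel k V n z} := by
  induction hx using Submodule.span_induction with
  | mem x hx => exact Submodule.subset_span (hB y x hx)
  | zero => rw [map_zero]; exact zero_mem _
  | add a b _ _ ha hb => rw [map_add]; exact add_mem ha hb
  | smul c a _ ha => rw [map_smul]; exact Submodule.smul_mem _ c ha

lemma span_op_left {n : ℕ} (B : GSer k V →ₗ[k] GSer k V →ₗ[k] GSer k V)
    (hB : ∀ x y, GRel k V n x → GRel k V n (B x y)) (x y : GSer k V)
    (hx : x ∈ Submodule.span k {z | GRel k V n z}) :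
    B x y ∈ Submodule.span k {z | GRel k V n z} :=
  span_op_right B.flip (fun y x h => hB x y h) y x hx

variable (k V)

/-- The product of the quotient `G`-algebra. -/
def QuotG.mul (n : ℕ) : QuotG k V n →ₗ[k] QuotG k V n →ₗ[k] QuotG k V n :=
  liftOp (relIdeal k V n) (serMul k V)
    (fun x y hy w => by
      rw [truncAt_serMul]
      exact sum_mem fun u _ => span_op_right _ (fun y x h => .mul_left y x h) _ _ (hy u.2))
    (fun x hx y w => by
      rw [truncAt_serMul]
      exact sum_mem fun u _ => span_op_left _ (fun x y h => .mul_right x y h) _ _ (hx u.1))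

/-- The bracket of the quotient `G`-algebra. -/
def QuotG.br (n : ℕ) : QuotG k V n →ₗ[k] QuotG k V n →ₗ[k] QuotG k V n :=
  liftOp (relIdeal k V n) (serBr k V)
    (fun x y hy w => by
      rw [truncAt_serBr]
      exact sum_mem fun u _ => span_op_right _ (fun y x h => .br_left y x h) _ _ (hy u.2))
    (fun x hx y w => by
      rw [truncAt_serBr]
      exact sum_mem fun u _ => span_op_left _ (fun x y h => .br_right x y h) _ _ (hx u.1))

variable {k V}

/-- Homogeneous elements of the quotient `G`-algebra. -/
def QuotG.IsHomog {n : ℕ} (p : ℤ) (q : QuotG k V n) : Prop :=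
  ∃ x : GSer k V, (∀ m, x m ≠ 0 → mdeg V m = p) ∧ (relIdeal k V n).mkQ x = q

/-- The weight filtration of the quotient `G`-algebra. -/
def QuotG.InFiltration {n : ℕ} (w : ℕ) (q : QuotG k V n) : Prop :=
  ∃ x : GSer k V, (∀ m, m.weight < w → x m = 0) ∧ (relIdeal k V n).mkQ x = q

variable (k V)

/-- The generator `t^α`. -/
def QuotG.gen (n : ℕ) (α : V.Idx) : QuotG k V n := (relIdeal k V n).mkQ (mono k V (.gen α))

/-- A differential of the quotient `G`-algebra: a derivation of degree one of both operations,
of square zero, which respects the filtration by which the algebra is complete. -/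
@[ext]
structure GDifferential (n : ℕ) : Type u where
  D : QuotG k V n →ₗ[k] QuotG k V n
  degree_one : ∀ p q, q.IsHomog p → (D q).IsHomog (p + 1)
  filtered : ∀ w q, q.InFiltration w → (D q).InFiltration w
  map_mul : ∀ p x y, x.IsHomog p →
    D (QuotG.mul k V n x y) =
      QuotG.mul k V n (D x) y + sgn p • QuotG.mul k V n x (D y)
  map_br : ∀ p x y, x.IsHomog p →
    D (QuotG.br k V n x y) =
      QuotG.br k V n (D x) y + sgn (p + 1) • QuotG.br k V n x (D y)
  sq_zero : ∀ x, D (D x) = 0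

end FreeG

/-! ### The formal manifold `(V[2], 0)`

A formal function is given by its Taylor coefficients at the distinguished point:
`f = ∑_p (1/p!) ∑_{γ_1,…,γ_p} f_{γ_1…γ_p} t^{γ_1} ⋯ t^{γ_p}` with `f_{γ_1…γ_p}` symmetric in the
graded sense. -/

section Formal

variable (k : Type u) [Field k] (V : GrSp)

/-- Formal functions on `V[2]`. -/
def FormalFn : Submodule k (List V.Idx → k) where
  carrier := {f | ∀ A x y C,
    f (A ++ x :: y :: C) = sgn (V.tdeg x * V.tdeg y) • f (A ++ y :: x :: C)}
  add_mem' hf hg A x y C := by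
    simp only [Pi.add_apply]
    rw [hf A x y C, hg A x y C, smul_add]
  zero_mem' A x y C := by simp
  smul_mem' c f hf A x y C := by
    simp only [Pi.smul_apply]
    rw [hf A x y C, smul_comm]

variable {k V}

/-- The product on Taylor coefficients, determined by `(fg)(0) = f(0) g(0)` and
`∂_x (fg) = (∂_x f) g + (-1)^{|x||f|} f (∂_x g)`, where `(∂_x f)_γ = f_{xγ}`. -/
def taylorMul (f g : List V.Idx → k) : List V.Idx → k
  | [] => f [] * g []
  | x :: l =>
      taylorMul (fun l' => f (x :: l')) g l +
      taylorMul (fun l' => sgn (V.tdeg x * lsum V.tdeg l') • f l') (fun l' => g (x :: l')) l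

lemma taylorMul_smul_left (c : ℤˣ) (f g : List V.Idx → k) (l : List V.Idx) :
    taylorMul (fun l' => c • f l') g l = c • taylorMul f g l := by
  induction l generalizing f g with
  | nil => simp [taylorMul, smul_mul_assoc]
  | cons x l ih =>
    simp only [taylorMul, smul_add]
    rw [ih]
    congr 1
    rw [← ih]
    congr 1
    funext l'
    rw [smul_comm]

lemma taylorMul_smul_right (c : ℤˣ) (f g : List V.Idx → k) (l : List V.Idx) :
    taylorMul f (fun l' => c • g l') l = c • taylorMul f g l := by
  induction l generalizing f g with
  | nil => simp [taylorMul, mul_smul_comm]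
  | cons x l ih =>
    simp only [taylorMul, smul_add]
    rw [ih, ih]

lemma lsum_swap (d : V.Idx → ℤ) (A C : List V.Idx) (x y : V.Idx) :
    lsum d (A ++ x :: y :: C) = lsum d (A ++ y :: x :: C) := by
  simp [lsum]; ring

lemma FormalFn.shift_mem {f : List V.Idx → k} (hf : f ∈ FormalFn k V) (x : V.Idx) :
    (fun l => f (x :: l)) ∈ FormalFn k V := fun A y z C => hf (x :: A) y z C

lemma FormalFn.twist_mem {f : List V.Idx → k} (hf : f ∈ FormalFn k V) (n : ℤ) :
    (fun l => sgn (n * lsum V.tdeg l) • f l) ∈ FormalFn k V := by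
  intro A x y C
  dsimp only
  rw [lsum_swap, hf A x y C, smul_comm]

lemma taylorMul_mem {f g : List V.Idx → k} (hf : f ∈ FormalFn k V) (hg : g ∈ FormalFn k V) :
    taylorMul f g ∈ FormalFn k V := by
  intro A
  induction A generalizing f g with
  | cons z A ih =>
    intro x y C
    simp only [List.cons_append, taylorMul, smul_add]
    rw [ih (FormalFn.shift_mem hf z) hg x y C,
      ih (FormalFn.twist_mem hf (V.tdeg z)) (FormalFn.shift_mem hg z) x y C]
  | nil =>
    intro x y C
    have hc : ∀ a b : V.Idx, (fun l' => sgn (V.tdeg a * lsum V.tdeg (b :: l')) • f (b :: l')) =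
        fun l' => sgn (V.tdeg a * V.tdeg b) • (sgn (V.tdeg a * lsum V.tdeg l') • f (b :: l')) := by
      intro a b
      funext l'
      simp only [lsum, List.map_cons, List.sum_cons, mul_add, Int.negOnePow_add, mul_smul]
    have hff : (fun l' => f (x :: y :: l')) =
        fun l' => sgn (V.tdeg x * V.tdeg y) • f (y :: x :: l') := by
      funext l'; exact hf [] x y l'
    have hgg : (fun l' => g (x :: y :: l')) =
        fun l' => sgn (V.tdeg x * V.tdeg y) • g (y :: x :: l') := by
      funext l'; exact hg [] x y l'
    have htw : (fun l' => sgn (V.tdeg y * lsum V.tdeg l') •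
          sgn (V.tdeg x * lsum V.tdeg l') • f l') =
        fun l' => sgn (V.tdeg x * lsum V.tdeg l') • sgn (V.tdeg y * lsum V.tdeg l') • f l' := by
      funext l'; rw [smul_comm]
    have hs : ∀ z : k, sgn (V.tdeg x * V.tdeg y) • sgn (V.tdeg y * V.tdeg x) • z = z := by
      intro z
      rw [mul_comm (V.tdeg y), smul_smul, ← Int.negOnePow_add, Int.negOnePow_even _ ⟨_, rfl⟩,
        one_smul]
    simp only [List.nil_append, taylorMul]
    rw [hc x y, hc y x, hff, hgg, htw]
    simp only [taylorMul_smul_left, taylorMul_smul_right, smul_add, hs]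
    abel

/-- The product of formal functions. -/
def FormalFn.mul (f g : FormalFn k V) : FormalFn k V :=
  ⟨taylorMul f.1 g.1, taylorMul_mem f.2 g.2⟩

instance : Mul (FormalFn k V) := ⟨FormalFn.mul⟩

/-- The partial derivative `∂/∂t^β`. -/
def FormalFn.pd (β : V.Idx) (f : FormalFn k V) : FormalFn k V :=
  ⟨fun l => f.1 (β :: l), FormalFn.shift_mem f.2 β⟩

/-- The parity involution `f ↦ (-1)^{|f|} f`. -/
def FormalFn.parity (f : FormalFn k V) : FormalFn k V :=
  ⟨fun l => sgn (1 * lsum V.tdeg l) • f.1 l, FormalFn.twist_mem f.2 1⟩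

variable (k V)

/-- Vector fields `X = ∑_α X^α ∂/∂t^α` on `V[2]`; these form a free module over the formal
functions. -/
abbrev VecField : Type u := V.Idx → FormalFn k V

variable {k V}

namespace VecField

/-- The coordinate vector field `∂/∂t^β`. -/
def coord (β : V.Idx) : VecField k V := fun α =>
  ⟨fun l => if l = [] ∧ α = β then 1 else 0, by intro A x y C; simp⟩

/-- The function `X(f) = ∑_α X^α ∂f/∂t^α`. -/
def app (X : VecField k V) (f : FormalFn k V) : FormalFn k V := ∑ α, X α * FormalFn.pd α f

/-- The vector field `f X`. -/
def fsmul (f : FormalFn k V) (X : VecField k V) : VecField k V := fun α => f * X α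

/-- The parity involution `X ↦ (-1)^{|X|} X`, where `|∂/∂t^α| = |e_α| - 2`. -/
def parity (X : VecField k V) : VecField k V := fun α => sgn (V.deg α - 2) • FormalFn.parity (X α)

/-- The parity involution of the tangent module shifted by one. -/
def shiftParity (X : VecField k V) : VecField k V := -X.parity

/-- The Lie derivative `[ν, X]` along an odd vector field `ν`:
`[ν, X]^α = ν(X^α) - (-1)^{|X|} X(ν^α)`. -/
def lieOdd (ν X : VecField k V) : VecField k V := fun α => ν.app (X α) - X.parity.app (ν α)

/-- `X` is homogeneous of degree `p` in the tangent module identified with `O ⊗ V[1]`, in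
which `∂/∂t^α` has degree `|e_α| - 1`. -/
def IsHomog (p : ℤ) (X : VecField k V) : Prop :=
  ∀ α l, (X α).1 l ≠ 0 → lsum V.tdeg l + V.sdeg α = p

end VecField

open VecField

variable (k V)

/-- A geometric `C_∞`-structure on the pointed formal manifold `(V[2], 0)`: a homological vector
field `ν` vanishing at the distinguished point, and a `C_∞`-structure on the tangent module
`O ⊗ V` whose first operation is `Lie_ν` and whose higher operations are tensors.
As usual, the operations `μ_n` of degree `2 - n` are encoded by the operations
`b_n(X_1, …, X_n) = (-1)^{∑ (n-i)|X_i|} μ_n(X_1, …, X_n)` of degree `1` on the shifted module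
`O ⊗ V[1]`, i.e. by a codifferential of the tensor coalgebra. The value of `b` on a list of length
`n` is `b_n`. -/
@[ext]
structure GeomCInf : Type u where
  ν : VecField k V
  ν_degree : ∀ α l, (ν α).1 l ≠ 0 → lsum V.tdeg l = V.tdeg α + 1
  ν_pointed : ∀ α, (ν α).1 [] = 0
  ν_sq : ∀ α, ν.app (ν α) = 0
  b : List (VecField k V) → VecField k V
  b_nil : b [] = 0
  b_one : ∀ X, b [X] = lieOdd ν X
  b_add : ∀ A X Y C, b (A ++ (X + Y) :: C) = b (A ++ X :: C) + b (A ++ Y :: C)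
  /-- linearity over even functions of the operations with at least two arguments -/
  b_even : ∀ A X C (f : FormalFn k V), A ++ C ≠ [] → FormalFn.parity f = f →
    b (A ++ fsmul f X :: C) = fsmul f (b (A ++ X :: C))
  /-- linearity over odd functions of the operations with at least two arguments -/
  b_odd : ∀ A X C (f : FormalFn k V), A ++ C ≠ [] → FormalFn.parity f = -f →
    b (A ++ fsmul f X :: C) = -fsmul f (b (A.map shiftParity ++ X :: C))
  b_degree : ∀ L : List (VecField k V × ℤ), 2 ≤ L.length → (∀ x ∈ L, x.1.IsHomog x.2) →
    (b (L.map Prod.fst)).IsHomog ((L.map Prod.snd).sum + 1)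
  /-- the Harrison condition: vanishing on shuffle products -/
  b_shuffle : ∀ A C : List (VecField k V × ℤ), A ≠ [] → C ≠ [] →
    (∀ x ∈ A, x.1.IsHomog x.2) → (∀ x ∈ C, x.1.IsHomog x.2) →
    ((signedShuffles Prod.snd A C).map (fun s => s.1 • b (s.2.map Prod.fst))).sum = 0
  /-- the structure equations of an `A_∞`-algebra -/
  b_ainf : ∀ L : List (VecField k V),
    ∑ s ∈ Finset.range L.length, ∑ l ∈ Finset.Icc 1 (L.length - s),
      b ((L.take s).map shiftParity ++ b ((L.drop s).take l) :: L.drop (s + l)) = 0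

end Formal

/-! ### Structure coefficients -/

section Coefficients

variable (k : Type u) [Field k] (V : GrSp)

/-- Systems of structure coefficients `c^α_{B;γ}`: for a word `B` of length `n ≥ 2` these describe
operations `V^{⊗n} ⊗ V^{⊙p} → V`, `p = |γ|`, and for empty `B` operations `V^{⊙p} → V`. -/
abbrev Coeffs : Type u := V.Idx → List V.Idx → List V.Idx → k

variable {k V}

/-- The coefficients `c^α_{B;γ}` which describe linear maps
`V^{⊗n}/(shuffle products) ⊗ V^{⊙p} → V` (where `n = 0` or `n ≥ 2`, and `n + p ≥ 1`). -/
structure Coeffs.Admissible (c : Coeffs k V) : Prop where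
  symm : ∀ α B A x y C,
    c α B (A ++ x :: y :: C) = sgn (V.tdeg x * V.tdeg y) • c α B (A ++ y :: x :: C)
  no_constant : ∀ α, c α [] [] = 0
  no_single : ∀ α β γ, c α [β] γ = 0
  shuffle : ∀ α A C γ, A ≠ [] → C ≠ [] →
    ((signedShuffles V.sdeg A C).map (fun s => s.1 • c α s.2 γ)).sum = 0

/-- Recognizes the left-normed brackets
`t^B = [ … [[t^{β_1} • t^{β_2}] • t^{β_3}] … • t^{β_n}]`. -/
def GMon.decodeLie {ι : Type} : GMon ι → Option (List ι)
  | .gen i => some [i]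
  | .br a (.gen i) => (decodeLie a).map (fun B => B ++ [i])
  | _ => none

/-- Recognizes the monomials `t^{γ_1}(t^{γ_2}( ⋯ (t^{γ_p} t^B)))`. -/
def GMon.decode {ι : Type} : GMon ι → Option (List ι × List ι)
  | .mul (.gen i) m => (decode m).map (fun x => (i :: x.1, x.2))
  | m => (decodeLie m).map (fun B => ([], B))

/-- The series
`∑_p (1/p!) c^α_{∅;γ} t^{γ_1} ⋯ t^{γ_p}
  - ∑_{n ≥ 2, p ≥ 0} (1/(n p!)) (-1)^{s(α,B)} c^α_{B;γ} t^{γ_1} ⋯ t^{γ_p} t^B`,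
where `s(α,B)` is the Koszul sign of the pairing of words in `V[1]` with words in the dual space.
By the theorem of Dynkin, Specht and Wever, `1/n` times the left-normed bracketing is
the identity on Lie elements of the tensor algebra, so that the second sum is the element dual to
the maps `V^{⊗n}/(shuffle products) ⊗ V^{⊙p} → V`. -/
def Coeffs.expand (c : Coeffs k V) (α : V.Idx) : GSer k V := fun m =>
  match m.decode with
  | none => 0
  | some (_, []) => 0
  | some (γ, [β]) => ((γ.length + 1).factorial : k)⁻¹ * c α [] (γ ++ [β])
  | some (γ, B) =>
      -(sgn (V.sdeg α * (1 + lsum V.sdeg B) + pairSum V.sdeg B) •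
        (((B.length : k) * (γ.length.factorial : k))⁻¹ * c α B γ))

/-- The system of coefficients of a differential `D` of the quotient by the square of the
commutator ideal: the dual of its restriction to the generators. -/
def GDifferential.IsCoeffs (D : GDifferential k V 2) (c : Coeffs k V) : Prop :=
  c.Admissible ∧
    ∀ α, D.D (QuotG.gen k V 2 α) = (relIdeal k V 2).mkQ (c.expand α)

open Classical in
/-- The (unique admissible) system of coefficients of a differential. -/
def GDifferential.coeffs (D : GDifferential k V 2) : Coeffs k V :=
  if h : ∃ c, D.IsCoeffs c then h.choose else 0

/-- The Taylor coefficients at `0` of the tensors of a geometric `C_∞`-structure. -/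
def GeomCInf.coeffs (S : GeomCInf k V) : Coeffs k V := fun α B γ =>
  if B = [] then (S.ν α).1 γ
  else if B.length = 1 then 0
  else (S.b (B.map VecField.coord) α).1 γ

end Coefficients

/-! ### Endomorphism operads -/

section EndOperad

variable (k : Type u) [Field k] (V : GrSp)

/-- `Hom(V^{⊗n}, V)`: `f` sends `e_{β_1} ⊗ ⋯ ⊗ e_{β_n}` to `∑_α f(β)(α) e_α`. -/
abbrev EndOp (n : ℕ) : Type u := (Fin n → V.Idx) → V.Idx → k

variable {k V}

namespace EndOp

/-- Homogeneous maps of degree `p`. -/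
def IsHomog {n : ℕ} (p : ℤ) (f : EndOp k V n) : Prop :=
  ∀ β α, f β α ≠ 0 → V.deg α = ∑ i, V.deg (β i) + p

/-- The identity map. -/
def one : EndOp k V 1 := fun β α => if β 0 = α then 1 else 0

/-- The exponent of the Koszul sign of `v_1 ⊗ ⋯ ⊗ v_n ↦ v_{σ 1} ⊗ ⋯ ⊗ v_{σ n}`, `d_i = |v_i|`. -/
def koszul {n : ℕ} (σ : Equiv.Perm (Fin n)) (d : Fin n → ℤ) : ℤ :=
  ∑ i, ∑ j, if i < j ∧ σ j < σ i then d (σ i) * d (σ j) else 0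

/-- The action of permutations: `(σ f)(v_1, …, v_n) = ± f(v_{σ 1}, …, v_{σ n})`. -/
def perm {n : ℕ} (σ : Equiv.Perm (Fin n)) (f : EndOp k V n) : EndOp k V n := fun β α =>
  sgn (koszul σ (V.deg ∘ β)) • f (β ∘ σ) α

/-- The composition `f ∘_i g`:
`(f ∘_i g)(v_1, …, v_m) = (-1)^{|g|(|v_1| + ⋯ + |v_{i-1}|)} f(v_1, …, g(v_i, …), …, v_m)`
(with `i` counted from zero in the code). -/
def circ {n n' m : ℕ} (h : n + n' = m + 1) (i : Fin n) (f : EndOp k V n) (g : EndOp k V n') :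
    EndOp k V m := fun γ α =>
  ∑ b : V.Idx,
    sgn ((V.deg b - ∑ j : Fin n', V.deg (γ ⟨i + j, by omega⟩)) *
      ∑ j : Fin i.1, V.deg (γ ⟨j, by omega⟩)) •
    (f (fun j : Fin n =>
        if h₁ : j < i then γ ⟨j, by omega⟩
        else if h₂ : i < j then γ ⟨j + n' - 1, by omega⟩ else b) α *
      g (fun j : Fin n' => γ ⟨i + j, by omega⟩) b)

/-- The differential induced on maps `f` of degree `p` by a differential `d` on `V`:
`d ∘ f - (-1)^p ∑_i f ∘_i d`. -/
def diff {n : ℕ} (d : EndOp k V 1) (p : ℤ) (f : EndOp k V n) : EndOp k V n :=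
  circ (Nat.add_comm 1 n) 0 d f - sgn p • ∑ i, circ (rfl : n + 1 = n + 1) i f d

end EndOp

/-- The degree of the operations `V^{⊗n} ⊗ V^{⊙p} → V`. -/
def opDeg (n p : ℕ) : ℤ := if n = 0 then 3 - 2 * p else 2 - n - 2 * p

/-- The operation `V^{⊗n} ⊗ V^{⊙p} → V` with coefficients `c^α_{B;γ}`, as an element of
`Hom(V^{⊗(n+p)}, V)`. It is characterized by the property that its extension `m` by linearity over
formal functions satisfies
`m(e_{β_1}, …, e_{β_n}; x, …, x) = (-1)^{∑ (n-i)|e_{β_i}|} ∑ c^α_{β;γ} t^{γ_1} ⋯ t^{γ_p} e_α`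
for `x = ∑_α t^α e_α`. -/
def opOf (n p : ℕ) (c : Coeffs k V) : EndOp k V (n + p) := fun x α =>
  let B := List.ofFn fun i : Fin n => x (Fin.castAdd p i)
  let γ := List.ofFn fun j : Fin p => x (Fin.natAdd n j)
  sgn (staircaseSum V.deg B + lsum V.deg γ * (opDeg n p + lsum V.deg B) + pairSum V.deg γ) •
    c α B γ

end EndOperad

/-! ### Operads defined through their algebras

An operad is determined by its algebras on a variable finite-dimensional graded vector space `V`:
it is the image of its action in the endomorphism operads of all `V`. -/

section Operads

variable (k : Type u) [Field k]

/-- A type of algebraic structure on finite-dimensional graded vector spaces, given by operations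
`V^{⊗n} ⊗ V^{⊙p} → V`. -/
structure Species where
  Str : GrSp → Type u
  coeffs : ∀ {V : GrSp}, Str V → Coeffs k V

/-- Differentials of the quotient of the free `G`-algebra by the square of the commutator ideal. -/
def gTwo : Species k where
  Str V := GDifferential k V 2
  coeffs D := D.coeffs

/-- Geometric `C_∞`-structures on `(V[2], 0)`. -/
def gerstC : Species k where
  Str V := GeomCInf k V
  coeffs S := S.coeffs

variable {k}

namespace Species

variable (F : Species k)

/-- The differential on `V` which underlies a structure. -/
def diffOp {V : GrSp} (S : F.Str V) : EndOp k V 1 := opOf 0 1 (F.coeffs S)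

/-- Families of `n`-ary operations on all `V` with a structure: the product of the endomorphism
operads `Hom(V^{⊗n}, V)` over all `V` and all structures on `V`. -/
abbrev Fam (n : ℕ) : Type u := ∀ V : GrSp, F.Str V → EndOp k V n

namespace Fam

/-- The family of identity maps. -/
def one (F : Species k) : F.Fam 1 := fun _ _ => EndOp.one

variable {F}

/-- Action of permutations on families. -/
def perm {n : ℕ} (σ : Equiv.Perm (Fin n)) (x : F.Fam n) : F.Fam n :=
  fun V S => EndOp.perm σ (x V S)

/-- Composition of families. -/
def circ {n n' m : ℕ} (h : n + n' = m + 1) (i : Fin n) (x : F.Fam n) (y : F.Fam n') : F.Fam m :=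
  fun V S => EndOp.circ h i (x V S) (y V S)

/-- Differential of families of degree `p`. -/
def diff {n : ℕ} (p : ℤ) (x : F.Fam n) : F.Fam n :=
  fun V S => EndOp.diff (F.diffOp S) p (x V S)

end Fam

/-- Membership, in arity `n` and degree `p`, in the dg suboperad generated by the operations (other
than the differential) of a structure. -/
inductive Gen : ∀ n : ℕ, ℤ → F.Fam n → Prop
  | op (n p : ℕ) : (2 ≤ n ∨ (n = 0 ∧ 2 ≤ p)) →
      Gen (n + p) (opDeg n p) (fun _ S => opOf n p (F.coeffs S))
  | one : Gen 1 0 (Fam.one F)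
  | zero (n : ℕ) (p : ℤ) : Gen n p 0
  | add {n : ℕ} {p : ℤ} {x y : F.Fam n} : Gen n p x → Gen n p y → Gen n p (x + y)
  | smul {n : ℕ} {p : ℤ} (a : k) {x : F.Fam n} : Gen n p x → Gen n p (a • x)
  | perm {n : ℕ} {p : ℤ} (σ : Equiv.Perm (Fin n)) {x : F.Fam n} :
      Gen n p x → Gen n p (Fam.perm σ x)
  | circ {n n' m : ℕ} {p q : ℤ} (h : n + n' = m + 1) (i : Fin n) {x : F.Fam n} {y : F.Fam n'} :
      Gen n p x → Gen n' q y → Gen m (p + q) (Fam.circ h i x y)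
  | diff {n : ℕ} {p : ℤ} {x : F.Fam n} : Gen n p x → Gen n (p + 1) (Fam.diff p x)

/-- The component of arity `n` and degree `p` of the dg operad of the species: the dg suboperad,
generated by the operations of a structure, of the product of the endomorphism operads. -/
def Operad (n : ℕ) (p : ℤ) : Submodule k (F.Fam n) where
  carrier := {x | F.Gen n p x}
  add_mem' := Gen.add
  zero_mem' := Gen.zero n p
  smul_mem' a _ h := Gen.smul a h

/-- The unit of the operad. -/
def Operad.one : F.Operad 1 0 := ⟨Fam.one F, Gen.one⟩

variable {F}

/-- The action of permutations on the operad. -/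
def Operad.perm {n : ℕ} {p : ℤ} (σ : Equiv.Perm (Fin n)) (x : F.Operad n p) : F.Operad n p :=
  ⟨Fam.perm σ x.1, Gen.perm σ x.2⟩

/-- The compositions of the operad. -/
def Operad.circ {n n' m : ℕ} {p q : ℤ} (h : n + n' = m + 1) (i : Fin n)
    (x : F.Operad n p) (y : F.Operad n' q) : F.Operad m (p + q) :=
  ⟨Fam.circ h i x.1 y.1, Gen.circ h i x.2 y.2⟩

/-- The differential of the operad. -/
def Operad.diff {n : ℕ} {p : ℤ} (x : F.Operad n p) : F.Operad n (p + 1) :=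
  ⟨Fam.diff p x.1, Gen.diff x.2⟩

/-- The value of an element of the operad on a structure. -/
def Operad.eval {n : ℕ} {p : ℤ} (x : F.Operad n p) {V : GrSp} (S : F.Str V) : EndOp k V n :=
  x.1 V S

variable (F)

/-- An algebra over the dg operad of a species on a graded vector space `V`: a differential `d` on
`V` together with a morphism of dg operads to the endomorphism operad of `(V, d)`. -/
@[ext]
structure OpAlgebra (V : GrSp) : Type u where
  d : EndOp k V 1
  d_degree : d.IsHomog 1
  d_sq : EndOp.circ (rfl : 1 + 1 = 1 + 1) 0 d d = 0
  act : ∀ (n : ℕ) (p : ℤ), F.Operad n p →ₗ[k] EndOp k V n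
  act_degree : ∀ n p (x : F.Operad n p), (act n p x).IsHomog p
  act_one : act 1 0 (Operad.one F) = EndOp.one
  act_perm : ∀ n p (σ : Equiv.Perm (Fin n)) (x : F.Operad n p),
    act n p (Operad.perm σ x) = EndOp.perm σ (act n p x)
  act_circ : ∀ n n' m p q (h : n + n' = m + 1) (i : Fin n)
    (x : F.Operad n p) (y : F.Operad n' q),
    act m (p + q) (Operad.circ h i x y) = EndOp.circ h i (act n p x) (act n' q y)
  act_diff : ∀ n p (x : F.Operad n p), act n (p + 1) (Operad.diff x) = EndOp.diff d p (act n p x)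

/-- The algebras over the dg operad of the species on each `V` are exactly the structures on `V`,
through evaluation. -/
def IsOperadOfStructures : Prop :=
  ∀ V : GrSp, ∃ ρ : F.Str V ≃ F.OpAlgebra V,
    ∀ S : F.Str V, (ρ S).d = F.diffOp S ∧
      ∀ n p (x : F.Operad n p), (ρ S).act n p x = Operad.eval x S

variable {F}

/-- An isomorphism of dg operads. -/
structure OperadIso (F G : Species k) where
  equiv : ∀ (n : ℕ) (p : ℤ), F.Operad n p ≃ₗ[k] G.Operad n p
  map_one : equiv 1 0 (Operad.one F) = Operad.one G
  map_perm : ∀ n p (σ : Equiv.Perm (Fin n)) (x : F.Operad n p),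
    equiv n p (Operad.perm σ x) = Operad.perm σ (equiv n p x)
  map_circ : ∀ n n' m p q (h : n + n' = m + 1) (i : Fin n)
    (x : F.Operad n p) (y : F.Operad n' q),
    equiv m (p + q) (Operad.circ h i x y) = Operad.circ h i (equiv n p x) (equiv n' q y)
  map_diff : ∀ n p (x : F.Operad n p), equiv n (p + 1) (Operad.diff x) = Operad.diff (equiv n p x)

end Species

end Operads

end GInf

end

noncomputable section

namespace GInf

section Signs

lemma zmodTwo_sq (x : ZMod 2) : x ^ 2 = x := by revert x; decide

lemma sgn_eq_of {a b : ℤ} (h : ((a - b : ℤ) : ZMod 2) = 0) : sgn a = sgn b := by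
  rw [Int.negOnePow_eq_iff]
  exact (ZMod.intCast_zmod_eq_zero_iff_dvd _ 2).1 h |>.imp (fun c hc => by push_cast at hc; omega)

variable {M : Type*} [AddCommGroup M]

lemma sgn_smul_smul (a b : ℤ) (x : M) : sgn a • sgn b • x = sgn (a + b) • x := by
  rw [smul_smul, ← Int.negOnePow_add]

lemma sgn_smul_self (a : ℤ) (x : M) : sgn a • sgn a • x = x := by
  have h : sgn (a + a) = 1 := Int.negOnePow_even _ ⟨_, rfl⟩
  rw [sgn_smul_smul, h, one_smul]

lemma sgn_one_smul (x : M) : sgn 1 • x = -x := by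
  have h : sgn 1 = -1 := Int.negOnePow_one
  rw [h]; simp

lemma sgn_smul_congr {a b : ℤ} (x : M) (h : ((a - b : ℤ) : ZMod 2) = 0) : sgn a • x = sgn b • x := by
  rw [sgn_eq_of h]

end Signs

section Lists

variable {X : Type*} (d : X → ℤ)

@[simp] lemma lsum_nil : lsum d [] = 0 := rfl
@[simp] lemma lsum_cons (x : X) (l : List X) : lsum d (x :: l) = d x + lsum d l := by simp [lsum]
@[simp] lemma lsum_append (l m : List X) : lsum d (l ++ m) = lsum d l + lsum d m := by simp [lsum]

@[simp] lemma pairSum_append (l m : List X) :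
    pairSum d (l ++ m) = pairSum d l + pairSum d m + lsum d l * lsum d m := by
  induction l with
  | nil => simp [pairSum]
  | cons x l ih => simp only [List.cons_append, pairSum, ih, lsum_append, lsum_cons]; ring

@[simp] lemma staircaseSum_append (l m : List X) :
    staircaseSum d (l ++ m) =
      staircaseSum d l + m.length * lsum d l + staircaseSum d m := by
  induction l with
  | nil => simp [staircaseSum]
  | cons x l ih =>
    simp only [List.cons_append, staircaseSum, ih, List.length_append, lsum_cons]
    push_cast; ring

end Lists

section Taylor

variable {k : Type u} [Field k] {V : GrSp}

lemma taylorMul_add_left (f f' g : List V.Idx → k) (l : List V.Idx) :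
    taylorMul (f + f') g l = taylorMul f g l + taylorMul f' g l := by
  induction l generalizing f f' g with
  | nil => simp [taylorMul, add_mul]
  | cons x l ih =>
    simp only [taylorMul]
    have h1 : (fun l' => (f + f') (x :: l')) = (fun l' => f (x :: l')) + fun l' => f' (x :: l') := rfl
    have h2 : (fun l' => sgn (V.tdeg x * lsum V.tdeg l') • (f + f') l') =
        (fun l' => sgn (V.tdeg x * lsum V.tdeg l') • f l') +
          fun l' => sgn (V.tdeg x * lsum V.tdeg l') • f' l' := by
      funext l'; simp [smul_add]
    rw [h1, h2, ih, ih]; abel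

lemma taylorMul_add_right (f g g' : List V.Idx → k) (l : List V.Idx) :
    taylorMul f (g + g') l = taylorMul f g l + taylorMul f g' l := by
  induction l generalizing f g g' with
  | nil => simp [taylorMul, mul_add]
  | cons x l ih =>
    simp only [taylorMul]
    have h1 : (fun l' => (g + g') (x :: l')) = (fun l' => g (x :: l')) + fun l' => g' (x :: l') := rfl
    rw [h1, ih, ih]; abel

lemma taylorMul_const_smul_left (c : k) (f g : List V.Idx → k) (l : List V.Idx) :
    taylorMul (c • f) g l = c * taylorMul f g l := by
  induction l generalizing f g with
  | nil => simp [taylorMul, mul_assoc]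
  | cons x l ih =>
    simp only [taylorMul, mul_add]
    have h2 : (fun l' => sgn (V.tdeg x * lsum V.tdeg l') • (c • f) l') =
        c • (fun l' => sgn (V.tdeg x * lsum V.tdeg l') • f l') := by
      funext l'; simp [mul_smul_comm]
    have h1 : (fun l' => (c • f) (x :: l')) = c • fun l' => f (x :: l') := rfl
    rw [h1, h2, ih, ih]

lemma taylorMul_const_smul_right (c : k) (f g : List V.Idx → k) (l : List V.Idx) :
    taylorMul f (c • g) l = c * taylorMul f g l := by
  induction l generalizing f g with
  | nil => simp [taylorMul, mul_left_comm]
  | cons x l ih =>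
    simp only [taylorMul, mul_add]
    have h1 : (fun l' => (c • g) (x :: l')) = c • fun l' => g (x :: l') := rfl
    rw [h1, ih, ih]

lemma taylorMul_twist (n : ℤ) (f g : List V.Idx → k) (l : List V.Idx) :
    taylorMul (fun l' => sgn (n * lsum V.tdeg l') • f l') (fun l' => sgn (n * lsum V.tdeg l') • g l') l
      = sgn (n * lsum V.tdeg l) • taylorMul f g l := by
  induction l generalizing f g with
  | nil => simp [taylorMul]
  | cons x l ih =>
    simp only [taylorMul, lsum_cons, mul_add, Int.negOnePow_add, mul_smul, smul_add]
    rw [taylorMul_smul_left, ih, taylorMul_smul_right]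
    congr 3
    rw [← ih]
    congr 1
    funext l'
    rw [smul_comm]

lemma taylorMul_assoc (f g h : List V.Idx → k) (l : List V.Idx) :
    taylorMul (taylorMul f g) h l = taylorMul f (taylorMul g h) l := by
  induction l generalizing f g h with
  | nil => simp [taylorMul, mul_assoc]
  | cons x l ih =>
    simp only [taylorMul]
    have h1 : (fun l' => taylorMul (fun l' => f (x :: l')) g l' +
        taylorMul (fun l' => sgn (V.tdeg x * lsum V.tdeg l') • f l') (fun l' => g (x :: l')) l') =
        taylorMul (fun l' => f (x :: l')) g + taylorMul (fun l' => sgn (V.tdeg x * lsum V.tdeg l') • f l')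
          (fun l' => g (x :: l')) := rfl
    have h2 : (fun l' => taylorMul (fun l' => g (x :: l')) h l' +
        taylorMul (fun l' => sgn (V.tdeg x * lsum V.tdeg l') • g l') (fun l' => h (x :: l')) l') =
        taylorMul (fun l' => g (x :: l')) h + taylorMul (fun l' => sgn (V.tdeg x * lsum V.tdeg l') • g l')
          (fun l' => h (x :: l')) := rfl
    have h3 : (fun l' => sgn (V.tdeg x * lsum V.tdeg l') • taylorMul f g l') =
        taylorMul (fun l' => sgn (V.tdeg x * lsum V.tdeg l') • f l')
          (fun l' => sgn (V.tdeg x * lsum V.tdeg l') • g l') := by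
      funext l'; rw [taylorMul_twist]
    rw [h1, h2, h3, taylorMul_add_left, taylorMul_add_right, ih, ih, ih, add_assoc]

lemma taylorMul_zero_left (g : List V.Idx → k) (l : List V.Idx) : taylorMul 0 g l = 0 := by
  have := taylorMul_const_smul_left 0 0 g l
  simpa using this

lemma taylorMul_zero_right (g : List V.Idx → k) (l : List V.Idx) : taylorMul g 0 l = 0 := by
  have := taylorMul_const_smul_right 0 g 0 l
  simpa using this

lemma taylorMul_one_left (f : List V.Idx → k) (l : List V.Idx) :
    taylorMul (fun l => if l = [] then 1 else 0) f l = f l := by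
  induction l generalizing f with
  | nil => simp [taylorMul]
  | cons x l ih =>
    simp only [taylorMul, reduceCtorEq, if_false]
    have h1 : (fun l' : List V.Idx => sgn (V.tdeg x * lsum V.tdeg l') • if l' = [] then (1 : k) else 0) =
        fun l' => if l' = [] then 1 else 0 := by
      funext l'; split_ifs with h <;> simp [h]
    rw [h1, ih]
    exact (congrArg (· + _) (taylorMul_zero_left f l)).trans (zero_add _)

lemma taylorMul_one_right (f : List V.Idx → k) (l : List V.Idx) :
    taylorMul f (fun l => if l = [] then 1 else 0) l = f l := by
  induction l generalizing f with
  | nil => simp [taylorMul]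
  | cons x l ih =>
    simp only [taylorMul, reduceCtorEq, if_false]
    rw [ih]
    exact (congrArg (_ + ·) (taylorMul_zero_right _ l)).trans (add_zero _)

/-- If `f` vanishes to order `a` and `g` to order `b`, then `f g` vanishes to order `a + b`. -/
lemma taylorMul_vanish (f g : List V.Idx → k) (a b : ℕ)
    (hf : ∀ l, l.length < a → f l = 0) (hg : ∀ l, l.length < b → g l = 0) (l : List V.Idx)
    (hl : l.length < a + b) : taylorMul f g l = 0 := by
  induction l generalizing f g a b with
  | nil =>
    simp only [taylorMul]
    rcases Nat.eq_zero_or_pos a with h | h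
    · rw [hg [] (by simpa [h] using hl), mul_zero]
    · rw [hf [] (by simpa using h), zero_mul]
  | cons x l ih =>
    simp only [taylorMul]
    simp only [List.length_cons] at hl
    have h1 : taylorMul (fun l' => f (x :: l')) g l = 0 := by
      rcases Nat.eq_zero_or_pos a with h | h
      · exact ih _ _ 0 b (by simp) hg (by omega)
      · exact ih _ _ (a - 1) b (fun m hm => hf _ (by simp; omega)) hg (by omega)
    have h2 : taylorMul (fun l' => sgn (V.tdeg x * lsum V.tdeg l') • f l') (fun l' => g (x :: l')) l
        = 0 := by
      rcases Nat.eq_zero_or_pos b with h | h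
      · exact ih _ _ a 0 (fun m hm => by rw [hf m hm, smul_zero]) (by simp) (by omega)
      · exact ih _ _ a (b - 1) (fun m hm => by rw [hf m hm, smul_zero])
          (fun m hm => hg _ (by simp; omega)) (by omega)
    rw [h1, h2, add_zero]

/-- The product is additive on integer degrees. -/
lemma taylorMul_degree {δ : V.Idx → ℤ} (f g : List V.Idx → k) (p q : ℤ)
    (hf : ∀ l, f l ≠ 0 → lsum δ l = p) (hg : ∀ l, g l ≠ 0 → lsum δ l = q)
    (l : List V.Idx) (hl : taylorMul f g l ≠ 0) : lsum δ l = p + q := by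
  induction l generalizing f g p q with
  | nil =>
    simp only [taylorMul] at hl
    rw [← hf [] (left_ne_zero_of_mul hl), ← hg [] (right_ne_zero_of_mul hl)]; rfl
  | cons x l ih =>
    simp only [taylorMul] at hl
    by_cases h : taylorMul (fun l' => f (x :: l')) g l = 0
    · rw [h, zero_add] at hl
      have := ih _ _ p (q - δ x) (fun m hm => hf m (by
        intro h0; apply hm; rw [h0, smul_zero]))
        (fun m hm => by rw [← hg _ hm, lsum_cons]; ring) hl
      rw [lsum_cons, this]; ring
    · have := ih _ _ (p - δ x) q (fun m hm => by rw [← hf _ hm, lsum_cons]; ring) hg h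
      rw [lsum_cons, this]; ring

end Taylor

namespace FormalFn

variable {k : Type u} [Field k] {V : GrSp}

instance : One (FormalFn k V) := ⟨⟨fun l => if l = [] then 1 else 0, by intro A x y C; simp⟩⟩

@[ext] lemma ext' {f g : FormalFn k V} (h : ∀ l, f.1 l = g.1 l) : f = g := Subtype.ext (funext h)

instance instRing : Ring (FormalFn k V) :=
  { (inferInstance : AddCommGroup (FormalFn k V)) with
    mul := (· * ·)
    one := 1
    left_distrib := fun f g h => Subtype.ext (funext fun l => taylorMul_add_right f.1 g.1 h.1 l)
    right_distrib := fun f g h => Subtype.ext (funext fun l => taylorMul_add_left f.1 g.1 h.1 l)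
    zero_mul := fun f => Subtype.ext (funext fun l => taylorMul_zero_left f.1 l)
    mul_zero := fun f => Subtype.ext (funext fun l => taylorMul_zero_right f.1 l)
    mul_assoc := fun f g h => Subtype.ext (funext fun l => taylorMul_assoc f.1 g.1 h.1 l)
    one_mul := fun f => Subtype.ext (funext fun l => taylorMul_one_left f.1 l)
    mul_one := fun f => Subtype.ext (funext fun l => taylorMul_one_right f.1 l) }

instance instAlgebra : Algebra k (FormalFn k V) :=
  Algebra.ofModule
    (fun c f g => Subtype.ext (funext fun l => taylorMul_const_smul_left c f.1 g.1 l))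
    (fun c f g => Subtype.ext (funext fun l => taylorMul_const_smul_right c f.1 g.1 l))

lemma coe_mul (f g : FormalFn k V) : (f * g).1 = taylorMul f.1 g.1 := rfl

lemma one_apply (l : List V.Idx) : (1 : FormalFn k V).1 l = if l = [] then 1 else 0 := rfl

/-- The twist `f ↦ (-1)^{n |f|} f`. -/
def tw (n : ℤ) : FormalFn k V →ₗ[k] FormalFn k V where
  toFun f := ⟨fun l => sgn (n * lsum V.tdeg l) • f.1 l, twist_mem f.2 n⟩
  map_add' f g := by ext l; simp [smul_add]
  map_smul' c f := by ext l; simp [mul_smul_comm]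

lemma tw_apply (n : ℤ) (f : FormalFn k V) (l : List V.Idx) :
    (tw n f).1 l = sgn (n * lsum V.tdeg l) • f.1 l := rfl

lemma parity_eq_tw (f : FormalFn k V) : parity f = tw 1 f := rfl

lemma tw_mul (n : ℤ) (f g : FormalFn k V) : tw n (f * g) = tw n f * tw n g := by
  ext l
  rw [tw_apply, coe_mul, coe_mul]
  exact (taylorMul_twist n f.1 g.1 l).symm

lemma tw_tw (m n : ℤ) (f : FormalFn k V) : tw m (tw n f) = tw (m + n) f := by
  ext l
  rw [tw_apply, tw_apply, tw_apply, sgn_smul_smul, add_mul]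

@[simp] lemma tw_one (n : ℤ) : tw n (1 : FormalFn k V) = 1 := by
  ext l
  rw [tw_apply, one_apply]
  split_ifs with h <;> simp [h]

lemma tw_congr {m n : ℤ} (h : ((m - n : ℤ) : ZMod 2) = 0) : tw m = (tw n : FormalFn k V →ₗ[k] _) := by
  apply LinearMap.ext
  intro f
  ext l
  rw [tw_apply, tw_apply]
  apply sgn_smul_congr
  rw [← sub_mul]
  push_cast at h ⊢
  rw [h, zero_mul]

@[simp] lemma tw_zero (f : FormalFn k V) : tw 0 f = f := by
  ext l; simp [tw_apply]

lemma tw_self (n : ℤ) (f : FormalFn k V) : tw n (tw n f) = f := by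
  rw [tw_tw, tw_congr (n := 0), tw_zero]
  push_cast; ring_nf; reduce_mod_char

/-- The partial derivatives as linear maps. -/
def pdₗ (x : V.Idx) : FormalFn k V →ₗ[k] FormalFn k V where
  toFun := pd x
  map_add' _ _ := rfl
  map_smul' _ _ := rfl

lemma pd_apply (x : V.Idx) (f : FormalFn k V) (l : List V.Idx) : (pd x f).1 l = f.1 (x :: l) := rfl

lemma pd_add (x : V.Idx) (f g : FormalFn k V) : pd x (f + g) = pd x f + pd x g := rfl
lemma pd_smul (x : V.Idx) (c : k) (f : FormalFn k V) : pd x (c • f) = c • pd x f := rfl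
lemma pd_sgn_smul (x : V.Idx) (c : ℤˣ) (f : FormalFn k V) : pd x (c • f) = c • pd x f := rfl
lemma pd_sum {ι : Type*} (s : Finset ι) (x : V.Idx) (f : ι → FormalFn k V) :
    pd x (∑ i ∈ s, f i) = ∑ i ∈ s, pd x (f i) := map_sum (pdₗ x) f s
@[simp] lemma pd_zero (x : V.Idx) : pd x (0 : FormalFn k V) = 0 := rfl
@[simp] lemma pd_one (x : V.Idx) : pd x (1 : FormalFn k V) = 0 := by
  ext l; simp [pd_apply, one_apply]

lemma pd_mul (x : V.Idx) (f g : FormalFn k V) :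
    pd x (f * g) = pd x f * g + tw (V.tdeg x) f * pd x g := rfl

lemma pd_tw (x : V.Idx) (n : ℤ) (f : FormalFn k V) :
    pd x (tw n f) = sgn (n * V.tdeg x) • tw n (pd x f) := by
  ext l
  change sgn (n * lsum V.tdeg (x :: l)) • f.1 (x :: l) =
    sgn (n * V.tdeg x) • sgn (n * lsum V.tdeg l) • f.1 (x :: l)
  rw [sgn_smul_smul, lsum_cons, mul_add]

lemma pd_pd (x y : V.Idx) (f : FormalFn k V) :
    pd x (pd y f) = sgn (V.tdeg x * V.tdeg y) • pd y (pd x f) := by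
  ext l
  change f.1 (y :: x :: l) = sgn (V.tdeg x * V.tdeg y) • f.1 (x :: y :: l)
  rw [mul_comm]; exact f.2 [] y x l

lemma sgn_smul_tw (c : ℤˣ) (n : ℤ) (f : FormalFn k V) : tw n (c • f) = c • tw n f := by
  ext l
  change sgn _ • c • f.1 l = c • sgn _ • f.1 l
  rw [smul_comm]

/-- Functions of a definite parity. -/
def HasPar (p : ℤ) (f : FormalFn k V) : Prop := ∀ n, tw n f = sgn (n * p) • f

lemma HasPar.of_support {p : ℤ} {f : FormalFn k V} (h : ∀ l, f.1 l ≠ 0 → lsum V.tdeg l = p) :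
    HasPar p f := by
  intro n
  ext l
  change sgn _ • f.1 l = sgn _ • f.1 l
  by_cases h0 : f.1 l = 0
  · rw [h0, smul_zero, smul_zero]
  · rw [h l h0]

lemma HasPar.congr {p q : ℤ} {f : FormalFn k V} (h : HasPar p f) (e : ((p - q : ℤ) : ZMod 2) = 0) :
    HasPar q f := by
  intro n
  rw [h n]
  apply sgn_smul_congr
  rw [← mul_sub]
  push_cast at e ⊢
  rw [e, mul_zero]

lemma HasPar.pd {p : ℤ} {f : FormalFn k V} (h : HasPar p f) (x : V.Idx) :
    HasPar (p + V.tdeg x) (pd x f) := by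
  intro n
  have := congrArg (FormalFn.pd x) (h n)
  rw [pd_tw, pd_sgn_smul] at this
  have h2 := congrArg (fun z => sgn (n * V.tdeg x) • z) this
  simp only [sgn_smul_self] at h2
  rw [h2, sgn_smul_smul]
  congr 2; ring

lemma HasPar.mul {p q : ℤ} {f g : FormalFn k V} (hf : HasPar p f) (hg : HasPar q g) :
    HasPar (p + q) (f * g) := by
  intro n
  rw [tw_mul, hf n, hg n, smul_mul_assoc, mul_smul_comm, sgn_smul_smul, mul_add]

lemma HasPar.add {p : ℤ} {f g : FormalFn k V} (hf : HasPar p f) (hg : HasPar p g) :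
    HasPar p (f + g) := by
  intro n; rw [map_add, hf n, hg n, smul_add]

lemma HasPar.smul {p : ℤ} {f : FormalFn k V} (c : ℤˣ) (hf : HasPar p f) : HasPar p (c • f) := by
  intro n; rw [sgn_smul_tw, hf n, smul_comm]

lemma HasPar.tw {p : ℤ} {f : FormalFn k V} (n : ℤ) (hf : HasPar p f) : HasPar p (tw n f) := by
  intro m; rw [tw_tw, add_comm, ← tw_tw, hf m, sgn_smul_tw]

lemma HasPar.zero (p : ℤ) : HasPar p (0 : FormalFn k V) := by
  intro n; rw [map_zero, smul_zero]

lemma HasPar.sum {ι : Type*} (s : Finset ι) {p : ℤ} {f : ι → FormalFn k V}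
    (hf : ∀ i ∈ s, HasPar p (f i)) : HasPar p (∑ i ∈ s, f i) := by
  intro n
  rw [map_sum, Finset.smul_sum]
  exact Finset.sum_congr rfl fun i hi => hf i hi n

/-- Graded commutativity. -/
lemma mul_comm_of_par {p : ℤ} {f : FormalFn k V} (hf : HasPar p f) (g : FormalFn k V) :
    f * g = tw p g * f := by
  ext l
  induction l generalizing p f g with
  | nil =>
    change f.1 [] * g.1 [] = (sgn (p * 0) • g.1 []) * f.1 []
    simp [mul_comm]
  | cons x l ih =>
    change (FormalFn.pd x (f * g)).1 l = (FormalFn.pd x (tw p g * f)).1 l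
    rw [pd_mul, pd_mul]
    change (_ : FormalFn k V).1 l + (_ : FormalFn k V).1 l = (_ : FormalFn k V).1 l + (_ : FormalFn k V).1 l
    rw [ih (hf.pd x), hf, tw_tw, smul_mul_assoc, pd_tw, smul_mul_assoc]
    rw [add_comm]
    congr 2
    · change sgn _ • (f * FormalFn.pd x g).1 l = sgn _ • (tw p (FormalFn.pd x g) * f).1 l
      rw [ih hf, mul_comm]
    · rw [add_comm]

lemma tw_sum {ι : Type*} (s : Finset ι) (n : ℤ) (f : ι → FormalFn k V) :
    tw n (∑ i ∈ s, f i) = ∑ i ∈ s, tw n (f i) := map_sum _ _ _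

end FormalFn

end GInf

namespace GInf

section Sums

variable {X M : Type*} [AddCommMonoid M]

/-- The sum over all decompositions of a word into two subwords. -/
def splitSum : (List X → List X → M) → List X → M
  | K, [] => K [] []
  | K, b :: B => K [] (b :: B) + splitSum (fun P => K (b :: P)) B

/-- The sum over all decompositions of a word into three subwords, the middle one nonempty. -/
def blockSum : (List X → List X → List X → M) → List X → M
  | _, [] => 0
  | K, b :: B => splitSum (fun Q R => K [] (b :: Q) R) B + blockSum (fun P => K (b :: P)) B

lemma splitSum_congr {K K' : List X → List X → M} {B : List X}
    (h : ∀ P Q, P ++ Q = B → K P Q = K' P Q) : splitSum K B = splitSum K' B := by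
  induction B generalizing K K' with
  | nil => exact h [] [] rfl
  | cons b B ih =>
    simp only [splitSum]
    rw [h [] (b :: B) rfl, ih (fun P Q e => h _ _ (by simp [e]))]

lemma blockSum_congr {K K' : List X → List X → List X → M} {B : List X}
    (h : ∀ P Q R, Q ≠ [] → P ++ (Q ++ R) = B → K P Q R = K' P Q R) :
    blockSum K B = blockSum K' B := by
  induction B generalizing K K' with
  | nil => rfl
  | cons b B ih =>
    simp only [blockSum]
    rw [splitSum_congr (fun P Q e => h [] (b :: P) Q (by simp) (by simp [e])),
      ih (fun P Q R hQ e => h _ _ _ hQ (by simp [e]))]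

lemma splitSum_add (K K' : List X → List X → M) (B : List X) :
    splitSum (fun P Q => K P Q + K' P Q) B = splitSum K B + splitSum K' B := by
  induction B generalizing K K' with
  | nil => rfl
  | cons b B ih => simp only [splitSum, ih]; abel

lemma blockSum_add (K K' : List X → List X → List X → M) (B : List X) :
    blockSum (fun P Q R => K P Q R + K' P Q R) B = blockSum K B + blockSum K' B := by
  induction B generalizing K K' with
  | nil => simp [blockSum]
  | cons b B ih => simp only [blockSum, ih, splitSum_add]; abel

lemma splitSum_zero (B : List X) : splitSum (fun _ _ => (0 : M)) B = 0 := by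
  induction B with
  | nil => rfl
  | cons b B ih => simp only [splitSum, ih, add_zero]

lemma blockSum_zero (B : List X) : blockSum (fun _ _ _ => (0 : M)) B = 0 := by
  induction B with
  | nil => rfl
  | cons b B ih => simp only [blockSum, ih, add_zero, splitSum_zero]

lemma splitSum_hom {N : Type*} [AddCommMonoid N] (φ : M →+ N) (K : List X → List X → M)
    (B : List X) : φ (splitSum K B) = splitSum (fun P Q => φ (K P Q)) B := by
  induction B generalizing K with
  | nil => rfl
  | cons b B ih => simp only [splitSum, ih, map_add]

lemma blockSum_hom {N : Type*} [AddCommMonoid N] (φ : M →+ N) (K : List X → List X → List X → M)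
    (B : List X) : φ (blockSum K B) = blockSum (fun P Q R => φ (K P Q R)) B := by
  induction B generalizing K with
  | nil => simp [blockSum]
  | cons b B ih => simp only [blockSum, ih, map_add, splitSum_hom]

lemma splitSum_sum {ι : Type*} (s : Finset ι) (K : ι → List X → List X → M) (B : List X) :
    splitSum (fun P Q => ∑ i ∈ s, K i P Q) B = ∑ i ∈ s, splitSum (K i) B := by
  induction B generalizing K with
  | nil => rfl
  | cons b B ih => simp only [splitSum, ih, Finset.sum_add_distrib]

lemma splitSum_map {Y : Type*} (g : Y → X) (K : List X → List X → M) (B : List Y) :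
    splitSum K (B.map g) = splitSum (fun P Q => K (P.map g) (Q.map g)) B := by
  induction B generalizing K with
  | nil => rfl
  | cons b B ih => simp only [splitSum, List.map_cons, ih, List.map_nil]

lemma blockSum_map {Y : Type*} (g : Y → X) (K : List X → List X → List X → M) (B : List Y) :
    blockSum K (B.map g) = blockSum (fun P Q R => K (P.map g) (Q.map g) (R.map g)) B := by
  induction B generalizing K with
  | nil => rfl
  | cons b B ih => simp only [blockSum, List.map_cons, ih, List.map_nil, splitSum_map]

lemma splitSum_append_cons (K : List X → List X → M) (A : List X) (x : X) (C : List X) :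
    splitSum K (A ++ x :: C) =
      splitSum (fun P Q => K P (Q ++ x :: C)) A + splitSum (fun P Q => K (A ++ x :: P) Q) C := by
  induction A generalizing K with
  | nil => simp [splitSum]
  | cons a A ih => simp only [List.cons_append, splitSum, ih, add_assoc]

lemma blockSum_append_cons (K : List X → List X → List X → M) (A : List X) (x : X) (C : List X) :
    blockSum K (A ++ x :: C) =
      blockSum (fun P Q R => K P Q (R ++ x :: C)) A +
      splitSum (fun P Q => splitSum (fun Q' R => K P (Q ++ x :: Q') R) C) A +
      blockSum (fun P Q R => K (A ++ x :: P) Q R) C := by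
  induction A generalizing K with
  | nil => simp [blockSum, splitSum]
  | cons a A ih =>
    simp only [List.cons_append, blockSum, splitSum, ih, splitSum_append_cons]
    abel

lemma splitSum_ite_left (F : List X → M) (B : List X) :
    splitSum (fun P Q => if P = [] then F Q else 0) B = F B := by
  cases B with
  | nil => simp [splitSum]
  | cons b B => simp [splitSum, splitSum_zero]

lemma splitSum_ite_right (F : List X → M) (B : List X) :
    splitSum (fun P Q => if Q = [] then F P else 0) B = F B := by
  induction B generalizing F with
  | nil => simp [splitSum]
  | cons b B ih => simp [splitSum, ih (fun P => F (b :: P))]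

/-- The sum over the decompositions of a word into three subwords of which the left one is cut
further. -/
lemma blockSum_splitSum_left (K : List X → List X → List X → List X → M) (B : List X) :
    blockSum (fun P Q R => splitSum (fun P₁ P₂ => K P₁ P₂ Q R) P) B =
      splitSum (fun P₁ B' => blockSum (fun P₂ Q R => K P₁ P₂ Q R) B') B := by
  induction B generalizing K with
  | nil => rfl
  | cons b B ih =>
    simp only [blockSum, splitSum, blockSum_add, ih]
    abel

lemma splitSum_assoc (K : List X → List X → List X → M) (B : List X) :
    splitSum (fun P Q => splitSum (fun P₁ P₂ => K P₁ P₂ Q) P) B =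
      splitSum (fun P₁ B' => splitSum (fun P₂ Q => K P₁ P₂ Q) B') B := by
  induction B generalizing K with
  | nil => rfl
  | cons b B ih =>
    simp only [splitSum, splitSum_add, ih]
    abel

lemma blockSum_splitSum_right (K : List X → List X → List X → List X → M) (B : List X) :
    blockSum (fun P Q R => splitSum (fun R₁ R₂ => K P Q R₁ R₂) R) B =
      splitSum (fun B' R₂ => blockSum (fun P Q R₁ => K P Q R₁ R₂) B') B := by
  induction B generalizing K with
  | nil => rfl
  | cons b B ih =>
    simp only [blockSum, splitSum, splitSum_add, ih, zero_add]
    rw [← splitSum_assoc (fun Q R₁ R₂ => K [] (b :: Q) R₁ R₂)]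

lemma splitSum_eq_sum_range (K : List X → List X → M) (B : List X) :
    splitSum K B = ∑ l ∈ Finset.range (B.length + 1), K (B.take l) (B.drop l) := by
  induction B generalizing K with
  | nil => simp [splitSum]
  | cons b B ih =>
    simp only [splitSum, ih]
    rw [List.length_cons, Finset.sum_range_succ' _ (B.length + 1), add_comm]
    rfl

lemma blockSum_eq_sum_range (K : List X → List X → List X → M) (B : List X) :
    blockSum K B = ∑ s ∈ Finset.range B.length, ∑ l ∈ Finset.Icc 1 (B.length - s),
      K (B.take s) ((B.drop s).take l) (B.drop (s + l)) := by
  induction B generalizing K with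
  | nil => simp [blockSum]
  | cons b B ih =>
    simp only [blockSum, ih, splitSum_eq_sum_range]
    rw [List.length_cons]
    refine Eq.trans ?_ (Finset.sum_range_succ' _ B.length).symm
    refine (add_comm _ _).trans (congrArg₂ (fun a b : M => a + b) ?_ ?_)
    · refine Finset.sum_congr rfl fun s _ => ?_
      rw [Nat.succ_sub_succ]
      refine Finset.sum_congr rfl fun l _ => ?_
      rw [show s + 1 + l = (s + l) + 1 by ring]
      rfl
    · refine Finset.sum_nbij' (fun l => l + 1) (fun l => l - 1) ?_ ?_ ?_ ?_ ?_
      · intro l hl; simp at hl ⊢; omega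
      · intro l hl; simp at hl ⊢; omega
      · intro l hl; simp
      · intro l hl; simp at hl ⊢; omega
      · intro l hl; rw [Nat.zero_add]; rfl

end Sums

section MC

variable {k : Type u} [Field k] {V : GrSp}

/-- The coefficients of the operations of a structure, including the unary one `∂_j ↦ [ν, ∂_j]`. -/
def Coeffs.full (c : Coeffs k V) (α : V.Idx) : List V.Idx → List V.Idx → k
  | [j] => fun γ => sgn (V.sdeg j) • c α [] (j :: γ)
  | B => c α B

lemma Coeffs.full_single (c : Coeffs k V) (α j : V.Idx) (γ : List V.Idx) :
    c.full α [j] γ = sgn (V.sdeg j) • c α [] (j :: γ) := rfl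

lemma Coeffs.full_of_length (c : Coeffs k V) (α : V.Idx) {B : List V.Idx} (h : 2 ≤ B.length) :
    c.full α B = c α B := by
  match B, h with
  | _ :: _ :: _, _ => rfl

/-- Coefficients of operations of the right degrees. -/
structure Coeffs.Graded (c : Coeffs k V) : Prop where
  no_constant : ∀ α, c α [] [] = 0
  no_single : ∀ α β γ, c α [β] γ = 0
  deg_nil : ∀ α γ, c α [] γ ≠ 0 → lsum V.tdeg γ = V.tdeg α + 1
  deg_word : ∀ α B γ, B ≠ [] → c α B γ ≠ 0 → lsum V.tdeg γ + V.sdeg α = lsum V.sdeg B + 1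

/-- The Taylor coefficients of `ν(ν^α)`. -/
def Coeffs.square (c : Coeffs k V) (α : V.Idx) (γ : List V.Idx) : k :=
  ∑ β, taylorMul (c β []) (fun l => c α [] (β :: l)) γ

/-- The Taylor coefficients of the structure equations of an `A_∞`-algebra. -/
def Coeffs.ainf (c : Coeffs k V) (α : V.Idx) (B γ : List V.Idx) : k :=
  ∑ β, taylorMul (c β []) (fun l => c.full α B (β :: l)) γ +
  blockSum (fun P Q R => ∑ β,
    sgn (lsum V.sdeg P + (lsum V.sdeg Q + 1 + V.sdeg β) * (1 + lsum V.sdeg P)) •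
      taylorMul (c.full β Q) (c.full α (P ++ β :: R)) γ) B

/-- The systems of structure coefficients which satisfy the quadratic structure equations. -/
structure Coeffs.IsMC (c : Coeffs k V) : Prop where
  adm : c.Admissible
  graded : c.Graded
  square_zero : ∀ α γ, c.square α γ = 0
  ainf_zero : ∀ α B γ, 2 ≤ B.length → c.ainf α B γ = 0

/-- The structure coefficients as formal functions. -/
def Coeffs.Admissible.fn {c : Coeffs k V} (h : c.Admissible) (α : V.Idx) (B : List V.Idx) :
    FormalFn k V := ⟨c α B, h.symm α B⟩

/-- The structure coefficients, including those of the unary operation, as formal functions. -/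
def Coeffs.Admissible.full {c : Coeffs k V} (h : c.Admissible) (α : V.Idx) (B : List V.Idx) :
    FormalFn k V := ⟨c.full α B, by
      match B with
      | [] => exact h.symm α []
      | [j] =>
        intro A x y C
        have := h.symm α [] (j :: A) x y C
        simp only [Coeffs.full_single, List.cons_append] at this ⊢
        rw [this, smul_comm]
      | _ :: _ :: _ => exact h.symm α _⟩

lemma Coeffs.Graded.full_degree {c : Coeffs k V} (h : c.Graded) (α : V.Idx) (B γ : List V.Idx)
    (hB : B ≠ []) (h0 : c.full α B γ ≠ 0) : lsum V.tdeg γ + V.sdeg α = lsum V.sdeg B + 1 := by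
  match B, hB with
  | [j], _ =>
    rw [Coeffs.full_single] at h0
    have := h.deg_nil α (j :: γ) (by intro h1; rw [h1, smul_zero] at h0; exact h0 rfl)
    simp only [lsum_cons, lsum_nil, GrSp.tdeg, GrSp.sdeg] at this ⊢
    linarith
  | x :: y :: B, _ => exact h.deg_word α _ γ (by simp) h0

lemma Coeffs.IsMC.fn_par {c : Coeffs k V} (h : c.IsMC) (α : V.Idx) :
    FormalFn.HasPar (V.sdeg α) (h.adm.fn α []) :=
  (FormalFn.HasPar.of_support (f := h.adm.fn α []) (h.graded.deg_nil α)).congr (by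
    simp only [GrSp.tdeg, GrSp.sdeg]; push_cast; ring_nf; reduce_mod_char)

lemma Coeffs.IsMC.full_par {c : Coeffs k V} (h : c.IsMC) (α : V.Idx) (B : List V.Idx)
    (hB : B ≠ []) : FormalFn.HasPar (lsum V.sdeg B + 1 + V.sdeg α) (h.adm.full α B) :=
  (FormalFn.HasPar.of_support (f := h.adm.full α B) (p := lsum V.sdeg B + 1 - V.sdeg α)
    (fun γ hγ => by rw [← h.graded.full_degree α B γ hB hγ]; ring)).congr (by
    push_cast; ring_nf; reduce_mod_char)

end MC

end GInf

namespace GInf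

section Shuffles

variable {X M : Type*} [AddCommGroup M] (d : X → ℤ)

/-- The sum of the values of a function on the shuffles of two words, with Koszul signs. -/
def shSum (F : List X → M) (A C : List X) : M :=
  ((signedShuffles d A C).map (fun s => s.1 • F s.2)).sum

lemma shSum_nil_left (F : List X → M) (C : List X) : shSum d F [] C = F C := by
  simp [shSum, signedShuffles]

lemma shSum_nil_right (F : List X → M) (A : List X) : shSum d F A [] = F A := by
  cases A <;> simp [shSum, signedShuffles]

lemma shSum_cons_cons (F : List X → M) (a : X) (A : List X) (c : X) (C : List X) :
    shSum d F (a :: A) (c :: C) = shSum d (fun l => F (a :: l)) A (c :: C) +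
      sgn (d c * lsum d (a :: A)) • shSum d (fun l => F (c :: l)) (a :: A) C := by
  rw [shSum, signedShuffles, List.map_append, List.sum_append, List.map_map, List.map_map]
  congr 1
  rw [shSum, List.smul_sum, List.map_map]
  congr 2
  funext s
  simp [mul_smul]

lemma shSum_congr {F G : List X → M} {A C : List X}
    (h : ∀ l, l.length = A.length + C.length → F l = G l) : shSum d F A C = shSum d G A C := by
  induction A generalizing F G C with
  | nil => rw [shSum_nil_left, shSum_nil_left]; exact h _ (by simp)
  | cons a A ihA =>
    induction C generalizing F G with
    | nil => rw [shSum_nil_right, shSum_nil_right]; exact h _ (by simp)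
    | cons c C ihC =>
      rw [shSum_cons_cons, shSum_cons_cons, ihA, ihC]
      · intro l hl; exact h _ (by simp [hl]; omega)
      · intro l hl; exact h _ (by simp [hl]; omega)

lemma shSum_comm (F : List X → M) (A C : List X) :
    shSum d F A C = sgn (lsum d A * lsum d C) • shSum d F C A := by
  induction A generalizing F C with
  | nil => simp [shSum_nil_left, shSum_nil_right]
  | cons a A ihA =>
    induction C generalizing F with
    | nil => simp [shSum_nil_left, shSum_nil_right]
    | cons c C ihC =>
      rw [shSum_cons_cons, shSum_cons_cons, ihA, ihC, smul_add, sgn_smul_smul, sgn_smul_smul,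
        add_comm]
      congr 1
      · apply sgn_smul_congr
        simp only [lsum_cons]; push_cast; ring_nf
      · apply sgn_smul_congr
        simp only [lsum_cons]; push_cast; ring_nf; reduce_mod_char

lemma shSum_hom {N : Type*} [AddCommGroup N] (φ : M →+ N) (F : List X → M) (A C : List X) :
    φ (shSum d F A C) = shSum d (fun l => φ (F l)) A C := by
  rw [shSum, shSum, map_list_sum, List.map_map]
  congr 2
  funext s
  simp only [Function.comp_apply]
  rcases Int.units_eq_one_or s.1 with h | h <;> simp [h]

lemma shSum_sum {ι : Type*} (s : Finset ι) (F : ι → List X → M) (A C : List X) :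
    shSum d (fun l => ∑ i ∈ s, F i l) A C = ∑ i ∈ s, shSum d (F i) A C := by
  classical
  induction A generalizing F C with
  | nil => simp [shSum_nil_left]
  | cons a A ihA =>
    induction C generalizing F with
    | nil => simp [shSum_nil_right]
    | cons c C ihC =>
      simp only [shSum_cons_cons, ihA, ihC, Finset.sum_add_distrib, Finset.smul_sum]

lemma shSum_sgn_smul (n : ℤˣ) (F : List X → M) (A C : List X) :
    shSum d (fun l => n • F l) A C = n • shSum d F A C :=
  (shSum_hom d (DistribSMul.toAddMonoidHom M n) F A C).symm

lemma shSum_map {Y : Type*} (g : Y → X) (F : List X → M) (A C : List Y) :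
    shSum d F (A.map g) (C.map g) = shSum (d ∘ g) (fun l => F (l.map g)) A C := by
  induction A generalizing F C with
  | nil => simp [shSum_nil_left]
  | cons a A ihA =>
    induction C generalizing F with
    | nil => simp [shSum_nil_right]
    | cons c C ihC =>
      have h := ihA (fun l => F (g a :: l)) (c :: C)
      have h' := ihC (fun l => F (g c :: l))
      rw [List.map_cons] at h h'
      rw [List.map_cons, List.map_cons, shSum_cons_cons, shSum_cons_cons, h, h']
      have e : lsum d (g a :: A.map g) = lsum (d ∘ g) (a :: A) := by simp [lsum]
      rw [e]; rfl

/-- Expansion of one letter of the first word. -/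
lemma shSum_expand_letter {ι : Type*} (s : Finset ι) (F G : List X → M) (m : X) (m' : ι → X)
    (n : ι → ℤ) (φ : ι → M →+ M) (hd : ∀ i, d m = n i + d (m' i))
    (h : ∀ U W, F (U ++ m :: W) = ∑ i ∈ s, sgn (n i * lsum d U) • φ i (G (U ++ m' i :: W)))
    (A₁ A₂ C : List X) :
    shSum d F (A₁ ++ m :: A₂) C =
      ∑ i ∈ s, sgn (n i * lsum d A₁) • φ i (shSum d G (A₁ ++ m' i :: A₂) C) := by
  have key : ∀ (ψ : M →+ M) (u : ℤ) (x : M), ψ (sgn u • x) = sgn u • ψ x := by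
    intro ψ u x
    rcases Int.units_eq_one_or (sgn u) with h | h <;> simp [h]
  have hcons : ∀ (F G : List X → M) (φ : ι → M →+ M), (∀ U W, F (U ++ m :: W) =
      ∑ i ∈ s, sgn (n i * lsum d U) • φ i (G (U ++ m' i :: W))) → ∀ c : X, ∀ U W,
      (fun l => F (c :: l)) (U ++ m :: W) = ∑ i ∈ s, sgn (n i * lsum d U) •
        (DistribSMul.toAddMonoidHom M (sgn (n i * d c))).comp (φ i)
          ((fun l => G (c :: l)) (U ++ m' i :: W)) := by
    intro F G φ h c U W
    have := h (c :: U) W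
    simp only [List.cons_append] at this
    simp only [this]
    refine Finset.sum_congr rfl fun i _ => ?_
    change _ = sgn _ • sgn _ • φ i _
    rw [sgn_smul_smul, lsum_cons]
    congr 2; ring
  induction A₁ generalizing F G C φ with
  | nil =>
    induction C generalizing F G φ with
    | nil =>
      simp only [shSum_nil_right]; exact h [] A₂
    | cons c C ihC =>
      have ih := ihC (fun l => F (c :: l)) (fun l => G (c :: l))
        (fun i => (DistribSMul.toAddMonoidHom M (sgn (n i * d c))).comp (φ i)) (hcons F G φ h c)
      simp only [List.nil_append] at ih ⊢
      rw [shSum_cons_cons, ih]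
      have h1 : (fun l => F (m :: l)) = fun l => ∑ i ∈ s, φ i (G (m' i :: l)) := by
        funext l; simpa using h [] l
      rw [h1, shSum_sum, Finset.smul_sum, ← Finset.sum_add_distrib]
      refine Finset.sum_congr rfl fun i _ => ?_
      rw [shSum_cons_cons, map_add, key, ← shSum_hom d (φ i)]
      simp only [lsum_nil, mul_zero, Int.negOnePow_zero, one_smul]
      congr 1
      change sgn _ • sgn _ • φ i _ = _
      rw [sgn_smul_smul]
      apply sgn_smul_congr
      simp only [lsum_cons, hd i]; push_cast; ring_nf; reduce_mod_char
  | cons a A₁ ihA =>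
    induction C generalizing F G φ with
    | nil =>
      simp only [shSum_nil_right]; exact h (a :: A₁) A₂
    | cons c C ihC =>
      have ih := ihC (fun l => F (c :: l)) (fun l => G (c :: l))
        (fun i => (DistribSMul.toAddMonoidHom M (sgn (n i * d c))).comp (φ i)) (hcons F G φ h c)
      rw [List.cons_append] at ih
      rw [List.cons_append, shSum_cons_cons, ihA (fun l => F (a :: l)) (fun l => G (a :: l))
        (fun i => (DistribSMul.toAddMonoidHom M (sgn (n i * d a))).comp (φ i)) (hcons F G φ h a), ih, Finset.smul_sum,
        ← Finset.sum_add_distrib]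
      refine Finset.sum_congr rfl fun i _ => ?_
      rw [List.cons_append, shSum_cons_cons, map_add, key, smul_add]
      congr 1
      · change sgn _ • sgn _ • φ i _ = _
        rw [sgn_smul_smul, lsum_cons]
        congr 2; ring
      · change sgn _ • sgn _ • sgn _ • φ i _ = _
        rw [sgn_smul_smul, sgn_smul_smul, sgn_smul_smul]
        apply sgn_smul_congr
        simp only [lsum_cons, lsum_append, hd i]; push_cast; ring_nf; reduce_mod_char

end Shuffles

end GInf

namespace GInf

open FormalFn

variable {k : Type u} [Field k] {V : GrSp}

namespace FormalFn

lemma HasPar.of_parity {p : ℤ} {f : FormalFn k V} (h : FormalFn.tw 1 f = sgn p • f) : HasPar p f := by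
  intro n
  rcases Int.even_or_odd n with hn | hn
  · rw [tw_congr (n := 0), tw_zero, sgn_eq_of (b := 0)]
    · simp
    · obtain ⟨m, rfl⟩ := hn; push_cast; ring_nf <;> reduce_mod_char
    · obtain ⟨m, rfl⟩ := hn; push_cast; ring_nf <;> reduce_mod_char
  · rw [tw_congr (n := 1), h, sgn_eq_of (b := n * p)]
    · obtain ⟨m, rfl⟩ := hn; push_cast; ring_nf <;> reduce_mod_char
    · obtain ⟨m, rfl⟩ := hn; push_cast; ring_nf <;> reduce_mod_char

lemma exists_add_of_par [CharZero k] (f : FormalFn k V) :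
    ∃ f₀ f₁, HasPar 0 f₀ ∧ HasPar 1 f₁ ∧ f = f₀ + f₁ := by
  refine ⟨(2⁻¹ : k) • (f + tw 1 f), (2⁻¹ : k) • (f - tw 1 f), HasPar.of_parity ?_,
    HasPar.of_parity ?_, ?_⟩
  · rw [map_smul, map_add, tw_self, add_comm]; simp
  · rw [map_smul, map_sub, tw_self, sgn_one_smul, ← smul_neg]; congr 1; abel
  · rw [← smul_add, show f + tw 1 f + (f - tw 1 f) = (2 : k) • f by rw [two_smul]; abel, smul_smul,
      inv_mul_cancel₀ two_ne_zero, one_smul]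

lemma eq_zero_of_eq_neg [CharZero k] {f : FormalFn k V} (h : f = -f) : f = 0 := by
  have : (2 : k) • f = 0 := by rw [two_smul]; nth_rewrite 1 [h]; abel
  exact (smul_eq_zero.1 this).resolve_left two_ne_zero

end FormalFn

namespace VecField

/-- The twist of a vector field by the degree in the tangent module shifted by one. -/
def tau (p : ℤ) : VecField k V →ₗ[k] VecField k V where
  toFun X := fun α => sgn (p * V.sdeg α) • tw p (X α)
  map_add' X Y := by funext α; simp [smul_add]
  map_smul' c X := by
    funext α
    change sgn _ • tw p (c • X α) = c • (sgn _ • tw p (X α))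
    rw [map_smul, smul_comm]

lemma tau_apply (p : ℤ) (X : VecField k V) (α : V.Idx) :
    tau p X α = sgn (p * V.sdeg α) • tw p (X α) := rfl

lemma shiftParity_eq (X : VecField k V) : shiftParity X = tau 1 X := by
  funext α
  change -(sgn (V.deg α - 2) • tw 1 (X α)) = sgn (1 * V.sdeg α) • tw 1 (X α)
  rw [← sgn_one_smul, sgn_smul_smul]
  apply sgn_smul_congr
  simp only [GrSp.sdeg]; push_cast; ring_nf <;> reduce_mod_char

lemma shiftParity_eq' : (shiftParity : VecField k V → VecField k V) = tau 1 :=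
  funext shiftParity_eq

lemma tau_tau (p q : ℤ) (X : VecField k V) : tau p (tau q X) = tau (p + q) X := by
  funext α
  rw [tau_apply, tau_apply, tau_apply, sgn_smul_tw, sgn_smul_smul, tw_tw, add_mul]

lemma tau_congr {m n : ℤ} (h : ((m - n : ℤ) : ZMod 2) = 0) :
    (tau m : VecField k V →ₗ[k] _) = tau n := by
  apply LinearMap.ext
  intro X
  funext α
  rw [tau_apply, tau_apply, tw_congr h]
  apply sgn_smul_congr
  rw [← sub_mul]; push_cast at h ⊢; rw [h, zero_mul]

lemma tau_zero (X : VecField k V) : tau 0 X = X := by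
  funext α; rw [tau_apply]; simp

lemma coord_apply (β α : V.Idx) : (coord β : VecField k V) α = if α = β then 1 else 0 := by
  ext l
  change (if l = [] ∧ α = β then (1 : k) else 0) = _
  split_ifs <;> simp_all [one_apply]

lemma tau_coord (p : ℤ) (β : V.Idx) :
    tau p (coord β : VecField k V) = sgn (p * V.sdeg β) • coord β := by
  funext α
  rw [tau_apply, Pi.smul_apply, coord_apply]
  split_ifs with h
  · rw [h, tw_one]
  · simp

lemma eq_sum_coord (X : VecField k V) : X = ∑ β, X β • coord β := by
  funext α
  rw [Finset.sum_apply, Finset.sum_eq_single α]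
  · simp [coord_apply]
  · intro β _ hβ
    rw [Pi.smul_apply, coord_apply, if_neg hβ.symm, smul_zero]
  · simp

lemma tau_smul {p : ℤ} (q : ℤ) {f : FormalFn k V} (hf : HasPar p f) (X : VecField k V) :
    tau q (f • X) = sgn (q * p) • f • tau q X := by
  funext α
  change sgn _ • tw q (f * X α) = sgn _ • (f * (sgn _ • tw q (X α)))
  rw [tw_mul, hf q, smul_mul_assoc, mul_smul_comm, smul_comm]

lemma fsmul_eq (f : FormalFn k V) (X : VecField k V) : fsmul f X = f • X := rfl

lemma app_add (ν : VecField k V) (f g : FormalFn k V) : ν.app (f + g) = ν.app f + ν.app g := by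
  simp only [app, pd_add, mul_add, Finset.sum_add_distrib]

@[simp] lemma app_zero (ν : VecField k V) : ν.app (0 : FormalFn k V) = 0 := by
  simp [app]

@[simp] lemma app_one (ν : VecField k V) : ν.app (1 : FormalFn k V) = 0 := by
  simp [app]

lemma app_sgn_smul (ν : VecField k V) (c : ℤˣ) (f : FormalFn k V) :
    ν.app (c • f) = c • ν.app f := by
  simp only [app, pd_sgn_smul, mul_smul_comm, Finset.smul_sum]

lemma app_smul (ν : VecField k V) (c : k) (f : FormalFn k V) :
    ν.app (c • f) = c • ν.app f := by
  simp only [app, pd_smul, mul_smul_comm, Finset.smul_sum]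

lemma app_sum (ν : VecField k V) {ι : Type*} (s : Finset ι) (f : ι → FormalFn k V) :
    ν.app (∑ i ∈ s, f i) = ∑ i ∈ s, ν.app (f i) := by
  classical
  induction s using Finset.induction_on with
  | empty => simp
  | insert a s ha ih => rw [Finset.sum_insert ha, Finset.sum_insert ha, app_add, ih]

/-- Odd vector fields. -/
def IsOdd (ν : VecField k V) : Prop := ∀ α, HasPar (V.sdeg α) (ν α)

lemma IsOdd.app_mul {ν : VecField k V} (hν : ν.IsOdd) (f g : FormalFn k V) :
    ν.app (f * g) = ν.app f * g + tw 1 f * ν.app g := by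
  simp only [app, pd_mul, mul_add, Finset.sum_add_distrib, Finset.sum_mul, Finset.mul_sum, mul_assoc]
  congr 1
  refine Finset.sum_congr rfl fun α _ => ?_
  rw [← mul_assoc, mul_comm_of_par (hν α), tw_tw, mul_assoc,
    tw_congr (n := 1) (by simp only [GrSp.sdeg, GrSp.tdeg]; push_cast; ring_nf <;> reduce_mod_char)]

lemma IsOdd.tw_app {ν : VecField k V} (hν : ν.IsOdd) (n : ℤ) (f : FormalFn k V) :
    ν.app (tw n f) = sgn n • tw n (ν.app f) := by
  simp only [app, tw_sum, tw_mul, pd_tw, Finset.smul_sum]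
  refine Finset.sum_congr rfl fun α _ => ?_
  rw [hν α n, smul_mul_assoc, mul_smul_comm, sgn_smul_smul]
  apply sgn_smul_congr
  simp only [GrSp.sdeg, GrSp.tdeg]; push_cast; ring_nf <;> reduce_mod_char

lemma IsOdd.app_par {ν : VecField k V} (hν : ν.IsOdd) {p : ℤ} {f : FormalFn k V}
    (hf : HasPar p f) : HasPar (p + 1) (ν.app f) := by
  refine HasPar.sum _ fun α _ => ((hν α).mul (hf.pd α)).congr ?_
  simp only [GrSp.sdeg, GrSp.tdeg]; push_cast; ring_nf <;> reduce_mod_char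

/-- A homological vector field acts on functions by a differential. -/
lemma IsOdd.app_app [CharZero k] {ν : VecField k V} (hν : ν.IsOdd) (h : ∀ α, ν.app (ν α) = 0)
    (f : FormalFn k V) : ν.app (ν.app f) = 0 := by
  have h1 : ν.app (ν.app f) = ∑ α, ∑ β, tw 1 (ν α) * (ν β * pd β (pd α f)) := by
    conv_lhs => rw [show ν.app f = ∑ α, ν α * pd α f from rfl]
    rw [app_sum]
    refine Finset.sum_congr rfl fun α _ => ?_
    rw [hν.app_mul, h, zero_mul, zero_add, ← Finset.mul_sum]; rfl
  apply eq_zero_of_eq_neg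
  rw [h1]
  nth_rewrite 1 [Finset.sum_comm]
  rw [← Finset.sum_neg_distrib]
  refine Finset.sum_congr rfl fun α _ => ?_
  rw [← Finset.sum_neg_distrib]
  refine Finset.sum_congr rfl fun β _ => ?_
  rw [pd_pd α β, hν β 1, hν α 1, mul_smul_comm, mul_smul_comm, smul_mul_assoc, ← mul_assoc,
    mul_comm_of_par (hν β), hν α, smul_mul_assoc, ← mul_assoc, smul_mul_assoc, smul_mul_assoc, sgn_smul_smul,
    sgn_smul_smul, ← sgn_one_smul, smul_mul_assoc, sgn_smul_smul]
  apply sgn_smul_congr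
  simp only [GrSp.sdeg, GrSp.tdeg]; push_cast; ring_nf
  reduce_mod_char

lemma IsOdd.lieOdd_smul {ν : VecField k V} (hν : ν.IsOdd) {p : ℤ} {f : FormalFn k V}
    (hf : HasPar p f) (X : VecField k V) :
    lieOdd ν (f • X) = ν.app f • X + sgn p • f • lieOdd ν X := by
  funext α
  change ν.app (f * X α) - app (parity (f • X)) (ν α) =
    ν.app f * X α + sgn p • (f * (ν.app (X α) - app (parity X) (ν α)))
  have h1 : app (parity (f • X)) (ν α) = sgn p • (f * app (parity X) (ν α)) := by
    simp only [app, Finset.mul_sum, Finset.smul_sum]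
    refine Finset.sum_congr rfl fun β _ => ?_
    change (sgn _ • tw 1 (f * X β)) * _ = sgn p • (f * ((sgn _ • tw 1 (X β)) * _))
    rw [tw_mul, hf 1, one_mul, smul_mul_assoc, smul_mul_assoc, smul_mul_assoc, smul_mul_assoc,
      mul_smul_comm, mul_assoc, smul_comm]
  rw [hν.app_mul, h1, hf 1, one_mul, mul_sub, smul_sub, smul_mul_assoc]
  abel

lemma lieOdd_add (ν X Y : VecField k V) : lieOdd ν (X + Y) = lieOdd ν X + lieOdd ν Y := by
  funext α
  have h1 : app (parity (X + Y)) (ν α) = app (parity X) (ν α) + app (parity Y) (ν α) := by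
    simp only [app, ← Finset.sum_add_distrib, ← add_mul]
    refine Finset.sum_congr rfl fun β _ => ?_
    congr 1
    change sgn _ • tw 1 (X β + Y β) = sgn _ • tw 1 (X β) + sgn _ • tw 1 (Y β)
    rw [map_add, smul_add]
  change ν.app (X α + Y α) - app (parity (X + Y)) (ν α) = (_ - _) + (_ - _)
  rw [h1, app_add]
  abel

lemma lieOdd_coord (ν : VecField k V) (α β : V.Idx) :
    lieOdd ν (coord β) α = sgn (V.sdeg β) • pd β (ν α) := by
  have h1 : app (parity (coord β : VecField k V)) (ν α) = sgn (V.deg β - 2) • pd β (ν α) := by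
    rw [app, Finset.sum_eq_single β]
    · change (sgn _ • tw 1 ((coord β : VecField k V) β)) * _ = _
      rw [coord_apply, if_pos rfl, tw_one, smul_mul_assoc, one_mul]
    · intro γ _ hγ
      change (sgn _ • tw 1 ((coord β : VecField k V) γ)) * _ = _
      rw [coord_apply, if_neg hγ, map_zero, smul_zero, zero_mul]
    · simp
  change ν.app ((coord β : VecField k V) α) - app (parity (coord β)) (ν α) = _
  have h2 : ν.app ((coord β : VecField k V) α) = 0 := by
    rw [coord_apply]; split_ifs <;> simp
  rw [h1, h2, zero_sub, ← sgn_one_smul, sgn_smul_smul]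
  apply sgn_smul_congr
  simp only [GrSp.sdeg]; push_cast; ring_nf <;> reduce_mod_char

/-- Every property of lists of vector fields which is compatible with linear combinations over
functions holds if it holds for the lists of coordinate vector fields. -/
lemma coord_induction [CharZero k] {P : List (VecField k V) → Prop}
    (hadd : ∀ A X Y C, P (A ++ X :: C) → P (A ++ Y :: C) → P (A ++ (X + Y) :: C))
    (hzero : ∀ A C, P (A ++ 0 :: C))
    (hsmul : ∀ (p : ℤ) (f : FormalFn k V), HasPar p f → ∀ A X C,
      P (A.map (tau p) ++ X :: C) → P (A ++ f • X :: C))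
    (hcoord : ∀ B : List V.Idx, P (B.map coord)) (L : List (VecField k V)) : P L := by
  suffices h : ∀ (n : ℕ) (A : List (VecField k V)) (B : List V.Idx), A.length = n →
      P (A ++ B.map coord) by simpa using h L.length L [] rfl
  intro n
  induction n with
  | zero =>
    intro A B hA
    rw [List.length_eq_zero_iff.1 hA]; exact hcoord B
  | succ n ih =>
    intro A B hA
    obtain ⟨A, X, rfl⟩ : ∃ A' X, A = A' ++ [X] := by
      rcases List.eq_nil_or_concat A with h | ⟨A', X, h⟩
      · simp [h] at hA
      · exact ⟨A', X, by simpa using h⟩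
    have hA' : A.length = n := by simpa using hA
    rw [List.append_assoc, List.singleton_append, eq_sum_coord X]
    have hs : ∀ s : Finset V.Idx, P (A ++ (∑ β ∈ s, X β • coord β) :: B.map coord) := by
      intro s
      induction s using Finset.induction_on with
      | empty => rw [Finset.sum_empty]; exact hzero _ _
      | insert β s hβ ihs =>
        rw [Finset.sum_insert hβ]
        refine hadd _ _ _ _ ?_ ihs
        obtain ⟨f₀, f₁, h₀, h₁, hf⟩ := exists_add_of_par (X β)
        rw [hf, add_smul]
        refine hadd _ _ _ _ (hsmul 0 f₀ h₀ _ _ _ ?_) (hsmul 1 f₁ h₁ _ _ _ ?_)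
        · have := ih (A.map (tau 0)) (β :: B) (by simpa using hA')
          simpa using this
        · have := ih (A.map (tau 1)) (β :: B) (by simpa using hA')
          simpa using this
    exact hs _

end VecField

open VecField

/-- Multilinear operations on vector fields, of which the first one is the Lie derivative along `ν`
and the others are linear over functions. -/
structure IsTensorial (ν : VecField k V) (b : List (VecField k V) → VecField k V) : Prop where
  one : ∀ X, b [X] = lieOdd ν X
  add : ∀ A X Y C, b (A ++ (X + Y) :: C) = b (A ++ X :: C) + b (A ++ Y :: C)
  smul : ∀ A X C (p : ℤ) (f : FormalFn k V), A ++ C ≠ [] → HasPar p f →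
    b (A ++ f • X :: C) = sgn p • f • b (A.map (tau p) ++ X :: C)

namespace IsTensorial

variable {ν : VecField k V} {b : List (VecField k V) → VecField k V}

/-- The operation as an additive map of one argument. -/
def slot (h : IsTensorial ν b) (A C : List (VecField k V)) : VecField k V →+ VecField k V :=
  AddMonoidHom.mk' (fun X => b (A ++ X :: C)) (fun X Y => h.add A X Y C)

lemma map_zero (h : IsTensorial ν b) (A C : List (VecField k V)) : b (A ++ 0 :: C) = 0 :=
  (h.slot A C).map_zero

lemma map_sgn (h : IsTensorial ν b) (A C : List (VecField k V)) (u : ℤˣ) (X : VecField k V) :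
    b (A ++ (u • X) :: C) = u • b (A ++ X :: C) := by
  rcases Int.units_eq_one_or u with hu | hu
  · simp [hu]
  · rw [hu, Units.neg_smul, one_smul, Units.neg_smul, one_smul]
    exact (h.slot A C).map_neg X

lemma map_sum (h : IsTensorial ν b) (A C : List (VecField k V)) {ι : Type*} (s : Finset ι)
    (X : ι → VecField k V) : b (A ++ (∑ i ∈ s, X i) :: C) = ∑ i ∈ s, b (A ++ X i :: C) :=
  _root_.map_sum (h.slot A C) X s

lemma map_tau_coords (h : IsTensorial ν b) (p : ℤ) (A : List V.Idx) (P C : List (VecField k V)) :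
    b (P ++ ((A.map coord).map (tau p) ++ C)) = sgn (p * lsum V.sdeg A) • b (P ++ (A.map coord ++ C)) := by
  induction A generalizing P with
  | nil => simp
  | cons a A ih =>
    simp only [List.map_cons, List.cons_append]
    rw [tau_coord, h.map_sgn]
    have := ih (P ++ [coord a])
    simp only [List.append_assoc, List.singleton_append] at this
    rw [this, sgn_smul_smul, lsum_cons, mul_add]

/-- The expansion of a vector field in one slot, where the preceding ones are coordinate fields. -/
lemma expand_slot (h : IsTensorial ν b) (A : List V.Idx) (C : List (VecField k V)) (Y : VecField k V)
    (p : V.Idx → ℤ) (hY : ∀ β, HasPar (p β) (Y β)) (hAC : A ≠ [] ∨ C ≠ []) :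
    b (A.map coord ++ Y :: C) =
      ∑ β, sgn (p β + p β * lsum V.sdeg A) • Y β • b (A.map coord ++ coord β :: C) := by
  conv_lhs => rw [eq_sum_coord Y, h.map_sum]
  refine Finset.sum_congr rfl fun β _ => ?_
  rw [h.smul _ _ _ (p β) _ (by rw [Ne, List.append_eq_nil_iff, not_and_or, List.map_eq_nil_iff]; exact hAC) (hY β)]
  have := h.map_tau_coords (p β) A [] (coord β :: C)
  rw [List.nil_append, List.nil_append] at this
  rw [this, smul_comm (Y β), sgn_smul_smul]

end IsTensorial

/-- The sum in the structure equations of an `A_∞`-algebra. -/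
def ainfSum (b : List (VecField k V) → VecField k V) (L : List (VecField k V)) : VecField k V :=
  blockSum (fun P Q R => b (P.map (tau 1) ++ b Q :: R)) L

lemma ainfSum_eq (b : List (VecField k V) → VecField k V) (L : List (VecField k V)) :
    ∑ s ∈ Finset.range L.length, ∑ l ∈ Finset.Icc 1 (L.length - s),
      b ((L.take s).map shiftParity ++ b ((L.drop s).take l) :: L.drop (s + l)) = ainfSum b L := by
  rw [ainfSum, blockSum_eq_sum_range, shiftParity_eq']

section Reduction

variable {ν : VecField k V} {b : List (VecField k V) → VecField k V}

lemma map_tau_tau (p q : ℤ) (A : List (VecField k V)) :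
    (A.map (tau q)).map (tau p) = A.map (tau (p + q)) := by
  rw [List.map_map]
  congr 1
  funext X
  exact tau_tau p q X

lemma tau_map_of_odd
    (hpar : ∀ L, tau 1 (b L) = -b (L.map (tau 1))) (p : ℤ) (L : List (VecField k V)) :
    tau p (b L) = sgn p • b (L.map (tau p)) := by
  rcases Int.even_or_odd p with hp | hp
  · have e : (((p - 0 : ℤ)) : ZMod 2) = 0 := by
      obtain ⟨m, rfl⟩ := hp; push_cast; ring_nf <;> reduce_mod_char
    rw [tau_congr e, sgn_eq_of e, tau_zero]
    have : (L.map (tau 0)) = L := by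
      conv_rhs => rw [← List.map_id L]
      congr 1; funext X; exact tau_zero X
    rw [this]; simp
  · have e : (((p - 1 : ℤ)) : ZMod 2) = 0 := by
      obtain ⟨m, rfl⟩ := hp; push_cast; ring_nf <;> reduce_mod_char
    rw [tau_congr e, sgn_eq_of e, sgn_one_smul]; exact hpar L

lemma ainfSum_single (h : IsTensorial ν b) (X : VecField k V) :
    ainfSum b [X] = lieOdd ν (lieOdd ν X) := by
  simp only [ainfSum, blockSum, splitSum, add_zero, List.map_nil, List.nil_append]
  rw [h.one X, h.one]

lemma ainfSum_smul [CharZero k] (hν : ν.IsOdd) (hsq : ∀ α, ν.app (ν α) = 0) (h : IsTensorial ν b)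
    (hpar : ∀ L, tau 1 (b L) = -b (L.map (tau 1)))
    {p : ℤ} {f : FormalFn k V} (hf : HasPar p f) (A : List (VecField k V)) (X : VecField k V)
    (C : List (VecField k V)) :
    ainfSum b (A ++ f • X :: C) = f • ainfSum b (A.map (tau p) ++ X :: C) := by
  have hone : ∀ Y, b [f • Y] = ν.app f • Y + sgn p • f • b [Y] := by
    intro Y; rw [h.one, h.one, hν.lieOdd_smul hf]
  by_cases hAC : A ++ C = []
  · obtain ⟨rfl, rfl⟩ := List.append_eq_nil_iff.1 hAC
    simp only [List.map_nil, List.nil_append]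
    rw [ainfSum_single h, ainfSum_single h, hν.lieOdd_smul hf, lieOdd_add,
      hν.lieOdd_smul (hν.app_par hf), hν.app_app hsq, zero_smul, zero_add]
    have e : lieOdd ν (sgn p • f • lieOdd ν X) = sgn p • lieOdd ν (f • lieOdd ν X) := by
      rw [← h.one (sgn p • f • lieOdd ν X), ← h.one (f • lieOdd ν X)]; exact h.map_sgn [] [] _ _
    rw [e, hν.lieOdd_smul hf, smul_add, sgn_smul_self, ← add_assoc]
    have e2 : sgn (p + 1) • ν.app f • lieOdd ν X = -(sgn p • ν.app f • lieOdd ν X) := by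
      rw [← sgn_one_smul, sgn_smul_smul, add_comm]
    rw [e2, neg_add_cancel, zero_add]
  · have hmid : ∀ P Q Q' R, P ++ Q = A → Q' ++ R = C →
        b (P.map (tau 1) ++ b (Q ++ f • X :: Q') :: R) =
          f • b ((P.map (tau p)).map (tau 1) ++ b (Q.map (tau p) ++ X :: Q') :: R) +
          (if P = [] then (if R = [] then sgn p • ν.app f • b (Q.map (tau p) ++ X :: Q') else 0) else 0) +
          (if Q = [] then (if Q' = [] then b (P.map (tau 1) ++ ν.app f • X :: R) else 0) else 0) := by
      intro P Q Q' R hA hC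
      have hout : ∀ Y, b (P.map (tau 1) ++ (sgn p • f • Y) :: R) =
          f • b ((P.map (tau p)).map (tau 1) ++ Y :: R) +
          (if P = [] then (if R = [] then sgn p • ν.app f • Y else 0) else 0) := by
        intro Y
        rw [h.map_sgn]
        by_cases hPR : P ++ R = []
        · obtain ⟨rfl, rfl⟩ := List.append_eq_nil_iff.1 hPR
          simp only [List.map_nil, List.nil_append, if_true]
          rw [hone, smul_add, sgn_smul_self, add_comm]
        · rw [h.smul _ _ _ p f (by simpa using hPR) hf, sgn_smul_self, map_tau_tau, map_tau_tau,
            add_comm p 1]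
          rw [List.append_eq_nil_iff, not_and_or] at hPR
          rcases hPR with h1 | h1 <;> simp [h1]
      by_cases hQQ : Q ++ Q' = []
      · obtain ⟨rfl, rfl⟩ := List.append_eq_nil_iff.1 hQQ
        simp only [List.map_nil, List.nil_append, if_true]
        rw [hone, h.add, hout, add_comm]
      · rw [h.smul _ _ _ p f hQQ hf, hout]
        rw [List.append_eq_nil_iff, not_and_or] at hQQ
        rcases hQQ with h1 | h1 <;> simp [h1]
    have hcancel : sgn p • ν.app f • b (A.map (tau p) ++ X :: C) +
        b (A.map (tau 1) ++ ν.app f • X :: C) = 0 := by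
      rw [h.smul _ _ _ (p + 1) _ (by simpa using hAC) (hν.app_par hf), map_tau_tau,
        tau_congr (m := p + 1 + 1) (n := p) (by push_cast; ring_nf <;> reduce_mod_char),
        add_comm p 1, ← sgn_smul_smul 1 p, sgn_one_smul, add_neg_cancel]
    rw [ainfSum, ainfSum, blockSum_append_cons, blockSum_append_cons, smul_add, smul_add,
      blockSum_map, splitSum_map]
    have e1 : blockSum (fun P Q R => b (P.map (tau 1) ++ b Q :: (R ++ f • X :: C))) A =
        f • blockSum (fun P Q R => b ((P.map (tau p)).map (tau 1) ++ b (Q.map (tau p)) ::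
          (R.map (tau p) ++ X :: C))) A := by
      refine Eq.trans ?_ (blockSum_hom (DistribSMul.toAddMonoidHom (VecField k V) f) _ A).symm
      refine blockSum_congr fun P Q R hQ hA => ?_
      have := h.smul (P.map (tau 1) ++ b Q :: R) X C p f (by simp) hf
      simp only [List.append_assoc, List.cons_append, List.map_append, List.map_cons] at this
      rw [this, tau_map_of_odd hpar, h.map_sgn, smul_comm f, sgn_smul_self, map_tau_tau, map_tau_tau,
        add_comm p 1]
      rfl
    have e3 : blockSum (fun P Q R => b ((A ++ f • X :: P).map (tau 1) ++ b Q :: R)) C =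
        f • blockSum (fun P Q R => b ((A.map (tau p) ++ X :: P).map (tau 1) ++ b Q :: R)) C := by
      refine Eq.trans ?_ (blockSum_hom (DistribSMul.toAddMonoidHom (VecField k V) f) _ C).symm
      refine blockSum_congr fun P Q R hQ hA => ?_
      simp only [List.map_append, List.map_cons, List.append_assoc, List.cons_append]
      rw [tau_smul 1 hf, one_mul, h.map_sgn, h.smul _ _ _ p f (by simp) hf, sgn_smul_self, map_tau_tau,
        map_tau_tau, add_comm p 1]
      rfl
    have e2 : splitSum (fun P Q => splitSum (fun Q' R =>
          b (P.map (tau 1) ++ b (Q ++ f • X :: Q') :: R)) C) A =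
        f • splitSum (fun P Q => splitSum (fun Q' R =>
          b ((P.map (tau p)).map (tau 1) ++ b (Q.map (tau p) ++ X :: Q') :: R)) C) A := by
      have step : splitSum (fun P Q => splitSum (fun Q' R =>
          b (P.map (tau 1) ++ b (Q ++ f • X :: Q') :: R)) C) A =
        splitSum (fun P Q => splitSum (fun Q' R =>
          f • b ((P.map (tau p)).map (tau 1) ++ b (Q.map (tau p) ++ X :: Q') :: R)) C +
          (if P = [] then sgn p • ν.app f • b (Q.map (tau p) ++ X :: C) else 0) +
          (if Q = [] then b (P.map (tau 1) ++ ν.app f • X :: C) else 0)) A := by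
        refine splitSum_congr fun P Q hA => ?_
        rw [splitSum_congr fun Q' R hC => hmid P Q Q' R hA hC, splitSum_add, splitSum_add]
        congr 1
        · congr 1
          split_ifs
          · exact splitSum_ite_right (fun Q' => sgn p • ν.app f • b (Q.map (tau p) ++ X :: Q')) C
          · exact splitSum_zero C
        · split_ifs
          · exact splitSum_ite_left (fun R => b (P.map (tau 1) ++ ν.app f • X :: R)) C
          · exact splitSum_zero C
      rw [step, splitSum_add, splitSum_add, splitSum_ite_left
          (fun Q => sgn p • ν.app f • b (Q.map (tau p) ++ X :: C)), splitSum_ite_right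
          (fun P => b (P.map (tau 1) ++ ν.app f • X :: C)), add_assoc, hcancel, add_zero]
      refine Eq.trans ?_ (splitSum_hom (DistribSMul.toAddMonoidHom (VecField k V) f) _ A).symm
      refine splitSum_congr fun P Q hA => ?_
      exact (splitSum_hom (DistribSMul.toAddMonoidHom (VecField k V) f) _ C).symm
    rw [e1, e2, e3]

lemma ainfSum_add (h : IsTensorial ν b) (A : List (VecField k V)) (X Y : VecField k V)
    (C : List (VecField k V)) :
    ainfSum b (A ++ (X + Y) :: C) = ainfSum b (A ++ X :: C) + ainfSum b (A ++ Y :: C) := by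
  simp only [ainfSum, blockSum_append_cons]
  have e1 : ∀ P Q R : List (VecField k V), b (P.map (tau 1) ++ b Q :: (R ++ (X + Y) :: C)) =
      b (P.map (tau 1) ++ b Q :: (R ++ X :: C)) + b (P.map (tau 1) ++ b Q :: (R ++ Y :: C)) := by
    intro P Q R
    have := h.add (P.map (tau 1) ++ b Q :: R) X Y C
    simpa using this
  have e2 : ∀ P Q Q' R : List (VecField k V), b (P.map (tau 1) ++ b (Q ++ (X + Y) :: Q') :: R) =
      b (P.map (tau 1) ++ b (Q ++ X :: Q') :: R) + b (P.map (tau 1) ++ b (Q ++ Y :: Q') :: R) := by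
    intro P Q Q' R; rw [h.add, h.add]
  have e3 : ∀ P Q R : List (VecField k V), b ((A ++ (X + Y) :: P).map (tau 1) ++ b Q :: R) =
      b ((A ++ X :: P).map (tau 1) ++ b Q :: R) + b ((A ++ Y :: P).map (tau 1) ++ b Q :: R) := by
    intro P Q R
    have := h.add (A.map (tau 1)) (tau 1 X) (tau 1 Y) (P.map (tau 1) ++ b Q :: R)
    simpa using this
  simp only [e1, e2, e3, blockSum_add, splitSum_add]
  abel

/-- The structure equations hold if they hold for coordinate vector fields. -/
lemma ainfSum_eq_zero [CharZero k] (hν : ν.IsOdd) (hsq : ∀ α, ν.app (ν α) = 0)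
    (h : IsTensorial ν b) (hpar : ∀ L, tau 1 (b L) = -b (L.map (tau 1)))
    (hc : ∀ B : List V.Idx, ainfSum b (B.map coord) = 0) (L : List (VecField k V)) :
    ainfSum b L = 0 := by
  induction L using coord_induction with
  | hadd A X Y C hX hY => rw [ainfSum_add h, hX, hY, add_zero]
  | hzero A C =>
    have := ainfSum_add h A 0 0 C
    rw [add_zero] at this
    exact left_eq_add.1 this
  | hsmul p f hf A X C ih => rw [ainfSum_smul hν hsq h hpar hf, ih, smul_zero]
  | hcoord B => exact hc B

end Reduction

end GInf

namespace GInf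

open FormalFn VecField

variable {k : Type u} [Field k] {V : GrSp}

lemma FormalFn.sum_apply {ι : Type*} (s : Finset ι) (f : ι → FormalFn k V) (l : List V.Idx) :
    (∑ i ∈ s, f i).1 l = ∑ i ∈ s, (f i).1 l := by
  rw [Submodule.coe_sum, Finset.sum_apply]

lemma FormalFn.sgn_smul_apply (c : ℤˣ) (f : FormalFn k V) (l : List V.Idx) :
    (c • f).1 l = c • f.1 l := rfl

namespace VecField

lemma IsHomog.par {X : VecField k V} {p : ℤ} (h : X.IsHomog p) (β : V.Idx) :
    HasPar (p - V.sdeg β) (X β) :=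
  HasPar.of_support fun l hl => by rw [← h β l hl]; ring

lemma IsHomog.tau_eq {X : VecField k V} {p : ℤ} (h : X.IsHomog p) (n : ℤ) :
    tau n X = sgn (n * p) • X := by
  funext α
  rw [tau_apply, h.par α n, sgn_smul_smul, Pi.smul_apply]
  congr 2; ring

lemma coord_isHomog (β : V.Idx) : (coord β : VecField k V).IsHomog (V.sdeg β) := by
  intro α l hl
  rw [coord_apply] at hl
  split_ifs at hl with h
  · rw [one_apply] at hl
    split_ifs at hl with h'
    · simp [h, h']
    · exact absurd rfl hl
  · exact absurd rfl hl

end VecField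

namespace IsTensorial

variable {ν : VecField k V} {b : List (VecField k V) → VecField k V}

lemma map_tau_homog (h : IsTensorial ν b) {Y : Type*} (g : Y → VecField k V) (d : Y → ℤ)
    (hg : ∀ y, (g y).IsHomog (d y)) (p : ℤ) (A : List Y) (P C : List (VecField k V)) :
    b (P ++ ((A.map g).map (tau p) ++ C)) = sgn (p * lsum d A) • b (P ++ (A.map g ++ C)) := by
  induction A generalizing P with
  | nil => simp
  | cons a A ih =>
    simp only [List.map_cons, List.cons_append]
    rw [(hg a).tau_eq, h.map_sgn]
    have := ih (P ++ [g a])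
    simp only [List.append_assoc, List.singleton_append] at this
    rw [this, sgn_smul_smul, lsum_cons, mul_add]

/-- The structure equations on coordinate vector fields. -/
lemma ainfSum_coord (h : IsTensorial ν b) (hν : ν.IsOdd) {c : Coeffs k V}
    (h0 : ∀ α, c α [] = (ν α).1)
    (hb : ∀ α B, B ≠ [] → c.full α B = (b (B.map coord) α).1)
    (hp : ∀ α B, B ≠ [] → HasPar (lsum V.sdeg B + 1 + V.sdeg α) (b (B.map coord) α))
    (α : V.Idx) (B γ : List V.Idx) (hB : 2 ≤ B.length) :
    (ainfSum b (B.map coord) α).1 γ = c.ainf α B γ := by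
  have hlie : ∀ (Y : VecField k V) (p : V.Idx → ℤ), (∀ β, HasPar (p β) (Y β)) →
      lieOdd ν Y α = ν.app (Y α) + ∑ β, sgn (p β) • (Y β * b [coord β] α) := by
    intro Y p hY
    have hs : ∀ s : Finset V.Idx, lieOdd ν (∑ β ∈ s, Y β • coord β) α =
        ∑ β ∈ s, (ν.app (Y β) * (coord β : VecField k V) α + sgn (p β) • (Y β * b [coord β] α)) := by
      intro s
      induction s using Finset.induction_on with
      | empty =>
        have := congrFun (h.map_zero [] []) α
        rw [List.nil_append, h.one] at this
        simpa using this
      | insert β s hβ ih =>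
        rw [Finset.sum_insert hβ, Finset.sum_insert hβ, lieOdd_add, Pi.add_apply, ih,
          hν.lieOdd_smul (hY β), h.one]
        rfl
    conv_lhs => rw [eq_sum_coord Y, hs]
    rw [Finset.sum_add_distrib]
    congr 1
    rw [Finset.sum_eq_single α]
    · rw [coord_apply, if_pos rfl, mul_one]
    · intro β _ hβ; rw [coord_apply, if_neg hβ.symm, mul_zero]
    · simp
  have hterm : ∀ P Q R, Q ≠ [] → P ++ (Q ++ R) = B →
      b (((P.map coord).map (tau 1)) ++ b (Q.map coord) :: R.map coord) α =
      ∑ β, sgn (lsum V.sdeg P + (lsum V.sdeg Q + 1 + V.sdeg β) * (1 + lsum V.sdeg P)) •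
        (b (Q.map coord) β * b ((P ++ β :: R).map coord) α) +
      if P = [] then (if R = [] then ν.app (b (Q.map coord) α) else 0) else 0 := by
    intro P Q R hQ hPQR
    by_cases hPR : P ++ R = []
    · obtain ⟨rfl, rfl⟩ := List.append_eq_nil_iff.1 hPR
      simp only [List.map_nil, List.nil_append, if_true]
      rw [h.one, hlie _ _ (fun β => hp β Q hQ), add_comm]
      congr 1
      refine Finset.sum_congr rfl fun β _ => ?_
      simp [lsum]
    · have e := h.map_tau_coords 1 P [] (b (Q.map coord) :: R.map coord)
      rw [List.nil_append, List.nil_append] at e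
      have hPR' : P ≠ [] ∨ R.map coord ≠ ([] : List (VecField k V)) := by
        rw [List.append_eq_nil_iff, not_and_or] at hPR
        simpa [Ne, List.map_eq_nil_iff] using hPR
      rw [e, h.expand_slot P _ _ _ (fun β => hp β Q hQ) hPR', Pi.smul_apply, Finset.sum_apply,
        Finset.smul_sum]
      have h2 : (if P = [] then (if R = [] then ν.app (b (Q.map coord) α) else 0) else 0) = 0 := by
        rw [List.append_eq_nil_iff, not_and_or] at hPR
        rcases hPR with h1 | h1 <;> simp [h1]
      rw [h2, add_zero]
      refine Finset.sum_congr rfl fun β _ => ?_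
      rw [List.map_append, List.map_cons]
      change sgn _ • sgn _ • ((_ : FormalFn k V) * (_ : FormalFn k V)) = _
      rw [sgn_smul_smul]
      congr 2; ring
  have happ : ∀ (K : List V.Idx → List V.Idx → List V.Idx → VecField k V),
      blockSum K B α = blockSum (fun P Q R => K P Q R α) B := fun K =>
    blockSum_hom (Pi.evalAddMonoidHom _ α) K B
  rw [ainfSum, blockSum_map, happ, blockSum_congr hterm, blockSum_add]
  have hlast : blockSum (fun P Q R => if P = [] then (if R = [] then ν.app (b (Q.map coord) α)
      else 0) else 0) B = ν.app (b (B.map coord) α) := by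
    match B, hB with
    | x :: B, _ =>
      simp only [blockSum, if_true, reduceCtorEq, if_false, blockSum_zero, add_zero]
      exact splitSum_ite_right (fun Q => ν.app (b ((x :: Q).map coord) α)) B
  rw [hlast, Coeffs.ainf, add_comm]
  have hB0 : B ≠ [] := by rintro rfl; simp at hB
  refine congrArg₂ (fun a b : k => a + b) ?_ ?_
  · rw [app, FormalFn.sum_apply]
    refine Finset.sum_congr rfl fun β _ => ?_
    rw [h0, hb α B hB0]; rfl
  · have hev : ∀ (K : List V.Idx → List V.Idx → List V.Idx → FormalFn k V),
        (blockSum K B).1 γ = blockSum (fun P Q R => (K P Q R).1 γ) B := fun K =>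
      blockSum_hom (((Pi.evalAddMonoidHom _ γ)).comp (FormalFn k V).subtype.toAddMonoidHom) K B
    rw [hev]
    refine blockSum_congr fun P Q R hQ _ => ?_
    rw [FormalFn.sum_apply]
    refine Finset.sum_congr rfl fun β _ => ?_
    rw [hb β Q hQ, hb α _ (by simp)]
    rfl

/-- Homogeneous vector fields together with their degrees. -/
abbrev HomogField (k : Type u) [Field k] (V : GrSp) : Type u :=
  {x : VecField k V × ℤ // x.1.IsHomog x.2}

/-- The shuffle relations hold if they hold for coordinate vector fields. -/
lemma shuffle (h : IsTensorial ν b)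
    (hc : ∀ A C : List V.Idx, A ≠ [] → C ≠ [] →
      shSum V.sdeg (fun B => b (B.map coord)) A C = 0)
    (A C : List (HomogField k V)) (hA : A ≠ []) (hC : C ≠ []) :
    shSum (fun x : HomogField k V => x.1.2) (fun L => b (L.map fun x => x.1.1)) A C = 0 := by
  set d : HomogField k V → ℤ := fun x => x.1.2 with hd
  set F : List (HomogField k V) → VecField k V :=
    fun L => if 2 ≤ L.length then b (L.map fun x => x.1.1) else 0 with hF
  have hFA : ∀ A C : List (HomogField k V), A ≠ [] → C ≠ [] →
      shSum d (fun L => b (L.map fun x => x.1.1)) A C = shSum d F A C := by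
    intro A C hA hC
    refine shSum_congr d fun l hl => ?_
    have := List.length_pos_of_ne_nil hA
    have := List.length_pos_of_ne_nil hC
    simp only [hF]
    rw [if_pos (by omega)]
  let mc : V.Idx → HomogField k V := fun β => ⟨(coord β, V.sdeg β), coord_isHomog β⟩
  have hexp : ∀ (m : HomogField k V) (U W : List (HomogField k V)),
      F (U ++ m :: W) = ∑ β, sgn ((m.1.2 - V.sdeg β) * lsum d U) •
        ((DistribSMul.toAddMonoidHom _ (sgn (m.1.2 - V.sdeg β))).comp
          (DistribSMul.toAddMonoidHom (VecField k V) (m.1.1 β))) (F (U ++ mc β :: W)) := by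
    intro m U W
    by_cases hUW : U ++ W = []
    · obtain ⟨rfl, rfl⟩ := List.append_eq_nil_iff.1 hUW
      simp [hF]
    · have hl : 1 ≤ U.length + W.length := by
        rw [← List.length_append]; exact List.length_pos_of_ne_nil hUW
      simp only [hF]
      rw [if_pos (by simp; omega)]
      have e1 : (U ++ m :: W).map (fun x => x.1.1) =
          U.map (fun x => x.1.1) ++ m.1.1 :: W.map (fun x => x.1.1) := by simp
      rw [e1]
      conv_lhs => rw [eq_sum_coord m.1.1, h.map_sum]
      refine Finset.sum_congr rfl fun β _ => ?_
      rw [if_pos (by simp; omega), h.smul _ _ _ _ _ (by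
        rw [Ne, List.append_eq_nil_iff, List.map_eq_nil_iff, List.map_eq_nil_iff,
          ← List.append_eq_nil_iff]; exact hUW) (m.2.par β)]
      have := h.map_tau_homog (fun x : HomogField k V => x.1.1) d (fun x => x.2)
        (m.1.2 - V.sdeg β) U [] (coord β :: W.map fun x => x.1.1)
      rw [List.nil_append, List.nil_append] at this
      rw [this]
      change sgn _ • (_ : FormalFn k V) • sgn _ • (_ : VecField k V) =
        sgn _ • sgn _ • (_ : FormalFn k V) • (_ : VecField k V)
      rw [List.map_append, List.map_cons, smul_comm (m.1.1 β), smul_comm]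
  have stage : ∀ C : List (HomogField k V),
      (∀ B : List V.Idx, B ≠ [] → shSum d F (B.map mc) C = 0) →
      ∀ A : List (HomogField k V), A ≠ [] → shSum d F A C = 0 := by
    intro C hC
    have : ∀ (n : ℕ) (A : List (HomogField k V)) (B : List V.Idx), A.length = n →
        (A ≠ [] ∨ B ≠ []) → shSum d F (A ++ B.map mc) C = 0 := by
      intro n
      induction n with
      | zero =>
        intro A B hA hAB
        have hA0 := List.length_eq_zero_iff.1 hA
        subst hA0
        exact hC B (hAB.resolve_left (by simp))
      | succ n ih =>
        intro A B hA hAB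
        obtain ⟨A, m, rfl⟩ : ∃ A' m, A = A' ++ [m] := by
          rcases List.eq_nil_or_concat A with h | ⟨A', m, h⟩
          · simp [h] at hA
          · exact ⟨A', m, by simpa using h⟩
        have hA' : A.length = n := by simpa using hA
        rw [List.append_assoc, List.singleton_append,
          shSum_expand_letter d Finset.univ F F m mc (fun β => m.1.2 - V.sdeg β) _
            (fun β => by simp [hd, mc]) (hexp m)]
        refine Finset.sum_eq_zero fun β _ => ?_
        have := ih A (β :: B) hA' (Or.inr (by simp))
        rw [List.map_cons] at this
        rw [this, _root_.map_zero, smul_zero]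
    intro A hA
    simpa using this A.length A [] rfl (Or.inl hA)
  rw [hFA A C hA hC]
  refine stage C (fun B hB => ?_) A hA
  rw [shSum_comm, stage (B.map mc) (fun B' hB' => ?_) C hC, smul_zero]
  rw [← hFA _ _ (by simpa using hB') (by simpa using hB), shSum_map]
  have := hc B' B hB' hB
  convert this using 1
  refine shSum_congr _ fun l _ => ?_
  rw [List.map_map]; rfl

end IsTensorial

namespace GeomCInf

variable (S : GeomCInf k V)

lemma isOdd : S.ν.IsOdd := fun α =>
  (HasPar.of_support (S.ν_degree α)).congr (by
    simp only [GrSp.tdeg, GrSp.sdeg]; push_cast; ring_nf; reduce_mod_char)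

lemma isTensorial : IsTensorial S.ν S.b where
  one := S.b_one
  add := S.b_add
  smul A X C p f hAC hf := by
    rcases Int.even_or_odd p with hp | hp
    · have e : (((p - 0 : ℤ)) : ZMod 2) = 0 := by
        obtain ⟨m, rfl⟩ := hp; push_cast; ring_nf; reduce_mod_char
      have h1 := S.b_even A X C f hAC (by
        rw [parity_eq_tw, hf 1, one_mul, sgn_eq_of e]; simp)
      rw [fsmul_eq, fsmul_eq] at h1
      have h2 : (A.map (tau p)) = A := by
        conv_rhs => rw [← List.map_id A]
        congr 1; funext X; rw [tau_congr e]; exact tau_zero X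
      rw [h1, h2, sgn_eq_of e]; simp
    · have e : (((p - 1 : ℤ)) : ZMod 2) = 0 := by
        obtain ⟨m, rfl⟩ := hp; push_cast; ring_nf; reduce_mod_char
      have h1 := S.b_odd A X C f hAC (by
        rw [parity_eq_tw, hf 1, one_mul, sgn_eq_of e, sgn_one_smul])
      rw [fsmul_eq, fsmul_eq, shiftParity_eq'] at h1
      rw [h1, tau_congr e, sgn_eq_of e, sgn_one_smul]

lemma coeffs_nil (α : V.Idx) : S.coeffs α [] = (S.ν α).1 := by
  funext γ; simp [coeffs]

lemma coeffs_of_length (α : V.Idx) {B : List V.Idx} (hB : 2 ≤ B.length) :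
    S.coeffs α B = (S.b (B.map coord) α).1 := by
  funext γ
  rw [coeffs, if_neg (by rintro rfl; simp at hB), if_neg (by omega)]

lemma full_coeffs (α : V.Idx) {B : List V.Idx} (hB : B ≠ []) :
    S.coeffs.full α B = (S.b (B.map coord) α).1 := by
  match B, hB with
  | [j], _ =>
    funext γ
    rw [Coeffs.full_single, coeffs_nil, List.map_cons, List.map_nil, S.b_one, lieOdd_coord]; rfl
  | x :: y :: B, _ => exact S.coeffs_of_length α (by simp)

lemma coeffs_graded : S.coeffs.Graded where
  no_constant α := by rw [coeffs_nil]; exact S.ν_pointed α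
  no_single α β γ := by simp [coeffs]
  deg_nil α γ h := S.ν_degree α γ (by rw [coeffs_nil] at h; exact h)
  deg_word α B γ hB h := by
    match B, hB with
    | [j], _ => simp [coeffs] at h
    | x :: y :: B, _ =>
      rw [S.coeffs_of_length α (by simp)] at h
      have := S.b_degree ((x :: y :: B).map fun β => (coord β, V.sdeg β)) (by simp) (by
        intro z hz
        obtain ⟨β, _, rfl⟩ := List.mem_map.1 hz
        exact coord_isHomog β) α γ (by
          rw [List.map_map]; exact h)
      rw [this, List.map_map]; rfl

lemma coeffs_admissible : S.coeffs.Admissible where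
  symm α B A x y C := by
    by_cases h0 : B = []
    · subst h0; rw [coeffs_nil]; exact (S.ν α).2 A x y C
    · by_cases h1 : B.length = 1
      · simp [coeffs, h0, h1]
      · rw [S.coeffs_of_length α (by have := List.length_pos_of_ne_nil h0; omega)]
        exact (S.b _ α).2 A x y C
  no_constant := S.coeffs_graded.no_constant
  no_single := S.coeffs_graded.no_single
  shuffle α A C γ hA hC := by
    have hh : ∀ D : List V.Idx, ∀ x ∈ D.map (fun β => ((coord β : VecField k V), V.sdeg β)),
        x.1.IsHomog x.2 := by
      intro D x hx
      obtain ⟨β, _, rfl⟩ := List.mem_map.1 hx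
      exact coord_isHomog β
    have h : shSum Prod.snd (fun L : List (VecField k V × ℤ) => S.b (L.map Prod.fst)) _ _ = 0 :=
      S.b_shuffle (A.map fun β => (coord β, V.sdeg β))
      (C.map fun β => (coord β, V.sdeg β)) (by simpa using hA) (by simpa using hC) (hh A) (hh C)
    rw [shSum_map] at h
    have h2 := congrArg (fun X : VecField k V => (X α).1 γ) h
    let ev : VecField k V →+ k := ((Pi.evalAddMonoidHom _ γ).comp
      (FormalFn k V).subtype.toAddMonoidHom).comp (Pi.evalAddMonoidHom _ α)
    have h3 : ev (shSum _ _ A C) = _ := h2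
    rw [shSum_hom] at h3
    change shSum V.sdeg (fun B => S.coeffs α B γ) A C = 0
    refine Eq.trans (shSum_congr _ fun l hl => ?_) h3
    have := List.length_pos_of_ne_nil hA
    have := List.length_pos_of_ne_nil hC
    rw [S.coeffs_of_length α (by omega), List.map_map]; rfl

lemma b_coord_par (α : V.Idx) (B : List V.Idx) (hB : B ≠ []) :
    HasPar (lsum V.sdeg B + 1 + V.sdeg α) (S.b (B.map coord) α) :=
  (HasPar.of_support (p := lsum V.sdeg B + 1 - V.sdeg α) (fun γ hγ => by
    rw [← S.coeffs_graded.full_degree α B γ hB (by rw [S.full_coeffs α hB]; exact hγ)]; ring)).congr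
    (by push_cast; ring_nf; reduce_mod_char)

lemma coeffs_isMC : S.coeffs.IsMC where
  adm := S.coeffs_admissible
  graded := S.coeffs_graded
  square_zero α γ := by
    have := congrArg (fun f : FormalFn k V => f.1 γ) (S.ν_sq α)
    rw [app] at this
    simp only [FormalFn.sum_apply] at this
    simp only [Coeffs.square, coeffs_nil]
    exact this
  ainf_zero α B γ hB := by
    rw [← S.isTensorial.ainfSum_coord S.isOdd S.coeffs_nil (fun α B hB => S.full_coeffs α hB)
      S.b_coord_par α B γ hB, ← ainfSum_eq, S.b_ainf]
    rfl

lemma coeffs_injective [CharZero k] : Function.Injective (coeffs : GeomCInf k V → Coeffs k V) := by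
  intro S S' h
  have hν : S.ν = S'.ν := by
    funext α
    apply Subtype.ext
    rw [← coeffs_nil, ← coeffs_nil, h]
  refine GeomCInf.ext hν (funext fun L => ?_)
  by_cases hL : L = []
  · rw [hL, S.b_nil, S'.b_nil]
  · induction L using coord_induction with
    | hadd A X Y C hX hY => rw [S.b_add, S'.b_add, hX (by simp), hY (by simp)]
    | hzero A C => rw [S.isTensorial.map_zero, S'.isTensorial.map_zero]
    | hsmul p f hf A X C ih =>
      by_cases hAC : A ++ C = []
      · obtain ⟨rfl, rfl⟩ := List.append_eq_nil_iff.1 hAC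
        rw [List.nil_append, S.b_one, S'.b_one, hν]
      · rw [S.isTensorial.smul _ _ _ p f hAC hf, S'.isTensorial.smul _ _ _ p f hAC hf, ih (by simp)]
    | hcoord B =>
      have hB : B ≠ [] := by simpa using hL
      funext α
      apply Subtype.ext
      rw [← S.full_coeffs α hB, ← S'.full_coeffs α hB, h]

end GeomCInf

end GInf

namespace GInf

open FormalFn VecField

variable {k : Type u} [Field k] {V : GrSp}

/-- The extension by linearity over functions of an operation which is given on coordinate vector
fields; the operation is applied after an element of degree `s`. -/
def extend : List (VecField k V) → ℤ → (List V.Idx → FormalFn k V) → FormalFn k V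
  | [], _, g => g []
  | X :: L, s, g => ∑ β, tw (1 + s) (X β) * extend L (s + V.sdeg β) (fun B => g (β :: B))

lemma extend_add (A : List (VecField k V)) (X Y : VecField k V) (C : List (VecField k V)) (s : ℤ)
    (g : List V.Idx → FormalFn k V) :
    extend (A ++ (X + Y) :: C) s g = extend (A ++ X :: C) s g + extend (A ++ Y :: C) s g := by
  induction A generalizing s g with
  | nil =>
    simp only [List.nil_append, extend, ← Finset.sum_add_distrib, ← add_mul]
    refine Finset.sum_congr rfl fun β _ => ?_
    rw [Pi.add_apply, map_add]
  | cons Z A ih =>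
    simp only [List.cons_append, extend, ih, mul_add, Finset.sum_add_distrib]

lemma extend_smul {p : ℤ} {f : FormalFn k V} (hf : HasPar p f) (A : List (VecField k V))
    (X : VecField k V) (C : List (VecField k V)) (s : ℤ) (g : List V.Idx → FormalFn k V) :
    extend (A ++ f • X :: C) s g =
      sgn (p * (1 + s)) • (f * extend (A.map (tau p) ++ X :: C) s g) := by
  induction A generalizing s g with
  | nil =>
    simp only [List.map_nil, List.nil_append, extend, Finset.mul_sum, Finset.smul_sum]
    refine Finset.sum_congr rfl fun β _ => ?_
    rw [Pi.smul_apply, smul_eq_mul, tw_mul, hf, smul_mul_assoc, smul_mul_assoc, mul_assoc, mul_comm p]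
  | cons Z A ih =>
    simp only [List.map_cons, List.cons_append, extend, ih, Finset.mul_sum, Finset.smul_sum]
    refine Finset.sum_congr rfl fun β _ => ?_
    rw [tau_apply, sgn_smul_tw, smul_mul_assoc, mul_smul_comm, mul_smul_comm, sgn_smul_smul,
      ← mul_assoc, ← mul_assoc, mul_comm_of_par hf, tw_tw, tw_tw,
      tw_congr (m := p + (1 + s) + p) (n := 1 + s) (by push_cast; ring_nf; reduce_mod_char)]
    congr 2; ring

lemma extend_coord (B : List V.Idx) (s : ℤ) (g : List V.Idx → FormalFn k V) :
    extend (B.map coord) s g = g B := by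
  induction B generalizing s g with
  | nil => rfl
  | cons b B ih =>
    simp only [List.map_cons, extend, ih]
    rw [Finset.sum_eq_single b]
    · rw [coord_apply, if_pos rfl, tw_one, one_mul]
    · intro β _ hβ; rw [coord_apply, if_neg hβ, map_zero, zero_mul]
    · simp

lemma tw_extend (L : List (VecField k V)) (s κ : ℤ) (g : List V.Idx → FormalFn k V)
    (hg : ∀ B, B.length = L.length → HasPar (lsum V.sdeg B + κ) (g B)) :
    tw 1 (extend L s g) = sgn κ • extend (L.map (tau 1)) s g := by
  induction L generalizing s κ g with
  | nil =>
    simp only [extend, List.map_nil]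
    rw [hg [] rfl 1]
    simp
  | cons X L ih =>
    simp only [extend, List.map_cons, tw_sum, Finset.smul_sum]
    refine Finset.sum_congr rfl fun β _ => ?_
    rw [tw_mul, ih _ (κ + V.sdeg β) _ (fun B hB => (hg (β :: B) (by simp [hB])).congr (by
      rw [lsum_cons]; push_cast; ring_nf)), tau_apply, sgn_smul_tw, mul_smul_comm,
      smul_mul_assoc, tw_tw, tw_tw, sgn_smul_smul, one_mul, add_comm 1 (1 + s)]

lemma extend_degree (L : List (VecField k V × ℤ)) (hL : ∀ x ∈ L, x.1.IsHomog x.2) (s κ : ℤ)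
    (g : List V.Idx → FormalFn k V)
    (hg : ∀ B, B.length = L.length → ∀ l, (g B).1 l ≠ 0 → lsum V.tdeg l = lsum V.sdeg B + κ)
    (l : List V.Idx) (hl : (extend (L.map Prod.fst) s g).1 l ≠ 0) :
    lsum V.tdeg l = (L.map Prod.snd).sum + κ := by
  induction L generalizing s κ g l with
  | nil => simpa using hg [] rfl l hl
  | cons x L ih =>
    simp only [List.map_cons, extend, FormalFn.sum_apply] at hl
    obtain ⟨β, _, hβ⟩ := Finset.exists_ne_zero_of_sum_ne_zero hl
    have := taylorMul_degree _ _ (x.2 - V.sdeg β) ((L.map Prod.snd).sum + (κ + V.sdeg β))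
      (fun m hm => by
        have h1 := hL x (by simp) β m (by
          intro h0; apply hm; rw [tw_apply, h0, smul_zero])
        linarith)
      (fun m hm => ih (fun y hy => hL y (by simp [hy])) _ _ _ (fun B hB m' hm' => by
        rw [hg (β :: B) (by simp [hB]) m' hm', lsum_cons]; ring) m hm) l hβ
    rw [this, List.map_cons, List.sum_cons]; ring

namespace Coeffs.IsMC

variable {c : Coeffs k V} (h : c.IsMC)

/-- The homological vector field with given Taylor coefficients. -/
def field : VecField k V := fun α => h.adm.fn α []

/-- The operations with given Taylor coefficients. -/
def ops : List (VecField k V) → VecField k V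
  | [] => 0
  | [X] => lieOdd h.field X
  | L => fun α => extend L 0 (h.adm.fn α)

lemma ops_of_length {L : List (VecField k V)} (hL : 2 ≤ L.length) :
    h.ops L = fun α => extend L 0 (h.adm.fn α) := by
  match L, hL with
  | _ :: _ :: _, _ => rfl

lemma field_isOdd : h.field.IsOdd := h.fn_par

lemma field_sq (α : V.Idx) : h.field.app (h.field α) = 0 := by
  ext γ
  rw [app, FormalFn.sum_apply]
  exact h.square_zero α γ

lemma two_le_length {X : Type*} {A : List X} {x : X} {C : List X} (hAC : A ++ C ≠ []) :
    2 ≤ (A ++ x :: C).length := by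
  have := List.length_pos_of_ne_nil hAC
  simp only [List.length_append, List.length_cons] at this ⊢
  omega

lemma ops_isTensorial : IsTensorial h.field h.ops where
  one X := rfl
  add A X Y C := by
    by_cases hAC : A ++ C = []
    · obtain ⟨rfl, rfl⟩ := List.append_eq_nil_iff.1 hAC
      exact lieOdd_add _ _ _
    · rw [h.ops_of_length (two_le_length hAC), h.ops_of_length (two_le_length hAC),
        h.ops_of_length (two_le_length hAC)]
      funext α
      exact extend_add _ _ _ _ _ _
  smul A X C p f hAC hf := by
    have hAC' : A.map (tau p) ++ C ≠ [] := by
      rw [Ne, List.append_eq_nil_iff, List.map_eq_nil_iff, ← List.append_eq_nil_iff]; exact hAC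
    rw [h.ops_of_length (two_le_length hAC), h.ops_of_length (two_le_length hAC')]
    funext α
    have := extend_smul hf A X C 0 (h.adm.fn α)
    rw [add_zero, mul_one] at this
    exact this

lemma ops_coord (α : V.Idx) {B : List V.Idx} (hB : B ≠ []) :
    h.ops (B.map coord) α = h.adm.full α B := by
  match B, hB with
  | [j], _ =>
    change lieOdd h.field (coord j) α = _
    rw [lieOdd_coord]; rfl
  | x :: y :: B, _ =>
    rw [h.ops_of_length (by simp)]
    change extend ((x :: y :: B).map coord) 0 (h.adm.fn α) = _
    rw [extend_coord]; rfl

lemma fn_par_of_length (α : V.Idx) {B : List V.Idx} (hB : 2 ≤ B.length) :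
    HasPar (lsum V.sdeg B + 1 + V.sdeg α) (h.adm.fn α B) := by
  have := h.full_par α B (by rintro rfl; simp at hB)
  have e : h.adm.full α B = h.adm.fn α B := Subtype.ext (c.full_of_length α hB)
  rwa [e] at this

lemma tau_ops (L : List (VecField k V)) : tau 1 (h.ops L) = -h.ops (L.map (tau 1)) := by
  match L with
  | [] => exact (map_zero _).trans neg_zero.symm
  | [X] =>
    funext α
    change sgn (1 * V.sdeg α) • tw 1 (h.field.app (X α) - app (parity X) (h.field α)) =
      -(h.field.app (sgn (1 * V.sdeg α) • tw 1 (X α)) - app (parity (tau 1 X)) (h.field α))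
    have e1 : sgn (1 * V.sdeg α) • tw 1 (app (parity X) (h.field α)) =
        -app (parity (tau 1 X)) (h.field α) := by
      rw [app, app, tw_sum, Finset.smul_sum, ← Finset.sum_neg_distrib]
      refine Finset.sum_congr rfl fun β _ => ?_
      change sgn _ • tw 1 ((sgn _ • tw 1 (X β)) * pd β (h.field α)) =
        -((sgn _ • tw 1 (sgn _ • tw 1 (X β))) * pd β (h.field α))
      rw [tw_mul, (h.field_isOdd α).pd β 1, mul_smul_comm, sgn_smul_tw, sgn_smul_tw, smul_mul_assoc,
        smul_mul_assoc, smul_mul_assoc, ← sgn_one_smul, sgn_smul_smul, sgn_smul_smul, sgn_smul_smul,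
        sgn_smul_smul]
      apply sgn_smul_congr
      simp only [GrSp.sdeg, GrSp.tdeg]; push_cast; ring_nf <;> reduce_mod_char
    rw [map_sub, smul_sub, e1, app_sgn_smul, h.field_isOdd.tw_app, sgn_one_smul, smul_neg]
    abel
  | X :: Y :: L =>
    rw [h.ops_of_length (by simp), h.ops_of_length (by simp)]
    funext α
    rw [tau_apply, tw_extend _ _ (1 + V.sdeg α) _ (fun B hB =>
      (h.fn_par_of_length α (by simp [hB])).congr (by push_cast; ring_nf)), sgn_smul_smul]
    change _ = -(extend _ 0 _)
    rw [← sgn_one_smul]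
    apply sgn_smul_congr
    push_cast; ring_nf <;> reduce_mod_char

lemma ainfSum_coord_single (j : V.Idx) : ainfSum h.ops [coord j] = 0 := by
  rw [ainfSum_single h.ops_isTensorial]
  funext α
  have h1 := congrArg (pd j) (h.field_sq α)
  rw [app, pd_sum, pd_zero] at h1
  have h2 : ∀ β, pd j (h.field β * pd β (h.field α)) = pd j (h.field β) * pd β (h.field α) +
      sgn (V.tdeg j) • (h.field β * pd β (pd j (h.field α))) := by
    intro β
    rw [pd_mul, h.field_isOdd β, pd_pd j β, smul_mul_assoc, mul_smul_comm, sgn_smul_smul]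
    congr 1
    apply sgn_smul_congr
    simp only [GrSp.sdeg, GrSp.tdeg]; push_cast; ring_nf <;> reduce_mod_char
  simp only [h2, Finset.sum_add_distrib, ← Finset.smul_sum] at h1
  change h.field.app (lieOdd h.field (coord j) α) - app (parity (lieOdd h.field (coord j))) (h.field α)
    = 0
  have h3 : app (parity (lieOdd h.field (coord j))) (h.field α) =
      ∑ β, pd j (h.field β) * pd β (h.field α) := by
    rw [app]
    refine Finset.sum_congr rfl fun β _ => ?_
    change (sgn _ • tw 1 (lieOdd h.field (coord j) β)) * _ = _
    rw [lieOdd_coord, sgn_smul_tw, (h.field_isOdd β).pd j 1, smul_mul_assoc, smul_mul_assoc,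
      smul_mul_assoc, sgn_smul_smul, sgn_smul_smul, sgn_eq_of (b := 0)]
    · simp
    · simp only [GrSp.sdeg, GrSp.tdeg]; push_cast; ring_nf <;> reduce_mod_char
  have h5 : sgn (V.tdeg j) = sgn (1 + V.sdeg j) := by
    apply sgn_eq_of
    simp only [GrSp.sdeg, GrSp.tdeg]; push_cast; ring_nf <;> reduce_mod_char
  rw [h3, lieOdd_coord, app_sgn_smul, eq_neg_of_add_eq_zero_left h1, h5, ← sgn_smul_smul,
    sgn_one_smul, neg_neg, sub_eq_zero]
  rfl

lemma ainfSum_ops [CharZero k] (L : List (VecField k V)) : ainfSum h.ops L = 0 := by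
  refine ainfSum_eq_zero h.field_isOdd h.field_sq h.ops_isTensorial h.tau_ops (fun B => ?_) L
  match B with
  | [] => rfl
  | [j] => exact h.ainfSum_coord_single j
  | x :: y :: B =>
    funext α
    ext γ
    rw [h.ops_isTensorial.ainfSum_coord h.field_isOdd (c := c) (fun _ => rfl)
      (fun α B hB => by rw [h.ops_coord α hB]; rfl)
      (fun α B hB => by rw [h.ops_coord α hB]; exact h.full_par α B hB) α _ γ (by simp),
      h.ainf_zero α _ γ (by simp)]
    rfl

lemma ops_shuffle (A C : List V.Idx) (hA : A ≠ []) (hC : C ≠ []) :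
    shSum V.sdeg (fun B => h.ops (B.map coord)) A C = 0 := by
  funext α
  ext γ
  let ev : VecField k V →+ k := ((Pi.evalAddMonoidHom _ γ).comp
    (FormalFn k V).subtype.toAddMonoidHom).comp (Pi.evalAddMonoidHom _ α)
  change ev (shSum _ _ A C) = 0
  rw [shSum_hom]
  have h0 : shSum V.sdeg (fun l => c α l γ) A C = 0 := h.adm.shuffle α A C γ hA hC
  refine Eq.trans (shSum_congr _ fun l hl => ?_) h0
  have h1 := List.length_pos_of_ne_nil hA
  have h2 := List.length_pos_of_ne_nil hC
  change (h.ops (l.map coord) α).1 γ = _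
  rw [h.ops_coord α (by rintro rfl; simp at hl; omega)]
  change c.full α l γ = c α l γ
  rw [c.full_of_length α (by omega)]

/-- The geometric `C_∞`-structure with given Taylor coefficients. -/
def toGeom [CharZero k] : GeomCInf k V where
  ν := h.field
  ν_degree := h.graded.deg_nil
  ν_pointed := h.graded.no_constant
  ν_sq := h.field_sq
  b := h.ops
  b_nil := rfl
  b_one := h.ops_isTensorial.one
  b_add := h.ops_isTensorial.add
  b_even A X C f hAC hf := by
    have h0 : HasPar 0 f := HasPar.of_parity (by simpa [parity_eq_tw] using hf)
    have := h.ops_isTensorial.smul A X C 0 f hAC h0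
    have h2 : A.map (tau 0) = A := by
      conv_rhs => rw [← List.map_id A]
      congr 1; funext X; exact tau_zero X
    rw [h2] at this
    rw [fsmul_eq, this, fsmul_eq]; simp
  b_odd A X C f hAC hf := by
    have h0 : HasPar 1 f := HasPar.of_parity (by rw [sgn_one_smul]; exact hf)
    have := h.ops_isTensorial.smul A X C 1 f hAC h0
    rw [sgn_one_smul] at this
    rw [shiftParity_eq']
    exact this
  b_degree L hL hh := by
    intro α l hl
    rw [h.ops_of_length (by simpa using hL)] at hl
    have := extend_degree L hh 0 (1 - V.sdeg α) (h.adm.fn α) (fun B hB l hl => by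
      have := h.graded.deg_word α B l (by rintro rfl; simp at hB; omega) hl
      linarith) l hl
    linarith
  b_shuffle A C hA hC hhA hhC := by
    lift A to List (IsTensorial.HomogField k V) using hhA
    lift C to List (IsTensorial.HomogField k V) using hhC
    have := h.ops_isTensorial.shuffle h.ops_shuffle A C (by simpa using hA) (by simpa using hC)
    change shSum Prod.snd (fun L : List (VecField k V × ℤ) => h.ops (L.map Prod.fst)) _ _ = 0
    rw [shSum_map]
    refine Eq.trans (shSum_congr _ fun l _ => ?_) this
    rw [List.map_map]; rfl
  b_ainf L := by rw [ainfSum_eq, h.ainfSum_ops]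

lemma coeffs_toGeom [CharZero k] : h.toGeom.coeffs = c := by
  funext α B
  match B with
  | [] => rw [GeomCInf.coeffs_nil]; rfl
  | [j] => funext γ; rw [h.graded.no_single, h.toGeom.coeffs_graded.no_single]
  | x :: y :: B =>
    rw [GeomCInf.coeffs_of_length _ _ (by simp)]
    change (h.ops _ α).1 = _
    rw [h.ops_coord α (by simp)]; rfl

end Coeffs.IsMC

end GInf

namespace GInf

open FormalFn

section Filtered

lemma GMon.weight_pos {ι : Type} (m : GMon ι) : 0 < m.weight := by
  induction m with
  | gen i => simp [GMon.weight]
  | mul a b ha hb => simp [GMon.weight, ha]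
  | br a b ha hb => simp [GMon.weight, ha]

variable {ι : Type} [Finite ι]

lemma GMon.finite_weight_lt (n : ℕ) : {m : GMon ι | m.weight < n}.Finite := by
  induction n with
  | zero => simp
  | succ n ih =>
    refine ((Set.finite_range GMon.gen).union ((Set.Finite.image2 GMon.mul ih ih).union
      (Set.Finite.image2 GMon.br ih ih))).subset ?_
    intro m hm
    simp only [Set.mem_setOf_eq] at hm
    match m with
    | .gen i => exact Or.inl ⟨i, rfl⟩
    | .mul a b =>
      simp only [GMon.weight] at hm
      have := a.weight_pos
      have := b.weight_pos
      exact Or.inr (Or.inl ⟨a, by simp; omega, b, by simp; omega, rfl⟩)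
    | .br a b =>
      simp only [GMon.weight] at hm
      have := a.weight_pos
      have := b.weight_pos
      exact Or.inr (Or.inr ⟨a, by simp; omega, b, by simp; omega, rfl⟩)

/-- The monomials of weight less than `n`. -/
def monosLT (ι : Type) [Finite ι] (n : ℕ) : Finset (GMon ι) := (GMon.finite_weight_lt n).toFinset

lemma mem_monosLT {n : ℕ} {m : GMon ι} : m ∈ monosLT ι n ↔ m.weight < n := by
  simp [monosLT]

variable (k : Type u) [Field k] (V : GrSp)

/-- The weight filtration of the space of series. -/
def serFil (n : ℕ) : Submodule k (GSer k V) where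
  carrier := {x | ∀ m, m.weight < n → x m = 0}
  add_mem' hx hy m hm := by rw [Pi.add_apply, hx m hm, hy m hm, add_zero]
  zero_mem' _ _ := rfl
  smul_mem' c x hx m hm := by rw [Pi.smul_apply, hx m hm, smul_zero]

variable {k V}

lemma mono_apply (m m' : GMon V.Idx) : mono k V m m' = open Classical in if m' = m then 1 else 0 := by
  classical
  simp [mono, Pi.single_apply]

lemma sub_sum_mem_serFil (n : ℕ) (x : GSer k V) :
    x - ∑ m ∈ monosLT V.Idx n, x m • mono k V m ∈ serFil k V n := by
  classical
  intro m hm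
  rw [Pi.sub_apply, Finset.sum_apply, Finset.sum_eq_single m]
  · simp [mono_apply]
  · intro m' _ h; simp [mono_apply, h.symm]
  · intro h; exact absurd (mem_monosLT.2 hm) h

lemma eq_zero_of_filtered {N : Type*} [AddCommGroup N] [Module k N] (fil : ℕ → Submodule k N)
    (sep : ∀ y, (∀ n, y ∈ fil n) → y = 0) (T : GSer k V →ₗ[k] N)
    (hT : ∀ n x, x ∈ serFil k V n → T x ∈ fil n) (h0 : ∀ m, T (mono k V m) = 0) : T = 0 := by
  apply LinearMap.ext
  intro x
  apply sep
  intro n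
  have h := hT n _ (sub_sum_mem_serFil n x)
  rw [map_sub, map_sum] at h
  simpa [h0] using h

lemma eq_of_filtered {N : Type*} [AddCommGroup N] [Module k N] (fil : ℕ → Submodule k N)
    (sep : ∀ y, (∀ n, y ∈ fil n) → y = 0) (T T' : GSer k V →ₗ[k] N)
    (hT : ∀ n x, x ∈ serFil k V n → T x ∈ fil n) (hT' : ∀ n x, x ∈ serFil k V n → T' x ∈ fil n)
    (h0 : ∀ m, T (mono k V m) = T' (mono k V m)) : T = T' := by
  rw [← sub_eq_zero]
  exact eq_zero_of_filtered fil sep (T - T') (fun n x hx => sub_mem (hT n x hx) (hT' n x hx))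
    (fun m => by rw [LinearMap.sub_apply, h0, sub_self])

lemma serMul_mul (x y : GSer k V) (a b : GMon V.Idx) : serMul k V x y (.mul a b) = x a * y b := rfl
lemma serMul_gen (x y : GSer k V) (i : V.Idx) : serMul k V x y (.gen i) = 0 := rfl
lemma serMul_br (x y : GSer k V) (a b : GMon V.Idx) : serMul k V x y (.br a b) = 0 := rfl
lemma serBr_br (x y : GSer k V) (a b : GMon V.Idx) : serBr k V x y (.br a b) = x a * y b := rfl
lemma serBr_gen (x y : GSer k V) (i : V.Idx) : serBr k V x y (.gen i) = 0 := rfl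
lemma serBr_mul (x y : GSer k V) (a b : GMon V.Idx) : serBr k V x y (.mul a b) = 0 := rfl

lemma serMul_mono (a b : GMon V.Idx) : serMul k V (mono k V a) (mono k V b) = mono k V (.mul a b) := by
  classical
  funext m
  match m with
  | .gen i => simp [serMul_gen, mono_apply]
  | .br _ _ => simp [serMul_br, mono_apply]
  | .mul a' b' => rw [serMul_mul]; simp only [mono_apply, GMon.mul.injEq]; split_ifs <;> simp_all

lemma serBr_mono (a b : GMon V.Idx) : serBr k V (mono k V a) (mono k V b) = mono k V (.br a b) := by
  classical
  funext m
  match m with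
  | .gen i => simp [serBr_gen, mono_apply]
  | .mul _ _ => simp [serBr_mul, mono_apply]
  | .br a' b' => rw [serBr_br]; simp only [mono_apply, GMon.br.injEq]; split_ifs <;> simp_all

lemma serMul_mem_left {n : ℕ} {x : GSer k V} (hx : x ∈ serFil k V n) (y : GSer k V) :
    serMul k V x y ∈ serFil k V n := by
  intro m hm
  match m with
  | .gen i => rfl
  | .br _ _ => rfl
  | .mul a b =>
    rw [serMul_mul, hx a, zero_mul]
    simp only [GMon.weight] at hm; omega

lemma serMul_mem_right {n : ℕ} (x : GSer k V) {y : GSer k V} (hy : y ∈ serFil k V n) :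
    serMul k V x y ∈ serFil k V n := by
  intro m hm
  match m with
  | .gen i => rfl
  | .br _ _ => rfl
  | .mul a b =>
    rw [serMul_mul, hy b, mul_zero]
    simp only [GMon.weight] at hm; omega

lemma serBr_mem_left {n : ℕ} {x : GSer k V} (hx : x ∈ serFil k V n) (y : GSer k V) :
    serBr k V x y ∈ serFil k V n := by
  intro m hm
  match m with
  | .gen i => rfl
  | .mul _ _ => rfl
  | .br a b =>
    rw [serBr_br, hx a, zero_mul]
    simp only [GMon.weight] at hm; omega

lemma serBr_mem_right {n : ℕ} (x : GSer k V) {y : GSer k V} (hy : y ∈ serFil k V n) :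
    serBr k V x y ∈ serFil k V n := by
  intro m hm
  match m with
  | .gen i => rfl
  | .mul _ _ => rfl
  | .br a b =>
    rw [serBr_br, hy b, mul_zero]
    simp only [GMon.weight] at hm; omega

/-- Two bilinear maps on series which are compatible with filtrations in each argument agree if they
agree on monomials. -/
lemma bilin_eq_of_filtered {N : Type*} [AddCommGroup N] [Module k N] (fil : ℕ → Submodule k N)
    (sep : ∀ y, (∀ n, y ∈ fil n) → y = 0) (T T' : GSer k V →ₗ[k] GSer k V →ₗ[k] N)
    (hl : ∀ n x y, x ∈ serFil k V n → T x y ∈ fil n) (hr : ∀ n x y, y ∈ serFil k V n → T x y ∈ fil n)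
    (hl' : ∀ n x y, x ∈ serFil k V n → T' x y ∈ fil n)
    (hr' : ∀ n x y, y ∈ serFil k V n → T' x y ∈ fil n)
    (h0 : ∀ a b, T (mono k V a) (mono k V b) = T' (mono k V a) (mono k V b)) : T = T' := by
  have h1 : ∀ b, T.flip (mono k V b) = T'.flip (mono k V b) := fun b =>
    eq_of_filtered fil sep _ _ (fun n x hx => hl n x _ hx) (fun n x hx => hl' n x _ hx)
      (fun a => h0 a b)
  have h2 : ∀ x, T x = T' x := fun x =>
    eq_of_filtered fil sep _ _ (fun n y hy => hr n x y hy) (fun n y hy => hr' n x y hy)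
      (fun b => LinearMap.congr_fun (h1 b) x)
  exact LinearMap.ext h2

end Filtered

section Model

variable (k : Type u) [Field k] (V : GrSp)

/-- Formal series of words in letters of degrees `|e_α| - 1` with formal functions as
coefficients. -/
abbrev WordFn : Type u := List V.Idx → FormalFn k V

/-- A model of the quotient of the free `G`-algebra: a square-zero extension of the formal
functions. -/
abbrev Model : Type u := FormalFn k V × WordFn k V

variable {k V}

namespace WordFn

/-- The product of series of words. -/
def mul : WordFn k V →ₗ[k] WordFn k V →ₗ[k] WordFn k V :=
  LinearMap.mk₂ k (fun ω η B => splitSum (fun P Q => ω P * tw (lsum V.sdeg P) (η Q)) B)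
    (by intro ω ω' η; funext B; simp only [Pi.add_apply, add_mul, splitSum_add])
    (by
      intro c ω η; funext B
      refine Eq.trans ?_ (splitSum_hom (DistribSMul.toAddMonoidHom _ c) _ B).symm
      exact splitSum_congr fun P Q _ => by rw [Pi.smul_apply, smul_mul_assoc]; rfl)
    (by intro ω η η'; funext B; simp only [Pi.add_apply, map_add, mul_add, splitSum_add])
    (by
      intro c ω η; funext B
      refine Eq.trans ?_ (splitSum_hom (DistribSMul.toAddMonoidHom _ c) _ B).symm
      exact splitSum_congr fun P Q _ => by
        rw [Pi.smul_apply, map_smul, mul_smul_comm]; rfl)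

/-- The product of series of words in the opposite order, with the Koszul sign. -/
def mulOp : WordFn k V →ₗ[k] WordFn k V →ₗ[k] WordFn k V :=
  LinearMap.mk₂ k (fun ω η B => splitSum (fun P Q =>
      sgn (lsum V.sdeg P * lsum V.sdeg Q) • (ω Q * tw (lsum V.sdeg Q) (η P))) B)
    (by intro ω ω' η; funext B; simp only [Pi.add_apply, add_mul, splitSum_add, smul_add])
    (by
      intro c ω η; funext B
      refine Eq.trans ?_ (splitSum_hom (DistribSMul.toAddMonoidHom _ c) _ B).symm
      exact splitSum_congr fun P Q _ => by
        rw [Pi.smul_apply, smul_mul_assoc, smul_comm]; rfl)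
    (by intro ω η η'; funext B; simp only [Pi.add_apply, map_add, mul_add, splitSum_add, smul_add])
    (by
      intro c ω η; funext B
      refine Eq.trans ?_ (splitSum_hom (DistribSMul.toAddMonoidHom _ c) _ B).symm
      exact splitSum_congr fun P Q _ => by
        rw [Pi.smul_apply, map_smul, mul_smul_comm, smul_comm]; rfl)

lemma mul_apply (ω η : WordFn k V) (B : List V.Idx) :
    mul ω η B = splitSum (fun P Q => ω P * tw (lsum V.sdeg P) (η Q)) B := rfl

lemma mulOp_apply (ω η : WordFn k V) (B : List V.Idx) :
    mulOp ω η B = splitSum (fun P Q =>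
      sgn (lsum V.sdeg P * lsum V.sdeg Q) • (ω Q * tw (lsum V.sdeg Q) (η P))) B := rfl

/-- The graded commutator. -/
def comm : WordFn k V →ₗ[k] WordFn k V →ₗ[k] WordFn k V := mul - mulOp

lemma comm_apply (ω η : WordFn k V) : comm ω η = mul ω η - mulOp ω η := rfl

/-- Series of words of a definite total parity. -/
def HasPar (p : ℤ) (ω : WordFn k V) : Prop := ∀ B, FormalFn.HasPar (p + lsum V.sdeg B) (ω B)

lemma mul_assoc (ω η ζ : WordFn k V) : mul (mul ω η) ζ = mul ω (mul η ζ) := by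
  funext B
  simp only [mul_apply]
  have h1 : ∀ P Q : List V.Idx, splitSum (fun P₁ P₂ => ω P₁ * tw (lsum V.sdeg P₁) (η P₂)) P *
      tw (lsum V.sdeg P) (ζ Q) =
      splitSum (fun P₁ P₂ => ω P₁ * tw (lsum V.sdeg P₁) (η P₂) * tw (lsum V.sdeg P₁ + lsum V.sdeg P₂) (ζ Q)) P := by
    intro P Q
    refine (splitSum_hom (AddMonoidHom.mulRight (tw (lsum V.sdeg P) (ζ Q))) _ P).trans ?_
    refine splitSum_congr fun P₁ P₂ h => ?_
    rw [← h, lsum_append]; rfl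
  have h2 : ∀ P Q : List V.Idx, ω P * tw (lsum V.sdeg P)
      (splitSum (fun P₁ P₂ => η P₁ * tw (lsum V.sdeg P₁) (ζ P₂)) Q) =
      splitSum (fun P₁ P₂ => ω P * tw (lsum V.sdeg P) (η P₁) * tw (lsum V.sdeg P + lsum V.sdeg P₁) (ζ P₂)) Q := by
    intro P Q
    refine (splitSum_hom ((AddMonoidHom.mulLeft (ω P)).comp
      (tw (lsum V.sdeg P)).toAddMonoidHom) _ Q).trans ?_
    refine splitSum_congr fun P₁ P₂ h => ?_
    change ω P * tw (lsum V.sdeg P) (η P₁ * tw (lsum V.sdeg P₁) (ζ P₂)) = _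
    rw [tw_mul, tw_tw, _root_.mul_assoc]
  simp only [h1, h2]
  exact splitSum_assoc (fun P₁ P₂ Q => ω P₁ * tw (lsum V.sdeg P₁) (η P₂) *
    tw (lsum V.sdeg P₁ + lsum V.sdeg P₂) (ζ Q)) B

lemma mulOp_eq {p q : ℤ} {ω η : WordFn k V} (hω : HasPar p ω) (hη : HasPar q η) :
    mulOp ω η = sgn (p * q) • mul η ω := by
  funext B
  rw [Pi.smul_apply, mul_apply, mulOp_apply]
  refine Eq.trans ?_ (splitSum_hom (DistribSMul.toAddMonoidHom _ (sgn (p * q))) _ B).symm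
  refine splitSum_congr fun P Q _ => ?_
  change _ = sgn (p * q) • (η P * tw (lsum V.sdeg P) (ω Q))
  rw [mul_comm_of_par (hη P), tw_tw, hη P, hω Q, smul_mul_assoc, mul_smul_comm, sgn_smul_smul,
    sgn_smul_smul]
  apply sgn_smul_congr
  push_cast; ring_nf <;> reduce_mod_char

lemma comm_eq {p q : ℤ} {ω η : WordFn k V} (hω : HasPar p ω) (hη : HasPar q η) :
    comm ω η = mul ω η - sgn (p * q) • mul η ω := by
  rw [comm_apply, mulOp_eq hω hη]

lemma HasPar.mul {p q : ℤ} {ω η : WordFn k V} (hω : HasPar p ω) (hη : HasPar q η) :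
    HasPar (p + q) (mul ω η) := by
  intro B
  rw [mul_apply, splitSum_eq_sum_range]
  refine FormalFn.HasPar.sum _ fun l _ => ((hω _).mul ((hη _).tw _)).congr ?_
  have : lsum V.sdeg B = lsum V.sdeg (B.take l) + lsum V.sdeg (B.drop l) := by
    rw [← lsum_append, List.take_append_drop]
  rw [this]
  push_cast; ring_nf

lemma HasPar.smul {p : ℤ} {ω : WordFn k V} (c : ℤˣ) (h : HasPar p ω) : HasPar p (c • ω) :=
  fun B => (h B).smul c

lemma HasPar.sub {p : ℤ} {ω η : WordFn k V} (hω : HasPar p ω) (hη : HasPar p η) :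
    HasPar p (ω - η) := by
  intro B n
  have h1 := hω B n
  have h2 := hη B n
  rw [Pi.sub_apply, map_sub, h1, h2, smul_sub]

lemma HasPar.congr {p q : ℤ} {ω : WordFn k V} (h : HasPar p ω) (e : ((p - q : ℤ) : ZMod 2) = 0) :
    HasPar q ω := fun B => FormalFn.HasPar.congr (h B) (by push_cast at e ⊢; rw [← e]; ring)

lemma HasPar.comm {p q : ℤ} {ω η : WordFn k V} (hω : HasPar p ω) (hη : HasPar q η) :
    HasPar (p + q) (WordFn.comm ω η) := by
  rw [comm_eq hω hη]
  exact (hω.mul hη).sub (((hη.mul hω).congr (by push_cast; ring_nf)).smul _)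

lemma mul_sgn_smul_left (c : ℤˣ) (ω η : WordFn k V) : mul (c • ω) η = c • mul ω η := by
  rcases Int.units_eq_one_or c with h | h <;> simp [h]

lemma mul_sgn_smul_right (c : ℤˣ) (ω η : WordFn k V) : mul ω (c • η) = c • mul ω η := by
  rcases Int.units_eq_one_or c with h | h <;> simp [h]

lemma comm_anti {p q : ℤ} {ω η : WordFn k V} (hω : HasPar p ω) (hη : HasPar q η) :
    comm ω η + sgn (p * q) • comm η ω = 0 := by
  rw [comm_eq hω hη, comm_eq hη hω, smul_sub, mul_comm q p, sgn_smul_self]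
  abel

lemma comm_jacobi {p q r : ℤ} {ω η ζ : WordFn k V} (hω : HasPar p ω) (hη : HasPar q η)
    (hζ : HasPar r ζ) :
    comm ω (comm η ζ) - comm (comm ω η) ζ - sgn (p * q) • comm η (comm ω ζ) = 0 := by
  rw [comm_eq hω (hη.comm hζ), comm_eq (hω.comm hη) hζ, comm_eq hη (hω.comm hζ), comm_eq hω hη,
    comm_eq hη hζ, comm_eq hω hζ]
  simp only [map_sub, LinearMap.sub_apply, mul_sgn_smul_left, mul_sgn_smul_right, smul_sub,
    sgn_smul_smul, mul_assoc]
  have e1 : sgn (p * q + p * r) = sgn (p * (q + r)) := by congr 1; ring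
  have e2 : sgn (p * q + (q * (p + r) + p * r)) = sgn ((p + q) * r) := by
    apply sgn_eq_of; push_cast; ring_nf <;> reduce_mod_char
  have e3 : sgn ((p + q) * r + p * q) = sgn (p * (q + r) + q * r) := by congr 1; ring
  have e4 : sgn (p * q + q * (p + r)) = sgn (q * r) := by
    apply sgn_eq_of; push_cast; ring_nf <;> reduce_mod_char
  rw [e1, e2, e3, e4]
  abel

/-- Multiplication by a function on the right, with a parity twist. -/
def rightMul (ω : WordFn k V) (g : FormalFn k V) : WordFn k V :=
  fun B => ω B * tw (lsum V.sdeg B + 1) g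

lemma mul_rightMul (ω η : WordFn k V) (g : FormalFn k V) :
    mul ω (rightMul η g) = rightMul (mul ω η) g := by
  funext B
  refine Eq.trans ?_ (splitSum_hom (AddMonoidHom.mulRight (tw (lsum V.sdeg B + 1) g)) _ B).symm
  refine splitSum_congr fun P Q h => ?_
  change ω P * tw _ (η Q * tw _ g) = (ω P * tw _ (η Q)) * tw _ g
  rw [tw_mul, tw_tw, _root_.mul_assoc, ← h, lsum_append, add_assoc]

lemma rightMul_mul {p : ℤ} (ω η : WordFn k V) (hη : HasPar p η) (g : FormalFn k V) :
    mul (rightMul ω g) η = rightMul (mul ω η) (tw p g) := by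
  funext B
  refine Eq.trans ?_ (splitSum_hom (AddMonoidHom.mulRight (tw (lsum V.sdeg B + 1) (tw p g))) _ B).symm
  refine splitSum_congr fun P Q h => ?_
  change (ω P * tw _ g) * tw _ (η Q) = (ω P * tw _ (η Q)) * tw _ (tw p g)
  rw [_root_.mul_assoc, _root_.mul_assoc, mul_comm_of_par ((hη Q).tw _), tw_tw, tw_tw]
  congr 3
  refine tw_congr ?_
  rw [← h, lsum_append]
  push_cast; ring_nf; reduce_mod_char

end WordFn

end Model

end GInf

namespace GInf

open FormalFn

section Extension

variable {k : Type u} [Field k] {V : GrSp} {I : Type*}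

/-- The extension to series of a family of functions indexed by monomials. -/
def extendSer (wt : I → ℕ) (Φ : GMon V.Idx → I → k) : GSer k V →ₗ[k] (I → k) where
  toFun x i := ∑ m ∈ monosLT V.Idx (wt i + 1), x m * Φ m i
  map_add' x y := by funext i; simp [add_mul, Finset.sum_add_distrib]
  map_smul' c x := by funext i; simp [mul_assoc, Finset.mul_sum]

lemma extendSer_apply (wt : I → ℕ) (Φ : GMon V.Idx → I → k) (x : GSer k V) (i : I) :
    extendSer wt Φ x i = ∑ m ∈ monosLT V.Idx (wt i + 1), x m * Φ m i := rfl

lemma extendSer_mono (wt : I → ℕ) (Φ : GMon V.Idx → I → k)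
    (h : ∀ m i, wt i < m.weight → Φ m i = 0) (m : GMon V.Idx) :
    extendSer wt Φ (mono k V m) = Φ m := by
  classical
  funext i
  rw [extendSer_apply, Finset.sum_eq_single m]
  · simp [mono_apply]
  · intro m' _ hne; simp [mono_apply, hne]
  · intro hm
    rw [mem_monosLT] at hm
    rw [h m i (by omega), mul_zero]

lemma extendSer_filtered (wt : I → ℕ) (Φ : GMon V.Idx → I → k) {n : ℕ} {x : GSer k V}
    (hx : x ∈ serFil k V n) (i : I) (hi : wt i < n) : extendSer wt Φ x i = 0 := by
  rw [extendSer_apply]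
  refine Finset.sum_eq_zero fun m hm => ?_
  rw [mem_monosLT] at hm
  rw [hx m (by omega), zero_mul]

end Extension

namespace WordFn

variable {k : Type u} [Field k] {V : GrSp}

lemma rightMul_apply (ω : WordFn k V) (g : FormalFn k V) (B : List V.Idx) :
    rightMul ω g B = ω B * tw (lsum V.sdeg B + 1) g := rfl

lemma rightMul_sgn_smul (c : ℤˣ) (ω : WordFn k V) (g : FormalFn k V) :
    rightMul ω (c • g) = c • rightMul ω g := by
  funext B
  rw [Pi.smul_apply, rightMul_apply, rightMul_apply, sgn_smul_tw, mul_smul_comm]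

lemma rightMul_sub (ω η : WordFn k V) (g : FormalFn k V) :
    rightMul (ω - η) g = rightMul ω g - rightMul η g := by
  funext B
  exact sub_mul _ _ _

lemma rightMul_sgn_smul_left (c : ℤˣ) (ω : WordFn k V) (g : FormalFn k V) :
    rightMul (c • ω) g = c • rightMul ω g := by
  funext B
  exact smul_mul_assoc c (ω B) (tw (lsum V.sdeg B + 1) g)

lemma HasPar.rightMul {p q : ℤ} {ω : WordFn k V} {g : FormalFn k V} (hω : HasPar p ω)
    (hg : FormalFn.HasPar q g) : HasPar (p + q) (WordFn.rightMul ω g) := fun B =>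
  ((hω B).mul (hg.tw _)).congr (by push_cast; ring_nf)

lemma HasPar.fsmul {p q : ℤ} {ω : WordFn k V} {f : FormalFn k V} (hf : FormalFn.HasPar q f)
    (hω : HasPar p ω) : HasPar (q + p) (f • ω) := fun B =>
  (hf.mul (hω B)).congr (by push_cast; ring_nf)

lemma HasPar.add {p : ℤ} {ω η : WordFn k V} (hω : HasPar p ω) (hη : HasPar p η) :
    HasPar p (ω + η) := fun B => (hω B).add (hη B)

lemma fsmul_mul (f : FormalFn k V) (ω η : WordFn k V) : mul (f • ω) η = f • mul ω η := by
  funext B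
  refine Eq.trans ?_ (splitSum_hom (AddMonoidHom.mulLeft f) _ B).symm
  exact splitSum_congr fun P Q _ => _root_.mul_assoc _ _ _

lemma mul_fsmul {p : ℤ} {ω : WordFn k V} (hω : HasPar p ω) (f : FormalFn k V) (η : WordFn k V) :
    mul ω (f • η) = tw p f • mul ω η := by
  funext B
  refine Eq.trans ?_ (splitSum_hom (AddMonoidHom.mulLeft (tw p f)) _ B).symm
  refine splitSum_congr fun P Q _ => ?_
  change ω P * tw _ (f * η Q) = tw p f * (ω P * tw _ (η Q))
  rw [tw_mul, ← _root_.mul_assoc, mul_comm_of_par (hω P), ← _root_.mul_assoc, tw_tw]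
  congr 3
  refine tw_congr ?_
  push_cast; ring_nf; reduce_mod_char

lemma comm_rightMul {p q r : ℤ} {ω η : WordFn k V} {g : FormalFn k V} (hω : HasPar p ω)
    (hη : HasPar q η) (hg : FormalFn.HasPar r g) :
    comm ω (rightMul η g) = rightMul (comm ω η) g := by
  rw [comm_eq hω (hη.rightMul hg), comm_eq hω hη, mul_rightMul, rightMul_mul _ _ hω, hg p,
    rightMul_sgn_smul, rightMul_sub, rightMul_sgn_smul_left, sgn_smul_smul]
  congr 1
  apply sgn_smul_congr
  push_cast; ring_nf; reduce_mod_char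

lemma comm_fsmul {p q r : ℤ} {ω η : WordFn k V} {f : FormalFn k V} (hω : HasPar p ω)
    (hη : HasPar q η) (hf : FormalFn.HasPar r f) :
    comm ω (f • η) = sgn (p * r) • f • comm ω η := by
  rw [comm_eq hω (HasPar.fsmul hf hη), comm_eq hω hη, mul_fsmul hω, fsmul_mul, hf p, smul_assoc,
    smul_sub, smul_sub]
  congr 1
  rw [smul_comm f, sgn_smul_smul]
  apply sgn_smul_congr
  push_cast; ring_nf

end WordFn

namespace Model

variable {k : Type u} [Field k] {V : GrSp}

/-- The product of the model. -/
def mul : Model k V →ₗ[k] Model k V →ₗ[k] Model k V :=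
  LinearMap.mk₂ k (fun M N => (M.1 * N.1, WordFn.rightMul M.2 N.1 + M.1 • N.2))
    (by
      intro M M' N
      refine Prod.ext (add_mul _ _ _) (funext fun B => ?_)
      change (M.2 B + M'.2 B) * _ + (M.1 + M'.1) * N.2 B =
        (M.2 B * _ + M.1 * N.2 B) + (M'.2 B * _ + M'.1 * N.2 B)
      rw [add_mul, add_mul]; abel)
    (by
      intro c M N
      refine Prod.ext (smul_mul_assoc _ _ _) (funext fun B => ?_)
      change (c • M.2 B) * _ + (c • M.1) * N.2 B = c • (M.2 B * _ + M.1 * N.2 B)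
      rw [smul_mul_assoc, smul_mul_assoc, smul_add])
    (by
      intro M N N'
      refine Prod.ext (mul_add _ _ _) (funext fun B => ?_)
      change M.2 B * tw _ (N.1 + N'.1) + M.1 * (N.2 B + N'.2 B) =
        (M.2 B * tw _ N.1 + M.1 * N.2 B) + (M.2 B * tw _ N'.1 + M.1 * N'.2 B)
      rw [map_add, mul_add, mul_add]; abel)
    (by
      intro c M N
      refine Prod.ext (mul_smul_comm _ _ _) (funext fun B => ?_)
      change M.2 B * tw _ (c • N.1) + M.1 * (c • N.2 B) = c • (M.2 B * tw _ N.1 + M.1 * N.2 B)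
      rw [map_smul, mul_smul_comm, mul_smul_comm, smul_add])

lemma mul_apply (M N : Model k V) :
    mul M N = (M.1 * N.1, WordFn.rightMul M.2 N.1 + M.1 • N.2) := rfl

/-- The bracket of the model. -/
def br : Model k V →ₗ[k] Model k V →ₗ[k] Model k V :=
  LinearMap.compr₂ (WordFn.comm.compl₁₂ (LinearMap.snd k _ _) (LinearMap.snd k _ _))
    (LinearMap.inr k (FormalFn k V) (WordFn k V))

lemma br_apply (M N : Model k V) : br M N = (0, WordFn.comm M.2 N.2) := rfl

/-- Elements of the model of a definite parity. -/
def HasPar (p : ℤ) (M : Model k V) : Prop := FormalFn.HasPar p M.1 ∧ WordFn.HasPar (p + 1) M.2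

lemma mul_comm {p q : ℤ} {M N : Model k V} (hM : HasPar p M) (hN : HasPar q N) :
    mul M N - sgn (p * q) • mul N M = 0 := by
  have h1 : ∀ {p q : ℤ} {f g : FormalFn k V}, FormalFn.HasPar p f → FormalFn.HasPar q g →
      f * g = sgn (p * q) • (g * f) := by
    intro p q f g hf hg
    rw [mul_comm_of_par hf, hg p, smul_mul_assoc]
  rw [sub_eq_zero]
  refine Prod.ext (h1 hM.1 hN.1) (funext fun B => ?_)
  change M.2 B * tw _ N.1 + M.1 * N.2 B = sgn _ • (N.2 B * tw _ M.1 + N.1 * M.2 B)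
  rw [smul_add, add_comm]
  congr 1
  · rw [h1 hM.1 (hN.2 B), hM.1, mul_smul_comm, sgn_smul_smul]
    apply sgn_smul_congr; push_cast; ring_nf <;> reduce_mod_char
  · rw [h1 (hM.2 B) (hN.1.tw _), hN.1, smul_mul_assoc, sgn_smul_smul]
    apply sgn_smul_congr; push_cast; ring_nf <;> reduce_mod_char

lemma mul_assoc (M N L : Model k V) : mul (mul M N) L - mul M (mul N L) = 0 := by
  rw [sub_eq_zero]
  refine Prod.ext (_root_.mul_assoc _ _ _) (funext fun B => ?_)
  change (M.2 B * tw _ N.1 + M.1 * N.2 B) * tw _ L.1 + (M.1 * N.1) * L.2 B =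
    M.2 B * tw _ (N.1 * L.1) + M.1 * (N.2 B * tw _ L.1 + N.1 * L.2 B)
  rw [tw_mul, add_mul, mul_add, _root_.mul_assoc, _root_.mul_assoc, _root_.mul_assoc, add_assoc]

lemma br_anti {p q : ℤ} {M N : Model k V} (hM : HasPar p M) (hN : HasPar q N) :
    br M N + sgn ((p + 1) * (q + 1)) • br N M = 0 := by
  refine Prod.ext ?_ (WordFn.comm_anti hM.2 hN.2)
  change (0 : FormalFn k V) + sgn _ • 0 = 0
  simp

lemma br_jacobi {p q r : ℤ} {M N L : Model k V} (hM : HasPar p M) (hN : HasPar q N)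
    (hL : HasPar r L) :
    br M (br N L) - br (br M N) L - sgn ((p + 1) * (q + 1)) • br N (br M L) = 0 := by
  refine Prod.ext ?_ (WordFn.comm_jacobi hM.2 hN.2 hL.2)
  change (0 : FormalFn k V) - 0 - sgn _ • 0 = 0
  simp

lemma br_mul {p q r : ℤ} {M N L : Model k V} (hM : HasPar p M) (hN : HasPar q N)
    (hL : HasPar r L) :
    br M (mul N L) - mul (br M N) L - sgn ((p + 1) * q) • mul N (br M L) = 0 := by
  refine Prod.ext ?_ ?_
  · change (0 : FormalFn k V) - 0 * L.1 - sgn _ • (N.1 * 0) = 0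
    simp
  · change WordFn.comm M.2 (WordFn.rightMul N.2 L.1 + N.1 • L.2) -
      (WordFn.rightMul (WordFn.comm M.2 N.2) L.1 + (0 : FormalFn k V) • L.2) -
      sgn _ • (WordFn.rightMul N.2 (0 : FormalFn k V) + N.1 • WordFn.comm M.2 L.2) = 0
    have h0 : WordFn.rightMul N.2 (0 : FormalFn k V) = 0 := by
      funext B; simp [WordFn.rightMul_apply]
    rw [map_add, WordFn.comm_rightMul hM.2 hN.2 hL.1, WordFn.comm_fsmul hM.2 hL.2 hN.1, h0,
      zero_smul]
    simp

variable (k V) in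
/-- The filtration of the model by the number of letters and variables. -/
def fil (n : ℕ) : Submodule k (Model k V) where
  carrier := {M | (∀ γ : List V.Idx, γ.length < n → M.1.1 γ = 0) ∧
    ∀ B γ : List V.Idx, B.length + γ.length < n → (M.2 B).1 γ = 0}
  add_mem' hM hN := ⟨fun γ h => by
    change (_ : FormalFn k V).1 γ + (_ : FormalFn k V).1 γ = _
    rw [hM.1 γ h, hN.1 γ h, add_zero], fun B γ h => by
    change (_ : FormalFn k V).1 γ + (_ : FormalFn k V).1 γ = _
    rw [hM.2 B γ h, hN.2 B γ h, add_zero]⟩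
  zero_mem' := ⟨fun _ _ => rfl, fun _ _ _ => rfl⟩
  smul_mem' c M hM := ⟨fun γ h => by
    change c * _ = _
    rw [hM.1 γ h, mul_zero], fun B γ h => by
    change c * (_ : FormalFn k V).1 γ = _
    rw [hM.2 B γ h, mul_zero]⟩

lemma fil_sep (M : Model k V) (h : ∀ n, M ∈ fil k V n) : M = 0 := by
  refine Prod.ext (FormalFn.ext' fun l => (h (l.length + 1)).1 l (by omega))
    (funext fun B => FormalFn.ext' fun l => (h (B.length + l.length + 1)).2 B l (by omega))

lemma fil_zero (M : Model k V) : M ∈ fil k V 0 :=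
  ⟨fun _ h => absurd h (by omega), fun _ _ h => absurd h (by omega)⟩

lemma _root_.GInf.splitSum_ne_zero {X N : Type*} [AddCommMonoid N] {K : List X → List X → N}
    {B : List X} (h : splitSum K B ≠ 0) : ∃ P Q, P ++ Q = B ∧ K P Q ≠ 0 := by
  by_contra! h0
  exact h ((splitSum_congr fun P Q e => h0 P Q e).trans (splitSum_zero B))

lemma mul_mem_fil {a b : ℕ} {M N : Model k V} (hM : M ∈ fil k V a) (hN : N ∈ fil k V b) :
    mul M N ∈ fil k V (a + b) := by
  refine ⟨fun γ h => taylorMul_vanish _ _ a b hM.1 hN.1 γ h, fun B γ h => ?_⟩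
  change taylorMul (M.2 B).1 (tw (lsum V.sdeg B + 1) N.1).1 γ + taylorMul M.1.1 (N.2 B).1 γ = 0
  rw [taylorMul_vanish _ _ (a - B.length) b (fun l hl => hM.2 B l (by omega))
      (fun l hl => by rw [tw_apply, hN.1 l hl, smul_zero]) γ (by omega),
    taylorMul_vanish _ _ a (b - B.length) hM.1 (fun l hl => hN.2 B l (by omega)) γ (by omega),
    add_zero]

lemma br_mem_fil {a b : ℕ} {M N : Model k V} (hM : M ∈ fil k V a) (hN : N ∈ fil k V b) :
    br M N ∈ fil k V (a + b) := by
  refine ⟨fun γ h => rfl, fun B γ h => ?_⟩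
  have key : ∀ (P Q : List V.Idx) (u v : FormalFn k V), P.length + Q.length = B.length →
      (∀ l, l.length < a - P.length → u.1 l = 0) → (∀ l, l.length < b - Q.length → v.1 l = 0) →
      (u * v).1 γ = 0 := fun P Q u v e hu hv => taylorMul_vanish _ _ _ _ hu hv γ (by omega)
  let ev : FormalFn k V →+ k := AddMonoidHom.mk' (fun f => f.1 γ) fun _ _ => rfl
  have h1 : (WordFn.mul M.2 N.2 B).1 γ = 0 := by
    refine (splitSum_hom ev _ B).trans ((splitSum_congr fun P Q e => ?_).trans (splitSum_zero B))
    exact key P Q _ _ (by rw [← e, List.length_append]) (fun l hl => hM.2 P l (by omega))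
      (fun l hl => by rw [tw_apply, hN.2 Q l (by omega), smul_zero])
  have h2 : (WordFn.mulOp M.2 N.2 B).1 γ = 0 := by
    refine (splitSum_hom ev _ B).trans ((splitSum_congr fun P Q e => ?_).trans (splitSum_zero B))
    change sgn _ • (M.2 Q * tw (lsum V.sdeg Q) (N.2 P)).1 γ = 0
    rw [key Q P _ _ (by rw [← e, List.length_append, add_comm]) (fun l hl => hM.2 Q l (by omega))
      (fun l hl => by rw [tw_apply, hN.2 P l (by omega), smul_zero]), smul_zero]
  change (WordFn.mul M.2 N.2 B).1 γ - (WordFn.mulOp M.2 N.2 B).1 γ = 0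
  rw [h1, h2, sub_zero]

/-- Homogeneity of an element of the model with respect to a grading for which the variables have
degrees `δ`, the letters have degrees `ε`, and series of words are shifted by `s`. -/
def HomogOf (δ ε : V.Idx → ℤ) (s D : ℤ) (M : Model k V) : Prop :=
  (∀ γ, M.1.1 γ ≠ 0 → lsum δ γ = D) ∧ ∀ B γ, (M.2 B).1 γ ≠ 0 → lsum δ γ + lsum ε B + s = D

lemma HomogOf.mul {δ ε : V.Idx → ℤ} {s D D' : ℤ} {M N : Model k V} (hM : HomogOf δ ε s D M)
    (hN : HomogOf δ ε s D' N) : HomogOf δ ε s (D + D') (Model.mul M N) := by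
  refine ⟨fun γ h => taylorMul_degree _ _ D D' hM.1 hN.1 γ h, fun B γ h => ?_⟩
  by_cases h1 : (M.2 B * tw (lsum V.sdeg B + 1) N.1).1 γ = 0
  · have h2 : (M.1 * N.2 B).1 γ ≠ 0 := fun h2 => h (by
      change (M.2 B * tw (lsum V.sdeg B + 1) N.1).1 γ + (M.1 * N.2 B).1 γ = 0
      rw [h1, h2, add_zero])
    have := taylorMul_degree _ _ D (D' - lsum ε B - s) hM.1
      (fun l hl => by rw [← hN.2 B l hl]; ring) γ h2
    linarith
  · have := taylorMul_degree _ _ (D - lsum ε B - s) D'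
      (fun l hl => by rw [← hM.2 B l hl]; ring)
      (fun l hl => hN.1 l (by intro h0; apply hl; rw [tw_apply, h0, smul_zero])) γ h1
    linarith

lemma HomogOf.br {δ ε : V.Idx → ℤ} {s D D' : ℤ} {M N : Model k V} (hM : HomogOf δ ε s D M)
    (hN : HomogOf δ ε s D' N) : HomogOf δ ε s (D + D' - s) (Model.br M N) := by
  refine ⟨fun γ h => absurd rfl h, fun B γ h => ?_⟩
  let ev : FormalFn k V →+ k := AddMonoidHom.mk' (fun f => f.1 γ) fun _ _ => rfl
  by_cases h1 : (WordFn.mul M.2 N.2 B).1 γ = 0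
  · have h2 : (WordFn.mulOp M.2 N.2 B).1 γ ≠ 0 := fun h2 => h (by
      change (WordFn.mul M.2 N.2 B).1 γ - (WordFn.mulOp M.2 N.2 B).1 γ = 0
      rw [h1, h2, sub_zero])
    obtain ⟨P, Q, e, hne⟩ := splitSum_ne_zero
      ((splitSum_hom ev _ B).symm.trans_ne h2)
    have hne' : (M.2 Q * tw (lsum V.sdeg Q) (N.2 P)).1 γ ≠ 0 := fun h0 => hne (by
      change sgn _ • (M.2 Q * tw (lsum V.sdeg Q) (N.2 P)).1 γ = 0
      rw [h0, smul_zero])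
    have := taylorMul_degree _ _ (D - lsum ε Q - s) (D' - lsum ε P - s)
      (fun l hl => by rw [← hM.2 Q l hl]; ring)
      (fun l hl => by
        rw [← hN.2 P l (by intro h0; apply hl; rw [tw_apply, h0, smul_zero])]; ring) γ hne'
    rw [← e, lsum_append]; linarith
  · obtain ⟨P, Q, e, hne⟩ := splitSum_ne_zero ((splitSum_hom ev _ B).symm.trans_ne h1)
    have := taylorMul_degree _ _ (D - lsum ε P - s) (D' - lsum ε Q - s)
      (fun l hl => by rw [← hM.2 P l hl]; ring)
      (fun l hl => by
        rw [← hN.2 Q l (by intro h0; apply hl; rw [tw_apply, h0, smul_zero])]; ring) γ hne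
    rw [← e, lsum_append]; linarith

end Model

end GInf

namespace GInf

open FormalFn

variable {k : Type u} [Field k] {V : GrSp}

/-- The coordinate function `t^i`. -/
def FormalFn.var (i : V.Idx) : FormalFn k V :=
  ⟨fun l => if l = [i] then 1 else 0, by
    intro A x y C
    have h1 : A ++ x :: y :: C ≠ [i] := fun h => by
      have := congrArg List.length h
      simp at this; omega
    have h2 : A ++ y :: x :: C ≠ [i] := fun h => by
      have := congrArg List.length h
      simp at this; omega
    simp [h1, h2]⟩

lemma FormalFn.var_apply (i : V.Idx) (l : List V.Idx) :
    (var i : FormalFn k V).1 l = if l = [i] then 1 else 0 := rfl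

/-- The word consisting of one letter. -/
def WordFn.letter (i : V.Idx) : WordFn k V := fun B => if B = [i] then 1 else 0

lemma FormalFn.pd_var (i j : V.Idx) : pd j (var i : FormalFn k V) = if j = i then 1 else 0 := by
  ext l
  rw [pd_apply, var_apply]
  by_cases h : j = i
  · simp [h, one_apply]
  · simp [h]

variable (k) in
/-- The value of a monomial in the model. -/
def evalMon : GMon V.Idx → Model k V
  | .gen i => (FormalFn.var i, WordFn.letter i)
  | .mul a b => Model.mul (evalMon a) (evalMon b)
  | .br a b => Model.br (evalMon a) (evalMon b)

lemma evalMon_homogOf {δ ε : V.Idx → ℤ} {s : ℤ} (D : GMon V.Idx → ℤ) (hs : ∀ i, ε i + s = δ i)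
    (hgen : ∀ i, D (.gen i) = δ i) (hmul : ∀ a b, D (.mul a b) = D a + D b)
    (hbr : ∀ a b, D (.br a b) = D a + D b - s) (m : GMon V.Idx) :
    (evalMon k m).HomogOf δ ε s (D m) := by
  induction m with
  | gen i =>
    rw [hgen]
    refine ⟨fun γ h => ?_, fun B γ h => ?_⟩
    · change (if γ = [i] then (1 : k) else 0) ≠ 0 at h
      split_ifs at h with h1
      · rw [h1]; simp
      · exact absurd rfl h
    · change ((if B = [i] then (1 : FormalFn k V) else 0) : FormalFn k V).1 γ ≠ 0 at h
      split_ifs at h with h1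
      · rw [one_apply] at h
        split_ifs at h with h2
        · rw [h1, h2]; simp [hs]
        · exact absurd rfl h
      · exact absurd rfl h
  | mul a b ha hb => rw [hmul]; exact ha.mul hb
  | br a b ha hb => rw [hbr]; exact ha.br hb

lemma evalMon_weight (m : GMon V.Idx) :
    (evalMon k m).HomogOf (fun _ => 1) (fun _ => 1) 0 m.weight :=
  evalMon_homogOf (fun m => (m.weight : ℤ)) (by simp) (by simp [GMon.weight])
    (by simp [GMon.weight]) (by simp [GMon.weight]) m

lemma evalMon_degree (m : GMon V.Idx) :
    (evalMon k m).HomogOf V.tdeg (fun i => - V.sdeg i) 1 (mdeg V m) :=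
  evalMon_homogOf (mdeg V) (by intro i; simp only [GrSp.sdeg]; change _ = 2 - V.deg i; ring)
    (fun _ => rfl)
    (fun _ _ => rfl) (fun _ _ => rfl) m

lemma lsum_one {X : Type*} (l : List X) : lsum (fun _ => 1) l = l.length := by
  induction l with
  | nil => rfl
  | cons a l ih => rw [lsum_cons, ih]; simp [add_comm]

lemma lsum_neg {X : Type*} (d : X → ℤ) (l : List X) : lsum (fun i => - d i) l = - lsum d l := by
  induction l with
  | nil => rfl
  | cons a l ih => rw [lsum_cons, ih, lsum_cons]; ring

lemma evalMon_fil (m : GMon V.Idx) : evalMon k m ∈ Model.fil k V m.weight := by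
  refine ⟨fun γ h => ?_, fun B γ h => ?_⟩
  · by_contra h0
    have := (evalMon_weight m).1 γ h0
    rw [lsum_one] at this; omega
  · by_contra h0
    have := (evalMon_weight m).2 B γ h0
    rw [lsum_one, lsum_one] at this; omega

lemma Model.HomogOf.hasPar {D : ℤ} {M : Model k V}
    (h : M.HomogOf V.tdeg (fun i => - V.sdeg i) 1 D) : M.HasPar D := by
  refine ⟨HasPar.of_support h.1, fun B => ?_⟩
  refine (HasPar.of_support (p := D - 1 + lsum V.sdeg B) fun γ hγ => ?_).congr ?_
  · have := h.2 B γ hγ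
    rw [lsum_neg] at this; linarith
  · push_cast; ring_nf; reduce_mod_char

lemma evalMon_hasPar (m : GMon V.Idx) : (evalMon k m).HasPar (mdeg V m) :=
  (evalMon_degree m).hasPar

variable (k V) in
/-- The map of series to the model. -/
def evalSer : GSer k V →ₗ[k] Model k V :=
  LinearMap.prod
    (LinearMap.codRestrict (FormalFn k V)
      (extendSer (fun γ : List V.Idx => γ.length) fun m γ => (evalMon k m).1.1 γ)
      (fun x A a b C => by
        rw [extendSer_apply, extendSer_apply, Finset.smul_sum]
        refine Finset.sum_congr (by simp) fun m _ => ?_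
        rw [(evalMon k m).1.2 A a b C, mul_smul_comm]))
    (LinearMap.pi fun B => LinearMap.codRestrict (FormalFn k V)
      (extendSer (fun γ : List V.Idx => B.length + γ.length) fun m γ => ((evalMon k m).2 B).1 γ)
      (fun x A a b C => by
        rw [extendSer_apply, extendSer_apply, Finset.smul_sum]
        refine Finset.sum_congr (by simp) fun m _ => ?_
        rw [((evalMon k m).2 B).2 A a b C, mul_smul_comm]))

lemma evalSer_fst (x : GSer k V) (γ : List V.Idx) : (evalSer k V x).1.1 γ =
    extendSer (fun γ : List V.Idx => γ.length) (fun m γ => (evalMon k m).1.1 γ) x γ := rfl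

lemma evalSer_snd (x : GSer k V) (B γ : List V.Idx) : ((evalSer k V x).2 B).1 γ =
    extendSer (fun γ : List V.Idx => B.length + γ.length) (fun m γ => ((evalMon k m).2 B).1 γ) x γ :=
  rfl

lemma evalSer_mono (m : GMon V.Idx) : evalSer k V (mono k V m) = evalMon k m := by
  refine Prod.ext (FormalFn.ext' fun γ => ?_) (funext fun B => FormalFn.ext' fun γ => ?_)
  · rw [evalSer_fst, extendSer_mono _ _ fun m γ h => (evalMon_fil m).1 γ h]
  · rw [evalSer_snd, extendSer_mono _ _ fun m γ h => (evalMon_fil m).2 B γ h]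

lemma evalSer_fil {n : ℕ} {x : GSer k V} (hx : x ∈ serFil k V n) :
    evalSer k V x ∈ Model.fil k V n :=
  ⟨fun γ h => extendSer_filtered _ _ hx γ h, fun _ γ h => extendSer_filtered _ _ hx γ h⟩

lemma evalSer_mul (x y : GSer k V) :
    evalSer k V (serMul k V x y) = Model.mul (evalSer k V x) (evalSer k V y) := by
  have h : (serMul k V).compr₂ (evalSer k V) = Model.mul.compl₁₂ (evalSer k V) (evalSer k V) := by
    refine bilin_eq_of_filtered (Model.fil k V) Model.fil_sep _ _
      (fun n x y hx => evalSer_fil (serMul_mem_left hx y))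
      (fun n x y hy => evalSer_fil (serMul_mem_right x hy))
      (fun n x y hx => Model.mul_mem_fil (b := 0) (evalSer_fil hx) (Model.fil_zero _))
      (fun n x y hy => ?_) (fun a b => ?_)
    · have := Model.mul_mem_fil (a := 0) (Model.fil_zero (evalSer k V x)) (evalSer_fil hy)
      rwa [zero_add] at this
    · change evalSer k V (serMul k V (mono k V a) (mono k V b)) =
        Model.mul (evalSer k V (mono k V a)) (evalSer k V (mono k V b))
      rw [serMul_mono, evalSer_mono, evalSer_mono, evalSer_mono]; rfl
  exact LinearMap.congr_fun₂ h x y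

lemma evalSer_br (x y : GSer k V) :
    evalSer k V (serBr k V x y) = Model.br (evalSer k V x) (evalSer k V y) := by
  have h : (serBr k V).compr₂ (evalSer k V) = Model.br.compl₁₂ (evalSer k V) (evalSer k V) := by
    refine bilin_eq_of_filtered (Model.fil k V) Model.fil_sep _ _
      (fun n x y hx => evalSer_fil (serBr_mem_left hx y))
      (fun n x y hy => evalSer_fil (serBr_mem_right x hy))
      (fun n x y hx => Model.br_mem_fil (b := 0) (evalSer_fil hx) (Model.fil_zero _))
      (fun n x y hy => ?_) (fun a b => ?_)
    · have := Model.br_mem_fil (a := 0) (Model.fil_zero (evalSer k V x)) (evalSer_fil hy)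
      rwa [zero_add] at this
    · change evalSer k V (serBr k V (mono k V a) (mono k V b)) =
        Model.br (evalSer k V (mono k V a)) (evalSer k V (mono k V b))
      rw [serBr_mono, evalSer_mono, evalSer_mono, evalSer_mono]; rfl
  exact LinearMap.congr_fun₂ h x y

lemma evalMon_commutator (m : GMon V.Idx) :
    (1 ≤ m.commutatorFactors → (evalMon k m).1 = 0) ∧
      (2 ≤ m.commutatorFactors → evalMon k m = 0) := by
  induction m with
  | gen i => simp [GMon.commutatorFactors]
  | br a b _ _ =>
    refine ⟨fun _ => rfl, fun h => ?_⟩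
    simp only [GMon.commutatorFactors] at h
    split_ifs at h <;> omega
  | mul a b ha hb =>
    simp only [GMon.commutatorFactors, evalMon, Model.mul_apply]
    refine ⟨fun h => ?_, fun h => ?_⟩
    · rcases Nat.eq_zero_or_pos a.commutatorFactors with h0 | h0
      · rw [hb.1 (by omega), mul_zero]
      · rw [ha.1 h0, zero_mul]
    · have hr : ∀ ω : WordFn k V, WordFn.rightMul ω (0 : FormalFn k V) = 0 := by
        intro ω; funext B; simp [WordFn.rightMul_apply]
      have hl : ∀ g : FormalFn k V, WordFn.rightMul (0 : WordFn k V) g = 0 := by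
        intro ω; funext B; simp [WordFn.rightMul_apply]
      rcases Nat.lt_or_ge a.commutatorFactors 2 with h2 | h2
      · rcases Nat.lt_or_ge b.commutatorFactors 2 with h3 | h3
        · rw [ha.1 (by omega), hb.1 (by omega), mul_zero, hr, zero_smul, add_zero]; rfl
        · rw [hb.2 h3]
          change ((evalMon k a).1 * (0 : FormalFn k V),
            WordFn.rightMul (evalMon k a).2 (0 : FormalFn k V) +
              (evalMon k a).1 • (0 : WordFn k V)) = 0
          rw [mul_zero, hr, smul_zero, add_zero]; rfl
      · rw [ha.2 h2]
        change ((0 : FormalFn k V) * (evalMon k b).1,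
            WordFn.rightMul (0 : WordFn k V) (evalMon k b).1 +
              (0 : FormalFn k V) • (evalMon k b).2) = 0
        rw [zero_mul, hl, zero_smul, add_zero]; rfl

lemma sgn_smul_map {M N : Type*} [AddCommGroup M] [AddCommGroup N] [Module k M] [Module k N]
    (T : M →ₗ[k] N) (c : ℤˣ) (x : M) : T (c • x) = c • T x := by
  rcases Int.units_eq_one_or c with h | h <;> simp [h]

lemma evalSer_rel {x : GSer k V} (h : GRel k V 2 x) : evalSer k V x = 0 := by
  induction h with
  | comm a b =>
    simp only [map_sub, sgn_smul_map, evalSer_mono, evalMon]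
    exact Model.mul_comm (evalMon_hasPar a) (evalMon_hasPar b)
  | assoc a b c =>
    simp only [map_sub, evalSer_mono, evalMon]
    exact Model.mul_assoc _ _ _
  | anti a b =>
    simp only [map_add, sgn_smul_map, evalSer_mono, evalMon]
    exact Model.br_anti (evalMon_hasPar a) (evalMon_hasPar b)
  | jacobi a b c =>
    simp only [map_sub, sgn_smul_map, evalSer_mono, evalMon]
    exact Model.br_jacobi (evalMon_hasPar a) (evalMon_hasPar b) (evalMon_hasPar c)
  | poisson a b c =>
    simp only [map_sub, sgn_smul_map, evalSer_mono, evalMon]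
    exact Model.br_mul (evalMon_hasPar a) (evalMon_hasPar b) (evalMon_hasPar c)
  | power m hm => rw [evalSer_mono]; exact (evalMon_commutator m).2 hm
  | mul_left y x _ ih => rw [evalSer_mul, ih, map_zero]
  | mul_right x y _ ih => rw [evalSer_mul, ih, map_zero]; rfl
  | br_left y x _ ih => rw [evalSer_br, ih, map_zero]
  | br_right x y _ ih => rw [evalSer_br, ih, map_zero]; rfl

lemma truncAt_apply (w : ℕ) (x : GSer k V) (m : GMon V.Idx) :
    truncAt k V w x m = if m.weight = w then x m else 0 := rfl

lemma sub_sum_truncAt_mem (n : ℕ) (x : GSer k V) :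
    x - ∑ w ∈ Finset.range n, truncAt k V w x ∈ serFil k V n := by
  intro m hm
  rw [Pi.sub_apply, Finset.sum_apply, Finset.sum_eq_single m.weight]
  · rw [truncAt_apply, if_pos rfl, sub_self]
  · intro w _ h; rw [truncAt_apply, if_neg h.symm]
  · intro h; exact absurd (Finset.mem_range.2 hm) h

lemma relIdeal_le_ker : relIdeal k V 2 ≤ LinearMap.ker (evalSer k V) := by
  intro x hx
  rw [LinearMap.mem_ker]
  apply Model.fil_sep
  intro n
  have h := evalSer_fil (sub_sum_truncAt_mem n x)
  rw [map_sub, map_sum, Finset.sum_eq_zero, sub_zero] at h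
  · exact h
  · intro w _
    have hle : Submodule.span k {y | GRel k V 2 y} ≤ LinearMap.ker (evalSer k V) :=
      Submodule.span_le.2 fun y hy => evalSer_rel hy
    exact hle (hx w)

variable (k V) in
/-- The map of the quotient `G`-algebra to the model. -/
def evalQuot : QuotG k V 2 →ₗ[k] Model k V :=
  (relIdeal k V 2).liftQ (evalSer k V) relIdeal_le_ker

lemma evalQuot_mk (x : GSer k V) : evalQuot k V ((relIdeal k V 2).mkQ x) = evalSer k V x := rfl

lemma evalQuot_mul (x y : QuotG k V 2) :
    evalQuot k V (QuotG.mul k V 2 x y) = Model.mul (evalQuot k V x) (evalQuot k V y) := by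
  obtain ⟨x, rfl⟩ := (relIdeal k V 2).mkQ_surjective x
  obtain ⟨y, rfl⟩ := (relIdeal k V 2).mkQ_surjective y
  exact evalSer_mul x y

lemma evalQuot_br (x y : QuotG k V 2) :
    evalQuot k V (QuotG.br k V 2 x y) = Model.br (evalQuot k V x) (evalQuot k V y) := by
  obtain ⟨x, rfl⟩ := (relIdeal k V 2).mkQ_surjective x
  obtain ⟨y, rfl⟩ := (relIdeal k V 2).mkQ_surjective y
  exact evalSer_br x y

/-- The image of a homogeneous series is homogeneous. -/
lemma evalSer_homogOf {δ ε : V.Idx → ℤ} {s : ℤ} (D : GMon V.Idx → ℤ) (p : ℤ) (x : GSer k V)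
    (h : ∀ m, (evalMon k m).HomogOf δ ε s (D m)) (hx : ∀ m, x m ≠ 0 → D m = p) :
    (evalSer k V x).HomogOf δ ε s p := by
  refine ⟨fun γ h0 => ?_, fun B γ h0 => ?_⟩
  · rw [evalSer_fst, extendSer_apply] at h0
    obtain ⟨m, _, hm⟩ := Finset.exists_ne_zero_of_sum_ne_zero h0
    rw [(h m).1 γ (right_ne_zero_of_mul hm), hx m (left_ne_zero_of_mul hm)]
  · rw [evalSer_snd, extendSer_apply] at h0
    obtain ⟨m, _, hm⟩ := Finset.exists_ne_zero_of_sum_ne_zero h0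
    rw [(h m).2 B γ (right_ne_zero_of_mul hm), hx m (left_ne_zero_of_mul hm)]

/-- A linear condition which holds for monomials and is closed holds for all series. -/
lemma evalSer_mem (C : Submodule k (Model k V))
    (hC : ∀ M, (∀ n, ∃ N ∈ C, M - N ∈ Model.fil k V n) → M ∈ C) (x : GSer k V)
    (h : ∀ m, x m ≠ 0 → evalMon k m ∈ C) : evalSer k V x ∈ C := by
  refine hC _ fun n => ⟨∑ m ∈ monosLT V.Idx n, x m • evalMon k m, sum_mem fun m _ => ?_, ?_⟩
  · by_cases h0 : x m = 0
    · rw [h0, zero_smul]; exact zero_mem _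
    · exact C.smul_mem _ (h m h0)
  · have := evalSer_fil (sub_sum_mem_serFil n x)
    rw [map_sub, map_sum] at this
    simpa only [map_smul, evalSer_mono] using this

variable (k V) in
/-- The elements of the model without constant terms, for which the coefficients of words of one
letter are the partial derivatives of the function. -/
def Model.tame : Submodule k (Model k V) where
  carrier := {M | M.1.1 [] = 0 ∧ M.2 [] = 0 ∧ ∀ j, M.2 [j] = tw (V.tdeg j) (pd j M.1)}
  add_mem' {M N} hM hN := by
    refine ⟨?_, ?_, fun j => ?_⟩
    · change M.1.1 [] + N.1.1 [] = 0
      rw [hM.1, hN.1, add_zero]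
    · change M.2 [] + N.2 [] = 0
      rw [hM.2.1, hN.2.1, add_zero]
    · change M.2 [j] + N.2 [j] = tw _ (pd j M.1 + pd j N.1)
      rw [hM.2.2, hN.2.2, map_add]
  zero_mem' := ⟨rfl, rfl, fun j => by
    change (0 : FormalFn k V) = tw _ 0
    rw [map_zero]⟩
  smul_mem' c M hM := by
    refine ⟨?_, ?_, fun j => ?_⟩
    · change c * M.1.1 [] = 0
      rw [hM.1, mul_zero]
    · change c • M.2 [] = 0
      rw [hM.2.1, smul_zero]
    · change c • M.2 [j] = tw _ (c • pd j M.1)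
      rw [hM.2.2, map_smul]

lemma Model.tame_closed (M : Model k V) (h : ∀ n, ∃ N ∈ tame k V, M - N ∈ Model.fil k V n) :
    M ∈ tame k V := by
  have h1 : ∀ n, ∃ N ∈ tame k V, (∀ γ : List V.Idx, γ.length < n → M.1.1 γ = N.1.1 γ) ∧
      ∀ B γ : List V.Idx, B.length + γ.length < n → (M.2 B).1 γ = (N.2 B).1 γ := by
    intro n
    obtain ⟨N, hN, hf⟩ := h n
    exact ⟨N, hN, fun γ hγ => sub_eq_zero.1 (hf.1 γ hγ), fun B γ hγ => sub_eq_zero.1 (hf.2 B γ hγ)⟩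
  refine ⟨?_, ?_, fun j => ?_⟩
  · obtain ⟨N, hN, hf, -⟩ := h1 1
    rw [hf [] (by simp), hN.1]
  · ext γ
    obtain ⟨N, hN, -, hf⟩ := h1 (γ.length + 1)
    rw [hf [] γ (by simp), hN.2.1]
  · ext γ
    obtain ⟨N, hN, hf, hf'⟩ := h1 (γ.length + 2)
    rw [hf' [j] γ (by simp; omega), hN.2.2, tw_apply, tw_apply, pd_apply, pd_apply,
      hf (j :: γ) (by simp)]

lemma evalMon_tame (m : GMon V.Idx) : evalMon k m ∈ Model.tame k V := by
  induction m with
  | gen i =>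
    refine ⟨by simp [evalMon, FormalFn.var_apply], by simp [evalMon, WordFn.letter], fun j => ?_⟩
    simp only [evalMon, FormalFn.pd_var, WordFn.letter]
    by_cases h : j = i
    · simp [h]
    · simp [h]
  | mul a b ha hb =>
    refine ⟨?_, ?_, fun j => ?_⟩
    · change (evalMon k a).1.1 [] * (evalMon k b).1.1 [] = 0
      rw [ha.1, zero_mul]
    · change (evalMon k a).2 [] * _ + (evalMon k a).1 * (evalMon k b).2 [] = 0
      rw [ha.2.1, hb.2.1, zero_mul, mul_zero, add_zero]
    · change (evalMon k a).2 [j] * tw _ (evalMon k b).1 + (evalMon k a).1 * (evalMon k b).2 [j] =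
        tw _ (pd j ((evalMon k a).1 * (evalMon k b).1))
      rw [ha.2.2, hb.2.2, pd_mul, map_add, tw_mul, tw_mul, tw_self]
      have h : tw (lsum V.sdeg [j] + 1) = (tw (V.tdeg j) : FormalFn k V →ₗ[k] _) := tw_congr (by
        simp only [lsum_cons, lsum_nil, GrSp.tdeg, GrSp.sdeg]; push_cast; ring_nf; reduce_mod_char)
      rw [h]
  | br a b ha hb =>
    refine ⟨rfl, ?_, fun j => ?_⟩
    · change (evalMon k a).2 [] * _ - sgn _ • ((evalMon k a).2 [] * _) = 0
      rw [ha.2.1, zero_mul, smul_zero, sub_zero]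
    · change ((evalMon k a).2 [] * _ + (evalMon k a).2 [j] * tw _ ((evalMon k b).2 [])) -
        (sgn _ • ((evalMon k a).2 [j] * tw _ ((evalMon k b).2 [])) +
          sgn _ • ((evalMon k a).2 [] * _)) = tw _ (pd j 0)
      rw [ha.2.1, hb.2.1]
      simp

lemma evalSer_tame (x : GSer k V) : evalSer k V x ∈ Model.tame k V :=
  evalSer_mem _ Model.tame_closed x fun m _ => evalMon_tame m

end GInf

namespace GInf

open FormalFn

section Relations

variable {k : Type u} [Field k] {V : GrSp}

lemma sgn_smul_mem {M : Type*} [AddCommGroup M] [Module k M] (S : Submodule k M) (c : ℤˣ) {x : M}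
    (h : x ∈ S) : c • x ∈ S := by
  rcases Int.units_eq_one_or c with h1 | h1 <;> simp [h1, h]

lemma truncAt_mono (w : ℕ) (m : GMon V.Idx) :
    truncAt k V w (mono k V m) = if m.weight = w then mono k V m else 0 := by
  funext m'
  rw [truncAt_apply]
  by_cases h : m' = m
  · subst h
    by_cases h1 : m'.weight = w <;> simp [h1]
  · by_cases h1 : m.weight = w <;> simp [mono_apply, h, h1]

lemma truncAt_rel {n : ℕ} {x : GSer k V} (h : GRel k V n x) (w : ℕ) :
    truncAt k V w x ∈ Submodule.span k {y | GRel k V n y} := by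
  induction h generalizing w with
  | comm a b =>
    simp only [map_sub, sgn_smul_map, truncAt_mono, GMon.weight, Nat.add_comm b.weight]
    by_cases hw : a.weight + b.weight = w
    · simp only [hw, if_true]
      exact Submodule.subset_span (.comm a b)
    · simp [hw]
  | assoc a b c =>
    simp only [map_sub, truncAt_mono, GMon.weight, Nat.add_assoc]
    by_cases hw : a.weight + (b.weight + c.weight) = w
    · simp only [hw, if_true]
      exact Submodule.subset_span (.assoc a b c)
    · simp [hw]
  | anti a b =>
    simp only [map_add, sgn_smul_map, truncAt_mono, GMon.weight, Nat.add_comm b.weight]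
    by_cases hw : a.weight + b.weight = w
    · simp only [hw, if_true]
      exact Submodule.subset_span (.anti a b)
    · simp [hw]
  | jacobi a b c =>
    simp only [map_sub, sgn_smul_map, truncAt_mono, GMon.weight, Nat.add_assoc,
      Nat.add_left_comm b.weight]
    by_cases hw : a.weight + (b.weight + c.weight) = w
    · simp only [hw, if_true]
      exact Submodule.subset_span (.jacobi a b c)
    · simp [hw]
  | poisson a b c =>
    simp only [map_sub, sgn_smul_map, truncAt_mono, GMon.weight, Nat.add_assoc,
      Nat.add_left_comm b.weight]
    by_cases hw : a.weight + (b.weight + c.weight) = w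
    · simp only [hw, if_true]
      exact Submodule.subset_span (.poisson a b c)
    · simp [hw]
  | power m hm =>
    rw [truncAt_mono]
    split_ifs
    · exact Submodule.subset_span (.power m hm)
    · simp
  | mul_left y x _ ih =>
    rw [truncAt_serMul]
    exact sum_mem fun u _ => span_op_right _ (fun y x h => .mul_left y x h) _ _ (ih u.2)
  | mul_right x y _ ih =>
    rw [truncAt_serMul]
    exact sum_mem fun u _ => span_op_left _ (fun x y h => .mul_right x y h) _ _ (ih u.1)
  | br_left y x _ ih =>
    rw [truncAt_serBr]
    exact sum_mem fun u _ => span_op_right _ (fun y x h => .br_left y x h) _ _ (ih u.2)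
  | br_right x y _ ih =>
    rw [truncAt_serBr]
    exact sum_mem fun u _ => span_op_left _ (fun x y h => .br_right x y h) _ _ (ih u.1)

lemma rel_mem {n : ℕ} {x : GSer k V} (h : GRel k V n x) : x ∈ relIdeal k V n := truncAt_rel h

variable (k) in
/-- The class of a monomial in the quotient. -/
def quotMon (m : GMon V.Idx) : QuotG k V 2 := (relIdeal k V 2).mkQ (mono k V m)

lemma mk_rel {x : GSer k V} (h : GRel k V 2 x) : (relIdeal k V 2).mkQ x = 0 :=
  (Submodule.Quotient.mk_eq_zero _).2 (rel_mem h)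

lemma quotMon_mul (a b : GMon V.Idx) :
    quotMon k (.mul a b) = QuotG.mul k V 2 (quotMon k a) (quotMon k b) := by
  rw [quotMon, ← serMul_mono]; rfl

lemma quotMon_br (a b : GMon V.Idx) :
    quotMon k (.br a b) = QuotG.br k V 2 (quotMon k a) (quotMon k b) := by
  rw [quotMon, ← serBr_mono]; rfl

lemma quotMon_comm (a b : GMon V.Idx) :
    quotMon k (.mul a b) = sgn (mdeg V a * mdeg V b) • quotMon k (.mul b a) := by
  have := mk_rel (k := k) (.comm a b)
  rwa [map_sub, sgn_smul_map, sub_eq_zero] at this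

lemma quotMon_assoc (a b c : GMon V.Idx) :
    quotMon k (.mul (.mul a b) c) = quotMon k (.mul a (.mul b c)) := by
  have := mk_rel (k := k) (.assoc a b c)
  rwa [map_sub, sub_eq_zero] at this

lemma quotMon_anti (a b : GMon V.Idx) :
    quotMon k (.br a b) = -(sgn ((mdeg V a + 1) * (mdeg V b + 1)) • quotMon k (.br b a)) := by
  have := mk_rel (k := k) (.anti a b)
  rw [map_add, sgn_smul_map] at this
  exact eq_neg_of_add_eq_zero_left this

lemma quotMon_jacobi (a b c : GMon V.Idx) :
    quotMon k (.br a (.br b c)) = quotMon k (.br (.br a b) c)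
        + sgn ((mdeg V a + 1) * (mdeg V b + 1)) • quotMon k (.br b (.br a c)) := by
  have := mk_rel (k := k) (.jacobi a b c)
  rw [map_sub, map_sub, sgn_smul_map, sub_eq_zero, sub_eq_iff_eq_add'] at this
  exact this

lemma quotMon_poisson (a b c : GMon V.Idx) :
    quotMon k (.br a (.mul b c)) = quotMon k (.mul (.br a b) c)
        + sgn ((mdeg V a + 1) * mdeg V b) • quotMon k (.mul b (.br a c)) := by
  have := mk_rel (k := k) (.poisson a b c)
  rw [map_sub, map_sub, sgn_smul_map, sub_eq_zero, sub_eq_iff_eq_add'] at this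
  exact this

lemma quotMon_power (m : GMon V.Idx) (h : 2 ≤ m.commutatorFactors) : quotMon k m = 0 :=
  mk_rel (.power m h)

end Relations

section NormalForms

variable {ι : Type}

/-- The left-normed bracket of a nonempty word. -/
def GMon.leftNormed : ι → List ι → GMon ι := fun b B => B.foldl (fun m i => .br m (.gen i)) (.gen b)

/-- The monomials `t^{γ_1}(t^{γ_2}( ⋯ (t^{γ_p} m)))`. -/
def GMon.mulWord (γ : List ι) (m : GMon ι) : GMon ι := γ.foldr (fun i m => .mul (.gen i) m) m

@[simp] lemma GMon.mulWord_nil (m : GMon ι) : mulWord [] m = m := rfl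
@[simp] lemma GMon.mulWord_cons (i : ι) (γ : List ι) (m : GMon ι) :
    mulWord (i :: γ) m = .mul (.gen i) (mulWord γ m) := rfl
@[simp] lemma GMon.leftNormed_nil (b : ι) : leftNormed b [] = .gen b := rfl
@[simp] lemma GMon.leftNormed_concat (b : ι) (B : List ι) (i : ι) :
    leftNormed b (B ++ [i]) = .br (leftNormed b B) (.gen i) := by
  simp [leftNormed]

lemma GMon.leftNormed_weight (b : ι) (B : List ι) : (leftNormed b B).weight = B.length + 1 := by
  induction B using List.reverseRecOn with
  | nil => rfl
  | append_singleton B i ih => simp [weight, ih]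

lemma GMon.mulWord_weight (γ : List ι) (m : GMon ι) : (mulWord γ m).weight = γ.length + m.weight := by
  induction γ with
  | nil => simp
  | cons i γ ih => simp [weight, ih]; ring

lemma GMon.leftNormed_isLie (b : ι) (B : List ι) : (leftNormed b B).IsLie := by
  induction B using List.reverseRecOn with
  | nil => trivial
  | append_singleton B i ih => rw [leftNormed_concat]; exact ⟨ih, trivial⟩

lemma GMon.leftNormed_commutatorFactors (b : ι) (B : List ι) (hB : B ≠ []) :
    (leftNormed b B).commutatorFactors = 1 := by
  rcases B.eq_nil_or_concat with h | ⟨B', i, rfl⟩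
  · exact absurd h hB
  · rw [List.concat_eq_append, leftNormed_concat, commutatorFactors, if_pos ⟨leftNormed_isLie b B', trivial⟩]

lemma GMon.mulWord_commutatorFactors (γ : List ι) (m : GMon ι) :
    (mulWord γ m).commutatorFactors = m.commutatorFactors := by
  induction γ with
  | nil => rfl
  | cons i γ ih => simp [commutatorFactors, ih]

lemma GMon.leftNormed_degree (V : GrSp) (b : V.Idx) (B : List V.Idx) :
    ((mdeg V (leftNormed b B) + 1 : ℤ) : ZMod 2) = ((lsum V.sdeg (b :: B) : ℤ) : ZMod 2) := by
  induction B using List.reverseRecOn with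
  | nil => simp [degree, GrSp.tdeg, GrSp.sdeg]; ring_nf; reduce_mod_char
  | append_singleton B i ih =>
    rw [leftNormed_concat]
    simp only [degree, lsum_cons, lsum_append, lsum_nil] at ih ⊢
    push_cast at ih ⊢
    have h2 : ((V.tdeg i : ℤ) : ZMod 2) = V.sdeg i + 1 := by
      simp only [GrSp.tdeg, GrSp.sdeg]; push_cast; ring_nf; reduce_mod_char
    rw [h2]
    linear_combination ih

end NormalForms

section Spanning

variable (k : Type u) [Field k] (V : GrSp)

/-- The span of the left-normed brackets of words of length `w`. -/
def lieSpan (w : ℕ) : Submodule k (QuotG k V 2) :=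
  Submodule.span k {q | ∃ b B, B.length + 1 = w ∧ q = quotMon k (GMon.leftNormed b B)}

/-- The span of the normal monomials of weight `w`. -/
def normalSpan (w : ℕ) : Submodule k (QuotG k V 2) :=
  Submodule.span k {q | ∃ γ b B, γ.length + (B.length + 1) = w ∧
    q = quotMon k (GMon.mulWord γ (GMon.leftNormed b B))}

variable {k V}

/-- A bilinear operation maps spans to a submodule if it does so on generators. -/
lemma span_bilin {M : Type*} [AddCommGroup M] [Module k M] (T : M →ₗ[k] M →ₗ[k] M) {s t : Set M}
    {S : Submodule k M} (h : ∀ x ∈ s, ∀ y ∈ t, T x y ∈ S) {x y : M}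
    (hx : x ∈ Submodule.span k s) (hy : y ∈ Submodule.span k t) : T x y ∈ S := by
  have h1 : ∀ y ∈ t, T x y ∈ S := by
    intro y hy
    have : Submodule.span k s ≤ S.comap (T.flip y) := Submodule.span_le.2 fun x hx => h x hx y hy
    exact this hx
  have : Submodule.span k t ≤ S.comap (T x) := Submodule.span_le.2 h1
  exact this hy

lemma leftNormed_mem (b : V.Idx) (B : List V.Idx) :
    quotMon k (GMon.leftNormed b B) ∈ lieSpan k V (B.length + 1) :=
  Submodule.subset_span ⟨b, B, rfl, rfl⟩

lemma lieSpan_le (w : ℕ) : lieSpan k V w ≤ normalSpan k V w :=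
  Submodule.span_le.2 fun q ⟨b, B, hw, hq⟩ => Submodule.subset_span ⟨[], b, B, by simpa using hw, hq⟩

lemma lieSpan_br_gen {w : ℕ} {x : QuotG k V 2} (hx : x ∈ lieSpan k V w) (i : V.Idx) :
    QuotG.br k V 2 x (quotMon k (.gen i)) ∈ lieSpan k V (w + 1) := by
  have : lieSpan k V w ≤ (lieSpan k V (w + 1)).comap ((QuotG.br k V 2).flip (quotMon k (.gen i))) :=
    Submodule.span_le.2 fun q ⟨b, B, hw, hq⟩ => by
      change QuotG.br k V 2 q _ ∈ lieSpan k V (w + 1)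
      rw [hq, ← quotMon_br, ← GMon.leftNormed_concat]
      exact Submodule.subset_span ⟨b, B ++ [i], by simp [hw], rfl⟩
  exact this hx

lemma leftNormed_br_mem (b : V.Idx) (B : List V.Idx) (c : V.Idx) (C : List V.Idx) :
    quotMon k (.br (GMon.leftNormed b B) (GMon.leftNormed c C)) ∈
      lieSpan k V (B.length + 1 + (C.length + 1)) := by
  induction C using List.reverseRecOn generalizing B with
  | nil => rw [quotMon_br]; exact lieSpan_br_gen (leftNormed_mem b B) c
  | append_singleton C i ih =>
    rw [GMon.leftNormed_concat, quotMon_jacobi]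
    refine add_mem ?_ (sgn_smul_mem _ _ ?_)
    · rw [quotMon_br]
      have := lieSpan_br_gen (ih B) i
      rwa [List.length_append, List.length_singleton]
    · rw [quotMon_anti, ← GMon.leftNormed_concat]
      refine neg_mem (sgn_smul_mem _ _ ?_)
      have := ih (B ++ [i])
      rw [List.length_append, List.length_singleton] at this ⊢
      convert this using 2
      ring

lemma gen_mul_mem {w : ℕ} (i : V.Idx) {x : QuotG k V 2} (hx : x ∈ normalSpan k V w) :
    QuotG.mul k V 2 (quotMon k (.gen i)) x ∈ normalSpan k V (w + 1) := by
  have : normalSpan k V w ≤ (normalSpan k V (w + 1)).comap (QuotG.mul k V 2 (quotMon k (.gen i))) :=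
    Submodule.span_le.2 fun q ⟨γ, b, B, hw, hq⟩ => by
      change QuotG.mul k V 2 _ q ∈ normalSpan k V (w + 1)
      rw [hq, ← quotMon_mul]
      exact Submodule.subset_span ⟨i :: γ, b, B, by simp; omega, rfl⟩
  exact this hx

lemma mulWord_mul (γ : List V.Idx) (m n : GMon V.Idx) :
    quotMon k (.mul (GMon.mulWord γ m) n) = quotMon k (GMon.mulWord γ (.mul m n)) := by
  induction γ with
  | nil => rfl
  | cons i γ ih =>
    rw [GMon.mulWord_cons, GMon.mulWord_cons, quotMon_assoc, quotMon_mul, ih, ← quotMon_mul]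

lemma mulWord_mem {w : ℕ} (γ : List V.Idx) {m : GMon V.Idx} (h : quotMon k m ∈ normalSpan k V w) :
    quotMon k (GMon.mulWord γ m) ∈ normalSpan k V (w + γ.length) := by
  induction γ with
  | nil => exact h
  | cons i γ ih => rw [GMon.mulWord_cons, quotMon_mul]; exact gen_mul_mem i ih

lemma normal_mem (γ : List V.Idx) (b : V.Idx) (B : List V.Idx) :
    quotMon k (GMon.mulWord γ (GMon.leftNormed b B)) ∈ normalSpan k V (γ.length + (B.length + 1)) :=
  Submodule.subset_span ⟨γ, b, B, rfl, rfl⟩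

lemma normalSpan_mul {v w : ℕ} {x y : QuotG k V 2} (hx : x ∈ normalSpan k V v)
    (hy : y ∈ normalSpan k V w) : QuotG.mul k V 2 x y ∈ normalSpan k V (v + w) := by
  refine span_bilin _ ?_ hx hy
  rintro x ⟨γ, b, B, hv, rfl⟩ y ⟨γ', b', B', hw, rfl⟩
  rw [← quotMon_mul]
  by_cases hB : B = []
  · subst hB
    rw [mulWord_mul, GMon.leftNormed_nil, ← GMon.mulWord_cons]
    have := mulWord_mem γ (normal_mem (k := k) (b :: γ') b' B')
    convert this using 2
    simp at hv hw ⊢; omega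
  · by_cases hB' : B' = []
    · subst hB'
      rw [quotMon_comm, mulWord_mul, GMon.leftNormed_nil, ← GMon.mulWord_cons]
      have := mulWord_mem γ' (normal_mem (k := k) (b' :: γ) b B)
      refine sgn_smul_mem _ _ ?_
      convert this using 2
      simp at hv hw ⊢; omega
    · rw [quotMon_power]
      · exact zero_mem _
      · simp only [GMon.commutatorFactors, GMon.mulWord_commutatorFactors,
          GMon.leftNormed_commutatorFactors _ _ hB, GMon.leftNormed_commutatorFactors _ _ hB']
        rfl

lemma mem_normalSpan_of_eq {v w : ℕ} (h : v = w) {x : QuotG k V 2} (hx : x ∈ normalSpan k V v) :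
    x ∈ normalSpan k V w := h ▸ hx

lemma leftNormed_br_mulWord (b : V.Idx) (B γ : List V.Idx) (c : V.Idx) (C : List V.Idx) :
    quotMon k (.br (GMon.leftNormed b B) (GMon.mulWord γ (GMon.leftNormed c C))) ∈
      normalSpan k V (B.length + 1 + (γ.length + (C.length + 1))) := by
  induction γ with
  | nil => have := lieSpan_le _ (leftNormed_br_mem (k := k) b B c C); simpa using this
  | cons i γ ih =>
    rw [GMon.mulWord_cons, quotMon_poisson]
    refine add_mem ?_ (sgn_smul_mem _ _ ?_)
    · rw [quotMon_mul]
      have := normalSpan_mul (lieSpan_le _ (leftNormed_br_mem (k := k) b B i [])) (normal_mem γ c C)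
      refine mem_normalSpan_of_eq ?_ this
      simp; omega
    · rw [quotMon_mul]
      have := gen_mul_mem i ih
      refine mem_normalSpan_of_eq ?_ this
      simp; omega

lemma normalSpan_br {v w : ℕ} {x y : QuotG k V 2} (hx : x ∈ normalSpan k V v)
    (hy : y ∈ normalSpan k V w) : QuotG.br k V 2 x y ∈ normalSpan k V (v + w) := by
  refine span_bilin _ ?_ hx hy
  rintro x ⟨γ, b, B, hv, rfl⟩ y ⟨γ', b', B', hw, rfl⟩
  rw [← quotMon_br, quotMon_anti]
  refine neg_mem (sgn_smul_mem _ _ ?_)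
  subst hv hw
  clear hx hy
  induction γ with
  | nil =>
    rw [quotMon_anti]
    refine neg_mem (sgn_smul_mem _ _ ?_)
    have := leftNormed_br_mulWord (k := k) b B γ' b' B'
    refine mem_normalSpan_of_eq ?_ this
    simp
  | cons i γ ih =>
    rw [GMon.mulWord_cons, quotMon_poisson]
    refine add_mem ?_ (sgn_smul_mem _ _ ?_)
    · rw [quotMon_mul, quotMon_anti]
      have h1 := leftNormed_br_mulWord (k := k) i [] γ' b' B'
      have := normalSpan_mul (neg_mem (sgn_smul_mem _ (sgn ((mdeg V (GMon.mulWord γ' (GMon.leftNormed b' B')) + 1) * (mdeg V (.gen i) + 1))) h1)) (normal_mem γ b B)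
      refine mem_normalSpan_of_eq ?_ this
      simp; omega
    · rw [quotMon_mul]
      have := gen_mul_mem i ih
      refine mem_normalSpan_of_eq ?_ this
      simp; omega

/-- The normal monomials span the quotient. -/
lemma quotMon_mem (m : GMon V.Idx) : quotMon k m ∈ normalSpan k V m.weight := by
  induction m with
  | gen i => exact normal_mem [] i []
  | mul a b ha hb => rw [quotMon_mul]; exact normalSpan_mul ha hb
  | br a b ha hb => rw [quotMon_br]; exact normalSpan_br ha hb

end Spanning

end GInf

namespace GInf

open FormalFn

section Words

variable {X : Type} [Fintype X] {M : Type*} [AddCommMonoid M]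

variable (X) in
/-- The words of a given length. -/
def words : ℕ → Finset (List X)
  | 0 => {[]}
  | n + 1 => ((Finset.univ : Finset X) ×ˢ words n).map
      ⟨fun p => p.1 :: p.2, fun p q h => by
        simp only [List.cons.injEq] at h; exact Prod.ext h.1 h.2⟩

lemma sum_words_zero (F : List X → M) : ∑ B ∈ words X 0, F B = F [] := by simp [words]

lemma sum_words_succ (n : ℕ) (F : List X → M) :
    ∑ B ∈ words X (n + 1), F B = ∑ b, ∑ B ∈ words X n, F (b :: B) := by
  rw [words, Finset.sum_map, Finset.sum_product]; rfl

lemma sum_words_concat (n : ℕ) (F : List X → M) :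
    ∑ B ∈ words X (n + 1), F B = ∑ B ∈ words X n, ∑ b, F (B ++ [b]) := by
  induction n generalizing F with
  | zero => rw [sum_words_succ, sum_words_zero]; simp [sum_words_zero]
  | succ n ih =>
    rw [sum_words_succ, sum_words_succ]
    exact Finset.sum_congr rfl fun b _ => ih _

lemma mem_words {n : ℕ} {B : List X} : B ∈ words X n ↔ B.length = n := by
  induction n generalizing B with
  | zero => simp [words]
  | succ n ih =>
    cases B with
    | nil => simp [words]
    | cons b B =>
      rw [words, Finset.mem_map, List.length_cons]
      constructor
      · rintro ⟨⟨a, C⟩, h, e⟩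
        obtain ⟨rfl, rfl⟩ := List.cons.inj e
        rw [ih.1 (Finset.mem_product.1 h).2]
      · intro h
        exact ⟨(b, B), Finset.mem_product.2 ⟨Finset.mem_univ _, ih.2 (by simpa using h)⟩, rfl⟩

end Words

section SymmetricPart

variable {k : Type u} [Field k] {V : GrSp}

/-- The product of the coordinates of a word. -/
def fnWord (γ : List V.Idx) : FormalFn k V := γ.foldr (fun i f => var i * f) 1

lemma fnWord_cons (i : V.Idx) (γ : List V.Idx) :
    (fnWord (i :: γ) : FormalFn k V) = var i * fnWord γ := rfl

lemma var_hasPar (i : V.Idx) : HasPar (V.tdeg i) (var i : FormalFn k V) :=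
  HasPar.of_support fun l h => by
    rw [var_apply] at h
    split_ifs at h with h1
    · simp [h1]
    · exact absurd rfl h

lemma pd_var_mul (x i : V.Idx) (g : FormalFn k V) :
    pd x (var i * g) = (if x = i then g else 0) + sgn (V.tdeg x * V.tdeg i) • (var i * pd x g) := by
  rw [pd_mul, pd_var, var_hasPar i, smul_mul_assoc]
  congr 1
  split_ifs <;> simp

section Theta

variable {Z : Type*} [AddCommGroup Z] [Module k Z] (L : V.Idx → Z →ₗ[k] Z)

/-- The action of a word of operators. -/
def opWord (γ : List V.Idx) (z : Z) : Z := γ.foldr (fun i z => L i z) z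

lemma opWord_cons (i : V.Idx) (γ : List V.Idx) (z : Z) :
    opWord L (i :: γ) z = L i (opWord L γ z) := rfl

lemma opWord_append (γ γ' : List V.Idx) (z : Z) :
    opWord L (γ ++ γ') z = opWord L γ (opWord L γ' z) := by
  simp [opWord]

/-- The action of the component of degree `p` of a formal function. -/
def theta (p : ℕ) (z : Z) : FormalFn k V →ₗ[k] Z where
  toFun f := ∑ γ ∈ words V.Idx p, f.1 γ • opWord L γ z
  map_add' f g := by
    rw [← Finset.sum_add_distrib]
    exact Finset.sum_congr rfl fun γ _ => add_smul _ _ _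
  map_smul' c f := by
    rw [Finset.smul_sum]
    exact Finset.sum_congr rfl fun γ _ => mul_smul _ _ _

lemma theta_apply (p : ℕ) (z : Z) (f : FormalFn k V) :
    theta L p z f = ∑ γ ∈ words V.Idx p, f.1 γ • opWord L γ z := rfl

lemma theta_zero (z : Z) (f : FormalFn k V) : theta L 0 z f = f.1 [] • z := by
  rw [theta_apply, sum_words_zero]; rfl

lemma theta_succ (p : ℕ) (z : Z) (f : FormalFn k V) :
    theta L (p + 1) z f = ∑ i, L i (theta L p z (pd i f)) := by
  rw [theta_apply, sum_words_succ]
  refine Finset.sum_congr rfl fun i _ => ?_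
  rw [theta_apply, map_sum]
  exact Finset.sum_congr rfl fun γ _ => by rw [map_smul]; rfl

lemma theta_var_mul (hL : ∀ i j z, L i (L j z) = sgn (V.tdeg i * V.tdeg j) • L j (L i z)) (p : ℕ) (z : Z) (a : V.Idx) (g : FormalFn k V) :
    theta L (p + 1) z (var a * g) = ((p : k) + 1) • L a (theta L p z g) := by
  induction p generalizing g with
  | zero =>
    rw [theta_succ]
    simp only [theta_zero, pd_var_mul]
    rw [Finset.sum_eq_single a]
    · have h : (var a : FormalFn k V).1 [] = 0 := by simp [var_apply]
      have h2 : (g + sgn (V.tdeg a * V.tdeg a) • (var a * pd a g)).1 [] = g.1 [] := by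
        change g.1 [] + sgn _ • ((var a : FormalFn k V).1 [] * _) = _
        rw [h, zero_mul, smul_zero, add_zero]
      rw [if_pos rfl, h2]; simp
    · intro i _ hi
      have h : (var a : FormalFn k V).1 [] = 0 := by simp [var_apply]
      have h2 : ((0 : FormalFn k V) + sgn (V.tdeg i * V.tdeg a) • (var a * pd i g)).1 [] = 0 := by
        change 0 + sgn _ • ((var a : FormalFn k V).1 [] * _) = _
        rw [h, zero_mul, smul_zero, add_zero]
      rw [if_neg hi, h2, zero_smul, map_zero]
    · simp
  | succ p ih =>
    rw [theta_succ]
    simp only [pd_var_mul, map_add, sgn_smul_map, ih, Finset.sum_add_distrib, map_smul]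
    have h1 : ∑ i, L i (theta L (p + 1) z (if i = a then g else 0)) = L a (theta L (p + 1) z g) := by
      rw [Finset.sum_eq_single a]
      · rw [if_pos rfl]
      · intro i _ hi; rw [if_neg hi, map_zero, map_zero]
      · simp
    have h2 : ∀ i, sgn (V.tdeg i * V.tdeg a) • ((p : k) + 1) • L i (L a (theta L p z (pd i g))) =
        ((p : k) + 1) • L a (L i (theta L p z (pd i g))) := by
      intro i
      rw [hL i a, smul_comm ((p : k) + 1), sgn_smul_self]
    simp only [h2]
    rw [h1, ← Finset.smul_sum, ← map_sum, ← theta_succ]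
    push_cast
    module

lemma theta_fnWord (hL : ∀ i j z, L i (L j z) = sgn (V.tdeg i * V.tdeg j) • L j (L i z)) (γ : List V.Idx) (z : Z) :
    theta L γ.length z (fnWord γ) = (γ.length.factorial : k) • opWord L γ z := by
  induction γ with
  | nil => simp [theta_zero, fnWord, one_apply, opWord]
  | cons a γ ih =>
    rw [fnWord_cons, List.length_cons, theta_var_mul L hL, ih, map_smul, smul_smul, opWord_cons,
      Nat.factorial_succ]
    push_cast; rfl

end Theta

lemma var_mul_congr (i : V.Idx) (γ : List V.Idx) (f g : FormalFn k V)
    (h : ∀ l : List V.Idx, l.length + 1 = γ.length → f.1 l = g.1 l) :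
    (var i * f).1 γ = (var i * g).1 γ := by
  induction γ generalizing f g with
  | nil =>
    change (var i : FormalFn k V).1 [] * _ = (var i : FormalFn k V).1 [] * _
    simp [var_apply]
  | cons x γ ih =>
    change (pd x (var i * f)).1 γ = (pd x (var i * g)).1 γ
    rw [pd_var_mul, pd_var_mul]
    change (if x = i then f else 0 : FormalFn k V).1 γ + sgn _ • (var i * pd x f).1 γ =
      (if x = i then g else 0 : FormalFn k V).1 γ + sgn _ • (var i * pd x g).1 γ
    rw [ih _ (pd x g) fun l hl => h (x :: l) (by simp [hl])]
    congr 1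
    split_ifs
    · exact h γ rfl
    · rfl

/-- Euler's formula. -/
lemma euler (f : FormalFn k V) (γ : List V.Idx) :
    (∑ i, var i * pd i f).1 γ = γ.length * f.1 γ := by
  induction γ generalizing f with
  | nil =>
    rw [FormalFn.sum_apply]
    simp only [List.length_nil, Nat.cast_zero, zero_mul]
    refine Finset.sum_eq_zero fun i _ => ?_
    change (var i : FormalFn k V).1 [] * _ = 0
    simp [var_apply]
  | cons x γ ih =>
    change (pd x (∑ i, var i * pd i f)).1 γ = _
    have h : pd x (∑ i, var i * pd i f) = pd x f + ∑ i, var i * pd i (pd x f) := by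
      rw [pd_sum]
      simp only [pd_var_mul, Finset.sum_add_distrib]
      congr 1
      · rw [Finset.sum_ite_eq]; simp
      · refine Finset.sum_congr rfl fun i _ => ?_
        rw [pd_pd x i, mul_smul_comm, sgn_smul_self]
    rw [h]
    change (pd x f).1 γ + (∑ i, var i * pd i (pd x f)).1 γ = _
    rw [ih, pd_apply, List.length_cons]
    push_cast; ring

lemma theta_self (f : FormalFn k V) (γ : List V.Idx) :
    (theta (fun i => LinearMap.mulLeft k (var i)) γ.length (1 : FormalFn k V) f).1 γ =
      (γ.length.factorial : k) * f.1 γ := by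
  suffices h : ∀ p, ∀ (f : FormalFn k V) (γ : List V.Idx), γ.length = p →
      (theta (fun i => LinearMap.mulLeft k (var i)) p (1 : FormalFn k V) f).1 γ =
      (p.factorial : k) * f.1 γ from h _ f γ rfl
  intro p
  induction p with
  | zero =>
    intro f γ hγ
    rw [theta_zero, List.eq_nil_of_length_eq_zero hγ]
    change f.1 [] * (1 : FormalFn k V).1 [] = _
    simp [one_apply]
  | succ p ih =>
    intro f γ hγ
    rw [theta_succ, FormalFn.sum_apply]
    have h : ∀ i, (LinearMap.mulLeft k (var i) (theta (fun i => LinearMap.mulLeft k (var i)) p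
        (1 : FormalFn k V) (pd i f))).1 γ = (p.factorial : k) * (var i * pd i f).1 γ := by
      intro i
      have h1 : (p.factorial : k) * (var i * pd i f).1 γ =
          (var i * ((p.factorial : k) • pd i f)).1 γ := by rw [mul_smul_comm]; rfl
      rw [h1]
      exact var_mul_congr i γ _ _ fun l hl => ih _ l (by omega)
    simp only [h]
    rw [← Finset.mul_sum, ← FormalFn.sum_apply, euler, hγ, Nat.factorial_succ]
    push_cast; ring

/-- Taylor expansion in each degree. -/
lemma sum_fnWord (f : FormalFn k V) (γ : List V.Idx) :
    ∑ γ' ∈ words V.Idx γ.length, f.1 γ' * (fnWord γ' : FormalFn k V).1 γ =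
      (γ.length.factorial : k) * f.1 γ := by
  rw [← theta_self, theta_apply, FormalFn.sum_apply]
  rfl

end SymmetricPart

section Decode

variable {ι : Type}

lemma GMon.decodeLie_leftNormed (b : ι) (B : List ι) : (leftNormed b B).decodeLie = some (b :: B) := by
  induction B using List.reverseRecOn with
  | nil => rfl
  | append_singleton B i ih => rw [leftNormed_concat, decodeLie, ih]; rfl

lemma GMon.decode_leftNormed (b : ι) (B : List ι) :
    (leftNormed b B).decode = some ([], b :: B) := by
  rcases B.eq_nil_or_concat with h | ⟨B', i, h⟩
  · subst h; rfl
  · have := decodeLie_leftNormed b B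
    rw [h, List.concat_eq_append] at this ⊢
    rw [leftNormed_concat] at this ⊢
    rw [decode, this]
    · rfl
    · simp

lemma GMon.decode_mulWord (γ : List ι) (b : ι) (B : List ι) :
    (mulWord γ (leftNormed b B)).decode = some (γ, b :: B) := by
  induction γ with
  | nil => exact decode_leftNormed b B
  | cons i γ ih => rw [mulWord_cons, decode, ih]; rfl

lemma GMon.eq_of_decodeLie (m : GMon ι) (B : List ι) (h : m.decodeLie = some B) :
    ∃ b C, B = b :: C ∧ m = leftNormed b C := by
  induction m generalizing B with
  | gen i =>
    simp only [decodeLie, Option.some.injEq] at h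
    exact ⟨i, [], h.symm, rfl⟩
  | mul a b _ _ => simp [decodeLie] at h
  | br a b iha _ =>
    cases b with
    | mul _ _ => simp [decodeLie] at h
    | br _ _ => simp [decodeLie] at h
    | gen i =>
      simp only [decodeLie, Option.map_eq_some_iff] at h
      obtain ⟨B', hB', rfl⟩ := h
      obtain ⟨b, C, rfl, rfl⟩ := iha B' hB'
      exact ⟨b, C ++ [i], rfl, by simp⟩

lemma GMon.eq_of_decode (m : GMon ι) (γ B : List ι) (h : m.decode = some (γ, B)) :
    ∃ b C, B = b :: C ∧ m = mulWord γ (leftNormed b C) := by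
  have key : ∀ m : GMon ι, (m.decodeLie).map (fun B => (([] : List ι), B)) = some (γ, B) →
      ∃ b C, B = b :: C ∧ m = mulWord γ (leftNormed b C) := by
    intro m hm
    obtain ⟨B', hB', he⟩ := Option.map_eq_some_iff.1 hm
    obtain ⟨rfl, rfl⟩ := Prod.mk.inj he
    exact eq_of_decodeLie m B' hB'
  induction m generalizing γ B with
  | gen i => exact key _ h
  | br a b _ _ => exact key _ h
  | mul a b _ ihb =>
    cases a with
    | mul _ _ => simp [decode, decodeLie] at h
    | br _ _ => simp [decode, decodeLie] at h
    | gen i =>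
      simp only [decode, Option.map_eq_some_iff] at h
      obtain ⟨⟨γ', B'⟩, hB', he⟩ := h
      obtain ⟨rfl, rfl⟩ := Prod.mk.inj he
      obtain ⟨b', C, hB, hm⟩ := ihb γ' B' hB' (fun m hm => by
        obtain ⟨B'', hB'', he⟩ := Option.map_eq_some_iff.1 hm
        obtain ⟨rfl, rfl⟩ := Prod.mk.inj he
        exact eq_of_decodeLie m B'' hB'')
      exact ⟨b', C, hB, by rw [mulWord_cons, ← hm]⟩

end Decode

end GInf

namespace GInf

open FormalFn

variable {k : Type u} [Field k] {V : GrSp}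

section LieWords

lemma WordFn.mul_letter_concat (ω : WordFn k V) (i x : V.Idx) (C : List V.Idx) :
    WordFn.mul ω (letter i) (C ++ [x]) = if x = i then ω C else 0 := by
  rw [WordFn.mul_apply, splitSum_append_cons]
  simp only [splitSum]
  have h1 : splitSum (fun P Q => ω P * tw (lsum V.sdeg P) (letter i (Q ++ [x]))) C =
      splitSum (fun P Q => if Q = [] then (if x = i then ω P else 0) else 0) C := by
    refine splitSum_congr fun P Q _ => ?_
    by_cases hQ : Q = []
    · subst hQ
      by_cases hx : x = i <;> simp [letter, hx]
    · have : Q ++ [x] ≠ [i] := by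
        intro h
        have := congrArg List.length h
        simp at this
        exact hQ this
      simp [letter, this, hQ]
  rw [h1, splitSum_ite_right (fun P => if x = i then ω P else 0)]
  simp [letter]

lemma WordFn.mulOp_letter_cons (ω : WordFn k V) (i x : V.Idx) (C : List V.Idx) :
    WordFn.mulOp ω (letter i) (x :: C) =
      if x = i then sgn (V.sdeg i * lsum V.sdeg C) • ω C else 0 := by
  rw [WordFn.mulOp_apply]
  simp only [splitSum]
  have h1 : splitSum (fun P Q => sgn (lsum V.sdeg (x :: P) * lsum V.sdeg Q) •
        (ω Q * tw (lsum V.sdeg Q) (letter i (x :: P)))) C =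
      splitSum (fun P Q => if P = [] then
        (if x = i then sgn (V.sdeg i * lsum V.sdeg Q) • ω Q else 0) else 0) C := by
    refine splitSum_congr fun P Q _ => ?_
    by_cases hP : P = []
    · subst hP
      by_cases hx : x = i <;> simp [letter, hx]
    · simp [letter, hP]
  rw [h1, splitSum_ite_left (fun Q => if x = i then sgn (V.sdeg i * lsum V.sdeg Q) • ω Q else 0)]
  simp [letter]

/-- The coefficients of the left-normed commutators of letters. -/
def lieCoef (k : Type u) [Field k] {V : GrSp} (b : V.Idx) (B C : List V.Idx) : k :=
  ((evalMon k (GMon.leftNormed b B)).2 C).1 []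

lemma leftNormed_snd (b : V.Idx) (B C : List V.Idx) :
    (evalMon k (GMon.leftNormed b B)).2 C = lieCoef k b B C • (1 : FormalFn k V) := by
  have key : ∀ f : FormalFn k V, (∀ γ, γ ≠ [] → f.1 γ = 0) → f = f.1 [] • (1 : FormalFn k V) := by
    intro f hf
    ext γ
    change f.1 γ = f.1 [] * (if γ = [] then 1 else 0)
    by_cases h : γ = []
    · simp [h]
    · simp [h, hf γ h]
  refine key _ ?_
  induction B using List.reverseRecOn generalizing C with
  | nil =>
    intro γ hγ
    simp only [GMon.leftNormed_nil, evalMon, WordFn.letter]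
    split_ifs
    · rw [one_apply, if_neg hγ]
    · rfl
  | append_singleton B i ih =>
    intro γ hγ
    rw [GMon.leftNormed_concat]
    simp only [evalMon, Model.br_apply, WordFn.comm_apply]
    change (WordFn.mul (evalMon k (GMon.leftNormed b B)).2 (WordFn.letter i) C).1 γ -
      (WordFn.mulOp (evalMon k (GMon.leftNormed b B)).2 (WordFn.letter i) C).1 γ = 0
    have h1 : (WordFn.mul (evalMon k (GMon.leftNormed b B)).2 (WordFn.letter i) C).1 γ = 0 := by
      rcases C.eq_nil_or_concat with h | ⟨C', x, h⟩
      · subst h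
        simp only [WordFn.mul_apply, splitSum, WordFn.letter]
        simp
      · rw [h, List.concat_eq_append, WordFn.mul_letter_concat]
        split_ifs
        · exact ih C' γ hγ
        · rfl
    have h2 : (WordFn.mulOp (evalMon k (GMon.leftNormed b B)).2 (WordFn.letter i) C).1 γ = 0 := by
      cases C with
      | nil =>
        simp only [WordFn.mulOp_apply, splitSum, WordFn.letter]
        simp
      | cons x C =>
        rw [WordFn.mulOp_letter_cons]
        split_ifs
        · change sgn _ • ((evalMon k (GMon.leftNormed b B)).2 C).1 γ = 0
          rw [ih C γ hγ, smul_zero]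
        · rfl
    rw [h1, h2, sub_zero]

lemma lieCoef_nil (b : V.Idx) (C : List V.Idx) : lieCoef k b [] C = if C = [b] then 1 else 0 := by
  simp only [lieCoef, GMon.leftNormed_nil, evalMon, WordFn.letter]
  split_ifs
  · simp [one_apply]
  · rfl

/-- The part of the coefficients of a product with a letter which comes from words which end with
this letter. -/
def lastCoef (i : V.Idx) (F : List V.Idx → k) (C : List V.Idx) : k :=
  if C.getLast? = some i then F C.dropLast else 0

/-- The part of the coefficients of a product with a letter which comes from words which begin with
this letter. -/
def firstCoef (i : V.Idx) (F : List V.Idx → k) : List V.Idx → k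
  | [] => 0
  | x :: C => if x = i then sgn (V.sdeg i * lsum V.sdeg C) • F C else 0

lemma lastCoef_concat (i x : V.Idx) (F : List V.Idx → k) (C : List V.Idx) :
    lastCoef i F (C ++ [x]) = if x = i then F C else 0 := by
  simp [lastCoef]

lemma lieCoef_concat (b : V.Idx) (B : List V.Idx) (i : V.Idx) (C : List V.Idx) :
    lieCoef k b (B ++ [i]) C = lastCoef i (lieCoef k b B) C - firstCoef i (lieCoef k b B) C := by
  rw [lieCoef, GMon.leftNormed_concat]
  simp only [evalMon, Model.br_apply, WordFn.comm_apply]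
  change (WordFn.mul (evalMon k (GMon.leftNormed b B)).2 (WordFn.letter i) C).1 [] -
    (WordFn.mulOp (evalMon k (GMon.leftNormed b B)).2 (WordFn.letter i) C).1 [] = _
  congr 1
  · rcases C.eq_nil_or_concat with h | ⟨C', x, h⟩
    · subst h
      simp only [WordFn.mul_apply, splitSum, WordFn.letter]
      simp [lastCoef]
    · rw [h, List.concat_eq_append, WordFn.mul_letter_concat, lastCoef_concat]
      split_ifs
      · rfl
      · rfl
  · cases C with
    | nil =>
      simp only [WordFn.mulOp_apply, splitSum, WordFn.letter]
      simp [firstCoef]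
    | cons x C =>
      rw [WordFn.mulOp_letter_cons, firstCoef]
      split_ifs
      · rfl
      · rfl

lemma lieCoef_length {b : V.Idx} {B C : List V.Idx} (h : lieCoef k b B C ≠ 0) :
    C.length = B.length + 1 := by
  have := (evalMon_weight (k := k) (GMon.leftNormed b B)).2 C [] h
  rw [lsum_one, lsum_one, List.length_nil, GMon.leftNormed_weight] at this
  push_cast at this; omega

lemma lieCoef_degree {b : V.Idx} {B C : List V.Idx} (h : lieCoef k b B C ≠ 0) :
    ((lsum V.sdeg C : ℤ) : ZMod 2) = (lsum V.sdeg (b :: B) : ℤ) := by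
  have := (evalMon_degree (k := k) (GMon.leftNormed b B)).2 C [] h
  rw [← GMon.leftNormed_degree, ← this, lsum_neg, lsum_nil]
  push_cast; ring_nf; reduce_mod_char

variable {Z : Type*} [AddCommGroup Z] [Module k Z]

lemma sum_lieCoef_concat (b : V.Idx) (B : List V.Idx) (i : V.Idx) (n : ℕ) (F : List V.Idx → Z) :
    ∑ C ∈ words V.Idx (n + 1), lieCoef k b (B ++ [i]) C • F C =
      ∑ C ∈ words V.Idx n, lieCoef k b B C •
        (F (C ++ [i]) - sgn (V.sdeg i * lsum V.sdeg (b :: B)) • F (i :: C)) := by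
  simp only [lieCoef_concat, sub_smul, Finset.sum_sub_distrib, smul_sub]
  congr 1
  · rw [sum_words_concat]
    refine Finset.sum_congr rfl fun C _ => ?_
    rw [Finset.sum_eq_single i]
    · rw [lastCoef_concat, if_pos rfl]
    · intro x _ hx; rw [lastCoef_concat, if_neg hx, zero_smul]
    · simp
  · rw [sum_words_succ, Finset.sum_comm]
    refine Finset.sum_congr rfl fun C _ => ?_
    rw [Finset.sum_eq_single i]
    · rw [firstCoef, if_pos rfl, smul_comm, smul_assoc]
      by_cases h : lieCoef k b B C = 0
      · rw [h, zero_smul, smul_zero, smul_zero]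
      · apply sgn_smul_congr
        have := lieCoef_degree h
        push_cast at this ⊢
        rw [this]; ring
    · intro x _ hx; rw [firstCoef, if_neg hx, zero_smul]
    · simp

variable (k) in
/-- The class of the left-normed bracket of a word. -/
def lieClass : List V.Idx → QuotG k V 2
  | [] => 0
  | b :: B => quotMon k (GMon.leftNormed b B)

lemma lieClass_concat (b : V.Idx) (B : List V.Idx) (i : V.Idx) :
    lieClass k (b :: (B ++ [i])) =
      QuotG.br k V 2 (lieClass k (b :: B)) (quotMon k (.gen i)) := by
  rw [lieClass, GMon.leftNormed_concat, quotMon_br]; rfl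

/-- The bracket of a left-normed bracket with a Lie polynomial. -/
lemma sum_lieCoef_append (q : V.Idx) (Q : List V.Idx) (b : V.Idx) (B : List V.Idx) :
    ∑ C ∈ words V.Idx (B.length + 1), lieCoef k b B C • lieClass k (q :: (Q ++ C)) =
      QuotG.br k V 2 (lieClass k (q :: Q)) (lieClass k (b :: B)) := by
  induction B using List.reverseRecOn generalizing Q with
  | nil =>
    rw [List.length_nil, sum_words_succ]
    simp only [sum_words_zero, lieCoef_nil]
    rw [Finset.sum_eq_single b]
    · rw [if_pos rfl, one_smul, lieClass_concat]; rfl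
    · intro c _ hc
      rw [if_neg (by simpa using hc), zero_smul]
    · simp
  | append_singleton B i ih =>
    rw [List.length_append, List.length_singleton, sum_lieCoef_concat]
    simp only [smul_sub, Finset.sum_sub_distrib]
    have h1 : ∀ C : List V.Idx, q :: (Q ++ (C ++ [i])) = q :: ((Q ++ C) ++ [i]) := by simp
    have h2 : ∀ C : List V.Idx, q :: (Q ++ (i :: C)) = q :: ((Q ++ [i]) ++ C) := by simp
    have e1 : ∑ C ∈ words V.Idx (B.length + 1), lieCoef k b B C • lieClass k (q :: (Q ++ (C ++ [i]))) =
        QuotG.br k V 2 (QuotG.br k V 2 (lieClass k (q :: Q)) (lieClass k (b :: B)))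
          (quotMon k (.gen i)) := by
      rw [← ih, map_sum, LinearMap.sum_apply]
      refine Finset.sum_congr rfl fun C _ => ?_
      rw [h1, lieClass_concat, map_smul, LinearMap.smul_apply]
    have e2 : ∑ C ∈ words V.Idx (B.length + 1), lieCoef k b B C •
        sgn (V.sdeg i * lsum V.sdeg (b :: B)) • lieClass k (q :: (Q ++ (i :: C))) =
        sgn (V.sdeg i * lsum V.sdeg (b :: B)) •
          QuotG.br k V 2 (lieClass k (q :: (Q ++ [i]))) (lieClass k (b :: B)) := by
      rw [← ih, Finset.smul_sum]
      refine Finset.sum_congr rfl fun C _ => ?_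
      rw [h2, smul_comm]
    rw [e1, e2, lieClass_concat, lieClass_concat]
    simp only [lieClass, ← quotMon_br]
    rw [quotMon_jacobi, quotMon_anti (GMon.leftNormed b B) (.br (GMon.leftNormed q Q) (.gen i)),
      smul_neg, sgn_smul_smul, sub_eq_add_neg]
    congr 2
    apply sgn_smul_congr
    have h3 := GMon.leftNormed_degree V b B
    have h4 : ((V.sdeg i : ℤ) : ZMod 2) = V.tdeg i + 1 := by
      simp only [GrSp.tdeg, GrSp.sdeg]; push_cast; ring_nf; reduce_mod_char
    simp only [GMon.degree]
    push_cast at h3 h4 ⊢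
    rw [← h3, h4]
    ring_nf; reduce_mod_char

/-- The theorem of Dynkin, Specht and Wever: left-normed bracketing multiplies Lie polynomials
by their degree. -/
lemma sum_lieCoef_lieClass (b : V.Idx) (B : List V.Idx) :
    ∑ C ∈ words V.Idx (B.length + 1), lieCoef k b B C • lieClass k C =
      ((B.length : k) + 1) • lieClass k (b :: B) := by
  induction B using List.reverseRecOn with
  | nil =>
    rw [List.length_nil, sum_words_succ]
    simp only [sum_words_zero, lieCoef_nil]
    rw [Finset.sum_eq_single b]
    · simp
    · intro c _ hc
      rw [if_neg (by simpa using hc), zero_smul]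
    · simp
  | append_singleton B i ih =>
    rw [List.length_append, List.length_singleton, sum_lieCoef_concat]
    simp only [smul_sub, Finset.sum_sub_distrib]
    have e1 : ∑ C ∈ words V.Idx (B.length + 1), lieCoef k b B C • lieClass k (C ++ [i]) =
        ((B.length : k) + 1) • lieClass k (b :: (B ++ [i])) := by
      rw [lieClass_concat, ← LinearMap.smul_apply, ← map_smul, ← ih, map_sum, LinearMap.sum_apply]
      refine Finset.sum_congr rfl fun C hC => ?_
      rw [mem_words] at hC
      match C, hC with
      | c :: C, _ => rw [List.cons_append, lieClass_concat, map_smul, LinearMap.smul_apply]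
    have e2 : ∑ C ∈ words V.Idx (B.length + 1), lieCoef k b B C •
        sgn (V.sdeg i * lsum V.sdeg (b :: B)) • lieClass k (i :: C) =
        - lieClass k (b :: (B ++ [i])) := by
      have := sum_lieCoef_append (k := k) i [] b B
      simp only [List.nil_append] at this
      have h2 : ∑ C ∈ words V.Idx (B.length + 1), lieCoef k b B C •
          sgn (V.sdeg i * lsum V.sdeg (b :: B)) • lieClass k (i :: C) =
          sgn (V.sdeg i * lsum V.sdeg (b :: B)) •
            QuotG.br k V 2 (lieClass k [i]) (lieClass k (b :: B)) := by
        rw [← this, Finset.smul_sum]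
        exact Finset.sum_congr rfl fun C _ => smul_comm _ _ _
      rw [h2, lieClass_concat]
      simp only [lieClass, ← quotMon_br, GMon.leftNormed_nil]
      rw [quotMon_anti (.gen i), smul_neg, sgn_smul_smul]
      have h3 := GMon.leftNormed_degree V b B
      have h4 : ((V.sdeg i : ℤ) : ZMod 2) = V.tdeg i + 1 := by
        simp only [GrSp.tdeg, GrSp.sdeg]; push_cast; ring_nf; reduce_mod_char
      rw [sgn_smul_congr (b := 0)]
      · simp
      · simp only [GMon.degree]
        push_cast at h3 h4 ⊢
        rw [← h3, h4]
        ring_nf; reduce_mod_char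
    rw [e1, e2]
    push_cast
    module

end LieWords

section Shuffle

variable {X M : Type*} [AddCommGroup M] (d : X → ℤ)

/-- The recursion for shuffles with respect to the last letters. -/
lemma shSum_concat_concat (F : List X → M) (A : List X) (a : X) (C : List X) (c : X) :
    shSum d F (A ++ [a]) (C ++ [c]) =
      sgn (d a * lsum d (C ++ [c])) • shSum d (fun l => F (l ++ [a])) A (C ++ [c]) +
        shSum d (fun l => F (l ++ [c])) (A ++ [a]) C := by
  induction A generalizing F C with
  | nil =>
    induction C generalizing F with
    | nil =>
      simp only [List.nil_append]
      rw [shSum_cons_cons, shSum_nil_left, shSum_nil_right, shSum_nil_left, shSum_nil_right, add_comm]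
      simp [mul_comm]
    | cons x C ih =>
      simp only [List.nil_append, List.cons_append] at ih ⊢
      rw [shSum_cons_cons, ih, shSum_nil_left, shSum_nil_left, shSum_nil_left, shSum_cons_cons,
        shSum_nil_left, smul_add, sgn_smul_smul]
      simp only [lsum_cons, lsum_append, lsum_nil, List.cons_append]
      rw [add_left_comm]
      congr 3
      ring
  | cons y A ihA =>
    induction C generalizing F with
    | nil =>
      have := ihA (fun l => F (y :: l)) []
      simp only [List.nil_append, List.cons_append] at this ⊢
      rw [shSum_cons_cons, this, shSum_nil_right, shSum_nil_right, shSum_nil_right, shSum_cons_cons,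
        shSum_nil_right, smul_add, sgn_smul_smul]
      simp only [lsum_cons, lsum_append, lsum_nil, List.cons_append]
      rw [add_right_comm, add_assoc, add_assoc]
      congr 2
      apply sgn_smul_congr
      push_cast; ring_nf
    | cons x C ih =>
      have h1 := ihA (fun l => F (y :: l)) (x :: C)
      have h2 := ih (fun l => F (x :: l))
      simp only [List.cons_append] at h1 h2 ⊢
      rw [shSum_cons_cons, h1, h2, shSum_cons_cons, shSum_cons_cons]
      simp only [smul_add, sgn_smul_smul, lsum_cons, lsum_append, lsum_nil, List.cons_append]
      have e : sgn (d x * (d y + (lsum d A + (d a + 0))) + d a * (lsum d C + (d c + 0))) =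
          sgn (d a * (d x + (lsum d C + (d c + 0))) + d x * (d y + lsum d A)) := by
        apply sgn_eq_of; push_cast; ring_nf
      rw [e]
      abel

end Shuffle

end GInf

namespace GInf

open FormalFn

section Shuffle

variable {X M : Type*} [AddCommGroup M] (d : X → ℤ)

lemma lsum_perm {l l' : List X} (h : l.Perm l') : lsum d l = lsum d l' := (h.map d).sum_eq

lemma shSum_congr_perm {F G : List X → M} {A C : List X}
    (h : ∀ l, l.Perm (A ++ C) → F l = G l) : shSum d F A C = shSum d G A C := by
  induction A generalizing F G C with
  | nil => rw [shSum_nil_left, shSum_nil_left]; exact h _ (List.Perm.refl _)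
  | cons a A ihA =>
    induction C generalizing F G with
    | nil => rw [shSum_nil_right, shSum_nil_right]; exact h _ (by simp)
    | cons c C ihC =>
      rw [shSum_cons_cons, shSum_cons_cons, ihA, ihC]
      · intro l hl
        exact h _ ((hl.cons c).trans (List.perm_middle (l₁ := a :: A)).symm)
      · intro l hl; exact h _ (hl.cons a)

lemma shSum_sub (F G : List X → M) (A C : List X) :
    shSum d (fun l => F l - G l) A C = shSum d F A C - shSum d G A C := by
  induction A generalizing F G C with
  | nil => simp only [shSum_nil_left]
  | cons a A ihA =>
    induction C generalizing F G with
    | nil => simp only [shSum_nil_right]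
    | cons c C ihC =>
      simp only [shSum_cons_cons, ihA, ihC, smul_sub]
      abel

lemma shSum_zero (A C : List X) : shSum d (fun _ => (0 : M)) A C = 0 := by
  have := shSum_sub d (fun _ => (0 : M)) (fun _ => 0) A C
  simpa using this

lemma shSum_ite (p : Prop) [Decidable p] (F : List X → M) (A C : List X) :
    shSum d (fun l => if p then F l else 0) A C = if p then shSum d F A C else 0 := by
  by_cases h : p <;> simp [h, shSum_zero]

/-- The functions on words which vanish on shuffles. -/
def ShVanish (F : List X → M) : Prop := ∀ A C, A ≠ [] → C ≠ [] → shSum d F A C = 0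

variable {d}

lemma ShVanish.apply {F : List X → M} (h : ShVanish d F) [DecidableEq X] (A C : List X)
    (hC : C ≠ []) : shSum d F A C = if A = [] then F C else 0 := by
  by_cases hA : A = []
  · rw [if_pos hA, hA, shSum_nil_left]
  · rw [if_neg hA, h A C hA hC]

end Shuffle

section LieShuffle

variable {k : Type u} [Field k] {V : GrSp}

lemma shSum_lastCoef (i : V.Idx) {F : List V.Idx → k} (hF : ShVanish V.sdeg F) (A C : List V.Idx)
    (hA : A ≠ []) (hC : C ≠ []) : shSum V.sdeg (lastCoef i F) A C =
      (if A = [i] then sgn (V.sdeg i * lsum V.sdeg C) • F C else 0) + if C = [i] then F A else 0 := by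
  obtain ⟨A, a, rfl⟩ := (A.eq_nil_or_concat.resolve_left hA)
  obtain ⟨C, c, rfl⟩ := (C.eq_nil_or_concat.resolve_left hC)
  simp only [List.concat_eq_append] at *
  rw [shSum_concat_concat]
  simp only [lastCoef_concat, shSum_ite]
  rw [hF.apply A _ hC, shSum_comm V.sdeg F (A ++ [a]) C, hF.apply C _ hA]
  congr 1
  · by_cases h : A = []
    · subst h
      by_cases ha : a = i <;> simp [ha]
    · have : A ++ [a] ≠ [i] := fun e => h (by
        have := congrArg List.length e; simpa using this)
      simp [h, this]
  · by_cases h : C = []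
    · subst h
      by_cases hc : c = i <;> simp [hc]
    · have : C ++ [c] ≠ [i] := fun e => h (by
        have := congrArg List.length e; simpa using this)
      simp [h, this]

lemma shSum_firstCoef_cons (i a : V.Idx) (F : List V.Idx → k) (A C : List V.Idx) :
    shSum V.sdeg (fun l => firstCoef i F (a :: l)) A C =
      if a = i then sgn (V.sdeg i * (lsum V.sdeg A + lsum V.sdeg C)) • shSum V.sdeg F A C else 0 := by
  simp only [firstCoef, shSum_ite]
  congr 1
  rw [← shSum_sgn_smul]
  exact shSum_congr_perm _ fun l hl => by rw [lsum_perm V.sdeg hl, lsum_append]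

lemma shSum_firstCoef (i : V.Idx) {F : List V.Idx → k} (hF : ShVanish V.sdeg F) (A C : List V.Idx)
    (hA : A ≠ []) (hC : C ≠ []) : shSum V.sdeg (firstCoef i F) A C =
      (if A = [i] then sgn (V.sdeg i * lsum V.sdeg C) • F C else 0) + if C = [i] then F A else 0 := by
  match A, C, hA, hC with
  | a :: A, c :: C, _, _ =>
    rw [shSum_cons_cons, shSum_firstCoef_cons, shSum_firstCoef_cons, hF.apply A _ (by simp),
      shSum_comm V.sdeg F (a :: A) C, hF.apply C _ (by simp)]
    congr 1
    · by_cases h : A = []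
      · subst h
        by_cases ha : a = i <;> simp [ha]
      · simp [h]
    · by_cases h : C = []
      · subst h
        by_cases hc : c = i
        · subst hc
          simp [sgn_smul_self]
        · simp [hc]
      · simp [h]

/-- Commutators vanish on shuffles. -/
lemma lieCoef_shVanish (b : V.Idx) (B : List V.Idx) : ShVanish V.sdeg (lieCoef k b B) := by
  induction B using List.reverseRecOn with
  | nil =>
    intro A C hA hC
    refine Eq.trans (shSum_congr V.sdeg (G := fun _ => 0) fun l hl => ?_) (shSum_zero _ _ _)
    rw [lieCoef_nil, if_neg]
    rintro rfl
    have := List.length_pos_iff.2 hA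
    have := List.length_pos_iff.2 hC
    simp at hl; omega
  | append_singleton B i ih =>
    intro A C hA hC
    have h : lieCoef k b (B ++ [i]) =
        fun l => lastCoef i (lieCoef k b B) l - firstCoef i (lieCoef k b B) l :=
      funext fun l => lieCoef_concat b B i l
    rw [h, shSum_sub, shSum_lastCoef i ih A C hA hC, shSum_firstCoef i ih A C hA hC, sub_self]

/-- The operator on functions on words which is adjoint to left-normed bracketing. -/
def lieAdj (F : List V.Idx → k) (n : ℕ) (C : List V.Idx) : k :=
  ∑ b, ∑ B ∈ words V.Idx n, lieCoef k b B C * F (b :: B)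

/-- The contribution to the adjoint of the bracketing of a decomposition of a word at a letter. -/
def pivot (F : List V.Idx → k) (U : List V.Idx) : List V.Idx → k
  | [] => 0
  | y :: W => sgn (U.length + pairSum V.sdeg U + V.sdeg y * lsum V.sdeg U) •
      shSum V.sdeg (fun l => F (y :: l)) U.reverse W

/-- The contribution to the adjoint of the bracketing of a decomposition of a word whose first
letter is the last one to be added. -/
def pivotTail (F : List V.Idx → k) (y₀ : V.Idx) (s : ℤ) : List V.Idx → List V.Idx → k
  | [], _ => 0
  | _ :: P, Q => -(sgn (V.sdeg y₀ * s) • pivot (fun l => F (l ++ [y₀])) P Q)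

lemma pivot_rec (F : List V.Idx → k) (y₀ x : V.Idx) (C D : List V.Idx) (hC : y₀ :: D = C ++ [x])
    (hD : D ≠ []) (P Q : List V.Idx) (h : P ++ Q = y₀ :: D) :
    pivot F P Q = pivot (fun l => F (l ++ [x])) P Q.dropLast +
      pivotTail F y₀ (lsum V.sdeg D) P Q := by
  have hlast : ∀ W : List V.Idx, ∀ z, P ++ (W ++ [z]) = y₀ :: D → z = x := by
    intro W z e
    rw [hC, ← List.append_assoc] at e
    simpa using (List.append_inj' e rfl).2
  match P, Q with
  | [], [] => simp at h
  | y :: P', [] => simp [pivot, pivotTail]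
  | [], y :: W =>
    obtain ⟨rfl, rfl⟩ := List.cons.inj h
    obtain ⟨W', z, hW⟩ := W.eq_nil_or_concat.resolve_left hD
    rw [List.concat_eq_append] at hW
    subst hW
    have hz := hlast (y :: W') z h
    subst hz
    have e : (y :: (W' ++ [z])).dropLast = y :: W' := by
      rw [← List.cons_append, List.dropLast_concat]
    rw [e]
    simp [pivot, pivotTail, shSum_nil_left]
  | y :: P', z :: W =>
    obtain ⟨rfl, hD'⟩ := List.cons.inj h
    change P' ++ z :: W = D at hD'
    rcases W.eq_nil_or_concat with hW | ⟨W', w, hW⟩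
    · subst hW
      simp only [pivot, pivotTail, List.dropLast_singleton, shSum_nil_right, List.reverse_cons, zero_add,
        sgn_smul_smul, List.cons_append]
      rw [← sgn_one_smul, sgn_smul_smul]
      apply sgn_smul_congr
      rw [← hD']
      simp only [pairSum, lsum_cons, lsum_append, lsum_nil, List.length_cons]
      push_cast; ring_nf
    · rw [List.concat_eq_append] at hW
      subst hW
      have hz := hlast (z :: W') w h
      subst hz
      have e : (z :: (W' ++ [w])).dropLast = z :: W' := by
        rw [← List.cons_append, List.dropLast_concat]
      rw [e]
      simp only [pivot, pivotTail, List.reverse_cons]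
      rw [shSum_concat_concat, smul_add, add_comm, ← sgn_one_smul, sgn_smul_smul, sgn_smul_smul,
        sgn_smul_smul]
      refine congrArg₂ (· + ·) ?_ ?_
      · congr 1
      · simp only [List.cons_append]
        apply sgn_smul_congr
        rw [← hD']
        simp only [pairSum, lsum_cons, lsum_append, lsum_nil, List.length_cons]
        push_cast; ring_nf

lemma lieAdj_rec (F : List V.Idx → k) (n : ℕ) (y₀ x : V.Idx) (C D : List V.Idx)
    (hC : y₀ :: D = C ++ [x]) :
    lieAdj F (n + 1) (y₀ :: D) = lieAdj (fun l => F (l ++ [x])) n C -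
      sgn (V.sdeg y₀ * lsum V.sdeg D) • lieAdj (fun l => F (l ++ [y₀])) n D := by
  rw [lieAdj, lieAdj, lieAdj, Finset.smul_sum, ← Finset.sum_sub_distrib]
  refine Finset.sum_congr rfl fun b _ => ?_
  rw [sum_words_concat, Finset.smul_sum, ← Finset.sum_sub_distrib]
  refine Finset.sum_congr rfl fun B _ => ?_
  simp only [lieCoef_concat, sub_mul, Finset.sum_sub_distrib]
  congr 1
  · rw [hC, Finset.sum_eq_single x]
    · rw [lastCoef_concat, if_pos rfl]; rfl
    · intro i _ hi; rw [lastCoef_concat, if_neg (Ne.symm hi), zero_mul]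
    · simp
  · rw [Finset.sum_eq_single y₀]
    · rw [firstCoef, if_pos rfl, smul_mul_assoc]; rfl
    · intro i _ hi; rw [firstCoef, if_neg (Ne.symm hi), zero_mul]
    · simp

lemma lieAdj_eq_pivot (n : ℕ) (F : List V.Idx → k) (C : List V.Idx) (hC : C.length = n + 1) :
    lieAdj F n C = splitSum (pivot F) C := by
  induction n generalizing F C with
  | zero =>
    match C, hC with
    | [c], _ =>
      simp only [lieAdj, sum_words_zero, splitSum, pivot]
      rw [Finset.sum_eq_single c]
      · simp [lieCoef_nil, shSum_nil_left, pairSum]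
      · intro b _ hb; simp [lieCoef_nil, Ne.symm hb]
      · simp
  | succ n ih =>
    match C, hC with
    | y₀ :: D, hC =>
      simp only [List.length_cons] at hC
      have hD : D ≠ [] := by rintro rfl; simp at hC
      obtain ⟨D', x, hx⟩ := D.eq_nil_or_concat.resolve_left hD
      rw [List.concat_eq_append] at hx
      have hC' : y₀ :: D = (y₀ :: D') ++ [x] := by rw [hx]; rfl
      rw [lieAdj_rec F n y₀ x (y₀ :: D') D hC', ih _ D (by omega), ih _ (y₀ :: D') (by
          have := congrArg List.length hC'; simp at this ⊢; omega),
        splitSum_congr (K := pivot F) (pivot_rec F y₀ x (y₀ :: D') D hC' hD), splitSum_add, sub_eq_add_neg]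
      congr 1
      · rw [hC', splitSum_append_cons]
        have h0 : ∀ (G : List V.Idx → k) (U : List V.Idx), pivot G U [] = 0 := fun _ _ => rfl
        simp only [splitSum, List.dropLast_concat, List.dropLast_nil, h0, add_zero]
      · simp only [splitSum, pivotTail, zero_add]
        change -(DistribSMul.toAddMonoidHom k (sgn (V.sdeg y₀ * lsum V.sdeg D)) (splitSum _ D)) = _
        rw [splitSum_hom]
        exact splitSum_hom (negAddMonoidHom : k →+ k) _ D

lemma pivot_eq {F : List V.Idx → k} (hF : ShVanish V.sdeg F) (U Q : List V.Idx) (hQ : Q ≠ []) :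
    pivot F U Q = F (U ++ Q) := by
  induction U using List.reverseRecOn generalizing Q with
  | nil =>
    match Q, hQ with
    | y :: W, _ => simp [pivot, shSum_nil_left, pairSum]
  | append_singleton U y ih =>
    match Q, hQ with
    | z :: W, _ =>
      have h1 := ih (y :: z :: W) (by simp)
      rw [List.append_assoc, List.singleton_append, ← h1]
      have h2 := hF (y :: U.reverse) (z :: W) (by simp) (by simp)
      rw [shSum_cons_cons] at h2
      simp only [pivot, List.reverse_append, List.reverse_singleton, List.singleton_append]
      rw [eq_neg_of_add_eq_zero_left h2, ← sgn_one_smul, sgn_smul_smul, sgn_smul_smul]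
      apply sgn_smul_congr
      have hr : lsum V.sdeg U.reverse = lsum V.sdeg U := lsum_perm _ (List.reverse_perm U)
      simp only [pairSum_append, pairSum, lsum_cons, lsum_append, lsum_nil, List.length_append,
        List.length_singleton, hr]
      push_cast; ring_nf

/-- The adjoint of the left-normed bracketing multiplies functions which vanish on shuffles by
the length of words. -/
lemma lieAdj_eq {F : List V.Idx → k} (hF : ShVanish V.sdeg F) (n : ℕ) (C : List V.Idx)
    (hC : C.length = n + 1) : lieAdj F n C = ((n : k) + 1) * F C := by
  rw [lieAdj_eq_pivot n F C hC, splitSum_eq_sum_range, Finset.sum_range_succ, List.drop_length,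
    pivot, add_zero, Finset.sum_congr rfl (g := fun _ => F C), Finset.sum_const,
    Finset.card_range, hC, nsmul_eq_mul]
  · push_cast; ring
  · intro l hl
    rw [Finset.mem_range] at hl
    rw [pivot_eq hF _ _ (by simpa using hl), List.take_append_drop]

end LieShuffle

end GInf

namespace GInf

open FormalFn

variable {k : Type u} [Field k] {V : GrSp}

section NormalIndex

/-- The normal monomials, indexed by a symmetric word and a nonempty word. -/
def normalMon (t : List V.Idx × V.Idx × List V.Idx) : GMon V.Idx :=
  GMon.mulWord t.1 (GMon.leftNormed t.2.1 t.2.2)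

variable (V) in
/-- The indices of the normal monomials of weight `w`. -/
def normalIdx (w : ℕ) : Finset (List V.Idx × V.Idx × List V.Idx) :=
  (((Finset.range w).biUnion (words V.Idx)) ×ˢ (Finset.univ ×ˢ
    ((Finset.range w).biUnion (words V.Idx)))).filter
      fun t => t.1.length + t.2.2.length + 1 = w

lemma mem_normalIdx {w : ℕ} {t : List V.Idx × V.Idx × List V.Idx} :
    t ∈ normalIdx V w ↔ t.1.length + t.2.2.length + 1 = w := by
  simp only [normalIdx, Finset.mem_filter, Finset.mem_product, Finset.mem_biUnion,
    Finset.mem_range, mem_words, Finset.mem_univ, true_and, exists_eq_right', and_iff_right_iff_imp]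
  intro h
  omega

lemma normalMon_weight (t : List V.Idx × V.Idx × List V.Idx) :
    (normalMon t).weight = t.1.length + t.2.2.length + 1 := by
  rw [normalMon, GMon.mulWord_weight, GMon.leftNormed_weight, add_assoc]

/-- The coefficients of the expansion of an element of the model in normal monomials. -/
def expandCoef (t : List V.Idx × V.Idx × List V.Idx) : Model k V →ₗ[k] k where
  toFun M := if t.2.2 = [] then ((t.1.length + 1).factorial : k)⁻¹ * M.1.1 (t.1 ++ [t.2.1])
    else (((t.2.2.length : k) + 1) * (t.1.length.factorial : k))⁻¹ * (M.2 (t.2.1 :: t.2.2)).1 t.1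
  map_add' M N := by
    split_ifs
    · exact mul_add _ _ _
    · exact mul_add _ _ _
  map_smul' c M := by
    split_ifs
    · exact mul_left_comm _ c _
    · exact mul_left_comm _ c _

variable (k V) in
/-- The expansion of an element of the model in normal monomials. -/
def expandModel : Model k V →ₗ[k] GSer k V :=
  LinearMap.pi fun m => match m.decode with
    | none => 0
    | some (_, []) => 0
    | some (γ, b :: B) => expandCoef (γ, b, B)

lemma expandModel_normalMon (M : Model k V) (t : List V.Idx × V.Idx × List V.Idx) :
    expandModel k V M (normalMon t) = expandCoef t M := by
  change (match (normalMon t).decode with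
    | none => 0
    | some (_, []) => 0
    | some (γ, b :: B) => expandCoef (γ, b, B) : Model k V →ₗ[k] k) M = _
  rw [normalMon, GMon.decode_mulWord]

lemma normalMon_injective : Function.Injective (normalMon : _ → GMon V.Idx) := by
  intro s t h
  have h' := congrArg GMon.decode h
  rw [normalMon, normalMon, GMon.decode_mulWord, GMon.decode_mulWord] at h'
  simp only [Option.some.injEq, Prod.mk.injEq, List.cons.injEq] at h'
  exact Prod.ext h'.1 (Prod.ext h'.2.1 h'.2.2)

lemma expandModel_eq_zero (M : Model k V) (m : GMon V.Idx) (h : ∀ t, m ≠ normalMon t) :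
    expandModel k V M m = 0 := by
  change (match m.decode with
    | none => 0
    | some (_, []) => 0
    | some (γ, b :: B) => expandCoef (γ, b, B) : Model k V →ₗ[k] k) M = _
  match hd : m.decode with
  | none => rfl
  | some (_, []) => rfl
  | some (γ, b :: B) =>
    obtain ⟨b', C, hB, hm⟩ := GMon.eq_of_decode m _ _ hd
    exact absurd hm (h (γ, b', C))

lemma truncAt_expandModel (w : ℕ) (M : Model k V) :
    truncAt k V w (expandModel k V M) =
      ∑ t ∈ normalIdx V w, expandCoef t M • mono k V (normalMon t) := by
  classical
  funext m
  rw [truncAt_apply, Finset.sum_apply]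
  by_cases hm : ∃ t, m = normalMon t
  · obtain ⟨t, rfl⟩ := hm
    rw [expandModel_normalMon]
    by_cases hw : t ∈ normalIdx V w
    · rw [if_pos (by rw [normalMon_weight]; exact mem_normalIdx.1 hw), Finset.sum_eq_single t]
      · simp [mono_apply]
      · intro s _ hs
        simp [mono_apply, normalMon_injective.ne hs.symm]
      · exact fun h => absurd hw h
    · rw [if_neg (by rw [normalMon_weight]; exact fun h => hw (mem_normalIdx.2 h))]
      refine (Finset.sum_eq_zero fun s hs => ?_).symm
      have : t ≠ s := fun h => hw (h ▸ hs)
      simp [mono_apply, normalMon_injective.ne this]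
  · push Not at hm
    rw [expandModel_eq_zero M m hm, ite_self]
    refine (Finset.sum_eq_zero fun s hs => ?_).symm
    simp [mono_apply, hm s]

lemma sum_normalIdx_sub {N : Type*} [AddCommMonoid N] (F : List V.Idx × V.Idx × List V.Idx → N)
    (p n : ℕ) (h : ∀ t, t ∈ normalIdx V (p + n + 1) → F t ≠ 0 → t.2.2.length = n) :
    ∑ t ∈ normalIdx V (p + n + 1), F t =
      ∑ b, ∑ B ∈ words V.Idx n, ∑ γ ∈ words V.Idx p, F (γ, b, B) := by
  rw [← Finset.sum_subset (s₁ := words V.Idx p ×ˢ (Finset.univ ×ˢ words V.Idx n)),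
    Finset.sum_product_right, Finset.sum_product]
  · intro t ht
    simp only [Finset.mem_product, mem_words, Finset.mem_univ, true_and] at ht
    rw [mem_normalIdx, ht.1, ht.2]
  · intro t ht ht'
    by_contra h0
    have := h t ht h0
    rw [mem_normalIdx] at ht
    refine ht' ?_
    simp only [Finset.mem_product, mem_words, Finset.mem_univ, true_and]
    omega

end NormalIndex

section NormalValues

/-- The value of a monomial multiplied by variables, on words of at least two letters. -/
lemma evalMon_mulWord (γ : List V.Idx) (m : GMon V.Idx) :
    (evalMon k (GMon.mulWord γ m)).1 = fnWord γ * (evalMon k m).1 ∧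
      ∀ C : List V.Idx, 2 ≤ C.length →
        (evalMon k (GMon.mulWord γ m)).2 C = fnWord γ * (evalMon k m).2 C := by
  induction γ with
  | nil => exact ⟨(one_mul _).symm, fun C _ => (one_mul _).symm⟩
  | cons i γ ih =>
    refine ⟨?_, fun C hC => ?_⟩
    · change var i * (evalMon k (GMon.mulWord γ m)).1 = _
      rw [ih.1, ← _root_.mul_assoc]; rfl
    · change WordFn.letter i C * _ + var i * (evalMon k (GMon.mulWord γ m)).2 C = _
      have : C ≠ [i] := by rintro rfl; simp at hC
      rw [ih.2 C hC, WordFn.letter, if_neg this, zero_mul, zero_add, ← _root_.mul_assoc]; rfl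

lemma fnWord_append (γ γ' : List V.Idx) :
    (fnWord (γ ++ γ') : FormalFn k V) = fnWord γ * fnWord γ' := by
  induction γ with
  | nil => exact (one_mul _).symm
  | cons i γ ih => rw [List.cons_append, fnWord_cons, ih, fnWord_cons, _root_.mul_assoc]

lemma evalMon_sym (γ : List V.Idx) (b : V.Idx) :
    (evalMon k (normalMon (γ, b, []))).1 = fnWord (γ ++ [b]) ∧
      ∀ C : List V.Idx, 2 ≤ C.length → (evalMon k (normalMon (γ, b, []))).2 C = 0 := by
  have h := evalMon_mulWord (k := k) γ (.gen b)
  refine ⟨h.1.trans ?_, fun C hC => (h.2 C hC).trans ?_⟩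
  · rw [fnWord_append]
    change _ = fnWord γ * (var b * 1)
    rw [mul_one]; rfl
  · have : C ≠ [b] := by rintro rfl; simp at hC
    change _ * WordFn.letter b C = 0
    rw [WordFn.letter, if_neg this, mul_zero]

lemma evalMon_lie (γ : List V.Idx) (b : V.Idx) (B : List V.Idx) (hB : B ≠ []) :
    (evalMon k (normalMon (γ, b, B))).1 = 0 ∧
      ∀ C : List V.Idx, 2 ≤ C.length →
        (evalMon k (normalMon (γ, b, B))).2 C = lieCoef k b B C • fnWord γ := by
  have h := evalMon_mulWord (k := k) γ (GMon.leftNormed b B)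
  refine ⟨h.1.trans ?_, fun C hC => (h.2 C hC).trans ?_⟩
  · rw [(evalMon_commutator _).1 (GMon.leftNormed_commutatorFactors b B hB).ge, mul_zero]
  · rw [leftNormed_snd, mul_smul_comm, mul_one]

end NormalValues

section Kernel

variable (k V) in
/-- The left multiplications by generators on the quotient with a unit adjoined. -/
def unitalMul (i : V.Idx) : (k × QuotG k V 2) →ₗ[k] (k × QuotG k V 2) :=
  LinearMap.prod 0 (LinearMap.coprod (LinearMap.toSpanSingleton k _ (quotMon k (.gen i)))
    (QuotG.mul k V 2 (quotMon k (.gen i))))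

lemma unitalMul_apply (i : V.Idx) (z : k × QuotG k V 2) : unitalMul k V i z =
    (0, z.1 • quotMon k (.gen i) + QuotG.mul k V 2 (quotMon k (.gen i)) z.2) := rfl

lemma truncAt_of_mem_serFil {n w : ℕ} (h : w < n) {x : GSer k V} (hx : x ∈ serFil k V n) :
    truncAt k V w x = 0 := by
  funext m
  rw [truncAt_apply]
  split_ifs with h1
  · exact hx m (by omega)
  · rfl

/-- A filtered linear map which maps monomials to relations maps all series to relations. -/
lemma mem_relIdeal_of_filtered (T : GSer k V →ₗ[k] GSer k V)
    (hT : ∀ n x, x ∈ serFil k V n → T x ∈ serFil k V n)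
    (h : ∀ m, T (mono k V m) ∈ relIdeal k V 2) (x : GSer k V) : T x ∈ relIdeal k V 2 := by
  intro w
  have h1 := truncAt_of_mem_serFil (Nat.lt_succ_self w) (hT _ _ (sub_sum_mem_serFil (w + 1) x))
  rw [map_sub, map_sub, sub_eq_zero] at h1
  rw [h1]
  have h2 : T (∑ m ∈ monosLT V.Idx (w + 1), x m • mono k V m) ∈ relIdeal k V 2 := by
    rw [map_sum]
    exact sum_mem fun m _ => by rw [map_smul]; exact Submodule.smul_mem _ _ (h m)
  exact h2 w

lemma gen_mul_gen_mul (i j : V.Idx) (q : QuotG k V 2) :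
    QuotG.mul k V 2 (quotMon k (.gen i)) (QuotG.mul k V 2 (quotMon k (.gen j)) q) =
      sgn (V.tdeg i * V.tdeg j) •
        QuotG.mul k V 2 (quotMon k (.gen j)) (QuotG.mul k V 2 (quotMon k (.gen i)) q) := by
  obtain ⟨x, rfl⟩ := (relIdeal k V 2).mkQ_surjective q
  let A : V.Idx → GSer k V →ₗ[k] GSer k V := fun i => serMul k V (mono k V (.gen i))
  have hc : ∀ y : GSer k V, (((sgn (V.tdeg i * V.tdeg j) : ℤ) : k)) • y =
      sgn (V.tdeg i * V.tdeg j) • y := by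
    intro y
    rcases Int.units_eq_one_or (sgn (V.tdeg i * V.tdeg j)) with h | h <;> simp [h]
  have key := mem_relIdeal_of_filtered
    ((A i).comp (A j) - (((sgn (V.tdeg i * V.tdeg j) : ℤ) : k)) • (A j).comp (A i))
    (fun n x hx => sub_mem (serMul_mem_right _ (serMul_mem_right _ hx))
      (Submodule.smul_mem _ _ (serMul_mem_right _ (serMul_mem_right _ hx))))
    (fun m => by
      rw [LinearMap.sub_apply, LinearMap.smul_apply, hc]
      change serMul k V _ (serMul k V _ _) - _ • serMul k V _ (serMul k V _ _) ∈ _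
      rw [serMul_mono, serMul_mono, serMul_mono, serMul_mono, ← Submodule.Quotient.mk_eq_zero]
      change (relIdeal k V 2).mkQ _ = 0
      rw [map_sub, sgn_smul_map, sub_eq_zero]
      change quotMon k _ = _ • quotMon k _
      rw [← quotMon_assoc, ← quotMon_assoc, quotMon_mul, quotMon_comm, quotMon_mul (.mul _ _),
        sgn_smul_map]
      rfl) x
  rw [LinearMap.sub_apply, LinearMap.smul_apply, hc, ← Submodule.Quotient.mk_eq_zero] at key
  change (relIdeal k V 2).mkQ _ = 0 at key
  rw [map_sub, sgn_smul_map, sub_eq_zero] at key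
  exact key

lemma unitalMul_comm (i j : V.Idx) (z : k × QuotG k V 2) :
    unitalMul k V i (unitalMul k V j z) =
      sgn (V.tdeg i * V.tdeg j) • unitalMul k V j (unitalMul k V i z) := by
  simp only [unitalMul_apply, zero_smul, zero_add, map_add, map_smul]
  refine Prod.ext ?_ ?_
  · change (0 : k) = sgn _ • 0
    rw [smul_zero]
  · change _ = sgn _ • ((_ : QuotG k V 2) + (_ : QuotG k V 2))
    rw [gen_mul_gen_mul, ← quotMon_mul, quotMon_comm, quotMon_mul, smul_comm, smul_add]
    rfl

lemma opWord_smul {Z : Type*} [AddCommGroup Z] [Module k Z] (L : V.Idx → Z →ₗ[k] Z)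
    (γ : List V.Idx) (c : k) (z : Z) : opWord L γ (c • z) = c • opWord L γ z := by
  induction γ with
  | nil => rfl
  | cons i γ ih => rw [opWord_cons, ih, map_smul]; rfl

lemma opWord_sum {Z : Type*} [AddCommGroup Z] [Module k Z] (L : V.Idx → Z →ₗ[k] Z)
    (γ : List V.Idx) {ι : Type*} (s : Finset ι) (z : ι → Z) :
    opWord L γ (∑ i ∈ s, z i) = ∑ i ∈ s, opWord L γ (z i) := by
  induction γ with
  | nil => rfl
  | cons i γ ih => rw [opWord_cons, ih, map_sum]; rfl

lemma opWord_unitalMul (γ : List V.Idx) (q : QuotG k V 2) :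
    opWord (unitalMul k V) γ (0, q) =
      (0, opWord (fun i => QuotG.mul k V 2 (quotMon k (.gen i))) γ q) := by
  induction γ with
  | nil => rfl
  | cons i γ ih => rw [opWord_cons, ih, unitalMul_apply, zero_smul, zero_add]; rfl

lemma opWord_quotMon (γ : List V.Idx) (m : GMon V.Idx) :
    opWord (fun i => QuotG.mul k V 2 (quotMon k (.gen i))) γ (quotMon k m) =
      quotMon k (GMon.mulWord γ m) := by
  induction γ with
  | nil => rfl
  | cons i γ ih => rw [opWord_cons, ih, GMon.mulWord_cons, quotMon_mul]

lemma opWord_unitalMul_one (γ : List V.Idx) (b : V.Idx) :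
    opWord (unitalMul k V) (γ ++ [b]) (1, 0) = (0, quotMon k (normalMon (γ, b, []))) := by
  rw [opWord_append]
  have : opWord (unitalMul k V) [b] (1, 0) = (0, quotMon k (.gen b)) := by
    change unitalMul k V b (1, 0) = _
    rw [unitalMul_apply]; simp
  rw [this, opWord_unitalMul, opWord_quotMon]; rfl

variable (k V) in
/-- The reconstruction of a class from its value in the model, in weight `w`. -/
def reconstruct (w : ℕ) : Model k V →ₗ[k] QuotG k V 2 :=
  (relIdeal k V 2).mkQ ∘ₗ truncAt k V w ∘ₗ expandModel k V

lemma reconstruct_apply (w : ℕ) (M : Model k V) : reconstruct k V w M =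
    ∑ t ∈ normalIdx V w, expandCoef t M • quotMon k (normalMon t) := by
  change (relIdeal k V 2).mkQ (truncAt k V w (expandModel k V M)) = _
  rw [truncAt_expandModel, map_sum]
  exact Finset.sum_congr rfl fun t _ => map_smul _ _ _

lemma reconstruct_sym [CharZero k] (γ : List V.Idx) (b : V.Idx) :
    reconstruct k V (γ.length + 0 + 1) (evalMon k (normalMon (γ, b, []))) =
      quotMon k (normalMon (γ, b, [])) := by
  have h := evalMon_sym (k := k) γ b
  rw [reconstruct_apply, sum_normalIdx_sub _ γ.length 0]
  · simp only [sum_words_zero, expandCoef, LinearMap.coe_mk, AddHom.coe_mk, if_true, h.1]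
    have h1 := congrArg Prod.snd (theta_fnWord (unitalMul k V) unitalMul_comm (γ ++ [b]) (1, 0))
    rw [opWord_unitalMul_one, theta_apply] at h1
    simp only [List.length_append, List.length_singleton] at h1
    rw [sum_words_concat] at h1
    simp only [opWord_unitalMul_one, Prod.snd_sum, Prod.smul_snd] at h1
    rw [Finset.sum_comm]
    have h2 : ∀ γ' ∈ words V.Idx γ.length, ∑ b', (((γ'.length + 1).factorial : k)⁻¹ *
        (fnWord (γ ++ [b]) : FormalFn k V).1 (γ' ++ [b'])) • quotMon k (normalMon (γ', b', [])) =
        ((γ.length + 1).factorial : k)⁻¹ • ∑ b', (fnWord (γ ++ [b]) : FormalFn k V).1 (γ' ++ [b']) •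
          quotMon k (normalMon (γ', b', [])) := by
      intro γ' hγ'
      rw [Finset.smul_sum, mem_words.1 hγ']
      exact Finset.sum_congr rfl fun b' _ => mul_smul _ _ _
    rw [Finset.sum_congr rfl h2, ← Finset.smul_sum, h1, smul_smul, inv_mul_cancel₀, one_smul]
    exact_mod_cast (Nat.factorial_pos _).ne'
  · intro t ht h0
    by_contra hn
    refine h0 ?_
    have hB : t.2.2 ≠ [] := fun e => hn (by rw [e]; rfl)
    simp only [expandCoef, LinearMap.coe_mk, AddHom.coe_mk, if_neg hB]
    rw [h.2 _ (by have := List.length_pos_iff.2 hB; simp; omega)]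
    change (_ * (0 : k)) • _ = _
    rw [mul_zero, zero_smul]

lemma reconstruct_lie [CharZero k] (γ : List V.Idx) (b : V.Idx) (B : List V.Idx) (hB : B ≠ []) :
    reconstruct k V (γ.length + B.length + 1) (evalMon k (normalMon (γ, b, B))) =
      quotMon k (normalMon (γ, b, B)) := by
  have h := evalMon_lie (k := k) γ b B hB
  have hlen := List.length_pos_iff.2 hB
  rw [reconstruct_apply, sum_normalIdx_sub]
  · have h1 : ∀ b', ∀ B' ∈ words V.Idx B.length, ∑ γ' ∈ words V.Idx γ.length,
        expandCoef (γ', b', B') (evalMon k (normalMon (γ, b, B))) • quotMon k (normalMon (γ', b', B')) =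
        ((B.length : k) + 1)⁻¹ • opWord (fun i => QuotG.mul k V 2 (quotMon k (.gen i))) γ
          (lieCoef k b B (b' :: B') • lieClass k (b' :: B')) := by
      intro b' B' hB'
      rw [mem_words] at hB'
      have hne : B' ≠ [] := List.length_pos_iff.1 (by omega)
      have h2 : ∀ γ' ∈ words V.Idx γ.length,
          expandCoef (γ', b', B') (evalMon k (normalMon (γ, b, B))) •
            quotMon k (normalMon (γ', b', B')) =
          (((B.length : k) + 1) * (γ.length.factorial : k))⁻¹ •
            ((lieCoef k b B (b' :: B')) • ((fnWord γ : FormalFn k V).1 γ' •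
              opWord (fun i => QuotG.mul k V 2 (quotMon k (.gen i))) γ' (lieClass k (b' :: B')))) := by
        intro γ' hγ'
        rw [mem_words] at hγ'
        simp only [expandCoef, LinearMap.coe_mk, AddHom.coe_mk, if_neg hne, hγ', hB']
        rw [h.2 _ (by simp; omega), lieClass, opWord_quotMon, smul_smul, smul_smul, mul_assoc]
        rfl
      rw [Finset.sum_congr rfl h2, ← Finset.smul_sum, ← Finset.smul_sum, ← theta_apply,
        theta_fnWord _ gen_mul_gen_mul]
      rw [opWord_smul, smul_comm (lieCoef k b B (b' :: B')), smul_smul, mul_inv, mul_assoc, inv_mul_cancel₀,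
        mul_one]
      exact_mod_cast (Nat.factorial_pos _).ne'
    rw [Finset.sum_congr rfl fun b' _ => Finset.sum_congr rfl (h1 b')]
    simp only [← Finset.smul_sum, ← opWord_sum]
    rw [← sum_words_succ B.length (fun C => lieCoef k b B C • lieClass k C), sum_lieCoef_lieClass]
    rw [opWord_smul, smul_smul, inv_mul_cancel₀, one_smul, lieClass, opWord_quotMon]
    · rfl
    · exact_mod_cast Nat.succ_ne_zero B.length
  · intro t ht h0
    have hne : t.2.2 ≠ [] := by
      intro e
      refine h0 ?_
      simp only [expandCoef, LinearMap.coe_mk, AddHom.coe_mk, if_pos e]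
      rw [h.1]
      change (_ * (0 : k)) • _ = _
      rw [mul_zero, zero_smul]
    have hl := List.length_pos_iff.2 hne
    have h5 : lieCoef k b B (t.2.1 :: t.2.2) ≠ 0 := by
      intro e
      refine h0 ?_
      simp only [expandCoef, LinearMap.coe_mk, AddHom.coe_mk, if_neg hne]
      rw [h.2 _ (by simp; omega), e, zero_smul]
      change (_ * (0 : k)) • _ = _
      rw [mul_zero, zero_smul]
    have := lieCoef_length h5
    simpa using this

lemma reconstruct_evalQuot [CharZero k] {w : ℕ} {q : QuotG k V 2} (hq : q ∈ normalSpan k V w) :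
    reconstruct k V w (evalQuot k V q) = q := by
  have : normalSpan k V w ≤ LinearMap.eqLocus
      (reconstruct k V w ∘ₗ evalQuot k V) LinearMap.id := by
    refine Submodule.span_le.2 ?_
    rintro q ⟨γ, b, B, hw, rfl⟩
    change reconstruct k V w (evalQuot k V (quotMon k (normalMon (γ, b, B)))) =
      quotMon k (normalMon (γ, b, B))
    have he : evalQuot k V (quotMon k (normalMon (γ, b, B))) = evalMon k (normalMon (γ, b, B)) :=
      evalSer_mono _
    rw [he]
    subst hw
    by_cases hB : B = []
    · subst hB; exact reconstruct_sym γ b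
    · exact reconstruct_lie γ b B hB
  exact this hq

lemma truncAt_eq_sum (w : ℕ) (x : GSer k V) :
    truncAt k V w x = ∑ m ∈ (monosLT V.Idx (w + 1)).filter (fun m => m.weight = w),
      x m • mono k V m := by
  classical
  funext m
  rw [truncAt_apply, Finset.sum_apply]
  split_ifs with h
  · rw [Finset.sum_eq_single m]
    · simp [mono_apply]
    · intro m' _ hne; simp [mono_apply, hne.symm]
    · intro hn
      exact absurd (Finset.mem_filter.2 ⟨mem_monosLT.2 (by omega), h⟩) hn
  · refine (Finset.sum_eq_zero fun m' hm' => ?_).symm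
    have : m ≠ m' := by
      rintro rfl
      exact h (Finset.mem_filter.1 hm').2
    simp [mono_apply, this]

lemma evalSer_truncAt (w : ℕ) (x : GSer k V) :
    (∀ γ : List V.Idx, (evalSer k V (truncAt k V w x)).1.1 γ =
      if γ.length = w then (evalSer k V x).1.1 γ else 0) ∧
    ∀ B γ : List V.Idx, ((evalSer k V (truncAt k V w x)).2 B).1 γ =
      if B.length + γ.length = w then ((evalSer k V x).2 B).1 γ else 0 := by
  refine ⟨fun γ => ?_, fun B γ => ?_⟩
  · rw [evalSer_fst, evalSer_fst, extendSer_apply, extendSer_apply]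
    split_ifs with h
    · refine Finset.sum_congr rfl fun m _ => ?_
      rw [truncAt_apply]
      by_cases h0 : (evalMon k m).1.1 γ = 0
      · rw [h0, mul_zero, mul_zero]
      · have := (evalMon_weight m).1 γ h0
        rw [lsum_one] at this
        rw [if_pos (by omega)]
    · refine Finset.sum_eq_zero fun m _ => ?_
      rw [truncAt_apply]
      by_cases h0 : (evalMon k m).1.1 γ = 0
      · rw [h0, mul_zero]
      · have := (evalMon_weight m).1 γ h0
        rw [lsum_one] at this
        rw [if_neg (by omega), zero_mul]
  · rw [evalSer_snd, evalSer_snd, extendSer_apply, extendSer_apply]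
    split_ifs with h
    · refine Finset.sum_congr rfl fun m _ => ?_
      rw [truncAt_apply]
      by_cases h0 : ((evalMon k m).2 B).1 γ = 0
      · rw [h0, mul_zero, mul_zero]
      · have := (evalMon_weight m).2 B γ h0
        rw [lsum_one, lsum_one] at this
        rw [if_pos (by omega)]
    · refine Finset.sum_eq_zero fun m _ => ?_
      rw [truncAt_apply]
      by_cases h0 : ((evalMon k m).2 B).1 γ = 0
      · rw [h0, mul_zero]
      · have := (evalMon_weight m).2 B γ h0
        rw [lsum_one, lsum_one] at this
        rw [if_neg (by omega), zero_mul]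

lemma mk_truncAt_mem (w : ℕ) (x : GSer k V) :
    (relIdeal k V 2).mkQ (truncAt k V w x) ∈ normalSpan k V w := by
  rw [truncAt_eq_sum, map_sum]
  refine sum_mem fun m hm => ?_
  rw [map_smul]
  have := quotMon_mem (k := k) m
  rw [(Finset.mem_filter.1 hm).2] at this
  exact Submodule.smul_mem _ _ this

lemma truncAt_truncAt (w : ℕ) (x : GSer k V) :
    truncAt k V w (truncAt k V w x) = truncAt k V w x := by
  funext m
  simp only [truncAt_apply]
  split_ifs <;> rfl

/-- The model is faithful. -/
theorem ker_evalSer [CharZero k] : LinearMap.ker (evalSer k V) = relIdeal k V 2 := by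
  refine le_antisymm (fun x hx w => ?_) relIdeal_le_ker
  rw [LinearMap.mem_ker] at hx
  have h0 : evalSer k V (truncAt k V w x) = 0 := by
    have h := evalSer_truncAt w x
    rw [hx] at h
    refine Prod.ext (FormalFn.ext' fun γ => (h.1 γ).trans (ite_self _))
      (funext fun B => FormalFn.ext' fun γ => (h.2 B γ).trans (ite_self _))
  have h1 := reconstruct_evalQuot (mk_truncAt_mem w x)
  rw [evalQuot_mk, h0, map_zero] at h1
  have h2 := (Submodule.Quotient.mk_eq_zero _).1 h1.symm w
  rwa [truncAt_truncAt] at h2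

end Kernel

end GInf

namespace GInf

open FormalFn

variable {k : Type u} [Field k] {V : GrSp}

section Reconstruction

variable (k V) in
/-- The elements of the model whose coefficients vanish on shuffles. -/
def Model.primitive : Submodule k (Model k V) where
  carrier := {M | ∀ γ, ShVanish V.sdeg fun B => (M.2 B).1 γ}
  add_mem' {M N} hM hN γ A C hA hC := by
    have h := shSum_sub V.sdeg (fun B => (M.2 B).1 γ) (fun B => -(N.2 B).1 γ) A C
    have h' := shSum_sub V.sdeg (fun _ => (0 : k)) (fun B => (N.2 B).1 γ) A C
    simp only [sub_neg_eq_add, zero_sub] at h h'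
    refine h.trans ?_
    rw [h', hM γ A C hA hC, hN γ A C hA hC, shSum_zero]
    simp
  zero_mem' γ A C _ _ := shSum_zero _ _ _
  smul_mem' c M hM γ A C hA hC := by
    have h := shSum_hom V.sdeg (AddMonoidHom.mulLeft c) (fun B => (M.2 B).1 γ) A C
    rw [hM γ A C hA hC, map_zero] at h
    exact h.symm

lemma Model.primitive_closed (M : Model k V)
    (h : ∀ n, ∃ N ∈ primitive k V, M - N ∈ Model.fil k V n) : M ∈ primitive k V := by
  intro γ A C hA hC
  obtain ⟨N, hN, hf⟩ := h (A.length + C.length + γ.length + 1)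
  rw [← hN γ A C hA hC]
  exact shSum_congr _ fun l hl => sub_eq_zero.1 (hf.2 l γ (by omega))

lemma normalMon_primitive (t : List V.Idx × V.Idx × List V.Idx) :
    evalMon k (normalMon t) ∈ Model.primitive k V := by
  obtain ⟨γ, b, B⟩ := t
  intro γ' A C hA hC
  have hA' := List.length_pos_iff.2 hA
  have hC' := List.length_pos_iff.2 hC
  by_cases hB : B = []
  · subst hB
    refine Eq.trans (shSum_congr V.sdeg (G := fun _ => 0) fun l hl => ?_) (shSum_zero _ _ _)
    rw [(evalMon_sym γ b).2 l (by omega)]; rfl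
  · refine Eq.trans (shSum_congr V.sdeg
      (G := fun l => AddMonoidHom.mulRight ((fnWord γ : FormalFn k V).1 γ') (lieCoef k b B l))
      fun l hl => ?_) ?_
    · rw [(evalMon_lie γ b B hB).2 l (by omega)]; rfl
    · rw [← shSum_hom, lieCoef_shVanish b B A C hA hC, map_zero]

lemma evalSer_primitive (x : GSer k V) : evalSer k V x ∈ Model.primitive k V := by
  refine evalSer_mem _ Model.primitive_closed x fun m _ => ?_
  have h : normalSpan k V m.weight ≤ (Model.primitive k V).comap (evalQuot k V) := by
    refine Submodule.span_le.2 ?_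
    rintro q ⟨γ, b, B, hw, rfl⟩
    have he : evalQuot k V (quotMon k (normalMon (γ, b, B))) = evalMon k (normalMon (γ, b, B)) :=
      evalSer_mono _
    change evalQuot k V (quotMon k (normalMon (γ, b, B))) ∈ Model.primitive k V
    rw [he]
    exact normalMon_primitive _
  have := h (quotMon_mem m)
  rw [← evalSer_mono]
  exact this

lemma evalSer_truncAt_expandModel (w : ℕ) (M : Model k V) :
    evalSer k V (truncAt k V w (expandModel k V M)) =
      ∑ t ∈ normalIdx V w, expandCoef t M • evalMon k (normalMon t) := by
  rw [truncAt_expandModel, map_sum]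
  exact Finset.sum_congr rfl fun t _ => by rw [map_smul, evalSer_mono]

/-- The elements of the model in the image of the `G`-algebra are determined. -/
theorem evalSer_expandModel [CharZero k] {M : Model k V} (ht : M ∈ Model.tame k V)
    (hp : M ∈ Model.primitive k V) : evalSer k V (expandModel k V M) = M := by
  have ht' := evalSer_tame (expandModel k V M)
  have h1 : (evalSer k V (expandModel k V M)).1 = M.1 := by
    ext γ
    rcases γ.eq_nil_or_concat with h | ⟨γ, a, h⟩
    · rw [h, ht.1, ht'.1]
    · rw [List.concat_eq_append] at h
      have hl : γ ++ [a] = γ ++ [a] := rfl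
      have e := (evalSer_truncAt (γ.length + 0 + 1) (expandModel k V M)).1 (γ ++ [a])
      rw [if_pos (by simp), evalSer_truncAt_expandModel] at e
      rw [h, ← e]
      have e2 : (∑ t ∈ normalIdx V (γ.length + 0 + 1),
          expandCoef t M • evalMon k (normalMon t)).1.1 (γ ++ [a]) =
          ∑ t ∈ normalIdx V (γ.length + 0 + 1),
            expandCoef t M * (evalMon k (normalMon t)).1.1 (γ ++ [a]) := by
        rw [Prod.fst_sum, FormalFn.sum_apply]; rfl
      rw [e2, sum_normalIdx_sub _ γ.length 0]
      · simp only [sum_words_zero, (evalMon_sym (k := k) _ _).1]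
        rw [Finset.sum_comm]
        have h3 := sum_fnWord M.1 (γ ++ [a])
        simp only [List.length_append, List.length_singleton] at h3
        rw [sum_words_concat] at h3
        have h4 : ∀ γ' ∈ words V.Idx γ.length, ∑ b, expandCoef (γ', b, []) M *
            (fnWord (γ' ++ [b]) : FormalFn k V).1 (γ ++ [a]) =
            ((γ.length + 1).factorial : k)⁻¹ * ∑ b, M.1.1 (γ' ++ [b]) *
              (fnWord (γ' ++ [b]) : FormalFn k V).1 (γ ++ [a]) := by
          intro γ' hγ'
          rw [Finset.mul_sum]
          refine Finset.sum_congr rfl fun b _ => ?_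
          simp only [expandCoef, LinearMap.coe_mk, AddHom.coe_mk, if_true, mem_words.1 hγ']
          ring
        rw [Finset.sum_congr rfl h4, ← Finset.mul_sum, h3, inv_mul_cancel_left₀]
        exact_mod_cast (Nat.factorial_pos _).ne'
      · intro t _ h0
        by_contra hn
        refine h0 ?_
        rw [show t = (t.1, t.2.1, t.2.2) from rfl,
          (evalMon_lie t.1 t.2.1 t.2.2 (fun e => hn (by rw [e]; rfl))).1]
        exact mul_zero _
  refine Prod.ext h1 (funext fun B => ?_)
  match B with
  | [] => rw [ht.2.1, ht'.2.1]
  | [j] => rw [ht.2.2, ht'.2.2, h1]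
  | x :: y :: C =>
    ext γ
    set B := x :: y :: C with hB
    have hBl : B.length = C.length + 1 + 1 := rfl
    have e := (evalSer_truncAt (γ.length + (C.length + 1) + 1) (expandModel k V M)).2 B γ
    rw [if_pos (by omega), evalSer_truncAt_expandModel] at e
    rw [← e]
    have e2 : ((∑ t ∈ normalIdx V (γ.length + (C.length + 1) + 1),
        expandCoef t M • evalMon k (normalMon t)).2 B).1 γ =
        ∑ t ∈ normalIdx V (γ.length + (C.length + 1) + 1),
          expandCoef t M * ((evalMon k (normalMon t)).2 B).1 γ := by
      rw [Prod.snd_sum, Finset.sum_apply, FormalFn.sum_apply]; rfl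
    rw [e2, sum_normalIdx_sub _ γ.length (C.length + 1)]
    · have h4 : ∀ b, ∀ B' ∈ words V.Idx (C.length + 1), ∑ γ' ∈ words V.Idx γ.length,
          expandCoef (γ', b, B') M * ((evalMon k (normalMon (γ', b, B'))).2 B).1 γ =
          (((C.length + 1 : ℕ) : k) + 1)⁻¹ * (lieCoef k b B' B * (M.2 (b :: B')).1 γ) := by
        intro b B' hB'
        rw [mem_words] at hB'
        have hne : B' ≠ [] := List.length_pos_iff.1 (by omega)
        have h5 : ∀ γ' ∈ words V.Idx γ.length,
            expandCoef (γ', b, B') M * ((evalMon k (normalMon (γ', b, B'))).2 B).1 γ =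
            ((((C.length + 1 : ℕ) : k) + 1)⁻¹ * (γ.length.factorial : k)⁻¹ * lieCoef k b B' B) *
              ((M.2 (b :: B')).1 γ' * (fnWord γ' : FormalFn k V).1 γ) := by
          intro γ' hγ'
          rw [(evalMon_lie γ' b B' hne).2 B (by omega)]
          simp only [expandCoef, LinearMap.coe_mk, AddHom.coe_mk, if_neg hne, mem_words.1 hγ', hB',
            mul_inv]
          change _ * (lieCoef k b B' B * (fnWord γ' : FormalFn k V).1 γ) = _
          ring
        rw [Finset.sum_congr rfl h5, ← Finset.mul_sum, sum_fnWord]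
        have : (γ.length.factorial : k) ≠ 0 := by exact_mod_cast (Nat.factorial_pos _).ne'
        field_simp
      rw [Finset.sum_congr rfl fun b _ => Finset.sum_congr rfl (h4 b)]
      simp only [← Finset.mul_sum]
      have h6 := lieAdj_eq (hp γ) (C.length + 1) B hBl
      rw [lieAdj] at h6
      rw [h6, inv_mul_cancel_left₀]
      exact_mod_cast Nat.succ_ne_zero (C.length + 1)
    · intro t _ h0
      by_contra hn
      refine h0 ?_
      rw [show t = (t.1, t.2.1, t.2.2) from rfl]
      by_cases hT : t.2.2 = []
      · rw [hT, (evalMon_sym t.1 t.2.1).2 B (by omega)]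
        exact mul_zero _
      · rw [(evalMon_lie t.1 t.2.1 t.2.2 hT).2 B (by omega)]
        have h7 : lieCoef k t.2.1 t.2.2 B = 0 := by
          by_contra h8
          have := lieCoef_length h8
          omega
        rw [h7, zero_smul]
        exact mul_zero _

end Reconstruction

section CoeffModel

/-- The elements of the model which correspond to a system of coefficients. -/
def Coeffs.Admissible.model {c : Coeffs k V} (h : c.Admissible) (α : V.Idx) : Model k V :=
  (h.fn α [], fun B => match B with
    | [] => 0
    | [j] => tw (V.tdeg j) (pd j (h.fn α []))
    | x :: y :: B => -(sgn (V.sdeg α * (1 + lsum V.sdeg (x :: y :: B)) +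
        pairSum V.sdeg (x :: y :: B)) • h.fn α (x :: y :: B)))

lemma pairSum_perm {X : Type*} (d : X → ℤ) {l l' : List X} (h : l.Perm l') :
    pairSum d l = pairSum d l' := by
  induction h with
  | nil => rfl
  | cons x h ih => simp only [pairSum, ih, lsum_perm d h]
  | swap x y l => simp only [pairSum, lsum_cons]; ring
  | trans _ _ h1 h2 => rw [h1, h2]

lemma Coeffs.Admissible.model_tame {c : Coeffs k V} (h : c.Admissible) (α : V.Idx) :
    h.model α ∈ Model.tame k V := ⟨h.no_constant α, rfl, fun _ => rfl⟩

lemma Coeffs.Admissible.model_snd {c : Coeffs k V} (h : c.Admissible) (α : V.Idx)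
    (B : List V.Idx) (hB : 2 ≤ B.length) : (h.model α).2 B =
      -(sgn (V.sdeg α * (1 + lsum V.sdeg B) + pairSum V.sdeg B) • h.fn α B) := by
  match B, hB with
  | _ :: _ :: _, _ => rfl

lemma shVanish_twist {X M : Type*} [AddCommGroup M] {d : X → ℤ} (F G : List X → M)
    (s : List X → ℤ) (hs : ∀ l l', l.Perm l' → s l = s l')
    (h : ∀ l, 2 ≤ l.length → G l = sgn (s l) • F l) (A C : List X) (hA : A ≠ []) (hC : C ≠ [])
    (hF : shSum d F A C = 0) : shSum d G A C = 0 := by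
  have hA' := List.length_pos_iff.2 hA
  have hC' := List.length_pos_iff.2 hC
  have := shSum_congr_perm d (F := G) (G := fun l => sgn (s (A ++ C)) • F l) (A := A) (C := C)
    fun l hl => by
      rw [h l (by rw [hl.length_eq, List.length_append]; omega), hs l _ hl]
  rw [this, shSum_sgn_smul, hF, smul_zero]

lemma Coeffs.Admissible.model_primitive {c : Coeffs k V} (h : c.Admissible) (α : V.Idx) :
    h.model α ∈ Model.primitive k V := by
  intro γ A C hA hC
  refine shVanish_twist (fun l => c α l γ) _
    (fun B => 1 + (V.sdeg α * (1 + lsum V.sdeg B) + pairSum V.sdeg B))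
    (fun l l' hl => by rw [lsum_perm _ hl, pairSum_perm _ hl]) (fun l hl => ?_) A C hA hC
    (h.shuffle α A C γ hA hC)
  rw [h.model_snd α l hl]
  change -(sgn _ • c α l γ) = _
  rw [← sgn_one_smul, sgn_smul_smul]

lemma Coeffs.Admissible.expand_eq {c : Coeffs k V} (h : c.Admissible) (α : V.Idx) :
    c.expand α = expandModel k V (h.model α) := by
  funext m
  change _ = (match m.decode with
    | none => 0
    | some (_, []) => 0
    | some (γ, b :: B) => expandCoef (γ, b, B) : Model k V →ₗ[k] k) (h.model α)
  rw [Coeffs.expand]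
  match m.decode with
  | none => rfl
  | some (_, []) => rfl
  | some (γ, [b]) => rfl
  | some (γ, b :: b' :: B) =>
    change -(sgn _ • _) = (((b' :: B).length + 1 : k) * _)⁻¹ * -(sgn _ • c α (b :: b' :: B) γ)
    rw [mul_neg, mul_smul_comm, List.length_cons (a := b)]
    push_cast
    rfl

lemma Coeffs.Admissible.evalSer_expand [CharZero k] {c : Coeffs k V} (h : c.Admissible)
    (α : V.Idx) : evalSer k V (c.expand α) = h.model α := by
  rw [h.expand_eq, evalSer_expandModel (h.model_tame α) (h.model_primitive α)]

lemma evalQuot_injective [CharZero k] : Function.Injective (evalQuot k V) := by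
  rw [← LinearMap.ker_eq_bot, evalQuot, Submodule.ker_liftQ_eq_bot]
  rw [ker_evalSer]

/-- Every family of classes is described by an admissible system of coefficients. -/
lemma exists_admissible [CharZero k] (q : V.Idx → QuotG k V 2) :
    ∃ c : Coeffs k V, c.Admissible ∧ ∀ α, q α = (relIdeal k V 2).mkQ (c.expand α) := by
  choose x hx using fun α => (relIdeal k V 2).mkQ_surjective (q α)
  let c : Coeffs k V := fun α B => match B with
    | [] => (evalSer k V (x α)).1.1
    | [_] => 0
    | a :: b :: B => fun γ => -(sgn (V.sdeg α * (1 + lsum V.sdeg (a :: b :: B)) +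
        pairSum V.sdeg (a :: b :: B)) • ((evalSer k V (x α)).2 (a :: b :: B)).1 γ)
  have hc : ∀ α B γ, 2 ≤ B.length → c α B γ = sgn (1 + (V.sdeg α * (1 + lsum V.sdeg B) +
        pairSum V.sdeg B)) • ((evalSer k V (x α)).2 B).1 γ := by
    intro α B γ hB
    match B, hB with
    | a :: b :: B, _ => rw [← sgn_smul_smul, sgn_one_smul]
  have hadm : c.Admissible := by
    refine ⟨fun α B A a b C => ?_, fun α => (evalSer_tame (x α)).1, fun _ _ _ => rfl,
      fun α A C γ hA hC => ?_⟩
    · match B with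
      | [] => exact (evalSer k V (x α)).1.2 A a b C
      | [_] => change (0 : k) = _ • (0 : k); rw [smul_zero]
      | x₁ :: x₂ :: B =>
        have e1 := hc α (x₁ :: x₂ :: B) (A ++ a :: b :: C) (by simp)
        have e2 := hc α (x₁ :: x₂ :: B) (A ++ b :: a :: C) (by simp)
        rw [((evalSer k V (x α)).2 _).2 A a b C, smul_comm] at e1
        exact e1.trans (congrArg _ e2.symm)
    · exact shVanish_twist (fun l => ((evalSer k V (x α)).2 l).1 γ) _
        (fun B => 1 + (V.sdeg α * (1 + lsum V.sdeg B) + pairSum V.sdeg B))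
        (fun l l' hl => by rw [lsum_perm _ hl, pairSum_perm _ hl])
        (fun l hl => hc α l γ hl) A C hA hC (evalSer_primitive (x α) γ A C hA hC)
  refine ⟨c, hadm, fun α => evalQuot_injective ?_⟩
  rw [← hx α, evalQuot_mk, evalQuot_mk, hadm.evalSer_expand]
  refine Prod.ext rfl (funext fun B => ?_)
  match B with
  | [] => exact (evalSer_tame (x α)).2.1
  | [j] => exact (evalSer_tame (x α)).2.2 j
  | a :: b :: B =>
    ext γ
    change _ = -(sgn _ • -(sgn _ • ((evalSer k V (x α)).2 (a :: b :: B)).1 γ))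
    rw [smul_neg, neg_neg, sgn_smul_self]

/-- Admissible systems of coefficients are determined by their expansions. -/
lemma Coeffs.Admissible.eq_of_expand [CharZero k] {c c' : Coeffs k V} (h : c.Admissible)
    (h' : c'.Admissible)
    (he : ∀ α, (relIdeal k V 2).mkQ (c.expand α) = (relIdeal k V 2).mkQ (c'.expand α)) :
    c = c' := by
  funext α B γ
  have h1 := congrArg (evalQuot k V) (he α)
  rw [evalQuot_mk, evalQuot_mk, h.evalSer_expand, h'.evalSer_expand] at h1
  match B with
  | [] => exact congrArg (fun M : Model k V => M.1.1 γ) h1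
  | [_] => rw [h.no_single, h'.no_single]
  | x :: y :: B =>
    have h2 := congrArg (fun M : Model k V => (M.2 (x :: y :: B)).1 γ) h1
    simp only [h.model_snd α (x :: y :: B) (by simp), h'.model_snd α (x :: y :: B) (by simp)] at h2
    have h3 := congrArg (fun z : k => sgn (V.sdeg α * (1 + lsum V.sdeg (x :: y :: B)) +
      pairSum V.sdeg (x :: y :: B)) • -z) h2
    change sgn _ • -(-(sgn _ • c α (x :: y :: B) γ)) =
      sgn _ • -(-(sgn _ • c' α (x :: y :: B) γ)) at h3
    rwa [neg_neg, neg_neg, sgn_smul_self, sgn_smul_self] at h3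

end CoeffModel

end GInf

namespace GInf

open FormalFn

variable {k : Type u} [Field k] {V : GrSp}

lemma sgn_succ_smul {M : Type*} [AddCommGroup M] (n : ℤ) (x : M) :
    sgn (n + 1) • x = -(sgn n • x) := by
  rw [← sgn_one_smul, sgn_smul_smul, add_comm]

namespace WordFn

/-- The operator which replaces letters by series of words. -/
def ins (ξ : V.Idx → WordFn k V) : WordFn k V →ₗ[k] WordFn k V where
  toFun ω B := blockSum (fun P Q R => ∑ β, sgn (lsum V.sdeg P) •
    (tw 1 (ω (P ++ β :: R)) * tw (lsum V.sdeg P) (ξ β Q))) B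
  map_add' ω η := by
    funext B
    simp only [Pi.add_apply, map_add, add_mul, smul_add, Finset.sum_add_distrib, blockSum_add]
  map_smul' c ω := by
    funext B
    refine Eq.trans ?_ (blockSum_hom (DistribSMul.toAddMonoidHom _ c) _ B).symm
    refine blockSum_congr fun P Q R _ _ => ?_
    change _ = c • ∑ β : V.Idx, (_ : FormalFn k V)
    rw [Finset.smul_sum]
    refine Finset.sum_congr rfl fun β _ => ?_
    rw [Pi.smul_apply, map_smul, smul_mul_assoc, smul_comm]

lemma ins_apply (ξ : V.Idx → WordFn k V) (ω : WordFn k V) (B : List V.Idx) :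
    ins ξ ω B = blockSum (fun P Q R => ∑ β, sgn (lsum V.sdeg P) •
      (tw 1 (ω (P ++ β :: R)) * tw (lsum V.sdeg P) (ξ β Q))) B := rfl

variable {ξ : V.Idx → WordFn k V}

lemma HasPar.ins (hξ : ∀ β, HasPar (V.sdeg β + 1) (ξ β)) {p : ℤ} {ω : WordFn k V}
    (hω : HasPar p ω) : HasPar (p + 1) (ins ξ ω) := by
  intro B
  rw [ins_apply, blockSum_eq_sum_range]
  refine FormalFn.HasPar.sum _ fun s _ => FormalFn.HasPar.sum _ fun l _ =>
    FormalFn.HasPar.sum _ fun β _ => FormalFn.HasPar.smul _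
      ((((hω _).tw 1).mul ((hξ β _).tw _)).congr ?_)
  have : lsum V.sdeg B = lsum V.sdeg (B.take s) + (lsum V.sdeg ((B.drop s).take l) +
      lsum V.sdeg (B.drop (s + l))) := by
    rw [← lsum_append, ← lsum_append, ← List.drop_drop, List.take_append_drop,
      List.take_append_drop]
  rw [this, lsum_append, lsum_cons]
  push_cast; ring_nf; reduce_mod_char

lemma ins_mul (hξ : ∀ β, HasPar (V.sdeg β + 1) (ξ β)) {p : ℤ} {ω : WordFn k V} (hω : HasPar p ω)
    (η : WordFn k V) : ins ξ (mul ω η) = mul (ins ξ ω) η + sgn p • mul ω (ins ξ η) := by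
  funext B
  let φ : ℤˣ → FormalFn k V → FormalFn k V →+ FormalFn k V := fun c g =>
    AddMonoidHom.mk' (fun f => c • (tw 1 f * g)) fun f f' => by rw [map_add, add_mul, smul_add]
  have e1 : ∀ P Q R β, sgn (lsum V.sdeg P) •
      (tw 1 (mul ω η (P ++ β :: R)) * tw (lsum V.sdeg P) (ξ β Q)) =
      splitSum (fun P₁ P₂ => sgn p • (ω P₁ * tw (lsum V.sdeg P₁) (sgn (lsum V.sdeg P₂) •
        (tw 1 (η (P₂ ++ β :: R)) * tw (lsum V.sdeg P₂) (ξ β Q))))) P +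
      splitSum (fun R₁ R₂ => (sgn (lsum V.sdeg P) • (tw 1 (ω (P ++ β :: R₁)) *
        tw (lsum V.sdeg P) (ξ β Q))) * tw (lsum V.sdeg P + lsum V.sdeg Q + lsum V.sdeg R₁) (η R₂)) R := by
    intro P Q R β
    change φ _ _ _ = _
    rw [mul_apply, splitSum_append_cons, map_add, splitSum_hom, splitSum_hom]
    congr 1
    · refine splitSum_congr fun P₁ P₂ h => ?_
      change sgn _ • (tw 1 (ω P₁ * tw _ _) * tw _ _) = _
      rw [← h, lsum_append, tw_mul, hω P₁ 1, tw_tw, sgn_smul_tw, tw_mul, tw_tw, tw_tw,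
        smul_mul_assoc, smul_mul_assoc, mul_smul_comm, sgn_smul_smul, sgn_smul_smul,
        _root_.mul_assoc, add_comm 1 (lsum V.sdeg P₁)]
      apply sgn_smul_congr
      push_cast; ring_nf; reduce_mod_char
    · refine splitSum_congr fun R₁ R₂ h => ?_
      change sgn _ • (tw 1 (ω (P ++ β :: R₁) * tw _ _) * tw _ _) = _
      rw [smul_mul_assoc, tw_mul, _root_.mul_assoc, _root_.mul_assoc,
        mul_comm_of_par ((hξ β Q).tw (lsum V.sdeg P)), tw_tw, tw_tw, lsum_append, lsum_cons]
      congr 3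
      rw [tw_congr]
      push_cast; ring_nf; reduce_mod_char
  rw [ins_apply]
  simp only [e1, Finset.sum_add_distrib, blockSum_add]
  rw [add_comm]
  congr 1
  · simp only [← splitSum_sum]
    rw [blockSum_splitSum_right (fun P Q R₁ R₂ => ∑ β, (sgn (lsum V.sdeg P) • (tw 1 (ω (P ++ β :: R₁)) *
        tw (lsum V.sdeg P) (ξ β Q))) * tw (lsum V.sdeg P + lsum V.sdeg Q + lsum V.sdeg R₁) (η R₂)),
      mul_apply]
    refine splitSum_congr fun B' R₂ _ => ?_
    rw [ins_apply]
    refine Eq.trans ?_ (blockSum_hom (AddMonoidHom.mulRight (tw (lsum V.sdeg B') (η R₂))) _ B').symm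
    refine blockSum_congr fun P Q R₁ _ h => ?_
    rw [← h, lsum_append, lsum_append, ← add_assoc]
    change _ = (∑ β : V.Idx, (_ : FormalFn k V)) * _
    rw [Finset.sum_mul]
  · simp only [← splitSum_sum]
    rw [blockSum_splitSum_left (fun P₁ P₂ Q R => ∑ β, sgn p • (ω P₁ * tw (lsum V.sdeg P₁)
      (sgn (lsum V.sdeg P₂) • (tw 1 (η (P₂ ++ β :: R)) * tw (lsum V.sdeg P₂) (ξ β Q))))),
      Pi.smul_apply, mul_apply]
    refine Eq.trans ?_ (splitSum_hom (DistribSMul.toAddMonoidHom _ (sgn p)) _ B).symm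
    refine splitSum_congr fun P₁ B' _ => ?_
    change _ = sgn p • (ω P₁ * tw _ (ins ξ η B'))
    rw [ins_apply]
    refine Eq.trans ?_ (blockSum_hom ((DistribSMul.toAddMonoidHom _ (sgn p)).comp
      ((AddMonoidHom.mulLeft (ω P₁)).comp (tw (lsum V.sdeg P₁)).toAddMonoidHom)) _ B').symm
    refine blockSum_congr fun P Q R₁ _ h => ?_
    change _ = sgn p • (ω P₁ * tw _ (∑ β : V.Idx, (_ : FormalFn k V)))
    rw [map_sum, Finset.mul_sum, Finset.smul_sum]

lemma ins_rightMul (hξ : ∀ β, HasPar (V.sdeg β + 1) (ξ β)) (ω : WordFn k V) (g : FormalFn k V) :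
    ins ξ (rightMul ω g) = rightMul (ins ξ ω) g := by
  funext B
  rw [rightMul_apply, ins_apply, ins_apply]
  refine Eq.trans ?_ (blockSum_hom (AddMonoidHom.mulRight (tw (lsum V.sdeg B + 1) g)) _ B).symm
  refine blockSum_congr fun P Q R _ h => ?_
  change _ = (∑ β : V.Idx, (_ : FormalFn k V)) * _
  rw [Finset.sum_mul]
  refine Finset.sum_congr rfl fun β _ => ?_
  rw [rightMul_apply, tw_mul, smul_mul_assoc, _root_.mul_assoc, _root_.mul_assoc,
    mul_comm_of_par ((hξ β Q).tw (lsum V.sdeg P)), tw_tw, tw_tw, ← h, lsum_append, lsum_append,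
    lsum_append, lsum_cons]
  congr 3
  rw [tw_congr]
  push_cast; ring_nf; reduce_mod_char

lemma ins_fsmul {p : ℤ} {f : FormalFn k V} (hf : FormalFn.HasPar p f) (ω : WordFn k V) :
    ins ξ (f • ω) = sgn p • f • ins ξ ω := by
  funext B
  rw [Pi.smul_apply, Pi.smul_apply, smul_eq_mul, ins_apply, ins_apply]
  refine Eq.trans ?_ (blockSum_hom ((DistribSMul.toAddMonoidHom _ (sgn p)).comp
    (AddMonoidHom.mulLeft f)) _ B).symm
  refine blockSum_congr fun P Q R _ h => ?_
  change _ = sgn p • (f * ∑ β : V.Idx, (_ : FormalFn k V))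
  rw [Finset.mul_sum, Finset.smul_sum]
  refine Finset.sum_congr rfl fun β _ => ?_
  rw [Pi.smul_apply, smul_eq_mul, tw_mul, hf 1, one_mul, smul_mul_assoc, smul_mul_assoc,
    mul_smul_comm, smul_comm, _root_.mul_assoc]

lemma ins_letter (α : V.Idx) (h0 : ξ α [] = 0) : ins ξ (letter α) = ξ α := by
  funext B
  have h1 : ∀ P Q R : List V.Idx, ∑ β, sgn (lsum V.sdeg P) • (tw 1 (letter (k := k) α (P ++ β :: R)) *
      tw (lsum V.sdeg P) (ξ β Q)) = if P = [] ∧ R = [] then ξ α Q else 0 := by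
    intro P Q R
    by_cases h : P = [] ∧ R = []
    · obtain ⟨rfl, rfl⟩ := h
      rw [Finset.sum_eq_single α]
      · simp [letter]
      · intro β _ hβ
        simp [letter, hβ]
      · simp
    · rw [if_neg h]
      refine Finset.sum_eq_zero fun β _ => ?_
      have : P ++ β :: R ≠ [α] := fun e => h (by
        have := congrArg List.length e
        simp only [List.length_append, List.length_cons, List.length_nil] at this
        exact ⟨List.length_eq_zero_iff.1 (by omega), List.length_eq_zero_iff.1 (by omega)⟩)
      simp [letter, this]
  rw [ins_apply]
  simp only [h1]
  cases B with
  | nil => exact h0.symm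
  | cons b B =>
    simp only [blockSum, List.cons_ne_nil, false_and, if_false, blockSum_zero, add_zero, true_and]
    exact splitSum_ite_right (fun Q => ξ α (b :: Q)) B

end WordFn

namespace Model

/-- The values on the generators of an odd derivation of the model. -/
structure OddFamily (M : V.Idx → Model k V) : Prop where
  par : ∀ α, (M α).HasPar (V.sdeg α)
  tame : ∀ α, M α ∈ Model.tame k V

/-- The odd derivation of the model with given values on the generators. -/
def der (M : V.Idx → Model k V) : Model k V →ₗ[k] Model k V where
  toFun N := (VecField.app (fun α => (M α).1) N.1,
    (fun B => VecField.app (fun α => (M α).1) (N.2 B)) + WordFn.ins (fun α => (M α).2) N.2)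
  map_add' N N' := by
    refine Prod.ext (VecField.app_add _ _ _) ?_
    change (fun B => VecField.app _ (N.2 B + N'.2 B)) + WordFn.ins _ (N.2 + N'.2) = (_ + _) + (_ + _)
    rw [map_add]
    simp only [VecField.app_add]
    exact add_add_add_comm (fun B => VecField.app _ (N.2 B)) _ _ _
  map_smul' c N := by
    refine Prod.ext (VecField.app_smul _ _ _) ?_
    change (fun B => VecField.app _ (c • N.2 B)) + WordFn.ins _ (c • N.2) = c • (_ + _)
    rw [map_smul, smul_add]
    simp only [VecField.app_smul]
    rfl

lemma der_fst (M : V.Idx → Model k V) (N : Model k V) :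
    (der M N).1 = VecField.app (fun α => (M α).1) N.1 := rfl

lemma der_snd (M : V.Idx → Model k V) (N : Model k V) (B : List V.Idx) :
    (der M N).2 B = VecField.app (fun α => (M α).1) (N.2 B) +
      WordFn.ins (fun α => (M α).2) N.2 B := rfl

variable {M : V.Idx → Model k V}

lemma OddFamily.isOdd (h : OddFamily M) : VecField.IsOdd fun α => (M α).1 := fun α => (h.par α).1

lemma OddFamily.der_hasPar (h : OddFamily M) {p : ℤ} {N : Model k V} (hN : N.HasPar p) :
    (der M N).HasPar (p + 1) :=
  ⟨h.isOdd.app_par hN.1, WordFn.HasPar.add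
    (fun B => (h.isOdd.app_par (hN.2 B)).congr (by push_cast; ring_nf))
    (WordFn.HasPar.ins (fun β => (h.par β).2) hN.2)⟩

lemma OddFamily.app_mul_words (h : OddFamily M) {p : ℤ} {ω : WordFn k V} (hω : WordFn.HasPar p ω)
    (η : WordFn k V) (B : List V.Idx) :
    VecField.app (fun α => (M α).1) (WordFn.mul ω η B) =
      WordFn.mul (fun B => VecField.app (fun α => (M α).1) (ω B)) η B +
        sgn p • WordFn.mul ω (fun B => VecField.app (fun α => (M α).1) (η B)) B := by
  let φ : FormalFn k V →+ FormalFn k V := AddMonoidHom.mk' (VecField.app fun α => (M α).1)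
    (VecField.app_add _)
  rw [WordFn.mul_apply, WordFn.mul_apply, WordFn.mul_apply]
  refine (splitSum_hom φ _ B).trans (Eq.trans ?_ (congrArg (_ + ·)
    (splitSum_hom (DistribSMul.toAddMonoidHom _ (sgn p)) _ B).symm))
  rw [← splitSum_add]
  refine splitSum_congr fun P Q _ => ?_
  change VecField.app _ (ω P * tw _ (η Q)) = VecField.app _ (ω P) * _ + sgn p • (ω P * tw _ (VecField.app _ (η Q)))
  rw [h.isOdd.app_mul, h.isOdd.tw_app, hω P 1, smul_mul_assoc, mul_smul_comm, sgn_smul_smul]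
  congr 1
  apply sgn_smul_congr
  push_cast; ring_nf; reduce_mod_char

lemma OddFamily.der_mul (h : OddFamily M) {p : ℤ} {N : Model k V} (hN : N.HasPar p)
    (L : Model k V) : der M (mul N L) = mul (der M N) L + sgn p • mul N (der M L) := by
  have hξ := fun β => (h.par β).2
  refine Prod.ext ?_ (funext fun B => ?_)
  · change VecField.app _ (N.1 * L.1) = VecField.app _ N.1 * L.1 + sgn p • (N.1 * VecField.app _ L.1)
    rw [h.isOdd.app_mul, hN.1 1, one_mul, smul_mul_assoc]
  · change VecField.app (fun α => (M α).1) (N.2 B * tw _ L.1 + N.1 * L.2 B) +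
        WordFn.ins (fun α => (M α).2) (WordFn.rightMul N.2 L.1 + N.1 • L.2) B =
      (((der M N).2 B) * tw _ L.1 + VecField.app (fun α => (M α).1) N.1 * L.2 B) +
        sgn p • (N.2 B * tw _ (VecField.app (fun α => (M α).1) L.1) + N.1 * (der M L).2 B)
    rw [map_add, WordFn.ins_rightMul hξ, WordFn.ins_fsmul hN.1, Pi.add_apply, WordFn.rightMul_apply,
      Pi.smul_apply, Pi.smul_apply, smul_eq_mul, VecField.app_add, h.isOdd.app_mul, h.isOdd.app_mul,
      h.isOdd.tw_app, der_snd, der_snd, hN.1 1, hN.2 B 1, one_mul, one_mul, add_mul, mul_add,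
      smul_add, smul_add, smul_mul_assoc, smul_mul_assoc, mul_smul_comm, sgn_smul_smul]
    have e : sgn (p + 1 + lsum V.sdeg B + (lsum V.sdeg B + 1)) = sgn p := by
      apply sgn_eq_of; push_cast; ring_nf; reduce_mod_char
    rw [e]
    abel

lemma OddFamily.der_br (h : OddFamily M) {p q : ℤ} {N L : Model k V} (hN : N.HasPar p)
    (hL : L.HasPar q) : der M (br N L) = br (der M N) L + sgn (p + 1) • br N (der M L) := by
  have hξ := fun β => (h.par β).2
  have hdN := (h.der_hasPar hN).2
  have hdL := (h.der_hasPar hL).2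
  have key : ∀ {p q : ℤ} {N L : Model k V}, WordFn.HasPar p N.2 → ∀ B,
      VecField.app (fun α => (M α).1) (WordFn.mul N.2 L.2 B) +
        WordFn.ins (fun α => (M α).2) (WordFn.mul N.2 L.2) B =
      WordFn.mul (der M N).2 L.2 B + sgn p • WordFn.mul N.2 (der M L).2 B := by
    intro p q N L hN B
    rw [h.app_mul_words hN, WordFn.ins_mul hξ hN]
    have e1 : WordFn.mul (der M N).2 L.2 = WordFn.mul (fun B => VecField.app (fun α => (M α).1) (N.2 B)) L.2
        + WordFn.mul (WordFn.ins (fun α => (M α).2) N.2) L.2 := by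
      rw [← LinearMap.add_apply, ← map_add]; rfl
    have e2 : WordFn.mul N.2 (der M L).2 = WordFn.mul N.2 (fun B => VecField.app (fun α => (M α).1) (L.2 B))
        + WordFn.mul N.2 (WordFn.ins (fun α => (M α).2) L.2) := by
      rw [← map_add]; rfl
    rw [e1, e2]
    simp only [Pi.add_apply, Pi.smul_apply, smul_add]
    abel
  refine Prod.ext ?_ (funext fun B => ?_)
  · change VecField.app _ 0 = (0 : FormalFn k V) + sgn (p + 1) • (0 : FormalFn k V)
    rw [VecField.app_zero, smul_zero, add_zero]
  · change VecField.app (fun α => (M α).1) (WordFn.comm N.2 L.2 B) +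
        WordFn.ins (fun α => (M α).2) (WordFn.comm N.2 L.2) B =
      WordFn.comm (der M N).2 L.2 B + sgn (p + 1) • WordFn.comm N.2 (der M L).2 B
    rw [WordFn.comm_eq hN.2 hL.2, WordFn.comm_eq hdN hL.2, WordFn.comm_eq hN.2 hdL]
    have h1 := key (q := 0) (N := N) (L := L) hN.2 B
    have h2 := key (q := 0) (N := L) (L := N) hL.2 B
    have e : ∀ (f g : FormalFn k V) (c : ℤˣ), VecField.app (fun α => (M α).1) (f - c • g) =
        VecField.app (fun α => (M α).1) f - c • VecField.app (fun α => (M α).1) g := by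
      intro f g c
      have := VecField.app_add (fun α => (M α).1) (f - c • g) (c • g)
      rw [sub_add_cancel, VecField.app_sgn_smul] at this
      rw [this, add_sub_cancel_right]
    simp only [map_sub, sgn_smul_map, Pi.sub_apply, Pi.smul_apply]
    rw [e]
    refine Eq.trans (b := (VecField.app (fun α => (M α).1) (WordFn.mul N.2 L.2 B) +
        WordFn.ins (fun α => (M α).2) (WordFn.mul N.2 L.2) B) - sgn ((p + 1) * (q + 1)) •
        (VecField.app (fun α => (M α).1) (WordFn.mul L.2 N.2 B) +
        WordFn.ins (fun α => (M α).2) (WordFn.mul L.2 N.2) B)) (by rw [smul_add]; abel) ?_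
    rw [h1, h2]
    simp only [smul_add, smul_sub, sgn_smul_smul]
    have s1 : sgn ((p + 1) * (q + 1) + (q + 1)) = sgn ((p + 1 + 1) * (q + 1)) := by
      apply sgn_eq_of; push_cast; ring_nf
    have s2 : sgn (p + 1 + (p + 1) * (q + 1 + 1)) = sgn ((p + 1) * (q + 1)) := by
      apply sgn_eq_of; push_cast; ring_nf; reduce_mod_char
    rw [s1, s2]
    abel

lemma OddFamily.der_fil (h : OddFamily M) {n : ℕ} {N : Model k V} (hN : N ∈ fil k V n) :
    der M N ∈ fil k V n := by
  have happ : ∀ (f : FormalFn k V) (n : ℕ), (∀ γ : List V.Idx, γ.length < n → f.1 γ = 0) →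
      ∀ γ : List V.Idx, γ.length < n → (VecField.app (fun α => (M α).1) f).1 γ = 0 := by
    intro f n hf γ hγ
    rw [VecField.app, FormalFn.sum_apply]
    refine Finset.sum_eq_zero fun β _ => taylorMul_vanish _ _ 1 (n - 1) (fun l hl => ?_)
      (fun l hl => hf (β :: l) (by rw [List.length_cons]; omega)) γ (by omega)
    rw [List.length_eq_zero_iff.1 (Nat.lt_one_iff.1 hl)]
    exact (h.tame β).1
  refine ⟨happ _ n hN.1, fun B γ hγ => ?_⟩
  rw [der_snd]
  change (VecField.app (fun α => (M α).1) (N.2 B)).1 γ +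
    (WordFn.ins (fun α => (M α).2) N.2 B).1 γ = 0
  rw [happ (N.2 B) (n - B.length) (fun l hl => hN.2 B l (by omega)) γ (by omega), zero_add]
  let ev : FormalFn k V →+ k := AddMonoidHom.mk' (fun f => f.1 γ) fun _ _ => rfl
  refine (blockSum_hom ev _ B).trans ((blockSum_congr fun P Q R hQ e => ?_).trans (blockSum_zero B))
  change (∑ β : V.Idx, (_ : FormalFn k V)).1 γ = 0
  rw [FormalFn.sum_apply]
  refine Finset.sum_eq_zero fun β _ => ?_
  have hl := congrArg List.length e
  have hQ' := List.length_pos_iff.2 hQ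
  simp only [List.length_append] at hl
  rw [FormalFn.sgn_smul_apply]
  refine (congrArg _ (taylorMul_vanish _ _ (n - (P.length + R.length + 1)) (1 - Q.length)
    (fun l hl => ?_) (fun l hl => ?_) γ (by omega))).trans (smul_zero _)
  · rw [tw_apply, hN.2 _ l (by simp only [List.length_append, List.length_cons]; omega), smul_zero]
  · omega

lemma OddFamily.der_gen (h : OddFamily M) (α : V.Idx) : der M (evalMon k (.gen α)) = M α := by
  refine Prod.ext ?_ (funext fun B => ?_)
  · change VecField.app _ (FormalFn.var α) = _
    rw [VecField.app, Finset.sum_eq_single α]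
    · rw [pd_var, if_pos rfl, mul_one]
    · intro β _ hβ; rw [pd_var, if_neg hβ, mul_zero]
    · simp
  · rw [der_snd]
    change VecField.app _ (if B = [α] then 1 else 0) + WordFn.ins _ (WordFn.letter α) B = _
    rw [WordFn.ins_letter (ξ := fun α => (M α).2) α (h.tame α).2.1]
    split_ifs
    · rw [VecField.app_one, zero_add]
    · rw [VecField.app_zero, zero_add]

lemma OddFamily.der_der_mon (h : OddFamily M) (hM : ∀ α, der M (M α) = 0) (m : GMon V.Idx) :
    der M (der M (evalMon k m)) = 0 := by
  induction m with
  | gen α => rw [h.der_gen, hM]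
  | mul a b ha hb =>
    have hp := evalMon_hasPar (k := k) a
    change der M (der M (mul _ _)) = 0
    rw [h.der_mul hp, map_add, sgn_smul_map, h.der_mul (h.der_hasPar hp), h.der_mul hp, ha, hb,
      map_zero, map_zero, LinearMap.zero_apply, smul_zero, add_zero, zero_add, sgn_succ_smul,
      neg_add_cancel]
  | br a b ha hb =>
    have hp := evalMon_hasPar (k := k) a
    have hq := evalMon_hasPar (k := k) b
    change der M (der M (br _ _)) = 0
    rw [h.der_br hp hq, map_add, sgn_smul_map, h.der_br (h.der_hasPar hp) hq,
      h.der_br hp (h.der_hasPar hq), ha, hb, map_zero, map_zero, LinearMap.zero_apply, smul_zero,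
      add_zero, zero_add, sgn_succ_smul (_ + 1), neg_add_cancel]

end Model

end GInf

namespace GInf

open FormalFn

variable {k : Type u} [Field k] {V : GrSp}

section CoeffModel

variable {c : Coeffs k V}

lemma Coeffs.Graded.fn_par (hg : c.Graded) (h : c.Admissible) (α : V.Idx) :
    FormalFn.HasPar (V.sdeg α) (h.fn α []) :=
  (FormalFn.HasPar.of_support (f := h.fn α []) (hg.deg_nil α)).congr (by
    simp only [GrSp.tdeg, GrSp.sdeg]; push_cast; ring_nf; reduce_mod_char)

lemma Coeffs.Graded.full_par (hg : c.Graded) (h : c.Admissible) (α : V.Idx) (B : List V.Idx)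
    (hB : B ≠ []) : FormalFn.HasPar (lsum V.sdeg B + 1 + V.sdeg α) (h.full α B) :=
  (FormalFn.HasPar.of_support (f := h.full α B) (p := lsum V.sdeg B + 1 - V.sdeg α)
    (fun γ hγ => by rw [← hg.full_degree α B γ hB hγ]; ring)).congr (by
    push_cast; ring_nf; reduce_mod_char)

/-- The words in the element of the model which corresponds to a system of coefficients. -/
lemma Coeffs.Graded.model_snd (hg : c.Graded) (h : c.Admissible) (α : V.Idx) (B : List V.Idx)
    (hB : B ≠ []) : (h.model α).2 B =
      sgn (1 + V.sdeg α * (1 + lsum V.sdeg B) + pairSum V.sdeg B) • h.full α B := by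
  match B, hB with
  | [j], _ =>
    have e : h.full α [j] = sgn (V.sdeg j) • pd j (h.fn α []) := rfl
    change tw (V.tdeg j) (pd j (h.fn α [])) = _
    rw [e, (hg.fn_par h α).pd j, sgn_smul_smul]
    apply sgn_smul_congr
    simp only [lsum_cons, lsum_nil, pairSum, GrSp.tdeg, GrSp.sdeg]
    push_cast; ring_nf; reduce_mod_char
    simp only [zmodTwo_sq]; ring_nf <;> reduce_mod_char
  | x :: y :: B, _ =>
    change -(sgn _ • h.fn α (x :: y :: B)) = sgn _ • h.fn α (x :: y :: B)
    rw [← sgn_one_smul, sgn_smul_smul, add_assoc]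

lemma Coeffs.Graded.oddFamily (hg : c.Graded) (h : c.Admissible) :
    Model.OddFamily fun α => h.model α where
  par α := ⟨hg.fn_par h α, fun B => by
    rcases eq_or_ne B [] with rfl | hB
    · exact FormalFn.HasPar.zero _
    · rw [hg.model_snd h α B hB]
      exact ((hg.full_par h α B hB).smul _).congr (by push_cast; ring_nf)⟩
  tame := h.model_tame

lemma Coeffs.Admissible.der_model_fst (h : c.Admissible) (α : V.Idx) (γ : List V.Idx) :
    (Model.der (fun α => h.model α) (h.model α)).1.1 γ = c.square α γ := by
  rw [Model.der_fst, VecField.app, FormalFn.sum_apply]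
  rfl

lemma Coeffs.Graded.der_model_snd (hg : c.Graded) (h : c.Admissible) (α : V.Idx)
    (B γ : List V.Idx) (hB : B ≠ []) :
    ((Model.der (fun α => h.model α) (h.model α)).2 B).1 γ =
      sgn (1 + V.sdeg α * (1 + lsum V.sdeg B) + pairSum V.sdeg B) • c.ainf α B γ := by
  have h1 : (Model.der (fun α => h.model α) (h.model α)).2 B =
      sgn (1 + V.sdeg α * (1 + lsum V.sdeg B) + pairSum V.sdeg B) •
        (∑ β, h.fn β [] * pd β (h.full α B) + blockSum (fun P Q R => ∑ β,
          sgn (lsum V.sdeg P + (lsum V.sdeg Q + 1 + V.sdeg β) * (1 + lsum V.sdeg P)) •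
            (h.full β Q * h.full α (P ++ β :: R))) B) := by
    rw [Model.der_snd, smul_add, hg.model_snd h α B hB, VecField.app_sgn_smul]
    congr 1
    rw [WordFn.ins_apply]
    refine Eq.trans ?_ (blockSum_hom (DistribSMul.toAddMonoidHom _ (sgn _)) _ B).symm
    refine blockSum_congr fun P Q R hQ e => ?_
    change _ = sgn _ • ∑ β : V.Idx, (_ : FormalFn k V)
    rw [Finset.smul_sum]
    refine Finset.sum_congr rfl fun β _ => ?_
    rw [hg.model_snd h α _ (by simp), hg.model_snd h β Q hQ, mul_comm_of_par (hg.full_par h β Q hQ),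
      hg.full_par h α (P ++ β :: R) (by simp), sgn_smul_tw, sgn_smul_tw,
      hg.full_par h α (P ++ β :: R) (by simp) 1, hg.full_par h β Q hQ, smul_mul_assoc, smul_mul_assoc,
      smul_mul_assoc, mul_smul_comm, mul_smul_comm]
    simp only [sgn_smul_smul]
    apply sgn_smul_congr
    rw [← e]
    simp only [lsum_append, lsum_cons, pairSum_append, pairSum]
    push_cast; ring_nf; reduce_mod_char
    simp only [zmodTwo_sq]; ring_nf <;> reduce_mod_char
  rw [h1, FormalFn.sgn_smul_apply]
  congr 1
  let ev : FormalFn k V →+ k := AddMonoidHom.mk' (fun f => f.1 γ) fun _ _ => rfl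
  change ev (_ + _) = _
  rw [map_add, map_sum, blockSum_hom]
  refine congrArg₂ (fun a b => a + b) rfl (blockSum_congr fun P Q R _ _ => ?_)
  rw [map_sum]
  rfl

end CoeffModel

section Lift

/-- The value on a monomial of the odd derivation of the algebra of series with given values
on the generators. -/
def derMon (x : V.Idx → GSer k V) : GMon V.Idx → GSer k V
  | .gen α => x α
  | .mul a b => serMul k V (derMon x a) (mono k V b) +
      sgn (mdeg V a) • serMul k V (mono k V a) (derMon x b)
  | .br a b => serBr k V (derMon x a) (mono k V b) +
      sgn (mdeg V a + 1) • serBr k V (mono k V a) (derMon x b)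

/-- Homogeneous series. -/
def SerHomog (p : ℤ) (x : GSer k V) : Prop := ∀ m, x m ≠ 0 → mdeg V m = p

lemma SerHomog.add {p : ℤ} {x y : GSer k V} (hx : SerHomog p x) (hy : SerHomog p y) :
    SerHomog p (x + y) := by
  intro m hm
  by_cases h : x m = 0
  · exact hy m fun h' => hm (by rw [Pi.add_apply, h, h', add_zero])
  · exact hx m h

lemma SerHomog.smul {p : ℤ} {x : GSer k V} (c : ℤˣ) (hx : SerHomog p x) : SerHomog p (c • x) :=
  fun m hm => hx m fun h => hm (by rw [Pi.smul_apply, h, smul_zero])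

lemma SerHomog.mono (m : GMon V.Idx) : SerHomog (mdeg V m) (mono k V m) := by
  intro m' h
  rw [mono_apply] at h
  split_ifs at h with h'
  · rw [h']
  · exact absurd rfl h

lemma SerHomog.serMul {p q : ℤ} {x y : GSer k V} (hx : SerHomog p x) (hy : SerHomog q y) :
    SerHomog (p + q) (serMul k V x y) := by
  intro m hm
  match m with
  | .gen i => exact absurd rfl hm
  | .br a b => exact absurd rfl hm
  | .mul a b =>
    rw [serMul_mul] at hm
    exact congrArg₂ (· + ·) (hx a (left_ne_zero_of_mul hm)) (hy b (right_ne_zero_of_mul hm))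

lemma SerHomog.serBr {p q : ℤ} {x y : GSer k V} (hx : SerHomog p x) (hy : SerHomog q y) :
    SerHomog (p + q - 1) (serBr k V x y) := by
  intro m hm
  match m with
  | .gen i => exact absurd rfl hm
  | .mul a b => exact absurd rfl hm
  | .br a b =>
    rw [serBr_br] at hm
    exact congrArg₂ (fun s t : ℤ => s + t - 1) (hx a (left_ne_zero_of_mul hm)) (hy b (right_ne_zero_of_mul hm))

lemma derMon_homog {x : V.Idx → GSer k V} (hx : ∀ α, SerHomog (V.tdeg α + 1) (x α))
    (m : GMon V.Idx) : SerHomog (mdeg V m + 1) (derMon x m) := by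
  induction m with
  | gen α => exact hx α
  | mul a b ha hb =>
    have h1 := ha.serMul (SerHomog.mono b)
    have h2 := (SerHomog.mono (k := k) a).serMul hb
    rw [show mdeg V a + 1 + mdeg V b = mdeg V (.mul a b) + 1 by
      change _ = mdeg V a + mdeg V b + 1; ring] at h1
    rw [show mdeg V a + (mdeg V b + 1) = mdeg V (.mul a b) + 1 by
      change _ = mdeg V a + mdeg V b + 1; ring] at h2
    exact h1.add (h2.smul _)
  | br a b ha hb =>
    have h1 := ha.serBr (SerHomog.mono b)
    have h2 := (SerHomog.mono (k := k) a).serBr hb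
    rw [show mdeg V a + 1 + mdeg V b - 1 = mdeg V (.br a b) + 1 by
      change _ = mdeg V a + mdeg V b - 1 + 1; ring] at h1
    rw [show mdeg V a + (mdeg V b + 1) - 1 = mdeg V (.br a b) + 1 by
      change _ = mdeg V a + mdeg V b - 1 + 1; ring] at h2
    exact h1.add (h2.smul _)

lemma derMon_fil (x : V.Idx → GSer k V) (m m' : GMon V.Idx) (h : m'.weight < m.weight) :
    derMon x m m' = 0 := by
  induction m generalizing m' with
  | gen α => exact absurd m'.weight_pos (by simp only [GMon.weight] at h; omega)
  | mul a b ha hb =>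
    change serMul k V (derMon x a) (mono k V b) m' + sgn _ • serMul k V (mono k V a) (derMon x b) m' = 0
    match m' with
    | .gen i => rw [serMul_gen, serMul_gen, smul_zero, add_zero]
    | .br a' b' => rw [serMul_br, serMul_br, smul_zero, add_zero]
    | .mul a' b' =>
      simp only [GMon.weight] at h
      rw [serMul_mul, serMul_mul, mono_apply, mono_apply]
      have h1 : derMon x a a' * (open Classical in if b' = b then (1 : k) else 0) = 0 := by
        split_ifs with e
        · rw [ha a' (by rw [e] at h; omega), zero_mul]
        · rw [mul_zero]
      have h2 : (open Classical in if a' = a then (1 : k) else 0) * derMon x b b' = 0 := by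
        split_ifs with e
        · rw [hb b' (by rw [e] at h; omega), mul_zero]
        · rw [zero_mul]
      rw [h1, h2, smul_zero, add_zero]
  | br a b ha hb =>
    change serBr k V (derMon x a) (mono k V b) m' + sgn _ • serBr k V (mono k V a) (derMon x b) m' = 0
    match m' with
    | .gen i => rw [serBr_gen, serBr_gen, smul_zero, add_zero]
    | .mul a' b' => rw [serBr_mul, serBr_mul, smul_zero, add_zero]
    | .br a' b' =>
      simp only [GMon.weight] at h
      rw [serBr_br, serBr_br, mono_apply, mono_apply]
      have h1 : derMon x a a' * (open Classical in if b' = b then (1 : k) else 0) = 0 := by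
        split_ifs with e
        · rw [ha a' (by rw [e] at h; omega), zero_mul]
        · rw [mul_zero]
      have h2 : (open Classical in if a' = a then (1 : k) else 0) * derMon x b b' = 0 := by
        split_ifs with e
        · rw [hb b' (by rw [e] at h; omega), mul_zero]
        · rw [zero_mul]
      rw [h1, h2, smul_zero, add_zero]

/-- The odd derivation of the algebra of series with given values on the generators. -/
def derSer (x : V.Idx → GSer k V) : GSer k V →ₗ[k] GSer k V :=
  extendSer (fun m : GMon V.Idx => m.weight) (derMon x)

lemma derSer_mono (x : V.Idx → GSer k V) (m : GMon V.Idx) :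
    derSer x (mono k V m) = derMon x m := extendSer_mono _ _ (derMon_fil x) m

lemma derSer_fil (x : V.Idx → GSer k V) {n : ℕ} {y : GSer k V} (hy : y ∈ serFil k V n) :
    derSer x y ∈ serFil k V n := fun m hm => extendSer_filtered _ _ hy m hm

lemma derSer_homog {x : V.Idx → GSer k V} (hx : ∀ α, SerHomog (V.tdeg α + 1) (x α)) {p : ℤ}
    {y : GSer k V} (hy : SerHomog p y) : SerHomog (p + 1) (derSer x y) := by
  intro m hm
  obtain ⟨m', _, h⟩ := Finset.exists_ne_zero_of_sum_ne_zero hm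
  rw [← hy m' (left_ne_zero_of_mul h)]
  exact derMon_homog hx m' m (right_ne_zero_of_mul h)

variable {M : V.Idx → Model k V}

lemma Model.OddFamily.evalSer_derMon (h : OddFamily M) {x : V.Idx → GSer k V}
    (hx : ∀ α, evalSer k V (x α) = M α) (m : GMon V.Idx) :
    evalSer k V (derMon x m) = der M (evalMon k m) := by
  induction m with
  | gen α => rw [h.der_gen]; exact hx α
  | mul a b ha hb =>
    change _ = der M (mul _ _)
    rw [h.der_mul (evalMon_hasPar a), derMon, map_add, sgn_smul_map, evalSer_mul, evalSer_mul, ha,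
      hb, evalSer_mono, evalSer_mono]
  | br a b ha hb =>
    change _ = der M (br _ _)
    rw [h.der_br (evalMon_hasPar a) (evalMon_hasPar b), derMon, map_add, sgn_smul_map, evalSer_br,
      evalSer_br, ha, hb, evalSer_mono, evalSer_mono]

lemma Model.OddFamily.evalSer_derSer (h : OddFamily M) {x : V.Idx → GSer k V}
    (hx : ∀ α, evalSer k V (x α) = M α) (y : GSer k V) :
    evalSer k V (derSer x y) = der M (evalSer k V y) := by
  have := eq_of_filtered (Model.fil k V) Model.fil_sep ((evalSer k V).comp (derSer x))
    ((der M).comp (evalSer k V)) (fun n y hy => evalSer_fil (derSer_fil x hy))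
    (fun n y hy => h.der_fil (evalSer_fil hy)) (fun m => by
      rw [LinearMap.comp_apply, LinearMap.comp_apply, derSer_mono, evalSer_mono, h.evalSer_derMon hx])
  exact LinearMap.congr_fun this y

lemma evalSer_hasPar {p : ℤ} {x : GSer k V} (hx : SerHomog p x) : (evalSer k V x).HasPar p :=
  (evalSer_homogOf (mdeg V) p x evalMon_degree hx).hasPar

lemma Model.OddFamily.der_br_evalSer (h : OddFamily M) {p : ℤ} {x : GSer k V} (hx : SerHomog p x)
    (y : GSer k V) : der M (br (evalSer k V x) (evalSer k V y)) =
      br (der M (evalSer k V x)) (evalSer k V y) +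
        sgn (p + 1) • br (evalSer k V x) (der M (evalSer k V y)) := by
  have hfil : ∀ (N : Model k V) {n : ℕ} {L : Model k V}, L ∈ fil k V n → br N L ∈ fil k V n := by
    intro N n L hL
    have := br_mem_fil (fil_zero N) hL
    rwa [zero_add] at this
  let T₁ : GSer k V →ₗ[k] Model k V := (der M).comp ((br (evalSer k V x)).comp (evalSer k V))
  let T₂ : GSer k V →ₗ[k] Model k V := (br (der M (evalSer k V x))).comp (evalSer k V) +
    (br (evalSer k V x)).comp ((der M).comp (sgn (p + 1) • evalSer k V))
  have hT : T₁ = T₂ := by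
    refine eq_of_filtered (Model.fil k V) Model.fil_sep _ _
      (fun n y hy => h.der_fil (hfil _ (evalSer_fil hy)))
      (fun n y hy => add_mem (hfil _ (evalSer_fil hy))
        (hfil _ (h.der_fil (sgn_smul_mem _ _ (evalSer_fil hy))))) (fun m => ?_)
    change der M (br (evalSer k V x) (evalSer k V (mono k V m))) =
      br (der M (evalSer k V x)) (evalSer k V (mono k V m)) +
        br (evalSer k V x) (der M (sgn (p + 1) • evalSer k V (mono k V m)))
    rw [evalSer_mono, h.der_br (evalSer_hasPar hx) (evalMon_hasPar m), sgn_smul_map, sgn_smul_map]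
  have := LinearMap.congr_fun hT y
  refine this.trans ?_
  change _ + br (evalSer k V x) (der M (sgn (p + 1) • evalSer k V y)) = _
  rw [sgn_smul_map, sgn_smul_map]
  rfl

/-- The differential of the quotient of the free `G`-algebra given by an odd derivation of square
zero of the model. -/
def Model.OddFamily.toDifferential [CharZero k] (h : OddFamily M) (hM : ∀ α, der M (M α) = 0)
    {x : V.Idx → GSer k V} (hx : ∀ α, evalSer k V (x α) = M α)
    (hdeg : ∀ α, SerHomog (V.tdeg α + 1) (x α)) : GDifferential k V 2 :=
  have hker : relIdeal k V 2 ≤ (relIdeal k V 2).comap (derSer x) := by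
    intro y hy
    rw [← ker_evalSer, LinearMap.mem_ker] at hy
    rw [Submodule.mem_comap, ← ker_evalSer, LinearMap.mem_ker, h.evalSer_derSer hx, hy, map_zero]
  have hQ : ∀ q, evalQuot k V ((relIdeal k V 2).mapQ (relIdeal k V 2) (derSer x) hker q) =
      der M (evalQuot k V q) := by
    intro q
    obtain ⟨y, rfl⟩ := (relIdeal k V 2).mkQ_surjective q
    exact h.evalSer_derSer hx y
  { D := (relIdeal k V 2).mapQ (relIdeal k V 2) (derSer x) hker
    degree_one := by
      rintro p q ⟨y, hy, rfl⟩
      exact ⟨derSer x y, derSer_homog hdeg hy, rfl⟩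
    filtered := by
      rintro w q ⟨y, hy, rfl⟩
      exact ⟨derSer x y, derSer_fil x hy, rfl⟩
    map_mul := by
      rintro p q r ⟨y, hy, rfl⟩
      apply evalQuot_injective
      rw [map_add, sgn_smul_map, evalQuot_mul, evalQuot_mul, hQ, hQ, hQ, evalQuot_mul, evalQuot_mk,
        h.der_mul (evalSer_hasPar hy)]
    map_br := by
      rintro p q r ⟨y, hy, rfl⟩
      obtain ⟨z, rfl⟩ := (relIdeal k V 2).mkQ_surjective r
      apply evalQuot_injective
      rw [map_add, sgn_smul_map, evalQuot_br, evalQuot_br, hQ, hQ, hQ, evalQuot_br, evalQuot_mk,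
        evalQuot_mk, h.der_br_evalSer hy]
    sq_zero := by
      intro q
      obtain ⟨y, rfl⟩ := (relIdeal k V 2).mkQ_surjective q
      apply evalQuot_injective
      rw [hQ, hQ, map_zero, evalQuot_mk]
      have := eq_of_filtered (Model.fil k V) Model.fil_sep ((der M).comp ((der M).comp (evalSer k V)))
        0 (fun n y hy => h.der_fil (h.der_fil (evalSer_fil hy))) (fun n y hy => zero_mem _)
        (fun m => by
          change der M (der M (evalSer k V (mono k V m))) = 0
          rw [evalSer_mono, h.der_der_mon hM])
      exact LinearMap.congr_fun this y }

lemma Model.OddFamily.toDifferential_gen [CharZero k] (h : OddFamily M) (hM : ∀ α, der M (M α) = 0)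
    {x : V.Idx → GSer k V} (hx : ∀ α, evalSer k V (x α) = M α)
    (hdeg : ∀ α, SerHomog (V.tdeg α + 1) (x α)) (α : V.Idx) :
    (h.toDifferential hM hx hdeg).D (QuotG.gen k V 2 α) = (relIdeal k V 2).mkQ (x α) := by
  change (relIdeal k V 2).mkQ (derSer x (mono k V (.gen α))) = _
  rw [derSer_mono]
  rfl

end Lift

end GInf

namespace GInf

open FormalFn

variable {k : Type u} [Field k] {V : GrSp}

lemma GMon.degree_leftNormed (b : V.Idx) (B : List V.Idx) :
    mdeg V (leftNormed b B) = 1 - lsum V.sdeg (b :: B) := by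
  induction B using List.reverseRecOn with
  | nil =>
    rw [leftNormed_nil, lsum_cons, lsum_nil]
    change V.tdeg b = _
    simp only [GrSp.tdeg, GrSp.sdeg]; ring
  | append_singleton B i ih =>
    rw [leftNormed_concat, ← List.cons_append, lsum_append, lsum_cons (x := i), lsum_nil]
    change mdeg V (leftNormed b B) + V.tdeg i - 1 = _
    rw [ih]
    simp only [GrSp.tdeg, GrSp.sdeg]; ring

lemma GMon.degree_mulWord (γ : List V.Idx) (m : GMon V.Idx) :
    mdeg V (mulWord γ m) = lsum V.tdeg γ + mdeg V m := by
  induction γ with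
  | nil => simp
  | cons i γ ih =>
    rw [mulWord_cons, lsum_cons]
    change V.tdeg i + mdeg V (mulWord γ m) = _
    rw [ih]; ring

lemma Coeffs.Graded.expand_homog {c : Coeffs k V} (hg : c.Graded) (α : V.Idx) :
    SerHomog (V.tdeg α + 1) (c.expand α) := by
  intro m hm
  have hd : ∀ γ b B, m.decode = some (γ, b :: B) →
      mdeg V m = lsum V.tdeg γ + 1 - lsum V.sdeg (b :: B) := by
    intro γ b B h
    obtain ⟨b', B', e, hm⟩ := GMon.eq_of_decode m γ _ h
    obtain ⟨rfl, rfl⟩ := List.cons.inj e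
    rw [hm, GMon.degree_mulWord, GMon.degree_leftNormed]; ring
  rw [Coeffs.expand] at hm
  split at hm
  · exact absurd rfl hm
  · exact absurd rfl hm
  · next γ β h =>
    have := hg.deg_nil α _ (right_ne_zero_of_mul hm)
    rw [hd _ _ _ h, ← this, lsum_append, lsum_cons, lsum_cons, lsum_nil, lsum_nil]
    simp only [GrSp.tdeg, GrSp.sdeg]; ring
  · next γ B h0 h1 h =>
    obtain ⟨b, B', rfl, -⟩ := GMon.eq_of_decode m γ B h
    have hne : c α (b :: B') γ ≠ 0 := fun h => hm (by rw [h, mul_zero, smul_zero, neg_zero])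
    have := hg.deg_word α _ γ (by simp) hne
    rw [hd _ _ _ h]
    simp only [GrSp.tdeg, GrSp.sdeg] at this ⊢
    linarith

lemma QuotG.isHomog_mono (m : GMon V.Idx) :
    QuotG.IsHomog (mdeg V m) ((relIdeal k V 2).mkQ (mono k V m)) :=
  ⟨_, SerHomog.mono m, rfl⟩

lemma evalQuot_fil {n : ℕ} {q : QuotG k V 2} (h : q.InFiltration n) :
    evalQuot k V q ∈ Model.fil k V n := by
  obtain ⟨x, hx, rfl⟩ := h
  exact evalSer_fil hx

variable [CharZero k]

/-- A solution of the quadratic equations gives a differential. -/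
theorem Coeffs.IsMC.exists_differential {c : Coeffs k V} (h : c.IsMC) :
    ∃ D : GDifferential k V 2, D.IsCoeffs c := by
  have hf := h.graded.oddFamily h.adm
  have hx := fun α => h.adm.evalSer_expand α
  have h1 : ∀ α, (Model.der (fun α => h.adm.model α) (h.adm.model α)).1 = 0 := by
    intro α
    ext γ
    rw [h.adm.der_model_fst, h.square_zero]
    rfl
  have hM : ∀ α, Model.der (fun α => h.adm.model α) (h.adm.model α) = 0 := by
    intro α
    have ht := evalSer_tame (derSer (fun α => c.expand α) (c.expand α))
    rw [hf.evalSer_derSer hx, h.adm.evalSer_expand] at ht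
    refine Prod.ext (h1 α) (funext fun B => ?_)
    match B with
    | [] => exact ht.2.1
    | [j] =>
      rw [ht.2.2 j, h1 α]
      exact map_zero (tw (V.tdeg j))
    | x :: y :: B =>
      ext γ
      rw [h.graded.der_model_snd h.adm α _ _ (by simp), h.ainf_zero α _ γ (by simp), smul_zero]
      rfl
  exact ⟨hf.toDifferential hM hx h.graded.expand_homog, h.adm,
    hf.toDifferential_gen hM hx h.graded.expand_homog⟩

namespace GDifferential

variable (D : GDifferential k V 2)

lemma evalQuot_D {c : Coeffs k V} (hc : D.IsCoeffs c) (hg : c.Graded) (x : GSer k V) :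
    evalQuot k V (D.D ((relIdeal k V 2).mkQ x)) =
      Model.der (fun α => hc.1.model α) (evalSer k V x) := by
  have hf := hg.oddFamily hc.1
  have := eq_of_filtered (Model.fil k V) Model.fil_sep
    ((evalQuot k V).comp (D.D.comp (relIdeal k V 2).mkQ))
    ((Model.der (fun α => hc.1.model α)).comp (evalSer k V))
    (fun n y hy => evalQuot_fil (D.filtered n _ ⟨y, hy, rfl⟩))
    (fun n y hy => hf.der_fil (evalSer_fil hy)) (fun m => by
      change evalQuot k V (D.D ((relIdeal k V 2).mkQ (mono k V m))) = Model.der _ (evalSer k V (mono k V m))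
      rw [evalSer_mono]
      induction m with
      | gen α =>
        rw [hf.der_gen]
        refine (congrArg _ (hc.2 α)).trans ?_
        rw [evalQuot_mk, hc.1.evalSer_expand]
      | mul a b ha hb =>
        rw [← serMul_mono]
        change evalQuot k V (D.D (QuotG.mul k V 2 ((relIdeal k V 2).mkQ (mono k V a))
          ((relIdeal k V 2).mkQ (mono k V b)))) = Model.der _ (Model.mul (evalMon k a) (evalMon k b))
        rw [D.map_mul _ _ _ (QuotG.isHomog_mono a), map_add, sgn_smul_map, evalQuot_mul, evalQuot_mul, ha,
          hb, hf.der_mul (evalMon_hasPar a), evalQuot_mk, evalQuot_mk, evalSer_mono, evalSer_mono]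
      | br a b ha hb =>
        rw [← serBr_mono]
        change evalQuot k V (D.D (QuotG.br k V 2 ((relIdeal k V 2).mkQ (mono k V a))
          ((relIdeal k V 2).mkQ (mono k V b)))) = Model.der _ (Model.br (evalMon k a) (evalMon k b))
        rw [D.map_br _ _ _ (QuotG.isHomog_mono a), map_add, sgn_smul_map, evalQuot_br, evalQuot_br, ha,
          hb, hf.der_br (evalMon_hasPar a) (evalMon_hasPar b), evalQuot_mk, evalQuot_mk,
          evalSer_mono, evalSer_mono])
  exact LinearMap.congr_fun this x

lemma IsCoeffs.graded {D : GDifferential k V 2} {c : Coeffs k V} (hc : D.IsCoeffs c) :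
    c.Graded := by
  have key : ∀ α, (hc.1.model α).HomogOf V.tdeg (fun i => - V.sdeg i) 1 (V.tdeg α + 1) := by
    intro α
    obtain ⟨x, hx, e⟩ := D.degree_one _ _ (QuotG.isHomog_mono (k := k) (.gen α))
    have := evalSer_homogOf (mdeg V) _ x evalMon_degree hx
    have e' := congrArg (evalQuot k V) (e.trans (hc.2 α))
    rw [evalQuot_mk, evalQuot_mk, hc.1.evalSer_expand] at e'
    rwa [e'] at this
  refine ⟨hc.1.no_constant, hc.1.no_single, fun α γ h => (key α).1 γ h, fun α B γ hB h => ?_⟩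
  match B, hB with
  | [j], _ => exact absurd (hc.1.no_single α j γ) h
  | x :: y :: B, _ =>
    have := (key α).2 (x :: y :: B) γ (by
      rw [hc.1.model_snd α (x :: y :: B) (by simp)]
      intro h0
      apply h
      have h1 : -(sgn (V.sdeg α * (1 + lsum V.sdeg (x :: y :: B)) + pairSum V.sdeg (x :: y :: B)) •
        c α (x :: y :: B) γ) = 0 := h0
      rw [neg_eq_zero] at h1
      rw [← sgn_smul_self (V.sdeg α * (1 + lsum V.sdeg (x :: y :: B)) +
        pairSum V.sdeg (x :: y :: B)) (c α (x :: y :: B) γ), h1, smul_zero])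
    rw [lsum_neg] at this
    simp only [GrSp.tdeg] at this
    simp only [GrSp.sdeg] at this ⊢
    linarith

/-- The coefficients of a differential satisfy the quadratic equations. -/
lemma IsCoeffs.isMC {D : GDifferential k V 2} {c : Coeffs k V} (hc : D.IsCoeffs c) :
    c.IsMC := by
  have hg := hc.graded
  have key : ∀ α, Model.der (fun α => hc.1.model α) (hc.1.model α) = 0 := by
    intro α
    rw [← hc.1.evalSer_expand α, ← D.evalQuot_D hc hg, ← hc.2 α, D.sq_zero, map_zero]
  refine ⟨hc.1, hg, fun α γ => ?_, fun α B γ hB => ?_⟩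
  · rw [← hc.1.der_model_fst, key]; rfl
  · have hne : B ≠ [] := fun h => by rw [h] at hB; simp at hB
    have := hg.der_model_snd hc.1 α B γ hne
    rw [key] at this
    rw [← sgn_smul_self (1 + V.sdeg α * (1 + lsum V.sdeg B) + pairSum V.sdeg B) (c.ainf α B γ),
      ← this]
    exact smul_zero _

lemma exists_isCoeffs : ∃ c, D.IsCoeffs c := by
  obtain ⟨c, hc, h⟩ := exists_admissible fun α => D.D (QuotG.gen k V 2 α)
  exact ⟨c, hc, h⟩

lemma isCoeffs_coeffs : D.IsCoeffs D.coeffs := by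
  rw [coeffs, dif_pos D.exists_isCoeffs]
  exact D.exists_isCoeffs.choose_spec

variable {D}

lemma IsCoeffs.coeffs_eq {c : Coeffs k V} (hc : D.IsCoeffs c) : D.coeffs = c :=
  D.isCoeffs_coeffs.1.eq_of_expand hc.1 fun α => by rw [← D.isCoeffs_coeffs.2, hc.2]

lemma coeffs_injective : Function.Injective (coeffs : GDifferential k V 2 → Coeffs k V) := by
  intro D D' e
  have hc := D.isCoeffs_coeffs
  have hc' := D'.isCoeffs_coeffs
  rw [← e] at hc'
  refine GDifferential.ext (LinearMap.ext fun q => ?_)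
  obtain ⟨x, rfl⟩ := (relIdeal k V 2).mkQ_surjective q
  apply evalQuot_injective
  rw [D.evalQuot_D hc hc.graded, D'.evalQuot_D hc' hc.graded]

lemma range_coeffs (c : Coeffs k V) :
    (∃ D : GDifferential k V 2, D.coeffs = c) ↔ c.IsMC := by
  constructor
  · rintro ⟨D, rfl⟩
    exact D.isCoeffs_coeffs.isMC
  · intro h
    obtain ⟨D, hD⟩ := h.exists_differential
    exact ⟨D, hD.coeffs_eq⟩

end GDifferential

end GInf

namespace GInf

section Words

variable {X M : Type*}

lemma exists_split {L : List X} {n : ℕ} (h : n ≤ L.length) : ∃ A C, L = A ++ C ∧ A.length = n :=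
  ⟨L.take n, L.drop n, (List.take_append_drop n L).symm, List.length_take_of_le h⟩

/-- The sum over all the letters of a word. -/
def letterSum [AddCommMonoid M] : (List X → X → List X → M) → List X → M
  | _, [] => 0
  | K, x :: l => K [] x l + letterSum (fun A => K (x :: A)) l

lemma letterSum_congr [AddCommMonoid M] {K K' : List X → X → List X → M} {L : List X}
    (h : ∀ A x C, A ++ x :: C = L → K A x C = K' A x C) : letterSum K L = letterSum K' L := by
  induction L generalizing K K' with
  | nil => rfl
  | cons x l ih =>
    simp only [letterSum]
    rw [h [] x l rfl, ih fun A y C e => h (x :: A) y C (by rw [← e]; rfl)]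

lemma letterSum_append [AddCommMonoid M] (K : List X → X → List X → M) (L L' : List X) :
    letterSum K (L ++ L') = letterSum (fun A x C => K A x (C ++ L')) L +
      letterSum (fun A => K (L ++ A)) L' := by
  induction L generalizing K with
  | nil => simp [letterSum]
  | cons x l ih => simp only [List.cons_append, letterSum, ih, add_assoc]

lemma letterSum_hom {N : Type*} [AddCommMonoid M] [AddCommMonoid N] (φ : M →+ N)
    (K : List X → X → List X → M) (L : List X) :
    φ (letterSum K L) = letterSum (fun A x C => φ (K A x C)) L := by
  induction L generalizing K with
  | nil => exact map_zero φ
  | cons x l ih => simp only [letterSum, map_add, ih]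

lemma letterSum_ofFn [AddCommMonoid M] (K : List X → X → List X → M) {m : ℕ} (f : Fin m → X) :
    letterSum K (List.ofFn f) = ∑ i : Fin m, K ((List.ofFn f).take i) (f i)
      ((List.ofFn f).drop (i + 1)) := by
  induction m generalizing K with
  | zero => simp [letterSum]
  | succ m ih =>
    rw [List.ofFn_succ, letterSum, Fin.sum_univ_succ, ih]
    rfl

lemma blockSum_eq_letterSum [AddCommMonoid M] (K : List X → List X → List X → M) (B : List X)
    (h : ∀ P Q R, 2 ≤ Q.length → K P Q R = 0) :
    blockSum K B = letterSum (fun P x R => K P [x] R) B := by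
  induction B generalizing K with
  | nil => rfl
  | cons b B ih =>
    rw [blockSum, letterSum, ih _ fun P Q R hQ => h _ _ _ hQ]
    congr 1
    refine Eq.trans (splitSum_congr fun P Q _ => ?_)
      (splitSum_ite_left (fun R => K [] [b] R) B)
    split_ifs with hP
    · rw [hP]
    · exact h _ _ _ (by have := List.length_pos_iff.2 hP; rw [List.length_cons]; omega)

end Words

lemma sgn_zero_smul {M : Type*} [AddCommGroup M] (x : M) : sgn 0 • x = x := by
  have h : sgn 0 = 1 := Int.negOnePow_zero
  rw [h, one_smul]

section Unshuffles

variable {V : GrSp} {M : Type*} [AddCommGroup M]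

/-- The sum over all the ways of distributing the letters of a word over two words, with Koszul
signs. -/
def unshuffleSum : (List V.Idx → List V.Idx → M) → List V.Idx → M
  | K, [] => K [] []
  | K, x :: l => unshuffleSum (fun l₁ l₂ => K (x :: l₁) l₂) l +
      unshuffleSum (fun l₁ l₂ => sgn (V.tdeg x * lsum V.tdeg l₁) • K l₁ (x :: l₂)) l

lemma unshuffleSum_congr {K K' : List V.Idx → List V.Idx → M} {L : List V.Idx}
    (h : ∀ l₁ l₂, (l₁ ++ l₂).Perm L → K l₁ l₂ = K' l₁ l₂) :
    unshuffleSum K L = unshuffleSum K' L := by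
  induction L generalizing K K' with
  | nil => exact h [] [] (List.Perm.refl _)
  | cons x l ih =>
    simp only [unshuffleSum]
    refine congrArg₂ (· + ·) (ih fun l₁ l₂ e => h _ _ (e.cons x)) (ih fun l₁ l₂ e => ?_)
    rw [h _ _ (List.perm_middle.trans (e.cons x))]

lemma unshuffleSum_hom {N : Type*} [AddCommGroup N] (φ : M →+ N)
    (K : List V.Idx → List V.Idx → M) (L : List V.Idx) :
    φ (unshuffleSum K L) = unshuffleSum (fun l₁ l₂ => φ (K l₁ l₂)) L := by
  induction L generalizing K with
  | nil => rfl
  | cons x l ih =>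
    have e : ∀ (c : ℤˣ) (y : M), φ (c • y) = c • φ y := by
      intro c y
      rcases Int.units_eq_one_or c with h | h <;> simp [h]
    simp only [unshuffleSum, map_add, ih, e]

lemma unshuffleSum_zero (L : List V.Idx) : unshuffleSum (fun _ _ => (0 : M)) L = 0 := by
  induction L with
  | nil => rfl
  | cons x l ih => simp only [unshuffleSum, smul_zero, ih, add_zero]

lemma taylorMul_eq_unshuffleSum {k : Type u} [Field k] (f g : List V.Idx → k) (L : List V.Idx) :
    taylorMul f g L = unshuffleSum (fun l₁ l₂ => f l₁ * g l₂) L := by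
  induction L generalizing f g with
  | nil => rfl
  | cons x l ih =>
    simp only [taylorMul, unshuffleSum, ih]
    congr 2
    funext l₁ l₂
    rw [smul_mul_assoc]

lemma unshuffleSum_left (K : List V.Idx → List V.Idx → M) (L : List V.Idx)
    (h : ∀ l₁ l₂, l₁ ≠ [] → K l₁ l₂ = 0) : unshuffleSum K L = K [] L := by
  induction L generalizing K with
  | nil => rfl
  | cons x l ih =>
    rw [unshuffleSum, ih (fun l₁ l₂ => sgn (V.tdeg x * lsum V.tdeg l₁) • K l₁ (x :: l₂))
      fun l₁ l₂ hl => by rw [h _ _ hl, smul_zero], lsum_nil, mul_zero,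
      sgn_zero_smul, unshuffleSum_congr (K' := fun _ _ => 0)
        fun l₁ l₂ _ => h _ _ (by simp), unshuffleSum_zero, zero_add]

lemma unshuffleSum_right (K : List V.Idx → List V.Idx → M) (L : List V.Idx)
    (h : ∀ l₁ l₂, l₂ ≠ [] → K l₁ l₂ = 0) : unshuffleSum K L = K L [] := by
  induction L generalizing K with
  | nil => rfl
  | cons x l ih =>
    rw [unshuffleSum, ih _ fun l₁ l₂ hl => h _ _ hl, unshuffleSum_congr (K' := fun _ _ => 0)
        fun l₁ l₂ _ => by rw [h _ _ (by simp), smul_zero], unshuffleSum_zero, add_zero]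

lemma unshuffleSum_single (K : List V.Idx → List V.Idx → M) (L : List V.Idx)
    (h : ∀ l₁ l₂, l₁.length ≠ 1 → K l₁ l₂ = 0) : unshuffleSum K L =
      letterSum (fun A x C => sgn (lsum V.tdeg A * V.tdeg x) • K [x] (A ++ C)) L := by
  induction L generalizing K with
  | nil => exact h _ _ (by simp)
  | cons x l ih =>
    rw [unshuffleSum, letterSum,
      ih (fun l₁ l₂ => sgn (V.tdeg x * lsum V.tdeg l₁) • K l₁ (x :: l₂))
        fun l₁ l₂ hl => by rw [h _ _ hl, smul_zero],
      unshuffleSum_left (fun l₁ l₂ => K (x :: l₁) l₂) _ fun l₁ l₂ hl => h _ _ (by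
        have := List.length_pos_iff.2 hl; rw [List.length_cons]; omega)]
    congr 1
    · rw [lsum_nil, zero_mul, sgn_zero_smul]; rfl
    · refine letterSum_congr fun A y C _ => ?_
      rw [sgn_smul_smul, lsum_cons, lsum_cons, lsum_nil, List.cons_append]
      congr 2; ring

end Unshuffles

namespace Species

variable {k : Type u} [Field k] {F : Species k}

variable (F) in
/-- Families of functions of words with values in `V`. -/
abbrev WordFam : Type u := ∀ V : GrSp, F.Str V → List V.Idx → V.Idx → k

variable (F) in
/-- The word functions which represent elements of the operad of arity `m` and degree `q`. -/
def WGen (m : ℕ) (q : ℤ) (Φ : F.WordFam) : Prop :=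
  F.Gen m q fun V S β => Φ V S (List.ofFn β)

namespace WGen

variable {m : ℕ} {q : ℤ} {Φ Ψ : F.WordFam}

lemma congr (h : F.WGen m q Φ) (e : ∀ (V : GrSp) (S : F.Str V) (L : List V.Idx),
    L.length = m → Φ V S L = Ψ V S L) : F.WGen m q Ψ := by
  have : (fun (V : GrSp) (S : F.Str V) (β : Fin m → V.Idx) => Ψ V S (List.ofFn β)) =
      fun V S β => Φ V S (List.ofFn β) := by
    funext V S β
    exact (e V S _ (List.length_ofFn)).symm
  rw [WGen, this]
  exact h

lemma zero : F.WGen m q fun _ _ _ => 0 := Gen.zero m q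

lemma add (h : F.WGen m q Φ) (h' : F.WGen m q Ψ) : F.WGen m q fun V S L => Φ V S L + Ψ V S L :=
  Gen.add h h'

lemma smul (a : k) (h : F.WGen m q Φ) : F.WGen m q fun V S L => a • Φ V S L := Gen.smul a h

lemma sgn_smul (c : ℤˣ) (h : F.WGen m q Φ) : F.WGen m q fun V S L => c • Φ V S L := by
  rcases Int.units_eq_one_or c with e | e
  · exact h.congr fun V S L _ => by rw [e, one_smul]
  · exact (h.smul (-1)).congr fun V S L _ => by
      rw [e, neg_smul, one_smul, Units.neg_smul, one_smul]

lemma sum {ι : Type*} (s : Finset ι) {Φ : ι → F.WordFam} (h : ∀ i ∈ s, F.WGen m q (Φ i)) :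
    F.WGen m q fun V S L => ∑ i ∈ s, Φ i V S L := by
  classical
  induction s using Finset.induction_on with
  | empty => exact zero.congr fun V S L _ => by simp
  | insert a s ha ih =>
    refine ((h a (Finset.mem_insert_self a s)).add
      (ih fun i hi => h i (Finset.mem_insert_of_mem hi))).congr fun V S L _ => ?_
    rw [Finset.sum_insert ha]

end WGen

/-- The exchange of two neighbouring subwords, with the Koszul sign. -/
def moveWord (a b c : ℕ) (Φ : F.WordFam) : F.WordFam := fun V S L =>
  sgn (lsum V.deg ((L.drop a).take b) * lsum V.deg ((L.drop (a + b)).take c)) •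
    Φ V S (L.take a ++ ((L.drop (a + b)).take c ++ ((L.drop a).take b ++ L.drop (a + b + c))))

lemma moveWord_append (Φ : F.WordFam) (V : GrSp) (S : F.Str V) (A B C D : List V.Idx) :
    moveWord A.length B.length C.length Φ V S (A ++ (B ++ (C ++ D))) =
      sgn (lsum V.deg B * lsum V.deg C) • Φ V S (A ++ (C ++ (B ++ D))) := by
  have e1 : (A ++ (B ++ (C ++ D))).drop (A.length + B.length) = C ++ D := by
    rw [← List.append_assoc, ← List.length_append, List.drop_left]
  have e2 : (A ++ (B ++ (C ++ D))).drop (A.length + B.length + C.length) = D := by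
    rw [← List.drop_drop, e1, List.drop_left]
  rw [moveWord, e1, e2, List.drop_left, List.take_left, List.take_left, List.take_left]

lemma koszul_swap {m : ℕ} (s : ℕ) (h : s + 1 < m) (d : Fin m → ℤ) :
    EndOp.koszul (Equiv.swap ⟨s, by omega⟩ ⟨s + 1, h⟩) d = d ⟨s, by omega⟩ * d ⟨s + 1, h⟩ := by
  have key : ∀ i j : Fin m, (i < j ∧ (Equiv.swap (⟨s, by omega⟩ : Fin m) ⟨s + 1, h⟩ j) <
      (Equiv.swap (⟨s, by omega⟩ : Fin m) ⟨s + 1, h⟩ i)) ↔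
      i = ⟨s, by omega⟩ ∧ j = ⟨s + 1, h⟩ := by
    intro i j
    simp only [Equiv.swap_apply_def, Fin.lt_def, Fin.ext_iff]
    split_ifs <;> (try dsimp only at *) <;> omega
  simp only [EndOp.koszul, key]
  rw [Finset.sum_eq_single ⟨s, by omega⟩, Finset.sum_eq_single ⟨s + 1, h⟩]
  · rw [if_pos ⟨rfl, rfl⟩, Equiv.swap_apply_left, Equiv.swap_apply_right, mul_comm]
  · intro j _ hj; rw [if_neg fun h => hj h.2]
  · simp
  · intro i _ hi
    exact Finset.sum_eq_zero fun j _ => by rw [if_neg fun h => hi h.1]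
  · simp

namespace WGen

variable {m : ℕ} {q : ℤ} {Φ Ψ : F.WordFam}

lemma swap (h : F.WGen m q Φ) (s : ℕ) (hs : s + 1 < m) : F.WGen m q (moveWord s 1 1 Φ) := by
  have := Gen.perm (Equiv.swap ⟨s, by omega⟩ ⟨s + 1, hs⟩) h
  rw [WGen]
  convert this using 1
  funext V S β
  obtain ⟨L, hL⟩ : ∃ L, L = List.ofFn β := ⟨_, rfl⟩
  have hlen : L.length = m := by rw [hL, List.length_ofFn]
  have hget : ∀ (i : ℕ) (hi : i < m), L[i]'(by omega) = β ⟨i, hi⟩ := by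
    intro i hi; simp [hL]
  have e1 : (L.drop s).take 1 = [β ⟨s, by omega⟩] := by
    rw [List.take_one_drop_eq_of_lt_length (by omega)]
    exact congrArg (fun x => [x]) (hget s _)
  have e2 : (L.drop (s + 1)).take 1 = [β ⟨s + 1, hs⟩] := by
    rw [List.take_one_drop_eq_of_lt_length (by omega)]
    exact congrArg (fun x => [x]) (hget (s + 1) _)
  rw [← hL, moveWord, e1, e2]
  change _ = sgn (EndOp.koszul _ (V.deg ∘ β)) • Φ V S (List.ofFn (β ∘ _))
  rw [koszul_swap s hs]
  simp only [lsum_cons, lsum_nil, add_zero, Function.comp]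
  congr 2
  refine List.ext_getElem ?_ fun i h1 h2 => ?_
  · simp [hlen]; omega
  · rw [List.length_ofFn] at h2
    rw [List.getElem_ofFn]
    simp only [List.getElem_append, List.length_take, hlen, Nat.min_eq_left (show s ≤ m by omega),
      List.length_cons, List.length_nil, List.getElem_take, List.getElem_drop,
      List.getElem_singleton]
    split_ifs
    all_goals
      try rw [hget _ (by omega)]
      refine congrArg β ?_
      rw [Equiv.swap_apply_def]
      simp only [Fin.ext_iff]
      split_ifs <;> (try dsimp only at *) <;> omega

lemma move_one (h : F.WGen m q Φ) (a b : ℕ) (hm : a + b + 1 ≤ m) :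
    F.WGen m q (moveWord a b 1 Φ) := by
  induction b generalizing a with
  | zero =>
    refine h.congr fun V S L hL => ?_
    obtain ⟨A, L', rfl, rfl⟩ := exists_split (L := L) (n := a) (by omega)
    rw [List.length_append] at hL
    obtain ⟨C, D, rfl, hC⟩ := exists_split (L := L') (n := 1) (by omega)
    have := moveWord_append Φ V S A [] C D
    rw [hC] at this
    refine Eq.trans ?_ this.symm
    simp
  | succ b ih =>
    refine ((ih a (by omega)).swap (a + b) (by omega)).congr fun V S L hL => ?_
    obtain ⟨A, L, rfl, rfl⟩ := exists_split (L := L) (n := a) (by omega)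
    rw [List.length_append] at hL
    obtain ⟨B, L, rfl, rfl⟩ := exists_split (L := L) (n := b) (by omega)
    rw [List.length_append] at hL
    obtain ⟨X, L, rfl, hX⟩ := exists_split (L := L) (n := 1) (by omega)
    rw [List.length_append] at hL
    obtain ⟨Y, D, rfl, hY⟩ := exists_split (L := L) (n := 1) (by omega)
    have e1 := moveWord_append (moveWord A.length B.length 1 Φ) V S (A ++ B) X Y D
    have e2 := moveWord_append Φ V S A B Y (X ++ D)
    have e3 := moveWord_append Φ V S A (B ++ X) Y D
    simp only [List.length_append, hX, hY, List.append_assoc] at e1 e2 e3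
    rw [e1, e2, e3, sgn_smul_smul, lsum_append]
    congr 2; ring

lemma move (h : F.WGen m q Φ) (a b c : ℕ) (hm : a + b + c ≤ m) :
    F.WGen m q (moveWord a b c Φ) := by
  induction c generalizing Φ with
  | zero =>
    refine h.congr fun V S L hL => ?_
    obtain ⟨A, L', rfl, rfl⟩ := exists_split (L := L) (n := a) (by omega)
    rw [List.length_append] at hL
    obtain ⟨C, D, rfl, rfl⟩ := exists_split (L := L') (n := b) (by omega)
    have := moveWord_append Φ V S A C [] D
    refine Eq.trans ?_ this.symm
    simp
  | succ c ih =>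
    refine (ih (h.move_one (a + c) b (by omega)) (by omega)).congr fun V S L hL => ?_
    obtain ⟨A, L, rfl, rfl⟩ := exists_split (L := L) (n := a) (by omega)
    rw [List.length_append] at hL
    obtain ⟨B, L, rfl, rfl⟩ := exists_split (L := L) (n := b) (by omega)
    rw [List.length_append] at hL
    obtain ⟨Y, L, rfl, rfl⟩ := exists_split (L := L) (n := c) (by omega)
    rw [List.length_append] at hL
    obtain ⟨X, D, rfl, hX⟩ := exists_split (L := L) (n := 1) (by omega)
    have e1 := moveWord_append (moveWord (A.length + Y.length) B.length 1 Φ) V S A B Y (X ++ D)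
    have e2 := moveWord_append Φ V S (A ++ Y) B X D
    have e3 := moveWord_append Φ V S A B (Y ++ X) D
    simp only [List.length_append, hX, List.append_assoc] at e1 e2 e3
    rw [e1, e2, e3, sgn_smul_smul, lsum_append]
    congr 2; ring

end WGen

end Species

end GInf

namespace GInf

section Degrees

variable (V : GrSp)

lemma lsum_tdeg (l : List V.Idx) : lsum V.tdeg l = 2 * l.length - lsum V.deg l := by
  induction l with
  | nil => simp
  | cons a l ih =>
    simp only [lsum_cons, ih, GrSp.tdeg, List.length_cons]
    push_cast; ring

lemma lsum_sdeg (l : List V.Idx) : lsum V.sdeg l = lsum V.deg l - l.length := by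
  induction l with
  | nil => simp
  | cons a l ih =>
    simp only [lsum_cons, ih, GrSp.sdeg, List.length_cons]
    push_cast; ring

lemma lsum_ofFn {X : Type*} (d : X → ℤ) {n : ℕ} (f : Fin n → X) :
    lsum d (List.ofFn f) = ∑ i, d (f i) := by
  rw [lsum, List.map_ofFn, List.sum_ofFn]; rfl

end Degrees

lemma take_drop_ofFn {X : Type*} {m : ℕ} (f : Fin m → X) (i l : ℕ) (h : i + l ≤ m) :
    ((List.ofFn f).drop i).take l = List.ofFn fun j : Fin l => f ⟨i + j, by omega⟩ := by
  refine List.ext_getElem (by simp; omega) fun j _ _ => by simp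

lemma take_ofFn {X : Type*} {m : ℕ} (f : Fin m → X) (l : ℕ) (h : l ≤ m) :
    (List.ofFn f).take l = List.ofFn fun j : Fin l => f ⟨j, by omega⟩ := by
  refine List.ext_getElem (by simp; omega) fun j _ _ => by simp

lemma take_eq_of_append {X : Type*} {L A B : List X} {n : ℕ} (h : L = A ++ B) (hn : A.length = n) :
    L.take n = A := by
  rw [h, ← hn, List.take_left]

lemma drop_eq_of_append {X : Type*} {L A B : List X} {n : ℕ} (h : L = A ++ B) (hn : A.length = n) :
    L.drop n = B := by
  rw [h, ← hn, List.drop_left]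

lemma take_drop_eq_of_append {X : Type*} {L A B C : List X} {n m : ℕ} (h : L = A ++ (B ++ C))
    (hn : A.length = n) (hm : B.length = m) : (L.drop n).take m = B := by
  rw [drop_eq_of_append h hn, ← hm, List.take_left]

namespace Species

variable {k : Type u} [Field k] {F : Species k}

/-- The insertion of a word function in another one. -/
def circWord (i n' : ℕ) (Φ Ψ : F.WordFam) : F.WordFam := fun V S L α => ∑ b : V.Idx,
  sgn ((V.deg b - lsum V.deg ((L.drop i).take n')) * lsum V.deg (L.take i)) •
    (Φ V S (L.take i ++ b :: L.drop (i + n')) α * Ψ V S ((L.drop i).take n') b)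

/-- The differential of a structure on the underlying space. -/
def diffCoef {V : GrSp} (S : F.Str V) (x b : V.Idx) : k :=
  sgn (V.deg x) • F.coeffs S b [] [x]

lemma diffOp_apply {V : GrSp} (S : F.Str V) (β : Fin 1 → V.Idx) (α : V.Idx) :
    F.diffOp S β α = diffCoef S (β 0) α := by
  change sgn _ • F.coeffs S α (List.ofFn fun i : Fin 0 => β (Fin.castAdd 1 i))
    (List.ofFn fun j : Fin 1 => β (Fin.natAdd 0 j)) = _
  have e1 : (List.ofFn fun i : Fin 0 => β (Fin.castAdd 1 i)) = [] := by simp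
  have e2 : (List.ofFn fun j : Fin 1 => β (Fin.natAdd 0 j)) = [β 0] := by simp [List.ofFn_succ]
  rw [e1, e2, diffCoef]
  simp only [staircaseSum, lsum_cons, lsum_nil, pairSum, opDeg]
  congr 2
  simp

/-- The differential of a word function of degree `q`. -/
def diffWord (q : ℤ) (Φ : F.WordFam) : F.WordFam := fun V S L α =>
  ∑ b, diffCoef S b α * Φ V S L b - sgn q • letterSum (fun A x C => ∑ b,
    sgn ((V.deg b - V.deg x) * lsum V.deg A) • (Φ V S (A ++ b :: C) α * diffCoef S x b)) L

namespace WGen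

variable {m : ℕ} {q : ℤ} {Φ Ψ : F.WordFam}

lemma circ {n n' m : ℕ} {p q : ℤ} (hΦ : F.WGen n p Φ) (hΨ : F.WGen n' q Ψ) (i : ℕ) (hi : i < n)
    (h : n + n' = m + 1) : F.WGen m (p + q) (circWord i n' Φ Ψ) := by
  have := Gen.circ h ⟨i, hi⟩ hΦ hΨ
  rw [WGen]
  convert this using 1
  funext V S β α
  refine Finset.sum_congr rfl fun b _ => ?_
  rw [take_drop_ofFn _ _ _ (by omega), take_ofFn _ _ (by omega), lsum_ofFn, lsum_ofFn]
  congr 4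
  refine List.ext_getElem (by simp; omega) fun j h1 h2 => ?_
  rw [List.length_ofFn] at h2
  simp only [List.getElem_append, List.getElem_cons, List.length_ofFn, List.getElem_ofFn,
    List.getElem_drop, Fin.lt_def]
  split_ifs
  all_goals first | rfl | omega | skip
  congr 2
  omega

lemma diff (hΦ : F.WGen m q Φ) : F.WGen m (q + 1) (diffWord q Φ) := by
  have := Gen.diff hΦ
  rw [WGen]
  convert this using 1
  funext V S β α
  change ∑ b, _ - _ = EndOp.circ (Nat.add_comm 1 m) 0 (F.diffOp S) _ β α - sgn q • ((∑ i : Fin m,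
    EndOp.circ (rfl : m + 1 = m + 1) i (fun β => Φ V S (List.ofFn β)) (F.diffOp S)) β α)
  congr 1
  · refine Finset.sum_congr rfl fun b _ => ?_
    have e : ∀ x : ℤ, sgn (x * ∑ j : Fin (0 : ℕ), V.deg (β ⟨j, by omega⟩)) = 1 := fun x => by simp
    refine Eq.trans ?_ (congrArg₂ (fun (s : ℤˣ) (x : k) => s • x) (e _).symm rfl)
    rw [one_smul, diffOp_apply]
    simp
  · congr 1
    rw [letterSum_ofFn, Finset.sum_apply, Finset.sum_apply]
    refine Finset.sum_congr rfl fun i _ => Finset.sum_congr rfl fun b _ => ?_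
    rw [take_ofFn _ _ (by omega), lsum_ofFn, diffOp_apply, Fin.sum_univ_one]
    congr 4
    refine List.ext_getElem (by simp; omega) fun j h1 h2 => ?_
    rw [List.length_ofFn] at h2
    simp only [List.getElem_append, List.getElem_cons, List.length_ofFn, List.getElem_ofFn,
      List.getElem_drop, Fin.lt_def]
    split_ifs
    all_goals first | rfl | omega | skip
    congr 2
    omega

lemma unshuffle (m : ℕ) (q : ℤ) (p a : ℕ) (hm : m = a + p)
    (K : ∀ V : GrSp, F.Str V → List V.Idx → List V.Idx → List V.Idx → V.Idx → k)
    (h : ∀ p₁ p₂, p₁ + p₂ = p → F.WGen m q fun V S L =>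
      K V S (L.take a) ((L.drop a).take p₁) (L.drop (a + p₁))) :
    F.WGen m q fun V S L => unshuffleSum (K V S (L.take a)) (L.drop a) := by
  induction p generalizing a K with
  | zero =>
    refine (h 0 0 rfl).congr fun V S L hL => ?_
    rw [List.take_zero, add_zero, List.drop_of_length_le (by omega)]
    rfl
  | succ p ih =>
    have h1 := ih (a + 1) (by omega)
      (fun V S A l₁ l₂ => K V S (A.take a) (A.drop a ++ l₁) l₂) fun p₁ p₂ e => by
        refine (h (p₁ + 1) p₂ (by omega)).congr fun V S L hL => ?_
        rw [List.take_take, Nat.min_eq_left (Nat.le_succ a), List.drop_take,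
          Nat.add_sub_cancel_left, add_comm p₁ 1, ← add_assoc, List.take_add, List.drop_drop]
    have h2 := ih (a + 1) (by omega) (fun V S A l₁ l₂ =>
        sgn (lsum V.tdeg (A.drop a) * lsum V.tdeg l₁) • K V S (A.take a) l₁ (A.drop a ++ l₂))
        fun p₁ p₂ e => by
      refine ((h p₁ (p₂ + 1) (by omega)).move a 1 p₁ (by omega)).congr fun V S L hL => ?_
      obtain ⟨A, L, rfl, rfl⟩ := exists_split (L := L) (n := a) (by omega)
      rw [List.length_append] at hL
      obtain ⟨X, L, rfl, hX⟩ := exists_split (L := L) (n := 1) (by omega)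
      rw [List.length_append] at hL
      obtain ⟨Y, D, rfl, rfl⟩ := exists_split (L := L) (n := p₁) (by omega)
      have e1 := moveWord_append (fun V S L => K V S (L.take A.length)
        ((L.drop A.length).take Y.length) (L.drop (A.length + Y.length))) V S A X Y D
      rw [hX] at e1
      rw [e1]
      have e2 : (A ++ (X ++ (Y ++ D))).take (A.length + 1) = A ++ X := by
        rw [← hX, ← List.length_append, ← List.append_assoc, List.take_left]
      have e3 : (A ++ (X ++ (Y ++ D))).drop (A.length + 1) = Y ++ D := by
        rw [← hX, ← List.length_append, ← List.append_assoc, List.drop_left]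
      have e4 : (A ++ (X ++ (Y ++ D))).drop (A.length + 1 + Y.length) = D := by
        rw [← List.drop_drop, e3, List.drop_left]
      have e5 : (A ++ (Y ++ (X ++ D))).drop (A.length + Y.length) = X ++ D := by
        rw [← List.drop_drop, List.drop_left, List.drop_left]
      rw [e2, e3, e4, e5, List.take_left, List.take_left, List.take_left, List.drop_left,
        List.drop_left, List.take_left]
      apply sgn_smul_congr
      rw [lsum_tdeg, lsum_tdeg]
      push_cast; ring_nf; reduce_mod_char
    refine (h1.add h2).congr fun V S L hL => ?_
    obtain ⟨A, L, rfl, rfl⟩ := exists_split (L := L) (n := a) (by omega)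
    rw [List.length_append] at hL
    obtain ⟨x, l, rfl⟩ := List.exists_cons_of_ne_nil (l := L) (by rintro rfl; simp at hL; omega)
    have e2 : (A ++ x :: l).take (A.length + 1) = A ++ [x] := by simp [List.take_append]
    have e3 : (A ++ x :: l).drop (A.length + 1) = l := by simp [List.drop_append]
    rw [e2, e3, List.take_left, List.drop_left, List.take_left, List.drop_left, unshuffleSum]
    congr 2
    funext l₁ l₂
    rw [lsum_cons, lsum_nil, add_zero]
    rfl

lemma shuffle (m : ℕ) (q : ℤ) (n : ℕ) (hn : n ≤ m)
    (φ : ∀ V : GrSp, F.Str V → List V.Idx → List V.Idx → V.Idx → k)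
    (h : F.WGen m q fun V S L =>
      sgn (staircaseSum V.deg (L.take n)) • φ V S (L.take n) (L.drop n)) (s : ℕ) :
    ∀ r a c : ℕ, a + c = s → r + s = n → F.WGen m q fun V S L =>
      sgn (staircaseSum V.deg (L.take n)) • shSum V.sdeg (fun l => φ V S (L.take r ++ l) (L.drop n))
        ((L.drop r).take a) ((L.drop (r + a)).take c) := by
  induction s with
  | zero =>
    rintro r a c hs rfl
    obtain ⟨rfl, rfl⟩ : a = 0 ∧ c = 0 := by omega
    refine h.congr fun V S L hL => ?_
    simp [shSum_nil_left]
  | succ s ih =>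
    rintro r a c hs rfl
    rcases a with _ | a
    · obtain rfl : c = s + 1 := by omega
      refine h.congr fun V S L hL => ?_
      rw [List.take_zero, shSum_nil_left, add_zero, ← List.take_add]
    rcases c with _ | c
    · obtain rfl : a = s := by omega
      refine h.congr fun V S L hL => ?_
      rw [List.take_zero, shSum_nil_right, ← List.take_add]
    have h1 := ih (r + 1) a (c + 1) (by omega) (by omega)
    have h2 := ((ih (r + 1) (a + 1) c (by omega) (by omega)).move r (a + 1) 1 (by omega)).sgn_smul
      (sgn (a + 1))
    refine (h1.add h2).congr fun V S L hL => ?_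
    obtain ⟨P, L, rfl, rfl⟩ := exists_split (L := L) (n := r) (by omega)
    rw [List.length_append] at hL
    obtain ⟨A, L, rfl, hA⟩ := exists_split (L := L) (n := a + 1) (by omega)
    rw [List.length_append] at hL
    obtain ⟨Y, L, rfl, hY⟩ := exists_split (L := L) (n := 1) (by omega)
    rw [List.length_append] at hL
    obtain ⟨C, γ, rfl, rfl⟩ := exists_split (L := L) (n := c) (by omega)
    obtain ⟨y, rfl⟩ := List.length_eq_one_iff.1 hY
    obtain ⟨x, X, rfl⟩ := List.exists_cons_of_ne_nil (l := A) (by rintro rfl; simp at hA)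
    obtain rfl : X.length = a := by simpa using hA
    have e1 := moveWord_append (fun V S L => sgn (staircaseSum V.deg (L.take (P.length + (s + 1)))) •
      shSum V.sdeg (fun l => φ V S (L.take (P.length + 1) ++ l) (L.drop (P.length + (s + 1))))
        ((L.drop (P.length + 1)).take (X.length + 1))
        ((L.drop (P.length + 1 + (X.length + 1))).take C.length)) V S P (x :: X) [y] (C ++ γ)
    rw [hA, hY] at e1
    rw [e1]
    obtain rfl : s = X.length + C.length + 1 := by omega
    obtain ⟨N, hN⟩ : ∃ N, N = P.length + (X.length + C.length + 1 + 1) := ⟨_, rfl⟩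
    obtain ⟨W₁, hW₁⟩ : ∃ W, W = P ++ (x :: X ++ ([y] ++ (C ++ γ))) := ⟨_, rfl⟩
    obtain ⟨W₂, hW₂⟩ : ∃ W, W = P ++ ([y] ++ (x :: X ++ (C ++ γ))) := ⟨_, rfl⟩
    have t1 : W₁.take N = P ++ (x :: X ++ y :: C) := take_eq_of_append (B := γ)
      (by simp [hW₁]) (by simp [hN]; omega)
    have t2 : W₂.take N = P ++ (y :: (x :: X ++ C)) := take_eq_of_append (B := γ)
      (by simp [hW₂]) (by simp [hN])
    have d1 : W₁.drop N = γ := drop_eq_of_append (A := P ++ (x :: X ++ y :: C))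
      (by simp [hW₁]) (by simp [hN]; omega)
    have d2 : W₂.drop N = γ := drop_eq_of_append (A := P ++ (y :: (x :: X ++ C)))
      (by simp [hW₂]) (by simp [hN])
    have p0 : W₁.take P.length = P := take_eq_of_append hW₁ rfl
    have p1 : W₁.take (P.length + 1) = P ++ [x] := take_eq_of_append
      (B := X ++ ([y] ++ (C ++ γ))) (by simp [hW₁]) (by simp)
    have p2 : W₂.take (P.length + 1) = P ++ [y] := take_eq_of_append
      (B := x :: X ++ (C ++ γ)) (by simp [hW₂]) (by simp)
    have a0 : (W₁.drop P.length).take (X.length + 1) = x :: X := take_drop_eq_of_append hW₁ rfl rfl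
    have a1 : (W₁.drop (P.length + 1)).take X.length = X := take_drop_eq_of_append (A := P ++ [x])
      (C := y :: C ++ γ) (by simp [hW₁]) (by simp) rfl
    have a2 : (W₂.drop (P.length + 1)).take (X.length + 1) = x :: X := take_drop_eq_of_append
      (A := P ++ [y]) (C := C ++ γ) (by simp [hW₂]) (by simp) rfl
    have c0 : (W₁.drop (P.length + (X.length + 1))).take (C.length + 1) = y :: C :=
      take_drop_eq_of_append (A := P ++ x :: X) (C := γ) (by simp [hW₁]) (by simp) rfl
    have c1 : (W₁.drop (P.length + 1 + X.length)).take (C.length + 1) = y :: C :=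
      take_drop_eq_of_append (A := P ++ x :: X) (C := γ) (by simp [hW₁]) (by simp; omega) rfl
    have c2 : (W₂.drop (P.length + 1 + (X.length + 1))).take C.length = C :=
      take_drop_eq_of_append (A := P ++ y :: x :: X) (C := γ) (by simp [hW₂]) (by simp; omega) rfl
    rw [← hN, ← hW₁, ← hW₂, t1, t2, d1, d2, p0, p1, p2, a0, a1, a2, c0, c1, c2, shSum_cons_cons,
      smul_add, sgn_smul_smul, sgn_smul_smul, sgn_smul_smul]
    congr 1
    · simp only [List.append_assoc, List.singleton_append]
    · simp only [List.append_assoc, List.singleton_append]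
      apply sgn_smul_congr
      simp only [staircaseSum_append, staircaseSum, lsum_append, lsum_cons, lsum_nil, lsum_sdeg,
        List.length_append, List.length_cons, GrSp.sdeg]
      push_cast; ring_nf; reduce_mod_char

end WGen

end Species

end GInf

namespace GInf

lemma unshuffleSum_sum {V : GrSp} {M ι : Type*} [AddCommGroup M] (s : Finset ι)
    (K : ι → List V.Idx → List V.Idx → M) (L : List V.Idx) :
    unshuffleSum (fun l₁ l₂ => ∑ i ∈ s, K i l₁ l₂) L = ∑ i ∈ s, unshuffleSum (K i) L := by
  induction L generalizing K with
  | nil => rfl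
  | cons x l ih => simp only [unshuffleSum, Finset.smul_sum, ih, Finset.sum_add_distrib]

lemma opDeg_eq (n p : ℕ) : opDeg n p = opDeg n 0 - 2 * p := by
  simp only [opDeg]
  split_ifs <;> push_cast <;> ring

lemma opDeg_of_ne {n : ℕ} (h : n ≠ 0) (p : ℕ) : opDeg n p = 2 - n - 2 * p := if_neg h

/-- The exponent of the sign which relates an operation to its coefficients. -/
def opExp (V : GrSp) (B γ : List V.Idx) : ℤ :=
  staircaseSum V.deg B + lsum V.deg γ * (opDeg B.length γ.length + lsum V.deg B) + pairSum V.deg γ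

section Homogeneity

variable {k : Type u} [Field k] {V : GrSp}

namespace EndOp

lemma IsHomog.zero {n : ℕ} (p : ℤ) : IsHomog p (0 : EndOp k V n) := fun _ _ h => absurd rfl h

lemma IsHomog.add {n : ℕ} {p : ℤ} {f g : EndOp k V n} (hf : f.IsHomog p) (hg : g.IsHomog p) :
    IsHomog p (f + g) := fun β α h => by
  by_cases h' : f β α = 0
  · exact hg β α fun h0 => h (by change f β α + g β α = 0; rw [h', h0, add_zero])
  · exact hf β α h'

lemma IsHomog.smul {n : ℕ} {p : ℤ} {f : EndOp k V n} (a : k) (hf : f.IsHomog p) :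
    IsHomog p (a • f) := fun β α h => hf β α fun h0 => h (by
  change a * f β α = 0; rw [h0, mul_zero])

lemma IsHomog.sgn_smul {n : ℕ} {p : ℤ} {f : EndOp k V n} (c : ℤˣ) (hf : f.IsHomog p) :
    IsHomog p (c • f) := fun β α h => hf β α fun h0 => h (by
  change c • f β α = 0; rw [h0, smul_zero])

lemma IsHomog.sum {ι : Type*} (s : Finset ι) {n : ℕ} {p : ℤ} {f : ι → EndOp k V n}
    (hf : ∀ i ∈ s, (f i).IsHomog p) : IsHomog p (∑ i ∈ s, f i) := by
  classical
  induction s using Finset.induction_on with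
  | empty => exact IsHomog.zero p
  | insert a s ha ih =>
    rw [Finset.sum_insert ha]
    exact (hf a (Finset.mem_insert_self a s)).add
      (ih fun i hi => hf i (Finset.mem_insert_of_mem hi))

lemma IsHomog.one : IsHomog 0 (EndOp.one : EndOp k V 1) := fun β α h => by
  rw [EndOp.one] at h
  split_ifs at h with h'
  · rw [← h', Fin.sum_univ_one, add_zero]
  · exact absurd rfl h

lemma IsHomog.perm {n : ℕ} {p : ℤ} {f : EndOp k V n} (σ : Equiv.Perm (Fin n)) (hf : f.IsHomog p) :
    IsHomog p (EndOp.perm σ f) := fun β α h => by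
  rw [hf (β ∘ σ) α fun h0 => h (by rw [EndOp.perm, h0, smul_zero])]
  congr 1
  exact Equiv.sum_comp σ fun i => V.deg (β i)

lemma IsHomog.circ {n n' m : ℕ} (h : n + n' = m + 1) (i : Fin n) {p q : ℤ} {f : EndOp k V n}
    {g : EndOp k V n'} (hf : f.IsHomog p) (hg : g.IsHomog q) :
    IsHomog (p + q) (EndOp.circ h i f g) := fun γ α h0 => by
  obtain ⟨b, _, hb⟩ := Finset.exists_ne_zero_of_sum_ne_zero h0
  have hfg := right_ne_zero_of_smul hb
  rw [hf _ α (left_ne_zero_of_mul hfg)]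
  have hg' := hg _ b (right_ne_zero_of_mul hfg)
  have e1 : ∑ j : Fin m, V.deg (γ j) = lsum V.deg ((List.ofFn γ).take i) +
      (lsum V.deg (((List.ofFn γ).drop i).take n') + lsum V.deg ((List.ofFn γ).drop (i + n'))) := by
    rw [← lsum_append, ← lsum_append, ← List.drop_drop, List.take_append_drop,
      List.take_append_drop, lsum_ofFn]
  have e3 : (List.ofFn fun j : Fin n => if h₁ : j < i then γ ⟨j, by omega⟩
        else if h₂ : i < j then γ ⟨j + n' - 1, by omega⟩ else b) =
      (List.ofFn γ).take i ++ b :: (List.ofFn γ).drop (i + n') := by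
    refine List.ext_getElem (by simp; omega) fun j h1 h2 => ?_
    rw [List.length_ofFn] at h1
    simp only [List.getElem_append, List.getElem_cons, List.length_ofFn, List.getElem_ofFn,
      List.getElem_drop, List.getElem_take, Fin.lt_def, List.length_take]
    split_ifs
    all_goals first | rfl | omega | skip
    congr 2
    omega
  have e4 := take_drop_ofFn γ i n' (by omega)
  rw [← lsum_ofFn V.deg, e3, e1, lsum_append, lsum_cons, hg', ← lsum_ofFn V.deg, ← e4]
  ring

lemma IsHomog.diff {n : ℕ} {d : EndOp k V 1} (hd : d.IsHomog 1) {p : ℤ} {f : EndOp k V n}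
    (hf : f.IsHomog p) : IsHomog (p + 1) (EndOp.diff d p f) := by
  have h1 := IsHomog.circ (Nat.add_comm 1 n) 0 hd hf
  rw [add_comm] at h1
  have h2 : IsHomog (p + 1) (-(sgn p • ∑ i, EndOp.circ (rfl : n + 1 = n + 1) i f d)) := by
    rw [← Units.neg_smul]
    exact (IsHomog.sum _ fun i _ => IsHomog.circ rfl i hf hd).sgn_smul _
  rw [EndOp.diff, sub_eq_add_neg]
  exact h1.add h2

end EndOp

lemma Coeffs.Graded.deg_eq {c : Coeffs k V} (hg : c.Graded) {α : V.Idx} {B γ : List V.Idx}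
    (h : c α B γ ≠ 0) : V.deg α = lsum V.deg B + lsum V.deg γ + opDeg B.length γ.length := by
  match B with
  | [] =>
    have := hg.deg_nil α γ h
    rw [lsum_tdeg] at this
    simp only [GrSp.tdeg, opDeg, List.length_nil, lsum_nil, if_true] at this ⊢
    linarith
  | [j] => exact absurd (hg.no_single α j γ) h
  | x :: y :: B =>
    have := hg.deg_word α _ γ (by simp) h
    rw [lsum_tdeg, lsum_sdeg] at this
    rw [opDeg_of_ne (by simp)]
    simp only [GrSp.sdeg] at this
    linarith

lemma opOf_apply (n p : ℕ) (c : Coeffs k V) (x : Fin (n + p) → V.Idx) (α : V.Idx) :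
    opOf n p c x α = sgn (opExp V ((List.ofFn x).take n) ((List.ofFn x).drop n)) •
      c α ((List.ofFn x).take n) ((List.ofFn x).drop n) := by
  have e1 : (List.ofFn fun i : Fin n => x (Fin.castAdd p i)) = (List.ofFn x).take n := by
    rw [take_ofFn _ _ (by omega)]; rfl
  have e2 : (List.ofFn fun j : Fin p => x (Fin.natAdd n j)) = (List.ofFn x).drop n := by
    refine List.ext_getElem (by simp) fun j _ _ => ?_
    simp only [List.getElem_ofFn, List.getElem_drop]
    rfl
  have e3 : ((List.ofFn x).take n).length = n := by simp
  have e4 : ((List.ofFn x).drop n).length = p := by simp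
  rw [opOf, opExp, e3, e4, ← e1, ← e2]

lemma Coeffs.Graded.opOf_isHomog {c : Coeffs k V} (hg : c.Graded) (n p : ℕ) :
    (opOf n p c).IsHomog (opDeg n p) := by
  intro x α h
  rw [opOf_apply] at h
  have := hg.deg_eq (right_ne_zero_of_smul h)
  rw [List.length_take, List.length_drop, List.length_ofFn, Nat.min_eq_left (by omega),
    Nat.add_sub_cancel_left, ← lsum_append, List.take_append_drop, lsum_ofFn] at this
  exact this

end Homogeneity

namespace Species

variable {k : Type u} [Field k] {F : Species k}

lemma WGen.op (n p : ℕ) (h : 2 ≤ n ∨ (n = 0 ∧ 2 ≤ p)) :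
    F.WGen (n + p) (opDeg n p) fun V S L α =>
      sgn (opExp V (L.take n) (L.drop n)) • F.coeffs S α (L.take n) (L.drop n) := by
  have := Gen.op (F := F) n p h
  rw [WGen]
  convert this using 1
  funext V S x α
  exact (opOf_apply n p (F.coeffs S) x α).symm

lemma Gen.isHomog (hF : ∀ {V : GrSp} (S : F.Str V), (F.coeffs S).Graded) {n : ℕ} {p : ℤ}
    {x : F.Fam n} (h : F.Gen n p x) (V : GrSp) (S : F.Str V) : (x V S).IsHomog p := by
  induction h with
  | op n p _ => exact (hF S).opOf_isHomog n p
  | one => exact EndOp.IsHomog.one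
  | zero n p => exact EndOp.IsHomog.zero p
  | add _ _ hx hy => exact hx.add hy
  | smul a _ hx => exact hx.smul a
  | perm σ _ hx => exact hx.perm σ
  | circ h i _ _ hx hy => exact EndOp.IsHomog.circ h i hx hy
  | diff _ hx => exact EndOp.IsHomog.diff ((hF S).opOf_isHomog 0 1) hx

variable (k) in
/-- The systems of coefficients with a given property, as a type of structure. -/
def coeffSpecies (P : ∀ V : GrSp, Coeffs k V → Prop) : Species k where
  Str V := {c : Coeffs k V // P V c}
  coeffs c := c.1

section Comap

variable {G : Species k} (τ : ∀ V : GrSp, F.Str V → G.Str V)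

/-- Restriction of an element of an operad along a map of structures. -/
lemma Gen.comap (hτ : ∀ (V : GrSp) (S : F.Str V), G.coeffs (τ V S) = F.coeffs S) {m : ℕ} {q : ℤ} {x : G.Fam m} (hx : G.Gen m q x) :
    F.Gen m q fun V S => x V (τ V S) := by
  induction hx with
  | op n p h =>
    simp only [hτ]
    exact Gen.op n p h
  | one => exact Gen.one
  | zero n p => exact Gen.zero n p
  | add _ _ hx hy => exact Gen.add hx hy
  | smul a _ hx => exact Gen.smul a hx
  | perm σ _ hx => exact Gen.perm σ hx
  | circ h i _ _ hx hy => exact Gen.circ h i hx hy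
  | diff _ hx =>
    have := Gen.diff hx
    simp only [Fam.diff, diffOp, hτ] at this ⊢
    exact this

/-- An algebra whose structure operations are those of a structure is given by evaluation on this
structure. -/
lemma OpAlgebra.act_comap (hτ : ∀ (V : GrSp) (S : F.Str V), G.coeffs (τ V S) = F.coeffs S)
    {V : GrSp} (A : F.OpAlgebra V) {T : G.Str V} (hd : A.d = G.diffOp T)
    (hop : ∀ n p h, A.act (n + p) (opDeg n p) ⟨_, Gen.op n p h⟩ = opOf n p (G.coeffs T))
    {m : ℕ} {q : ℤ} {x : G.Fam m} (hx : G.Gen m q x) :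
    A.act m q ⟨_, hx.comap τ hτ⟩ = x V T := by
  induction hx with
  | op n p h =>
    refine Eq.trans (congrArg (A.act (n + p) (opDeg n p)) (Subtype.ext ?_)) (hop n p h)
    funext V S
    simp only [hτ]
  | one => exact A.act_one
  | zero n p => exact map_zero (A.act n p)
  | add hx hy ex ey =>
    exact (map_add (A.act _ _) ⟨_, hx.comap τ hτ⟩ ⟨_, hy.comap τ hτ⟩).trans (by rw [ex, ey])
  | smul a hx ex => exact (map_smul (A.act _ _) a ⟨_, hx.comap τ hτ⟩).trans (by rw [ex])
  | perm σ hx ex => exact (A.act_perm _ _ σ ⟨_, hx.comap τ hτ⟩).trans (by rw [ex]; rfl)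
  | circ h₀ i hx hy ex ey =>
    exact (A.act_circ _ _ _ _ _ h₀ i ⟨_, hx.comap τ hτ⟩ ⟨_, hy.comap τ hτ⟩).trans
      (by rw [ex, ey]; rfl)
  | @diff n p x hx ex =>
    have e := (A.act_diff _ _ ⟨_, hx.comap τ hτ⟩).trans (by rw [ex, hd])
    refine Eq.trans (congrArg (A.act n (p + 1)) (Subtype.ext ?_)) e
    funext V S
    simp only [Operad.diff, Fam.diff, diffOp, hτ]

/-- A relation which holds in all structures of a species holds in all algebras over its operad. -/
lemma OpAlgebra.eq_zero_of_wgen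
    (hτ : ∀ (V : GrSp) (S : F.Str V), G.coeffs (τ V S) = F.coeffs S) {V : GrSp} (A : F.OpAlgebra V) {T : G.Str V}
    (hd : A.d = G.diffOp T)
    (hop : ∀ n p h, A.act (n + p) (opDeg n p) ⟨_, Gen.op n p h⟩ = opOf n p (G.coeffs T))
    {m : ℕ} {q : ℤ} {Φ : G.WordFam} (hΦ : G.WGen m q Φ)
    (h0 : ∀ (W : GrSp) (S : F.Str W) (L : List W.Idx), L.length = m → Φ W (τ W S) L = 0)
    (L : List V.Idx) (hL : L.length = m) : Φ V T L = 0 := by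
  have e := A.act_comap τ hτ hd hop hΦ
  have e0 : (⟨_, hΦ.comap τ hτ⟩ : F.Operad m q) = 0 := by
    apply Subtype.ext
    funext W S β
    exact h0 W S _ List.length_ofFn
  rw [e0, map_zero] at e
  subst hL
  have := congrFun e L.get
  rw [List.ofFn_get] at this
  exact this.symm

end Comap

end Species

end GInf

namespace GInf

section PermInvariance

lemma opExp_perm {V : GrSp} (B : List V.Idx) {γ γ' : List V.Idx} (h : γ.Perm γ') :
    opExp V B γ = opExp V B γ' := by
  rw [opExp, opExp, lsum_perm _ h, pairSum_perm _ h, h.length_eq]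

lemma sgn_smul_unshuffleSum {V : GrSp} {M : Type*} [AddCommGroup M] (f : List V.Idx → ℤ)
    (hf : ∀ {l l' : List V.Idx}, l.Perm l' → f l = f l') (K : List V.Idx → List V.Idx → M)
    (L : List V.Idx) : sgn (f L) • unshuffleSum K L =
      unshuffleSum (fun l₁ l₂ => sgn (f (l₁ ++ l₂)) • K l₁ l₂) L := by
  refine (unshuffleSum_hom (DistribSMul.toAddMonoidHom M (sgn (f L))) K L).trans
    (unshuffleSum_congr fun l₁ l₂ h => ?_)
  rw [hf h]
  rfl

end PermInvariance

lemma blockSum_whole {X M : Type*} [AddCommMonoid M] (K : List X → List X → List X → M)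
    {B : List X} (hB : B ≠ []) (h : ∀ P Q R, P ≠ [] ∨ R ≠ [] → K P Q R = 0) :
    blockSum K B = K [] B [] := by
  obtain ⟨b, B, rfl⟩ := List.exists_cons_of_ne_nil hB
  rw [blockSum, blockSum_congr (K' := fun _ _ _ => 0) fun P Q R _ _ => h _ _ _ (Or.inl (by simp)),
    blockSum_zero, add_zero]
  refine Eq.trans (splitSum_congr fun Q R _ => ?_)
    (splitSum_ite_right (fun Q => K [] (b :: Q) []) B)
  split_ifs with hR
  · rw [hR]
  · exact h _ _ _ (Or.inr hR)

namespace Coeffs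

variable {k : Type u} [Field k] {V : GrSp}

/-- The coefficients of the operations other than the differential. -/
def cut (c : Coeffs k V) : Coeffs k V := fun α B γ => if B = [] ∧ γ.length ≤ 1 then 0 else c α B γ

/-- The coefficients of the differential. -/
def lin (c : Coeffs k V) : Coeffs k V := fun α B γ => if B = [] ∧ γ.length = 1 then c α B γ else 0

lemma cut_of_ne (c : Coeffs k V) (α : V.Idx) {B : List V.Idx} (h : B ≠ []) (γ : List V.Idx) :
    c.cut α B γ = c α B γ := if_neg fun h' => h h'.1

lemma cut_of_length (c : Coeffs k V) (α : V.Idx) (B : List V.Idx) {γ : List V.Idx}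
    (h : 2 ≤ γ.length) : c.cut α B γ = c α B γ := if_neg fun h' => absurd h'.2 (by omega)

lemma cut_nil (c : Coeffs k V) (α : V.Idx) {γ : List V.Idx} (h : γ.length ≤ 1) :
    c.cut α [] γ = 0 := if_pos ⟨rfl, h⟩

lemma lin_of_ne (c : Coeffs k V) (α : V.Idx) (B γ : List V.Idx) (h : B ≠ [] ∨ γ.length ≠ 1) :
    c.lin α B γ = 0 := if_neg fun h' => h.elim (fun h => h h'.1) fun h => h h'.2

lemma lin_single (c : Coeffs k V) (α x : V.Idx) : c.lin α [] [x] = c α [] [x] := if_pos ⟨rfl, rfl⟩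

lemma full_lin_of_ne (c : Coeffs k V) (α : V.Idx) {B γ : List V.Idx} (hB : B ≠ [])
    (h : B.length ≠ 1 ∨ γ ≠ []) : c.lin.full α B γ = 0 := by
  match B, hB with
  | [j], _ =>
    rw [full_single, lin_of_ne c α _ _ (Or.inr (by simpa using h)), smul_zero]
  | _ :: _ :: _, _ => exact lin_of_ne c α _ _ (Or.inl (by simp))

lemma Graded.cut_add_lin {c : Coeffs k V} (h : c.Graded) : c.cut + c.lin = c := by
  funext α B γ
  change c.cut α B γ + c.lin α B γ = _
  match B, γ with
  | [], [] => rw [cut_nil _ _ (by simp), lin_of_ne _ _ _ _ (by simp), h.no_constant, add_zero]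
  | [], [x] => rw [cut_nil _ _ (by simp), lin_single, zero_add]
  | [], _ :: _ :: _ => rw [cut_of_length _ _ _ (by simp), lin_of_ne _ _ _ _ (by simp), add_zero]
  | _ :: _, _ => rw [cut_of_ne _ _ (by simp), lin_of_ne _ _ _ _ (by simp), add_zero]

lemma Graded.cut {c : Coeffs k V} (h : c.Graded) : c.cut.Graded where
  no_constant α := cut_nil _ _ (by simp)
  no_single α β γ := (cut_of_ne _ _ (by simp) _).trans (h.no_single α β γ)
  deg_nil α γ h0 := h.deg_nil α γ fun h1 => h0 (by rw [Coeffs.cut, h1, ite_self])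
  deg_word α B γ hB h0 := h.deg_word α B γ hB fun h1 => h0 (by rw [Coeffs.cut, h1, ite_self])

lemma full_add (c e : Coeffs k V) (α : V.Idx) (B : List V.Idx) :
    (c + e).full α B = c.full α B + e.full α B := by
  match B with
  | [] => rfl
  | [j] => funext γ; exact smul_add _ _ _
  | _ :: _ :: _ => rfl

/-- The composition which is quadratic in the structure equations. -/
def comp (c e : Coeffs k V) (α : V.Idx) (B γ : List V.Idx) : k :=
  ∑ β, taylorMul (c β []) (fun l => e.full α B (β :: l)) γ +
  blockSum (fun P Q R => ∑ β,
    sgn (lsum V.sdeg P + (lsum V.sdeg Q + 1 + V.sdeg β) * (1 + lsum V.sdeg P)) •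
      taylorMul (c.full β Q) (e.full α (P ++ β :: R)) γ) B

lemma ainf_eq_comp (c : Coeffs k V) : c.ainf = c.comp c := rfl

lemma ainf_nil (c : Coeffs k V) (α : V.Idx) (γ : List V.Idx) : c.ainf α [] γ = c.square α γ := by
  rw [ainf, blockSum, add_zero]
  rfl

lemma comp_add_left (c c' e : Coeffs k V) (α : V.Idx) (B γ : List V.Idx) :
    (c + c').comp e α B γ = c.comp e α B γ + c'.comp e α B γ := by
  simp only [comp]
  rw [add_add_add_comm, ← Finset.sum_add_distrib, ← blockSum_add]
  congr 1
  · refine Finset.sum_congr rfl fun β _ => ?_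
    rw [← taylorMul_add_left]
    rfl
  · refine blockSum_congr fun P Q R _ _ => ?_
    rw [← Finset.sum_add_distrib]
    refine Finset.sum_congr rfl fun β _ => ?_
    rw [← smul_add, ← taylorMul_add_left, full_add]

lemma comp_add_right (c e e' : Coeffs k V) (α : V.Idx) (B γ : List V.Idx) :
    c.comp (e + e') α B γ = c.comp e α B γ + c.comp e' α B γ := by
  simp only [comp]
  rw [add_add_add_comm, ← Finset.sum_add_distrib, ← blockSum_add]
  congr 1
  · refine Finset.sum_congr rfl fun β _ => ?_
    rw [← taylorMul_add_right, full_add]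
    rfl
  · refine blockSum_congr fun P Q R _ _ => ?_
    rw [← Finset.sum_add_distrib]
    refine Finset.sum_congr rfl fun β _ => ?_
    rw [← smul_add, ← taylorMul_add_right, full_add]

lemma comp_lin_nil (c : Coeffs k V) (α : V.Idx) (γ : List V.Idx) :
    c.comp c.lin α [] γ = ∑ β, c β [] γ * c α [] [β] := by
  rw [comp, blockSum, add_zero]
  refine Finset.sum_congr rfl fun β _ => ?_
  rw [taylorMul_eq_unshuffleSum, unshuffleSum_right _ _ fun l₁ l₂ h => ?_]
  · exact congrArg _ (lin_single c α β)
  · exact mul_eq_zero_of_right _ (lin_of_ne _ _ _ _ (Or.inr (by simpa using h)))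

lemma comp_lin (c : Coeffs k V) (α : V.Idx) {B : List V.Idx} (hB : 2 ≤ B.length) (γ : List V.Idx) :
    c.comp c.lin α B γ = sgn (lsum V.sdeg B + 1) • ∑ β, c β B γ * c α [] [β] := by
  rw [comp, blockSum_whole _ (by rintro rfl; simp at hB)]
  · rw [Finset.sum_eq_zero, zero_add, Finset.smul_sum]
    · refine Finset.sum_congr rfl fun β _ => ?_
      rw [taylorMul_eq_unshuffleSum, unshuffleSum_right _ _ fun l₁ l₂ h => ?_, List.nil_append,
        full_single, lin_single, mul_smul_comm, sgn_smul_smul, full_of_length _ _ hB]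
      · apply sgn_smul_congr
        simp only [lsum_nil]
        push_cast; ring_nf; reduce_mod_char
      · rw [full_lin_of_ne _ _ (by simp) (Or.inr h), mul_zero]
    · intro β _
      rw [show (fun l => c.lin.full α B (β :: l)) = 0 from funext fun l =>
        full_lin_of_ne _ _ (by rintro rfl; simp at hB) (Or.inr (by simp)), taylorMul_zero_right]
  · intro P Q R h
    refine Finset.sum_eq_zero fun β _ => ?_
    rw [show c.lin.full α (P ++ β :: R) = 0 from funext fun l =>
        full_lin_of_ne _ _ (by simp) (Or.inl (by
          rw [List.length_append, List.length_cons]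
          rcases h with h | h <;> have := List.length_pos_iff.2 h <;> omega)),
      taylorMul_zero_right, smul_zero]

lemma lin_comp (c e : Coeffs k V) (α : V.Idx) (B γ : List V.Idx) :
    c.lin.comp e α B γ =
      ∑ β, letterSum (fun A x C => sgn (lsum V.tdeg A * V.tdeg x) •
        (c β [] [x] * e.full α B (β :: (A ++ C)))) γ +
      letterSum (fun P x R => ∑ β,
        sgn (lsum V.sdeg P + (V.sdeg x + 1 + V.sdeg β) * (1 + lsum V.sdeg P) + V.sdeg x) •
          (c β [] [x] * e.full α (P ++ β :: R) γ)) B := by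
  rw [comp]
  congr 1
  · refine Finset.sum_congr rfl fun β _ => ?_
    rw [taylorMul_eq_unshuffleSum, unshuffleSum_single _ _ fun l₁ l₂ h => ?_]
    · simp only [lin_single]
    · rw [lin_of_ne _ _ _ _ (Or.inr h), zero_mul]
  · rw [blockSum_eq_letterSum]
    · refine letterSum_congr fun P x R _ => Finset.sum_congr rfl fun β _ => ?_
      rw [taylorMul_eq_unshuffleSum, unshuffleSum_left _ _ fun l₁ l₂ h => ?_, full_single,
        lin_single, smul_mul_assoc, sgn_smul_smul, lsum_cons, lsum_nil, add_zero]
      rw [full_lin_of_ne _ _ (by simp) (Or.inr h), zero_mul]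
    · intro P Q R h
      refine Finset.sum_eq_zero fun β _ => ?_
      rw [show c.lin.full β Q = 0 from funext fun l =>
          full_lin_of_ne _ _ (by rintro rfl; simp at h) (Or.inl (by omega)),
        taylorMul_zero_left, smul_zero]

end Coeffs

end GInf

namespace GInf

lemma Coeffs.full_of_ne {k : Type u} [Field k] {V : GrSp} (c : Coeffs k V) (α : V.Idx)
    {B : List V.Idx} (h : B.length ≠ 1) : c.full α B = c α B := by
  match B, h with
  | [], _ => rfl
  | _ :: _ :: _, _ => rfl

lemma opDeg_cast (n p : ℕ) : ((opDeg n p : ℤ) : ZMod 2) = ((opDeg n 0 : ℤ) : ZMod 2) := by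
  rw [opDeg_eq]
  push_cast; reduce_mod_char

namespace Species

variable {k : Type u} [Field k] {F : Species k}

namespace WGen

lemma unshuffle_apply (m : ℕ) (q : ℤ) (p a : ℕ) (hm : m = a + p)
    (K : ∀ V : GrSp, F.Str V → List V.Idx → List V.Idx → List V.Idx → V.Idx → k)
    (h : ∀ p₁ p₂, p₁ + p₂ = p → F.WGen m q fun V S L =>
      K V S (L.take a) ((L.drop a).take p₁) (L.drop (a + p₁))) :
    F.WGen m q fun V S L α => unshuffleSum (fun l₁ l₂ => K V S (L.take a) l₁ l₂ α) (L.drop a) :=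
  (unshuffle m q p a hm K h).congr fun V S L _ => funext fun α =>
    unshuffleSum_hom (Pi.evalAddMonoidHom (fun _ : V.Idx => k) α) _ _

lemma cutOp (n p : ℕ) (hn : n ≠ 1) : F.WGen (n + p) (opDeg n p) fun V S L α =>
    sgn (opExp V (L.take n) (L.drop n)) • (F.coeffs S).cut α (L.take n) (L.drop n) := by
  by_cases h : 2 ≤ n ∨ (n = 0 ∧ 2 ≤ p)
  · refine (WGen.op n p h).congr fun V S L hL => funext fun α => ?_
    rcases h with h | ⟨rfl, h⟩
    · rw [Coeffs.cut_of_ne]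
      intro e
      have := congrArg List.length e
      rw [List.length_take, List.length_nil] at this
      omega
    · rw [Coeffs.cut_of_length _ _ _ (by rw [List.length_drop]; omega)]
  · obtain ⟨rfl, hp⟩ : n = 0 ∧ p ≤ 1 := by omega
    refine zero.congr fun V S L hL => funext fun α => ?_
    rw [List.take_zero, Coeffs.cut_nil _ _ (by rw [List.length_drop]; omega), smul_zero]
    rfl

lemma fullCut (n p : ℕ) (hn : 1 ≤ n) : F.WGen (n + p) (2 - n - 2 * p) fun V S L α =>
    sgn (staircaseSum V.deg (L.take n) + lsum V.deg (L.drop n) * (n + lsum V.deg (L.take n)) +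
      pairSum V.deg (L.drop n)) • (F.coeffs S).cut.full α (L.take n) (L.drop n) := by
  by_cases h : n = 1
  · subst h
    have h1 := (cutOp (F := F) 0 (1 + p) (by omega)).sgn_smul (sgn 1)
    rw [zero_add, show opDeg 0 (1 + p) = 2 - (1 : ℕ) - 2 * p by
      simp only [opDeg, if_true]; push_cast; ring] at h1
    refine h1.congr fun V S L hL => funext fun α => ?_
    obtain ⟨x, l, rfl⟩ := List.exists_cons_of_ne_nil (l := L) (by rintro rfl; simp at hL; omega)
    change sgn 1 • sgn _ • (F.coeffs S).cut α [] (x :: l) =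
      sgn (staircaseSum V.deg [x] + lsum V.deg l * ((1 : ℕ) + lsum V.deg [x]) +
        pairSum V.deg l) • (F.coeffs S).cut.full α [x] l
    rw [Coeffs.full_single, sgn_smul_smul, sgn_smul_smul]
    apply sgn_smul_congr
    simp only [opExp, List.take_zero, List.drop_zero, staircaseSum, lsum_cons, lsum_nil, pairSum,
      List.length_nil, GrSp.sdeg, opDeg, if_true]
    push_cast; ring_nf; reduce_mod_char
  · have h1 := cutOp (F := F) n p h
    rw [opDeg_of_ne (by omega)] at h1
    refine h1.congr fun V S L hL => funext fun α => ?_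
    have h2 : (L.take n).length = n := by rw [List.length_take]; omega
    rw [Coeffs.full_of_ne _ _ (by omega)]
    apply sgn_smul_congr
    rw [opExp, h2, opDeg_of_ne (by omega)]
    push_cast; ring_nf; reduce_mod_char

lemma vectorField (hG : ∀ {V : GrSp} (S : F.Str V), (F.coeffs S).Graded) (n p : ℕ) (hn : n ≠ 1) : F.WGen (n + p) (opDeg n p + 1) fun V S L α =>
    sgn (opExp V (L.take n) (L.drop n) + lsum V.deg (L.drop n)) • ∑ β,
      taylorMul ((F.coeffs S).cut β []) (fun l => (F.coeffs S).cut.full α (L.take n) (β :: l))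
        (L.drop n) := by
  refine (unshuffle_apply (n + p) _ p n rfl (fun V S A l₁ l₂ α =>
    sgn (opExp V A (l₁ ++ l₂) + lsum V.deg (l₁ ++ l₂)) • ∑ β,
      (F.coeffs S).cut β [] l₁ * (F.coeffs S).cut.full α A (β :: l₂)) ?_).congr
    fun V S L _ => funext fun α => ?_
  · intro p₁ p₂ hp
    have h1 := ((cutOp (F := F) n (1 + p₂) hn).circ (cutOp (F := F) 0 p₁ (by omega)) n (by omega)
      (show n + (1 + p₂) + (0 + p₁) = n + p + 1 by omega)).sgn_smul (sgn (opDeg n 0))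
    rw [show opDeg n (1 + p₂) + opDeg 0 p₁ = opDeg n p + 1 by
      rw [opDeg_eq n p, opDeg_eq n (1 + p₂), ← hp]; simp only [opDeg, if_true]; push_cast; ring]
      at h1
    refine h1.congr fun V S L hL => funext fun α => ?_
    obtain ⟨A, L, rfl, rfl⟩ := exists_split (L := L) (n := n) (by omega)
    rw [List.length_append] at hL
    obtain ⟨l₁, l₂, rfl, rfl⟩ := exists_split (L := L) (n := p₁) (by omega)
    rw [List.length_append] at hL
    have e1 : (A ++ (l₁ ++ l₂)).drop (A.length + l₁.length) = l₂ := by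
      rw [← List.drop_drop, List.drop_left, List.drop_left]
    change sgn _ • ∑ b : V.Idx, (_ : k) = sgn _ • ∑ b : V.Idx, (_ : k)
    rw [Finset.smul_sum, Finset.smul_sum]
    refine Finset.sum_congr rfl fun β _ => ?_
    simp only [zero_add, e1, List.take_left, List.drop_left, List.take_zero, List.drop_zero]
    rw [Coeffs.full_of_ne _ _ hn, smul_mul_smul_comm, mul_comm ((F.coeffs S).cut β [] l₁)]
    by_cases h0 : (F.coeffs S).cut β [] l₁ = 0
    · rw [h0, mul_zero, smul_zero, smul_zero, smul_zero, smul_zero]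
    have e2 := (hG S).cut.deg_eq h0
    have e3 : sgn (opExp V A (β :: l₂)) * sgn (opExp V [] l₁) =
      sgn (opExp V A (β :: l₂) + opExp V [] l₁) := (Int.negOnePow_add _ _).symm
    rw [e3, sgn_smul_smul, sgn_smul_smul]
    apply sgn_smul_congr
    simp only [opExp, lsum_append, lsum_cons, lsum_nil, pairSum, pairSum_append, staircaseSum, e2]
    push_cast
    simp only [opDeg_cast _ (List.length _)]
    simp only [opDeg, List.length_nil, if_true]
    push_cast; ring_nf; reduce_mod_char
  · rw [← sgn_smul_unshuffleSum (fun l => opExp V (L.take n) l + lsum V.deg l)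
      (fun h => by rw [opExp_perm _ h, lsum_perm _ h]), unshuffleSum_sum]
    simp only [taylorMul_eq_unshuffleSum]

end WGen

end Species

end GInf

namespace GInf

namespace Species

variable {k : Type u} [Field k] {F : Species k}

namespace WGen

lemma block (hG : ∀ {V : GrSp} (S : F.Str V), (F.coeffs S).Graded) (n p s l : ℕ) (hn : n ≠ 0)
    (hl : 1 ≤ l) (hs : s + l ≤ n) : F.WGen (n + p) (opDeg n p + 1) fun V S L α =>
    sgn (opExp V (L.take n) (L.drop n) + lsum V.deg (L.drop n)) • ∑ β,
      sgn (lsum V.sdeg ((L.take n).take s) + (lsum V.sdeg (((L.take n).drop s).take l) + 1 +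
          V.sdeg β) * (1 + lsum V.sdeg ((L.take n).take s))) •
        taylorMul ((F.coeffs S).cut.full β (((L.take n).drop s).take l))
          ((F.coeffs S).cut.full α ((L.take n).take s ++ β :: (L.take n).drop (s + l)))
          (L.drop n) := by
  obtain ⟨r, rfl⟩ := Nat.exists_eq_add_of_le hs
  refine (unshuffle_apply (s + l + r + p) _ p (s + l + r) rfl (fun V S A l₁ l₂ α =>
    sgn (opExp V A (l₁ ++ l₂) + lsum V.deg (l₁ ++ l₂)) • ∑ β,
      sgn (lsum V.sdeg (A.take s) + (lsum V.sdeg ((A.drop s).take l) + 1 + V.sdeg β) *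
        (1 + lsum V.sdeg (A.take s))) • ((F.coeffs S).cut.full β ((A.drop s).take l) l₁ *
          (F.coeffs S).cut.full α (A.take s ++ β :: A.drop (s + l)) l₂)) ?_).congr
    fun V S L _ => funext fun α => ?_
  · intro p₁ p₂ hp
    have h1 := (((fullCut (F := F) (s + 1 + r) p₂ (by omega)).circ (fullCut (F := F) l p₁ hl) s
      (by omega) (show s + 1 + r + p₂ + (l + p₁) = s + l + r + p + 1 by omega)).move
      (s + l) r p₁ (by omega)).sgn_smul (sgn (s + r * l))
    rw [show (2 - ((s + 1 + r : ℕ) : ℤ) - 2 * p₂) + (2 - (l : ℤ) - 2 * p₁) =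
      opDeg (s + l + r) p + 1 by rw [opDeg_of_ne hn, ← hp]; push_cast; ring] at h1
    refine h1.congr fun V S L hL => funext fun α => ?_
    obtain ⟨P, L, rfl, rfl⟩ := exists_split (L := L) (n := s) (by omega)
    rw [List.length_append] at hL
    obtain ⟨Q, L, rfl, rfl⟩ := exists_split (L := L) (n := l) (by omega)
    rw [List.length_append] at hL
    obtain ⟨R, L, rfl, rfl⟩ := exists_split (L := L) (n := r) (by omega)
    rw [List.length_append] at hL
    obtain ⟨l₁, l₂, rfl, rfl⟩ := exists_split (L := L) (n := p₁) (by omega)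
    have e1 : (P ++ (Q ++ (R ++ (l₁ ++ l₂)))).take (P.length + Q.length + R.length) =
      P ++ (Q ++ R) := take_eq_of_append (B := l₁ ++ l₂) (by simp) (by simp; omega)
    have e2 : (P ++ (Q ++ (R ++ (l₁ ++ l₂)))).drop (P.length + Q.length + R.length) = l₁ ++ l₂ :=
      drop_eq_of_append (A := P ++ (Q ++ R)) (by simp) (by simp; omega)
    have e3 : (P ++ (Q ++ (R ++ (l₁ ++ l₂)))).drop (P.length + Q.length + R.length + l₁.length) =
      l₂ := drop_eq_of_append (A := P ++ (Q ++ (R ++ l₁))) (by simp) (by simp; omega)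
    have e4 : (P ++ (Q ++ R)).drop (P.length + Q.length) = R :=
      drop_eq_of_append (A := P ++ Q) (by simp) (by simp)
    have m1 := fun Φ : F.WordFam => moveWord_append Φ V S (P ++ Q) R l₁ l₂
    simp only [List.length_append, List.append_assoc] at m1
    have w1 : (P ++ (Q ++ (l₁ ++ (R ++ l₂)))).drop (P.length + (Q.length + l₁.length)) =
      R ++ l₂ := drop_eq_of_append (A := P ++ (Q ++ l₁)) (by simp) (by simp)
    have w2 : (Q ++ (l₁ ++ (R ++ l₂))).take (Q.length + l₁.length) = Q ++ l₁ :=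
      take_eq_of_append (B := R ++ l₂) (by simp) (by simp)
    have w3 : ∀ β, (P ++ β :: (R ++ l₂)).take (P.length + 1 + R.length) = P ++ β :: R :=
      fun β => take_eq_of_append (B := l₂) (by simp) (by simp; omega)
    have w4 : ∀ β, (P ++ β :: (R ++ l₂)).drop (P.length + 1 + R.length) = l₂ :=
      fun β => drop_eq_of_append (A := P ++ β :: R) (by simp) (by simp; omega)
    simp only [m1, e1, e2, e3, e4, circWord, List.take_left, List.drop_left, w1, w2, w3, w4,
      Pi.smul_apply, Finset.smul_sum]
    refine Finset.sum_congr rfl fun β _ => ?_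
    rw [smul_mul_smul_comm, mul_comm ((F.coeffs S).cut.full β Q l₁)]
    by_cases h0 : (F.coeffs S).cut.full β Q l₁ = 0
    · rw [h0, mul_zero]; simp only [smul_zero]
    have e5 := (hG S).cut.full_degree β Q l₁ (by rintro rfl; simp at hl) h0
    rw [lsum_tdeg, lsum_sdeg] at e5
    obtain ⟨b, hb⟩ : ∃ b, b = V.deg β := ⟨_, rfl⟩
    have e6 : b = lsum V.deg Q + lsum V.deg l₁ + 2 - Q.length - 2 * l₁.length := by
      simp only [GrSp.sdeg] at e5; linarith
    have e7 : ∀ x y : ℤ, sgn x * sgn y = sgn (x + y) := fun x y => (Int.negOnePow_add x y).symm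
    rw [e7, sgn_smul_smul, sgn_smul_smul, sgn_smul_smul, sgn_smul_smul]
    apply sgn_smul_congr
    rw [opExp, opDeg_of_ne (by simp only [List.length_append]; omega)]
    simp only [opExp, lsum_append, lsum_cons, lsum_nil, pairSum, pairSum_append, staircaseSum,
      staircaseSum_append, lsum_sdeg, GrSp.sdeg, ← hb, e6, List.length_append, List.length_cons]
    push_cast; ring_nf; reduce_mod_char
  · rw [← sgn_smul_unshuffleSum (fun γ => opExp V (L.take (s + l + r)) γ + lsum V.deg γ)
      (fun h => by rw [opExp_perm _ h, lsum_perm _ h]), unshuffleSum_sum]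
    simp only [taylorMul_eq_unshuffleSum]
    congr 1
    refine Finset.sum_congr rfl fun β _ => ?_
    exact (sgn_smul_unshuffleSum (fun _ => _) (fun _ => rfl) _ _).symm

end WGen

end Species

end GInf

namespace GInf

lemma letterSum_sum {X M ι : Type*} [AddCommMonoid M] (s : Finset ι)
    (K : ι → List X → X → List X → M) (L : List X) :
    letterSum (fun A x C => ∑ i ∈ s, K i A x C) L = ∑ i ∈ s, letterSum (K i) L := by
  induction L generalizing K with
  | nil => simp [letterSum]
  | cons x l ih => simp only [letterSum, ih, Finset.sum_add_distrib]

lemma smul_letterSum {X M : Type*} [AddCommGroup M] (a : ℤˣ) (K : List X → X → List X → M)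
    (L : List X) : a • letterSum K L = letterSum (fun A x C => a • K A x C) L :=
  letterSum_hom (DistribSMul.toAddMonoidHom M a) K L

lemma sgn_mul_sgn (a b : ℤ) : sgn a * sgn b = sgn (a + b) := (Int.negOnePow_add a b).symm

lemma Coeffs.Admissible.move_front {k : Type u} [Field k] {V : GrSp} {c : Coeffs k V}
    (hc : c.Admissible) (α : V.Idx) (B A : List V.Idx) (x : V.Idx) (C : List V.Idx) :
    c α B (A ++ x :: C) = sgn (V.tdeg x * lsum V.tdeg A) • c α B (x :: (A ++ C)) := by
  induction A using List.reverseRecOn generalizing C with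
  | nil => rw [lsum_nil, mul_zero, sgn_zero_smul]; rfl
  | append_singleton A a ih =>
    rw [List.append_assoc, List.singleton_append, hc.symm, ih, sgn_smul_smul, List.append_assoc,
      lsum_append, lsum_cons, lsum_nil]
    apply sgn_smul_congr
    push_cast; ring_nf

lemma Coeffs.Graded.deg_single {k : Type u} [Field k] {V : GrSp} {c : Coeffs k V}
    (hg : c.Graded) {α x : V.Idx} (h : c α [] [x] ≠ 0) : V.deg α = V.deg x + 1 := by
  have := hg.deg_nil α [x] h
  simp only [lsum_cons, lsum_nil, GrSp.tdeg] at this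
  linarith

namespace Species

variable {k : Type u} [Field k] {F : Species k}

variable (F) in
/-- The word functions of the operations of a structure. -/
def opWord (n : ℕ) : F.WordFam := fun _ S L α =>
  sgn (opExp _ (L.take n) (L.drop n)) • F.coeffs S α (L.take n) (L.drop n)

lemma opWord_append {V : GrSp} (S : F.Str V) {n : ℕ} {B : List V.Idx} (hB : B.length = n)
    (γ : List V.Idx) (α : V.Idx) :
    F.opWord n V S (B ++ γ) α = sgn (opExp V B γ) • F.coeffs S α B γ := by
  subst hB
  rw [opWord, List.take_left, List.drop_left]

lemma diffWord_opWord {V : GrSp} (S : F.Str V) (hc : (F.coeffs S).Admissible)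
    (hg : (F.coeffs S).Graded) (B γ : List V.Idx)
    (h : 2 ≤ B.length ∨ (B = [] ∧ 2 ≤ γ.length)) (α : V.Idx) :
    diffWord (opDeg B.length γ.length) (F.opWord B.length) V S (B ++ γ) α =
      -(sgn (opExp V B γ + lsum V.deg γ) • ((F.coeffs S).comp (F.coeffs S).lin α B γ +
        (F.coeffs S).lin.comp (F.coeffs S).cut α B γ)) := by
  have h1 : ∑ b, diffCoef S b α * F.opWord B.length V S (B ++ γ) b =
      -(sgn (opExp V B γ + lsum V.deg γ) • (F.coeffs S).comp (F.coeffs S).lin α B γ) := by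
    have hs : (F.coeffs S).comp (F.coeffs S).lin α B γ = sgn (lsum V.deg B + opDeg B.length 0 + 1) •
        ∑ β, F.coeffs S β B γ * F.coeffs S α [] [β] := by
      rcases h with h | ⟨rfl, -⟩
      · rw [Coeffs.comp_lin _ _ h]
        apply sgn_smul_congr
        rw [lsum_sdeg, opDeg_of_ne (by omega)]
        push_cast; ring_nf; reduce_mod_char
      · rw [Coeffs.comp_lin_nil]
        refine (sgn_zero_smul _).symm.trans (sgn_smul_congr _ ?_)
        simp only [lsum_nil, opDeg, List.length_nil, if_true]
        push_cast; reduce_mod_char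
    rw [hs, ← sgn_one_smul, sgn_smul_smul, sgn_smul_smul, Finset.smul_sum]
    refine Finset.sum_congr rfl fun β _ => ?_
    rw [opWord_append S rfl, diffCoef, smul_mul_smul_comm, mul_comm, mul_comm (F.coeffs S α [] [β]),
      sgn_mul_sgn]
    by_cases h0 : F.coeffs S β B γ = 0
    · rw [h0, zero_mul, smul_zero, smul_zero]
    apply sgn_smul_congr
    rw [hg.deg_eq h0]
    push_cast
    rw [opDeg_cast]
    ring_nf; reduce_mod_char
  have h2 : sgn (opDeg B.length γ.length) • letterSum (fun A x C => ∑ b,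
      sgn ((V.deg b - V.deg x) * lsum V.deg (B ++ A)) •
        (F.opWord B.length V S ((B ++ A) ++ b :: C) α * diffCoef S x b)) γ =
      sgn (opExp V B γ + lsum V.deg γ) • ∑ β, letterSum (fun A x C =>
        sgn (lsum V.tdeg A * V.tdeg x) • ((F.coeffs S) β [] [x] *
          (F.coeffs S).cut.full α B (β :: (A ++ C)))) γ := by
    rw [← letterSum_sum]
    rw [smul_letterSum, smul_letterSum]
    refine letterSum_congr fun A x C e => ?_
    rw [Finset.smul_sum, Finset.smul_sum]
    refine Finset.sum_congr rfl fun β _ => ?_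
    have hfull : (F.coeffs S).cut.full α B (β :: (A ++ C)) =
        F.coeffs S α B (β :: (A ++ C)) := by
      rcases h with h | ⟨rfl, h⟩
      · rw [Coeffs.full_of_length _ _ h, Coeffs.cut_of_ne _ _ (by rintro rfl; simp at h)]
      · refine Coeffs.cut_of_length _ _ _ ?_
        rw [← e] at h
        simp only [List.length_append, List.length_cons] at h ⊢
        omega
    rw [hfull, List.append_assoc, opWord_append S rfl, diffCoef, hc.move_front,
      sgn_smul_smul (opExp V B (A ++ β :: C)),
      smul_mul_smul_comm, mul_comm (F.coeffs S α B _), sgn_mul_sgn, sgn_smul_smul, sgn_smul_smul,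
      sgn_smul_smul]
    by_cases h0 : F.coeffs S β [] [x] = 0
    · rw [h0, zero_mul, smul_zero, smul_zero]
    have h3 := hg.deg_single h0
    apply sgn_smul_congr
    rw [← e]
    simp only [opExp, lsum_append, lsum_cons, pairSum, pairSum_append, List.length_append,
      List.length_cons, lsum_tdeg, GrSp.tdeg, h3]
    push_cast
    ring_nf; reduce_mod_char
  have h3 : sgn (opDeg B.length γ.length) • letterSum (fun A x C => ∑ b,
      sgn ((V.deg b - V.deg x) * lsum V.deg A) •
        (F.opWord B.length V S (A ++ b :: (C ++ γ)) α * diffCoef S x b)) B =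
      sgn (opExp V B γ + lsum V.deg γ) • letterSum (fun P x R => ∑ β,
        sgn (lsum V.sdeg P + (V.sdeg x + 1 + V.sdeg β) * (1 + lsum V.sdeg P) + V.sdeg x) •
          (F.coeffs S β [] [x] * (F.coeffs S).cut.full α (P ++ β :: R) γ)) B := by
    rw [smul_letterSum, smul_letterSum]
    refine letterSum_congr fun A x C e => ?_
    rw [Finset.smul_sum, Finset.smul_sum]
    refine Finset.sum_congr rfl fun β _ => ?_
    have hl : (A ++ β :: C).length = B.length := by rw [← e]; simp
    have h4 : 2 ≤ B.length := by
      rcases h with h | ⟨rfl, -⟩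
      · exact h
      · simp at e
    rw [Coeffs.full_of_length _ _ (by omega), Coeffs.cut_of_ne _ _ (by simp), ← List.cons_append,
      ← List.append_assoc, opWord_append S hl, diffCoef, smul_mul_smul_comm,
      mul_comm (F.coeffs S α _ _), sgn_mul_sgn, sgn_smul_smul, sgn_smul_smul, sgn_smul_smul]
    by_cases h0 : F.coeffs S β [] [x] = 0
    · rw [h0, zero_mul, smul_zero, smul_zero]
    have h3 := hg.deg_single h0
    apply sgn_smul_congr
    rw [opExp, hl, opExp, opDeg_of_ne (by omega), ← e]
    simp only [lsum_append, lsum_cons, staircaseSum, staircaseSum_append, lsum_sdeg, GrSp.sdeg,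
      List.length_append, List.length_cons, h3]
    push_cast
    ring_nf; reduce_mod_char
  rw [diffWord, letterSum_append, h1, smul_add, h2, h3, Coeffs.lin_comp, smul_add, smul_add]
  abel

end Species

end GInf

namespace GInf

namespace Species

variable {k : Type u} [Field k] {F : Species k}

namespace WGen

lemma comp_cut (hG : ∀ {V : GrSp} (S : F.Str V), (F.coeffs S).Graded) (n p : ℕ) (hn : n ≠ 1) :
    F.WGen (n + p) (opDeg n p + 1) fun V S L α =>
      sgn (opExp V (L.take n) (L.drop n) + lsum V.deg (L.drop n)) •
        (F.coeffs S).cut.comp (F.coeffs S).cut α (L.take n) (L.drop n) := by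
  refine ((vectorField hG n p hn).add (WGen.sum (Finset.range n) fun s hs =>
    WGen.sum (Finset.Icc 1 (n - s)) fun l hl => block hG n p s l ?_ ?_ ?_)).congr
      fun V S L hL => funext fun α => ?_
  · rw [Finset.mem_range] at hs; omega
  · exact (Finset.mem_Icc.1 hl).1
  · rw [Finset.mem_range] at hs
    have := (Finset.mem_Icc.1 hl).2
    omega
  · have h : (L.take n).length = n := by rw [List.length_take]; omega
    rw [Coeffs.comp, blockSum_eq_sum_range, h, smul_add, Finset.smul_sum (s := Finset.range n)]
    refine congrArg₂ (fun a b : k => a + b) rfl ((Finset.sum_apply _ _ _).trans ?_)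
    refine Finset.sum_congr rfl fun s _ => ?_
    rw [Finset.sum_apply, Finset.smul_sum]

lemma ainf (hA : ∀ {V : GrSp} (S : F.Str V), (F.coeffs S).Admissible)
    (hG : ∀ {V : GrSp} (S : F.Str V), (F.coeffs S).Graded) (n p : ℕ)
    (h : 2 ≤ n ∨ (n = 0 ∧ 2 ≤ p)) : F.WGen (n + p) (opDeg n p + 1) fun V S L α =>
      sgn (opExp V (L.take n) (L.drop n) + lsum V.deg (L.drop n)) •
        (F.coeffs S).ainf α (L.take n) (L.drop n) := by
  refine ((comp_cut hG n p (by omega)).add ((WGen.op n p h).diff.sgn_smul (sgn 1))).congr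
    fun V S L hL => funext fun α => ?_
  obtain ⟨B, γ, rfl, rfl⟩ := exists_split (L := L) (n := n) (by omega)
  rw [List.length_append] at hL
  obtain rfl : γ.length = p := by omega
  have e1 := diffWord_opWord S (hA S) (hG S) B γ (by
    rcases h with h | ⟨h, h'⟩
    · exact Or.inl h
    · exact Or.inr ⟨List.length_eq_zero_iff.1 h, h'⟩) α
  have e2 : (F.coeffs S).ainf α B γ = (F.coeffs S).cut.comp (F.coeffs S).cut α B γ +
      ((F.coeffs S).comp (F.coeffs S).lin α B γ +
        (F.coeffs S).lin.comp (F.coeffs S).cut α B γ) := by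
    rw [Coeffs.ainf_eq_comp]
    calc (F.coeffs S).comp (F.coeffs S) α B γ
        = (F.coeffs S).comp ((F.coeffs S).cut + (F.coeffs S).lin) α B γ := by
          rw [(hG S).cut_add_lin]
      _ = ((F.coeffs S).cut + (F.coeffs S).lin).comp (F.coeffs S).cut α B γ +
          (F.coeffs S).comp (F.coeffs S).lin α B γ := by
          rw [Coeffs.comp_add_right, (hG S).cut_add_lin]
      _ = _ := by rw [Coeffs.comp_add_left]; abel
  rw [List.take_left, List.drop_left, e2, smul_add]
  change _ + sgn 1 • diffWord (opDeg B.length γ.length) (F.opWord B.length) V S (B ++ γ) α = _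
  rw [e1, sgn_one_smul, neg_neg]

lemma swap_relation (n p s : ℕ) (h : 2 ≤ n ∨ (n = 0 ∧ 2 ≤ p)) (hs : s + 2 ≤ p) :
    F.WGen (n + p) (opDeg n p) fun V S L =>
      F.opWord n V S L + sgn 1 • moveWord (n + s) 1 1 (F.opWord n) V S L :=
  (WGen.op n p h).add (((WGen.op n p h).move (n + s) 1 1 (by omega)).sgn_smul _)

lemma swap_relation_apply {V : GrSp} (S : F.Str V) (B A : List V.Idx) (x y : V.Idx)
    (C : List V.Idx) (α : V.Idx) :
    (F.opWord B.length V S (B ++ (A ++ x :: y :: C)) + sgn 1 •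
      moveWord (B.length + A.length) 1 1 (F.opWord B.length) V S (B ++ (A ++ x :: y :: C))) α =
      sgn (opExp V B (A ++ x :: y :: C)) • (F.coeffs S α B (A ++ x :: y :: C) -
        sgn (V.tdeg x * V.tdeg y) • F.coeffs S α B (A ++ y :: x :: C)) := by
  have e := moveWord_append (F.opWord B.length) V S (B ++ A) [x] [y] C
  simp only [List.length_append, List.append_assoc, List.length_singleton] at e
  change _ + (sgn 1 • moveWord (B.length + A.length) 1 1 (F.opWord B.length) V S
    (B ++ (A ++ ([x] ++ ([y] ++ C))))) α = _
  rw [e, sgn_smul_smul, Pi.smul_apply, smul_sub, opWord_append S rfl, opWord_append S rfl,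
    sub_eq_add_neg, sgn_smul_smul, sgn_smul_smul, ← sgn_one_smul, sgn_smul_smul,
    opExp_perm B (List.Perm.append_left A (List.Perm.swap y x C))]
  congr 1
  apply sgn_smul_congr
  simp only [lsum_cons, lsum_nil, GrSp.tdeg, List.singleton_append]
  push_cast; ring_nf; reduce_mod_char

lemma shuffle_relation (n p a : ℕ) (hn : 2 ≤ n) (ha : a ≤ n) : F.WGen (n + p) (opDeg n p)
    fun V S L α => sgn (opExp V (L.take n) (L.drop n)) •
      shSum V.sdeg (fun l => F.coeffs S α l (L.drop n)) (L.take a) ((L.drop a).take (n - a)) := by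
  refine (shuffle (n + p) (opDeg n p) n (by omega) (fun V S B γ α =>
    sgn (lsum V.deg γ * (opDeg n p + lsum V.deg B) + pairSum V.deg γ) • F.coeffs S α B γ) ?_ n
    0 a (n - a) (by omega) (by omega)).congr fun V S L hL => funext fun α => ?_
  · refine (WGen.op (F := F) n p (Or.inl hn)).congr fun V S L hL => funext fun α => ?_
    have h1 : (L.take n).length = n := by rw [List.length_take]; omega
    have h2 : (L.drop n).length = p := by rw [List.length_drop]; omega
    change _ = sgn _ • sgn _ • (_ : k)
    rw [opExp, h1, h2, sgn_smul_smul, add_assoc]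
  · obtain ⟨A, L, rfl, rfl⟩ := exists_split (L := L) (n := a) (by omega)
    rw [List.length_append] at hL
    obtain ⟨C, γ, rfl, hC⟩ := exists_split (L := L) (n := n - A.length) (by omega)
    rw [List.length_append] at hL
    obtain rfl : γ.length = p := by omega
    obtain rfl : A.length + C.length = n := by omega
    have e1 : (A ++ (C ++ γ)).take (A.length + C.length) = A ++ C :=
      take_eq_of_append (B := γ) (by simp) (by simp)
    have e2 : (A ++ (C ++ γ)).drop (A.length + C.length) = γ :=
      drop_eq_of_append (A := A ++ C) (by simp) (by simp)
    rw [e1, e2, zero_add, Nat.add_sub_cancel_left, List.drop_zero, List.take_left, List.drop_left,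
      List.take_left, Pi.smul_apply]
    have e3 := shSum_hom (d := V.sdeg) (Pi.evalAddMonoidHom (fun _ : V.Idx => k) α)
      (fun l α => sgn (lsum V.deg γ * (opDeg (A.length + C.length) γ.length + lsum V.deg l) +
        pairSum V.deg γ) • F.coeffs S α l γ) A C
    refine (congrArg (fun x : k => sgn (staircaseSum V.deg (A ++ C)) • x) e3).trans ?_
    rw [opExp, List.length_append, add_assoc, ← sgn_smul_smul]
    refine congrArg (fun x : k => sgn (staircaseSum V.deg (A ++ C)) • x) (Eq.trans ?_
      (shSum_sgn_smul _ _ _ A C))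
    refine shSum_congr_perm _ fun l hl => ?_
    rw [← lsum_perm V.deg hl]
    rfl

end WGen

end Species

end GInf

namespace GInf

namespace Coeffs

variable {k : Type u} [Field k] {V : GrSp} {c : Coeffs k V}

lemma opOf_zero_one_apply (c : Coeffs k V) (x : Fin 1 → V.Idx) (α : V.Idx) :
    opOf 0 1 c x α = sgn (V.deg (x 0)) • c α [] [x 0] :=
  Species.diffOp_apply (F := Species.coeffSpecies k fun _ _ => True) ⟨c, trivial⟩ x α

lemma square_single (c : Coeffs k V) (hg : c.Graded) (α x : V.Idx) :
    c.square α [x] = ∑ β, c β [] [x] * c α [] [β] := by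
  refine Finset.sum_congr rfl fun β _ => ?_
  change taylorMul _ _ [] + taylorMul _ _ [] = _
  simp only [taylorMul, hg.no_constant, smul_zero, zero_mul, add_zero]

lemma Graded.circ_opOf (hg : c.Graded) (x : Fin 1 → V.Idx) (α : V.Idx) :
    EndOp.circ (rfl : 1 + 1 = 1 + 1) 0 (opOf 0 1 c) (opOf 0 1 c) x α = -c.square α [x 0] := by
  rw [square_single c hg, ← Finset.sum_neg_distrib]
  refine Finset.sum_congr rfl fun β _ => ?_
  rw [opOf_zero_one_apply, opOf_zero_one_apply]
  have e : ∀ y : ℤ, sgn (y * ∑ j : Fin (0 : ℕ), V.deg (x ⟨j, by omega⟩)) = 1 := fun y => by simp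
  refine (congrArg (fun s : ℤˣ => s • _) (e _)).trans ?_
  rw [one_smul]
  change sgn (V.deg β) • c α [] [β] * sgn (V.deg (x 0)) • c β [] [x 0] = _
  rw [smul_mul_smul_comm, sgn_mul_sgn, mul_comm (c α [] [β]), ← sgn_one_smul]
  by_cases h0 : c β [] [x 0] = 0
  · rw [h0, zero_mul, smul_zero, smul_zero]
  apply sgn_smul_congr
  rw [hg.deg_single h0]
  push_cast; ring_nf; reduce_mod_char

end Coeffs

namespace Species

variable {k : Type u} [Field k] {F : Species k} {V : GrSp}

section

variable {P : ∀ V : GrSp, Coeffs k V → Prop}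

/-- A system of coefficients as a structure. -/
def coeffSpecies.mk (c : Coeffs k V) (h : P V c) : (coeffSpecies k P).Str V := ⟨c, h⟩

lemma coeffSpecies.prop (S : (coeffSpecies k P).Str V) : P V ((coeffSpecies k P).coeffs S) := S.2

end

namespace OpAlgebra

open Classical in
/-- The structure operations of an algebra over the operad of a species. -/
def operation (A : F.OpAlgebra V) (n p : ℕ) : EndOp k V (n + p) :=
  if h : 2 ≤ n ∨ (n = 0 ∧ 2 ≤ p) then A.act _ _ ⟨_, Gen.op n p h⟩
  else if h : n = 0 ∧ p = 1 then fun x => A.d fun _ => x ⟨0, by omega⟩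
  else 0

/-- The structure coefficients of an algebra over the operad of a species. -/
def coeffs (A : F.OpAlgebra V) : Coeffs k V := fun α B γ =>
  sgn (opExp V B γ) • A.operation B.length γ.length
    (fun i => (B ++ γ)[i.1]'(by rw [List.length_append]; exact i.2)) α

lemma operation_congr (A : F.OpAlgebra V) {n p n' p' : ℕ} (hn : n' = n) (hp : p' = p)
    (x : Fin (n + p) → V.Idx) (y : Fin (n' + p') → V.Idx)
    (h : ∀ i : Fin (n + p), y ⟨i, by omega⟩ = x i) : A.operation n' p' y = A.operation n p x := by
  subst hn hp
  exact congrArg _ (funext h)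

lemma opOf_coeffs (A : F.OpAlgebra V) (n p : ℕ) : opOf n p A.coeffs = A.operation n p := by
  funext x α
  rw [opOf_apply, coeffs, sgn_smul_self]
  refine congrFun (A.operation_congr (by simp) (by simp) x _ fun i => ?_) α
  simp only [List.take_append_drop, List.getElem_ofFn]

lemma act_op (A : F.OpAlgebra V) (n p : ℕ) (h : 2 ≤ n ∨ (n = 0 ∧ 2 ≤ p)) :
    A.act (n + p) (opDeg n p) ⟨_, Gen.op n p h⟩ = opOf n p A.coeffs := by
  rw [opOf_coeffs, operation, dif_pos h]

lemma d_eq (A : F.OpAlgebra V) : A.d = opOf 0 1 A.coeffs := by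
  rw [opOf_coeffs, operation, dif_neg (by omega), dif_pos ⟨rfl, rfl⟩]
  funext x
  exact congrArg A.d (funext fun i => congrArg x (Subsingleton.elim _ _))

lemma operation_isHomog (A : F.OpAlgebra V) (n p : ℕ) : (A.operation n p).IsHomog (opDeg n p) := by
  rw [operation]
  split_ifs with h h
  · exact A.act_degree _ _ _
  · obtain ⟨rfl, rfl⟩ := h
    have e : (fun x : Fin 1 → V.Idx => A.d fun _ => x ⟨0, by omega⟩) = A.d :=
      funext fun x => congrArg A.d (funext fun i => congrArg x (Subsingleton.elim _ _))
    exact (congrArg (EndOp.IsHomog 1) e).mpr A.d_degree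
  · exact EndOp.IsHomog.zero _

lemma coeffs_deg (A : F.OpAlgebra V) {α : V.Idx} {B γ : List V.Idx} (h : A.coeffs α B γ ≠ 0) :
    V.deg α = lsum V.deg B + lsum V.deg γ + opDeg B.length γ.length := by
  rw [A.operation_isHomog _ _ _ _ (right_ne_zero_of_smul h), ← lsum_append, ← lsum_ofFn V.deg]
  congr 2
  refine List.ext_getElem (by simp) fun i _ _ => by simp

lemma coeffs_eq_zero (A : F.OpAlgebra V) (α : V.Idx) {B γ : List V.Idx}
    (h : ¬ (2 ≤ B.length ∨ (B.length = 0 ∧ 2 ≤ γ.length)))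
    (h' : ¬ (B.length = 0 ∧ γ.length = 1)) : A.coeffs α B γ = 0 := by
  rw [coeffs, operation, dif_neg h, dif_neg h']
  exact smul_zero _

lemma coeffs_graded (A : F.OpAlgebra V) : A.coeffs.Graded where
  no_constant α := A.coeffs_eq_zero α (by simp) (by simp)
  no_single α β γ := A.coeffs_eq_zero α (by simp) (by simp)
  deg_nil α γ h := by
    have := A.coeffs_deg h
    simp only [lsum_tdeg, GrSp.tdeg, opDeg, List.length_nil, if_true, lsum_nil] at this ⊢
    linarith
  deg_word α B γ hB h := by
    have := A.coeffs_deg h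
    rw [opDeg_of_ne (List.length_pos_iff.2 hB).ne'] at this
    simp only [lsum_tdeg, lsum_sdeg, GrSp.sdeg] at this ⊢
    linarith

lemma coeffs_admissible (hF : ∀ {V : GrSp} (S : F.Str V), (F.coeffs S).IsMC)
    (A : F.OpAlgebra V) : A.coeffs.Admissible where
  no_constant := A.coeffs_graded.no_constant
  no_single := A.coeffs_graded.no_single
  symm α B L x y C := by
    by_cases h : B.length = 1
    · rw [A.coeffs_eq_zero α (by omega) (by omega), A.coeffs_eq_zero α (by omega) (by omega),
        smul_zero]
    have h2 := A.eq_zero_of_wgen (G := coeffSpecies k fun _ c => c.Graded)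
      (fun _ S => coeffSpecies.mk (F.coeffs S) (hF S).graded) (fun _ _ => rfl) (T := coeffSpecies.mk A.coeffs A.coeffs_graded)
      A.d_eq A.act_op (WGen.swap_relation B.length (L ++ x :: y :: C).length L.length
        (by rw [List.length_append, List.length_cons, List.length_cons]; omega)
        (by rw [List.length_append, List.length_cons, List.length_cons]; omega))
      (fun W S L' hL => by
        obtain ⟨B', L', rfl, hB⟩ := exists_split (L := L') (n := B.length) (by omega)
        rw [List.length_append] at hL
        obtain ⟨A', L', rfl, hA⟩ := exists_split (L := L') (n := L.length) (by
          rw [List.length_append] at hL; omega)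
        simp only [List.length_append, List.length_cons] at hL
        obtain ⟨x', L', rfl⟩ := List.exists_cons_of_ne_nil (l := L')
          (by rintro rfl; rw [List.length_nil] at hL; omega)
        obtain ⟨y', C', rfl⟩ := List.exists_cons_of_ne_nil (l := L')
          (by rintro rfl; rw [List.length_cons, List.length_nil] at hL; omega)
        rw [← hB, ← hA]
        funext α
        rw [WGen.swap_relation_apply]
        refine (congrArg _ (sub_eq_zero.2 ?_)).trans (smul_zero _)
        exact (hF S).adm.symm α B' A' x' y' C')
      (B ++ (L ++ x :: y :: C)) (List.length_append)
    have h3 := congrFun h2 α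
    rw [WGen.swap_relation_apply] at h3
    exact sub_eq_zero.1 ((smul_eq_zero_iff_eq _).1 h3)
  shuffle α B C γ hB hC := by
    have hB' := List.length_pos_iff.2 hB
    have hC' := List.length_pos_iff.2 hC
    have h2 := A.eq_zero_of_wgen (G := coeffSpecies k fun _ c => c.Graded)
      (fun _ S => coeffSpecies.mk (F.coeffs S) (hF S).graded) (fun _ _ => rfl) (T := coeffSpecies.mk A.coeffs A.coeffs_graded)
      A.d_eq A.act_op (WGen.shuffle_relation (B.length + C.length) γ.length B.length
        (by omega) (by omega))
      (fun W S L hL => by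
        obtain ⟨B', L, rfl, hB1⟩ := exists_split (L := L) (n := B.length) (by omega)
        rw [List.length_append] at hL
        obtain ⟨C', γ', rfl, hC1⟩ := exists_split (L := L) (n := C.length) (by omega)
        rw [List.length_append] at hL
        funext α
        rw [Nat.add_sub_cancel_left, ← hB1, ← hC1, List.take_left, List.drop_left, List.take_left,
          drop_eq_of_append (A := B' ++ C') (B := γ') (by simp) (by simp)]
        refine (congrArg _ ?_).trans (smul_zero _)
        exact (hF S).adm.shuffle α B' C' γ' (List.length_pos_iff.1 (by omega))
          (List.length_pos_iff.1 (by omega)))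
      (B ++ (C ++ γ)) (by simp; omega)
    have h3 := congrFun h2 α
    simp only [Nat.add_sub_cancel_left, List.take_left, List.drop_left,
          drop_eq_of_append (L := B ++ (C ++ γ)) (A := B ++ C) (B := γ) (by simp)
            List.length_append] at h3
    exact (smul_eq_zero_iff_eq _).1 h3

lemma ainf_coeffs (hF : ∀ {V : GrSp} (S : F.Str V), (F.coeffs S).IsMC) (A : F.OpAlgebra V)
    (α : V.Idx) (B γ : List V.Idx) (h : 2 ≤ B.length ∨ (B.length = 0 ∧ 2 ≤ γ.length)) :
    A.coeffs.ainf α B γ = 0 := by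
  have h2 := A.eq_zero_of_wgen (G := coeffSpecies k fun _ c => c.Admissible ∧ c.Graded)
    (fun _ S => coeffSpecies.mk (F.coeffs S) ⟨(hF S).adm, (hF S).graded⟩) (fun _ _ => rfl)
    (T := coeffSpecies.mk A.coeffs ⟨A.coeffs_admissible hF, A.coeffs_graded⟩) A.d_eq A.act_op
    (WGen.ainf (fun S => (coeffSpecies.prop S).1) (fun S => (coeffSpecies.prop S).2) B.length γ.length h)
    (fun W S L hL => by
      funext α
      refine (congrArg _ ?_).trans (smul_zero _)
      rcases h with h | ⟨h, -⟩
      · exact (hF S).ainf_zero α _ _ (by rw [List.length_take]; omega)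
      · rw [h, List.take_zero, Coeffs.ainf_nil]
        exact (hF S).square_zero α _) (B ++ γ) List.length_append
  have h3 := congrFun h2 α
  simp only [List.take_left, List.drop_left] at h3
  exact (smul_eq_zero_iff_eq _).1 h3

lemma coeffs_isMC (hF : ∀ {V : GrSp} (S : F.Str V), (F.coeffs S).IsMC) (A : F.OpAlgebra V) :
    A.coeffs.IsMC where
  adm := A.coeffs_admissible hF
  graded := A.coeffs_graded
  square_zero α γ := by
    match γ with
    | [] =>
      refine Finset.sum_eq_zero fun β _ => ?_
      rw [taylorMul, A.coeffs_graded.no_constant, zero_mul]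
    | [x] =>
      have := A.coeffs_graded.circ_opOf (fun _ => x) α
      rw [← A.d_eq, A.d_sq] at this
      exact neg_eq_zero.1 this.symm
    | x :: y :: γ =>
      rw [← Coeffs.ainf_nil]
      exact A.ainf_coeffs hF α [] _ (Or.inr ⟨rfl, by simp⟩)
  ainf_zero α B γ h := A.ainf_coeffs hF α B γ (Or.inl h)

/-- The algebra over the operad of a species which is given by a structure. -/
def ofStr (S : F.Str V) (h : (F.coeffs S).IsMC)
    (hF : ∀ {V : GrSp} (S : F.Str V), (F.coeffs S).Graded) : F.OpAlgebra V where
  d := F.diffOp S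
  d_degree := h.graded.opOf_isHomog 0 1
  d_sq := by
    funext x α
    refine (h.graded.circ_opOf x α).trans ?_
    rw [h.square_zero, neg_zero]
    rfl
  act n p :=
    { toFun := fun x => Operad.eval x S
      map_add' := fun _ _ => rfl
      map_smul' := fun _ _ => rfl }
  act_degree n p x := Gen.isHomog hF x.2 V S
  act_one := rfl
  act_perm _ _ _ _ := rfl
  act_circ _ _ _ _ _ _ _ _ _ := rfl
  act_diff _ _ _ := rfl

lemma ext_of_coeffs {A A' : F.OpAlgebra V} (h : A.coeffs = A'.coeffs) {S : F.Str V}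
    (hS : F.coeffs S = A'.coeffs) : A = A' := by
  have key : ∀ A : F.OpAlgebra V, A.coeffs = F.coeffs S → ∀ n p (x : F.Operad n p),
      A.act n p x = x.1 V S := fun A hA n p x =>
    A.act_comap (G := F) (fun _ S => S) (fun _ _ => rfl) (T := S)
      (A.d_eq.trans (by rw [hA]; rfl)) (fun n p h => (A.act_op n p h).trans (by rw [hA])) x.2
  refine OpAlgebra.ext ?_ ?_
  · rw [A.d_eq, A'.d_eq, h]
  · funext n p
    refine LinearMap.ext fun x => ?_
    rw [key A (h.trans hS.symm), key A' hS.symm]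

lemma coeffs_ofStr (S : F.Str V) (h : (F.coeffs S).IsMC)
    (hF : ∀ {V : GrSp} (S : F.Str V), (F.coeffs S).Graded) : (ofStr S h hF).coeffs = F.coeffs S := by
  have hop : ∀ n p, n ≠ 1 → n + p ≠ 0 →
      opOf n p (ofStr S h hF).coeffs = opOf n p (F.coeffs S) := by
    intro n p hn hp
    by_cases h1 : 2 ≤ n ∨ (n = 0 ∧ 2 ≤ p)
    · rw [← act_op _ n p h1]; rfl
    · obtain ⟨rfl, rfl⟩ : n = 0 ∧ p = 1 := by omega
      rw [← d_eq]; rfl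
  funext α B γ
  by_cases h1 : B.length = 1
  · obtain ⟨β, rfl⟩ := List.length_eq_one_iff.1 h1
    rw [(coeffs_graded _).no_single, h.graded.no_single]
  by_cases h2 : B.length + γ.length = 0
  · obtain ⟨rfl, rfl⟩ : B = [] ∧ γ = [] :=
      ⟨List.length_eq_zero_iff.1 (by omega), List.length_eq_zero_iff.1 (by omega)⟩
    rw [(coeffs_graded _).no_constant, h.graded.no_constant]
  have e := congrFun (congrFun (hop _ _ h1 h2)
    (fun i => (B ++ γ)[i.1]'(by rw [List.length_append]; exact i.2))) α
  have e' : (List.ofFn fun i : Fin (B.length + γ.length) =>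
      (B ++ γ)[i.1]'(by rw [List.length_append]; exact i.2)) = B ++ γ :=
    List.ext_getElem (by simp) fun i _ _ => by simp
  rw [opOf_apply, opOf_apply, e', List.take_left, List.drop_left] at e
  exact smul_left_cancel _ e

end OpAlgebra

/-- A species of which the structures are given by the solutions of the structure equations is
described by its operad. -/
theorem isOperadOfStructures_of_isMC (F : Species k)
    (hinj : ∀ {V : GrSp} {S S' : F.Str V}, F.coeffs S = F.coeffs S' → S = S')
    (hrange : ∀ {V : GrSp} (c : Coeffs k V), (∃ S : F.Str V, F.coeffs S = c) ↔ c.IsMC) :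
    F.IsOperadOfStructures := by
  intro V
  have hF : ∀ {V : GrSp} (S : F.Str V), (F.coeffs S).IsMC := fun S => (hrange _).1 ⟨S, rfl⟩
  choose σ hσ using fun A : F.OpAlgebra V => (hrange _).2 (A.coeffs_isMC hF)
  refine ⟨⟨fun S => OpAlgebra.ofStr S (hF S) fun S => (hF S).graded, σ, fun S => hinj ?_,
    fun A => OpAlgebra.ext_of_coeffs ?_ (hσ A)⟩, fun S => ⟨rfl, fun _ _ _ => rfl⟩⟩
  · rw [hσ, OpAlgebra.coeffs_ofStr]
  · rw [OpAlgebra.coeffs_ofStr, hσ]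

end Species

end GInf

namespace GInf

namespace Species

variable {k : Type u} [Field k]

/-- A bijection between the structures of two species which preserves the structure coefficients
induces an isomorphism of the operads. -/
def OperadIso.ofEquiv {F G : Species k} (Φ : ∀ V : GrSp, F.Str V ≃ G.Str V)
    (h : ∀ (V : GrSp) (S : F.Str V), G.coeffs (Φ V S) = F.coeffs S) : OperadIso F G :=
  have h' : ∀ (V : GrSp) (T : G.Str V), F.coeffs ((Φ V).symm T) = G.coeffs T := fun V T => by
    rw [← h, Equiv.apply_symm_apply]
  { equiv := fun n p =>
      { toFun := fun x => ⟨fun V T => x.1 V ((Φ V).symm T),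
          Gen.comap (fun V T => (Φ V).symm T) h' x.2⟩
        invFun := fun y => ⟨fun V S => y.1 V (Φ V S), Gen.comap (fun V S => Φ V S) h y.2⟩
        map_add' := fun _ _ => rfl
        map_smul' := fun _ _ => rfl
        left_inv := fun x => Subtype.ext <| funext fun V => funext fun S =>
          congrArg (x.1 V) ((Φ V).symm_apply_apply S)
        right_inv := fun y => Subtype.ext <| funext fun V => funext fun T =>
          congrArg (y.1 V) ((Φ V).apply_symm_apply T) }
    map_one := rfl
    map_perm := fun _ _ _ _ => rfl
    map_circ := fun _ _ _ _ _ _ _ _ _ => rfl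
    map_diff := fun n p x => Subtype.ext <| funext fun V => funext fun T => by
      change EndOp.diff (opOf 0 1 (F.coeffs ((Φ V).symm T))) p _ =
        EndOp.diff (opOf 0 1 (G.coeffs T)) p _
      rw [h']
      rfl }

lemma OperadIso.eval_ofEquiv {F G : Species k} (Φ : ∀ V : GrSp, F.Str V ≃ G.Str V)
    (h : ∀ (V : GrSp) (S : F.Str V), G.coeffs (Φ V S) = F.coeffs S) {V : GrSp} (S : F.Str V)
    {n : ℕ} {p : ℤ} (x : F.Operad n p) :
    Operad.eval ((OperadIso.ofEquiv Φ h).equiv n p x) (Φ V S) = Operad.eval x S :=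
  congrArg (x.1 V) ((Φ V).symm_apply_apply S)

end Species

section Equivalence

variable {k : Type u} [Field k] [CharZero k]

lemma GeomCInf.range_coeffs {V : GrSp} (c : Coeffs k V) :
    (∃ S : GeomCInf k V, S.coeffs = c) ↔ c.IsMC := by
  refine ⟨?_, fun h => ⟨h.toGeom, h.coeffs_toGeom⟩⟩
  rintro ⟨S, rfl⟩
  exact S.coeffs_isMC

lemma GDifferential.exists_geom {V : GrSp} (D : GDifferential k V 2) :
    ∃ S : GeomCInf k V, S.coeffs = D.coeffs :=
  (GeomCInf.range_coeffs _).2 ((GDifferential.range_coeffs _).1 ⟨D, rfl⟩)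

lemma GeomCInf.exists_differential {V : GrSp} (S : GeomCInf k V) :
    ∃ D : GDifferential k V 2, D.coeffs = S.coeffs :=
  (GDifferential.range_coeffs _).2 ((GeomCInf.range_coeffs _).1 ⟨S, rfl⟩)

/-- The bijection between differentials of the quotient `G`-algebra and geometric
`C_∞`-structures with the same structure coefficients. -/
def GDifferential.equivGeom (V : GrSp) : GDifferential k V 2 ≃ GeomCInf k V where
  toFun D := D.exists_geom.choose
  invFun S := S.exists_differential.choose
  left_inv D := GDifferential.coeffs_injective
    ((GeomCInf.exists_differential _).choose_spec.trans D.exists_geom.choose_spec)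
  right_inv S := GeomCInf.coeffs_injective
    ((GDifferential.exists_geom _).choose_spec.trans S.exists_differential.choose_spec)

lemma GDifferential.coeffs_equivGeom {V : GrSp} (D : GDifferential k V 2) :
    (GDifferential.equivGeom V D).coeffs = D.coeffs := D.exists_geom.choose_spec

end Equivalence

end GInf

end

open GInf in
theorem theorem4p11 (k : Type u) [Field k] [CharZero k] :
    (gTwo k).IsOperadOfStructures ∧ (gerstC k).IsOperadOfStructures ∧
    ∃ (Φ : ∀ V : GrSp, GDifferential k V 2 ≃ GeomCInf k V)
      (e : Species.OperadIso (gTwo k) (gerstC k)),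
      (∀ (V : GrSp) (D : GDifferential k V 2) (α : V.Idx),
        D.D (QuotG.gen k V 2 α) = (relIdeal k V 2).mkQ ((Φ V D).coeffs.expand α)) ∧
      ∀ (V : GrSp) (D : GDifferential k V 2) (n : ℕ) (p : ℤ) (x : (gTwo k).Operad n p),
        Species.Operad.eval (e.equiv n p x) (F := gerstC k) (V := V) (Φ V D) =
          Species.Operad.eval x (F := gTwo k) (V := V) D := by
  have h : ∀ (V : GrSp) (D : (gTwo k).Str V),
      (gerstC k).coeffs (GDifferential.equivGeom (k := k) V D) = (gTwo k).coeffs D :=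
    fun V D => GDifferential.coeffs_equivGeom D
  refine ⟨Species.isOperadOfStructures_of_isMC (gTwo k)
      (fun e => GDifferential.coeffs_injective e) GDifferential.range_coeffs,
    Species.isOperadOfStructures_of_isMC (gerstC k)
      (fun e => GeomCInf.coeffs_injective e) GeomCInf.range_coeffs,
    GDifferential.equivGeom, Species.OperadIso.ofEquiv _ h, fun V D α => ?_,
    fun V D n p x => Species.OperadIso.eval_ofEquiv _ h D x⟩
  rw [GDifferential.coeffs_equivGeom]
  exact D.isCoeffs_coeffs.2 α
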